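/- Let $l<\frac14$, $k>0$, $2l+k<1$, $l+k\le 1$ and $k\ge |l|$. Let $\alpha,\beta$ be hermitian $2\times 2$ matrices with $\alpha^2=\beta^2=I$, $\alpha\beta+\beta\alpha=0$, let $M,m,g\in\mathbb R$, and consider the one-dimensional Dirac--Klein--Gordon Cauchy problem $$-i\beta\,\partial_t\psi+i\alpha\beta\,\partial_x\psi+M\psi=g\,\phi\psi,\qquad \partial_t^2\phi-\partial_x^2\phi+m^2\phi=\langle\beta\psi,\psi\rangle_{\mathbb C^2},$$ $$\psi(0)=\psi_0\in H^{-l}(\mathbb R;\mathbb C^2),\qquad \phi(0)=\phi_0\in H^{k}(\mathbb R;\mathbb R),\qquad \phi_t(0)=\phi_1\in H^{k-1}(\mathbb R;\mathbb R),$$ with $\psi$ taking values in $\mathbb C^2$ and $\phi$ real-valued. Notation. Let $\langle y\rangle=(1+y^2)^{1/2}$, let $\widetilde u(\xi,\tau)$ be the space-time Fourier transform, and let $X^{s,b}_\pm$ (for $\mathbb C^2$-valued $u$) and $Y^{s,b}_\pm$ (for $\mathbb C$-valued $u$) be the completion of $\mathcal S(\mathbb R^2)$ in the norm $\|\langle\xi\rangle^s\langle\tau\pm|\xi|\rangle^b\,\widetilde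 u(\xi,\tau)\|_{L^2_{\xi\tau}}$; $X^{s,b}_\pm[0,T]$ and $Y^{s,b}_\pm[0,T]$ are the spaces of restrictions to $[0,T]$ (for $b>\frac12$ their elements are identified with continuous curves of tempered distributions). Put $\psi_\pm=\pi_\pm(D)\psi$, where $\pi_\pm(D)$ is the Fourier multiplier with symbol $\frac12\bigl(I\pm\frac{\xi}{|\xi|}\alpha\bigr)$, so that $\psi=\psi_++\psi_-$, and $\phi_\pm=\phi\pm iA^{-1/2}\phi_t$ with $A=-\partial_x^2+1$, so that $\phi=\frac12(\phi_++\phi_-)$ and $\phi_t=\frac1{2i}A^{1/2}(\phi_+-\phi_-)$. The differential equations are understood in the sense of distributions on $(0,T)\times\mathbb R$, where $\phi\psi$ and $\langle\beta\psi,\psi\rangle$ denote the limits in this sense, as $\varepsilon\to0^+$, of $\phi_\varepsilon\psi_\varepsilon$ and $\langle\beta\psi_\varepsilon,\psi_\varepsilon\rangle$, with $u_\varepsilon=\rho_\varepsilon*u$ the convolution in $x$ with $\rho_\varepsilon(x)=\varepsilon^{-1}\rho(x/\varepsilon)$; the limits are required to exist and to satisfy the equations for every $\rho\in\mathcal S(\mathbb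 R)$ with $\int\rho\,dx=1$. Then there is $\varepsilon_0>0$, depending only on $l$ and $k$, such that for every $\varepsilon'\in(0,\varepsilon_0)$ there is a time $T=T(\|\psi_0\|_{H^{-l}},\|\phi_0\|_{H^k},\|\phi_1\|_{H^{k-1}})>0$, depending on the data only through these norms, such that for all data as above the Cauchy problem has a unique solution $(\psi,\phi,\phi_t)$ on $[0,T]$ with $$\psi_\pm\in X^{-l,\frac12+\varepsilon'}_\pm[0,T],\qquad \phi_\pm\in Y^{k,\frac12+\varepsilon'}_\pm[0,T],$$ and this solution satisfies $$\psi\in C([0,T],H^{-l}(\mathbb R)),\qquad \phi\in C([0,T],H^k(\mathbb R)),\qquad \phi_t\in C([0,T],H^{k-1}(\mathbb R)).$$ -/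

import Mathlib

open scoped SchwartzMap FourierTransform LineDeriv ENNReal Topology
open MeasureTheory Filter

noncomputable section

namespace DKG

/-- Space-time `ℝ × ℝ` with its Euclidean structure; `p 0` is the time, `p 1` the position. -/
abbrev Spacetime := EuclideanSpace ℝ (Fin 2)

/-- Two-spinors, with the hermitian norm of `ℂ²`. -/
abbrev Spinor := EuclideanSpace ℂ (Fin 2)

/-- The action of a `2 × 2` matrix on spinors. -/
abbrev act (a : Matrix (Fin 2) (Fin 2) ℂ) : Spinor →L[ℂ] Spinor :=
  Matrix.toEuclideanCLM (𝕜 := ℂ) (n := Fin 2) a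

/-- The unit vector in time direction. -/
abbrev eT : Spacetime := EuclideanSpace.single 0 1

/-- The unit vector in space direction. -/
abbrev eX : Spacetime := EuclideanSpace.single 1 1

/-! ### Restriction of test functions to a time slice, mollifiers -/

theorem hasTemperateGrowth_slice (t : ℝ) :
    (fun x : ℝ ↦ t • eT + x • eX).HasTemperateGrowth := by
  have h : (fun x : ℝ ↦ x • eX).HasTemperateGrowth :=
    ((ContinuousLinearMap.id ℝ ℝ).smulRight eX).hasTemperateGrowth
  exact (Function.HasTemperateGrowth.const (t • eT)).add h

theorem antilipschitz_slice (t : ℝ) :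
    AntilipschitzWith 1 (fun x : ℝ ↦ t • eT + x • eX) := by
  refine AntilipschitzWith.of_le_mul_dist fun x y ↦ ?_
  rw [dist_add_left, dist_eq_norm, dist_eq_norm, ← sub_smul, norm_smul]
  simp

/-- The function `x ↦ η (t, x)` for a Schwartz function `η` on space-time. -/
def slice (t : ℝ) (η : 𝓢(Spacetime, ℂ)) : 𝓢(ℝ, ℂ) :=
  SchwartzMap.compCLMOfAntilipschitz ℂ (hasTemperateGrowth_slice t) (antilipschitz_slice t) η

theorem hasTemperateGrowth_reflect (ε x : ℝ) :
    (fun y : ℝ ↦ ε⁻¹ * (x - y)).HasTemperateGrowth := by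
  have h : (fun y : ℝ ↦ (-ε⁻¹) • y).HasTemperateGrowth :=
    ((-ε⁻¹) • ContinuousLinearMap.id ℝ ℝ).hasTemperateGrowth
  have h' := (Function.HasTemperateGrowth.const (E := ℝ) (ε⁻¹ * x)).add h
  convert h' using 1
  funext y
  simp only [Pi.add_apply, smul_eq_mul]
  ring

theorem antilipschitz_reflect {ε : ℝ} (hε : 0 < ε) (x : ℝ) :
    AntilipschitzWith ε.toNNReal (fun y : ℝ ↦ ε⁻¹ * (x - y)) := by
  refine AntilipschitzWith.of_le_mul_dist fun y z ↦ ?_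
  have h : ε⁻¹ * (x - y) - ε⁻¹ * (x - z) = ε⁻¹ * (z - y) := by ring
  rw [Real.dist_eq, Real.dist_eq, h, abs_mul, abs_of_pos (inv_pos.mpr hε),
    Real.coe_toNNReal ε hε.le, ← mul_assoc, mul_inv_cancel₀ hε.ne', one_mul, abs_sub_comm]

/-- The function `y ↦ ε⁻¹ ρ ((x - y) / ε)` (only used for `ε > 0`). -/
def kernelAt (ρ : 𝓢(ℝ, ℂ)) (ε x : ℝ) : 𝓢(ℝ, ℂ) :=
  if hε : 0 < ε then
    (ε⁻¹ : ℂ) • SchwartzMap.compCLMOfAntilipschitz ℂ (hasTemperateGrowth_reflect ε x)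
      (antilipschitz_reflect hε x) ρ
  else 0

section General

variable {F : Type*} [NormedAddCommGroup F] [NormedSpace ℂ F]

/-- The mollification `(ρ_ε * u)(x)` with `ρ_ε (y) = ε⁻¹ ρ (y / ε)` of a tempered distribution. -/
def mollify (ρ : 𝓢(ℝ, ℂ)) (ε : ℝ) (u : 𝓢'(ℝ, F)) (x : ℝ) : F :=
  u (kernelAt ρ ε x)

/-- The Fourier transform of `u` is the function `f`. -/
def HasFourierDensity {V : Type*} [NormedAddCommGroup V] [InnerProductSpace ℝ V]
    [FiniteDimensional ℝ V] [MeasurableSpace V] [BorelSpace V]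
    (u : 𝓢'(V, F)) (f : V → F) : Prop :=
  AEStronglyMeasurable f volume ∧
    ∀ η : 𝓢(V, ℂ), Integrable (fun ξ ↦ η ξ • f ξ) ∧ (𝓕 u) η = ∫ ξ, η ξ • f ξ

/-- `v = m(D) u`, where `m(D)` is the Fourier multiplier with the (not necessarily continuous,
operator-valued) symbol `m`. -/
def IsMultiplier (m : ℝ → F →L[ℂ] F) (u v : 𝓢'(ℝ, F)) : Prop :=
  ∃ f : ℝ → F, HasFourierDensity u f ∧ HasFourierDensity v (fun ξ ↦ m ξ (f ξ))

/-- The `H^s` norm (infinite if `u` does not belong to `H^s`). -/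
def sobolevENorm [CompleteSpace F] (s : ℝ) (u : 𝓢'(ℝ, F)) : ℝ≥0∞ :=
  ⨅ (f : Lp F 2 (volume : Measure ℝ))
    (_ : TemperedDistribution.besselPotential ℝ F s u = (f : 𝓢'(ℝ, F))), ‖f‖ₑ

/-- `u ∈ C([0,T], H^s)`. -/
def ContinuousInSobolev [CompleteSpace F] (s T : ℝ) (u : ℝ → 𝓢'(ℝ, F)) : Prop :=
  (∀ t ∈ Set.Icc 0 T, TemperedDistribution.MemSobolev s 2 (u t)) ∧
    ∀ t₀ ∈ Set.Icc 0 T,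
      Tendsto (fun t ↦ sobolevENorm s (u t - u t₀)) (𝓝[Set.Icc 0 T] t₀) (𝓝 0)

/-- The bracket `⟨y⟩ = (1 + y²)^(1/2)`. -/
def bracket (y : ℝ) : ℝ := √(1 + y ^ 2)

/-- `U ∈ X^{s,b}_σ`, `σ = ±1`: the Fourier transform of `U` is a function, square integrable with
the weight `⟨ξ⟩^s ⟨τ + σ|ξ|⟩^b`. The factors `2π` come from the convention `e^{-2πi(tτ + xξ)}` in
the Fourier transform. -/
def MemX (s b σ : ℝ) (U : 𝓢'(Spacetime, F)) : Prop :=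
  ∃ f : Spacetime → F, HasFourierDensity U f ∧
    MemLp (fun p ↦ (bracket (2 * Real.pi * p 1) ^ s *
      bracket (2 * Real.pi * (p 0 + σ * |p 1|)) ^ b) • f p) 2 volume

/-- `η ∈ C_c^∞((0,T) × ℝ)`. -/
def IsTest (T : ℝ) (η : 𝓢(Spacetime, ℂ)) : Prop :=
  HasCompactSupport η ∧ tsupport η ⊆ {p | 0 < p 0 ∧ p 0 < T}

/-- The pairing of a curve of tempered distributions, seen as a distribution on
`(0,T) × ℝ`, with a test function. -/
def pair [CompleteSpace F] (T : ℝ) (u : ℝ → 𝓢'(ℝ, F)) (η : 𝓢(Spacetime, ℂ)) : F :=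
  ∫ t in (0 : ℝ)..T, u t (slice t η)

/-- `u ∈ X^{s,b}_σ[0,T]`: `u` is the restriction to the time interval of an element of
`X^{s,b}_σ`. -/
def MemXLoc [CompleteSpace F] (s b σ T : ℝ) (u : ℝ → 𝓢'(ℝ, F)) : Prop :=
  ContinuousOn u (Set.Icc 0 T) ∧
    ∃ U : 𝓢'(Spacetime, F), MemX s b σ U ∧ ∀ η, IsTest T η → U η = pair T u η

end General

/-- A real-valued distribution. -/
def IsReal (u : 𝓢'(ℝ, ℂ)) : Prop :=
  ∀ η : 𝓢(ℝ, ℂ), (∀ x, (η x).im = 0) → (u η).im = 0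

/-- The symbol `π_σ(ξ) = ½ (I + σ (ξ/|ξ|) α)`, `σ = ±1`. -/
def diracSymbol (α : Matrix (Fin 2) (Fin 2) ℂ) (σ ξ : ℝ) : Spinor →L[ℂ] Spinor :=
  act ((1 / 2 : ℂ) • (1 + ((σ * Real.sign ξ : ℝ) : ℂ) • α))

/-- The operator `A^{-1/2}`, where `A = -∂_x² + 1`. -/
def invSqrtA : 𝓢'(ℝ, ℂ) →L[ℂ] 𝓢'(ℝ, ℂ) :=
  TemperedDistribution.fourierMultiplierCLM ℂ
    (fun ξ : ℝ ↦ (((1 + (2 * Real.pi * ξ) ^ 2) ^ (-1 / 2 : ℝ) : ℝ) : ℂ))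

/-- The half waves `φ_σ = φ + σ i A^{-1/2} φ_t`, `σ = ±1`; equivalently `φ = ½ (φ_+ + φ_-)` and
`φ_t = (2i)⁻¹ A^{1/2} (φ_+ - φ_-)`. -/
def halfWave (σ : ℝ) (φ φt : 𝓢'(ℝ, ℂ)) : 𝓢'(ℝ, ℂ) :=
  φ + ((σ : ℂ) * Complex.I) • invSqrtA φt

/-- The Yukawa term `φ ψ`, mollified in space, paired with the test function `η`. -/
def yukawa (T : ℝ) (φ : ℝ → 𝓢'(ℝ, ℂ)) (ψ : ℝ → 𝓢'(ℝ, Spinor)) (ρ : 𝓢(ℝ, ℂ)) (ε : ℝ)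
    (η : 𝓢(Spacetime, ℂ)) : Spinor :=
  ∫ t in (0 : ℝ)..T, ∫ x : ℝ,
    slice t η x • (mollify ρ ε (φ t) x • mollify ρ ε (ψ t) x)

/-- The density `⟨βψ, ψ⟩`, mollified in space, paired with the test function `η`. -/
def density (β : Matrix (Fin 2) (Fin 2) ℂ) (T : ℝ) (ψ : ℝ → 𝓢'(ℝ, Spinor)) (ρ : 𝓢(ℝ, ℂ))
    (ε : ℝ) (η : 𝓢(Spacetime, ℂ)) : ℂ :=
  ∫ t in (0 : ℝ)..T, ∫ x : ℝ,
    slice t η x * inner ℂ (mollify ρ ε (ψ t) x) (act β (mollify ρ ε (ψ t) x))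

/-- `(ψ, φ, φ_t)` solves the Cauchy problem on `[0,T]` with
`ψ_± = π_±(D)ψ ∈ X^{-l,b}_±[0,T]` and `φ_± ∈ Y^{k,b}_±[0,T]`. The equations hold in the sense of
distributions on `(0,T) × ℝ`; the nonlinear terms are the distributional limits of the products of
the mollified functions, for every mollifier `ρ`. -/
structure IsSolution (α β : Matrix (Fin 2) (Fin 2) ℂ) (M m g l k b T : ℝ)
    (ψ₀ : 𝓢'(ℝ, Spinor)) (φ₀ φ₁ : 𝓢'(ℝ, ℂ))
    (ψ : ℝ → 𝓢'(ℝ, Spinor)) (φ φt : ℝ → 𝓢'(ℝ, ℂ)) : Prop where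
  continuousOn_psi : ContinuousOn ψ (Set.Icc 0 T)
  continuousOn_phi : ContinuousOn φ (Set.Icc 0 T)
  continuousOn_phit : ContinuousOn φt (Set.Icc 0 T)
  /-- `φ` is real-valued -/
  isReal : ∀ t ∈ Set.Icc 0 T, IsReal (φ t)
  /-- `π_±(D)ψ` belongs to `X^{-l,b}_±[0,T]` -/
  memX_psi : ∀ σ ∈ ({1, -1} : Set ℝ), ∃ ψσ : ℝ → 𝓢'(ℝ, Spinor),
    (∀ t ∈ Set.Icc 0 T, IsMultiplier (diracSymbol α σ) (ψ t) (ψσ t)) ∧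
      MemXLoc (-l) b σ T ψσ
  /-- `φ_±` belongs to `Y^{k,b}_±[0,T]` -/
  memY_phi : ∀ σ ∈ ({1, -1} : Set ℝ), MemXLoc k b σ T (fun t ↦ halfWave σ (φ t) (φt t))
  /-- `-iβ ∂_t ψ + iαβ ∂_x ψ + M ψ = g φ ψ` -/
  dirac : ∀ ρ : 𝓢(ℝ, ℂ), ∫ x, ρ x = 1 → ∀ η, IsTest T η →
    Tendsto (fun ε ↦ (g : ℂ) • yukawa T φ ψ ρ ε η) (𝓝[>] 0)
      (𝓝 (Complex.I • act β (pair T ψ (∂_{eT} η)) -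
        Complex.I • act (α * β) (pair T ψ (∂_{eX} η)) + (M : ℂ) • pair T ψ η))
  /-- `∂_t φ = φ_t` -/
  deriv_phi : ∀ η, IsTest T η → pair T φ (∂_{eT} η) = -pair T φt η
  /-- `∂_t² φ - ∂_x² φ + m² φ = ⟨βψ, ψ⟩` -/
  kleinGordon : ∀ ρ : 𝓢(ℝ, ℂ), ∫ x, ρ x = 1 → ∀ η, IsTest T η →
    Tendsto (fun ε ↦ density β T ψ ρ ε η) (𝓝[>] 0)
      (𝓝 (pair T φ (∂_{eT} (∂_{eT} η)) - pair T φ (∂_{eX} (∂_{eX} η)) +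
        (m : ℂ) ^ 2 * pair T φ η))
  initial_psi : ψ 0 = ψ₀
  initial_phi : φ 0 = φ₀
  initial_phit : φt 0 = φ₁

end DKG

end

noncomputable section

namespace DKG

open scoped Real ComplexConjugate
open Complex (I I_sq conj_I conj_ofReal continuous_conj exp_add measurable_ofReal norm_I
  norm_ofNat norm_real ofRealCLM ofReal_im ofReal_one ofReal_zero real_smul)
open ENNReal (coe_lt_top coe_ne_top mul_lt_top mul_ne_top ofReal ofReal_le_ofReal ofReal_lt_top
  ofReal_mul ofReal_ne_top ofReal_pow pow_lt_top pow_ne_top toReal_mono)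
open Function (comp_apply uncurry)
open Real (exp mul_rpow norm_eq_abs norm_of_nonneg one_le_rpow one_le_sqrt pi_gt_three rpow_add
  rpow_le_rpow rpow_le_rpow_of_exponent_le rpow_le_rpow_of_nonpos rpow_mul rpow_natCast rpow_neg
  rpow_nonneg rpow_one rpow_pos_of_pos rpow_sub_one rpow_zero sqrt_eq_rpow)
open Set (Icc Iic Ioc Ioi Ioo)

local notation "ℝ²" => ℝ × ℝ
local notation "𝓛¹" => (volume : Measure ℝ)
local notation "𝓛²" => (volume : Measure (ℝ × ℝ))
local notation "𝓢²" => 𝓢(Spacetime, ℂ)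

/-- The inhomogeneous bracket `1 + |x|`. -/
def jb (x : ℝ) : ℝ := 1 + |x|

theorem integral_congr {X E : Type*} [MeasurableSpace X] [NormedAddCommGroup E] [NormedSpace ℝ E]
    {μ : Measure X} {f g : X → E} (h : ∀ x, f x = g x) : ∫ x, f x ∂μ = ∫ x, g x ∂μ :=
  integral_congr_ae (.of_forall h)

local notation:max "jc" x:max s:max => ((jb x ^ s : ℝ) : ℂ)

theorem one_le_jb (x : ℝ) : 1 ≤ jb x := by simp [jb]

theorem jb_pos (x : ℝ) : 0 < jb x := one_pos.trans_le (one_le_jb x)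

@[fun_prop]
theorem continuous_jb : Continuous jb := by unfold jb; fun_prop

@[fun_prop]
theorem measurable_jb : Measurable jb := continuous_jb.measurable

theorem jb_neg (x : ℝ) : jb (-x) = jb x := by simp [jb]

theorem jb_add_le (x y : ℝ) : jb (x + y) ≤ jb x + jb y := by unfold jb; linarith [abs_add_le x y]

theorem jb_add_le_mul (x y : ℝ) : jb (x + y) ≤ jb x * jb y := by
  unfold jb; nlinarith [abs_add_le x y, mul_nonneg (abs_nonneg x) (abs_nonneg y)]

theorem jb_rpow_pos (x a : ℝ) : 0 < jb x ^ a := Real.rpow_pos_of_pos (jb_pos x) a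

theorem jb_rpow_nonneg (x a : ℝ) : 0 ≤ jb x ^ a := (jb_rpow_pos x a).le

theorem norm_ofReal_of_nonneg {x : ℝ} (h : 0 ≤ x) : ‖(x : ℂ)‖ = x := Complex.norm_of_nonneg h

theorem exists_lintegral_jb_le {A : ℝ} (hA : 1 < A) :
    ∃ C : NNReal, ∀ y : ℝ, ∫⁻ x, ofReal (jb (x + y) ^ (-A)) ≤ C := by
  have h : Integrable (fun x => jb x ^ (-A)) := by
    simpa [jb] using integrable_one_add_norm (E := ℝ) (by simpa using hA)
  refine ⟨(∫⁻ x, ofReal (jb x ^ (-A))).toNNReal, fun y => ?_⟩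
  rw [lintegral_add_right_eq_self (fun x => ofReal (jb x ^ (-A))) y, ENNReal.coe_toNNReal]
  exact h.lintegral_lt_top.ne

theorem mul_rpow_neg_le_add {x y z A B D : ℝ} (hx : 1 ≤ x) (hy : 1 ≤ y) (hz : 1 ≤ z)
    (hA : 0 ≤ A) (hB : 0 ≤ B) (hD : 0 ≤ D) :
    x ^ (-A) * y ^ (-B) * z ^ (-D) ≤
      x ^ (-(A + B + D)) + y ^ (-(A + B + D)) + z ^ (-(A + B + D)) := by
  have key : ∀ m, 1 ≤ m → m ≤ x → m ≤ y → m ≤ z →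
      x ^ (-A) * y ^ (-B) * z ^ (-D) ≤ m ^ (-(A + B + D)) := by
    intro m hm h1 h2 h3
    have hm0 : 0 < m := by linarith
    have e : m ^ (-(A + B + D)) = m ^ (-A) * m ^ (-B) * m ^ (-D) := by
      rw [← rpow_add hm0, ← rpow_add hm0]; ring_nf
    rw [e]
    have i1 := rpow_le_rpow_of_nonpos hm0 h1 (neg_nonpos.2 hA)
    have i2 := rpow_le_rpow_of_nonpos hm0 h2 (neg_nonpos.2 hB)
    have i3 := rpow_le_rpow_of_nonpos hm0 h3 (neg_nonpos.2 hD)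
    gcongr
  have px : 0 ≤ x ^ (-(A + B + D)) := by positivity
  have py : 0 ≤ y ^ (-(A + B + D)) := by positivity
  have pz : 0 ≤ z ^ (-(A + B + D)) := by positivity
  rcases le_total x y with h | h <;> rcases le_total x z with h' | h' <;>
    rcases le_total y z with h'' | h''
  all_goals first
    | exact (key x hx le_rfl (by linarith) (by linarith)).trans (by linarith)
    | exact (key y hy (by linarith) le_rfl (by linarith)).trans (by linarith)
    | exact (key z hz (by linarith) (by linarith) le_rfl).trans (by linarith)

theorem exists_lintegral_jb_mul_le {A B D : ℝ} (hA : 0 ≤ A) (hB : 0 ≤ B) (hD : 0 ≤ D)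
    (h : 1 < A + B + D) :
    ∃ C : NNReal, ∀ y₁ y₂ y₃ : ℝ,
      ∫⁻ x, ofReal (jb (x + y₁) ^ (-A) * jb (x + y₂) ^ (-B) * jb (x + y₃) ^ (-D)) ≤ C := by
  obtain ⟨C, hC⟩ := exists_lintegral_jb_le h
  refine ⟨C + C + C, fun y₁ y₂ y₃ => ?_⟩
  calc _ ≤ ∫⁻ x, (ofReal (jb (x + y₁) ^ (-(A + B + D))) +
          ofReal (jb (x + y₂) ^ (-(A + B + D))) +
          ofReal (jb (x + y₃) ^ (-(A + B + D)))) := by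
        refine lintegral_mono fun x => ?_
        have p1 := jb_pos (x + y₁)
        have p2 := jb_pos (x + y₂)
        have p3 := jb_pos (x + y₃)
        rw [← ENNReal.ofReal_add (by positivity) (by positivity),
          ← ENNReal.ofReal_add (by positivity) (by positivity)]
        exact ofReal_le_ofReal
          (mul_rpow_neg_le_add (one_le_jb _) (one_le_jb _) (one_le_jb _) hA hB hD)
    _ ≤ _ := by
        rw [lintegral_add_right _ (by fun_prop), lintegral_add_right _ (by fun_prop)]
        push_cast
        gcongr <;> apply hC

theorem lintegral_prod_shear (s : ℝ) {f : ℝ² → ℝ≥0∞} (hf : Measurable f) :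
    ∫⁻ p : ℝ², f p = ∫⁻ c : ℝ, ∫⁻ ξ : ℝ, f (c + s * ξ, ξ) := by
  rw [Measure.volume_eq_prod, lintegral_prod_symm _ hf.aemeasurable]
  rw [lintegral_lintegral_swap (f := fun c ξ : ℝ => f (c + s * ξ, ξ))]
  · refine lintegral_congr fun ξ => ?_
    exact (lintegral_add_right_eq_self (fun c => f (c, ξ)) (s * ξ)).symm
  · exact (hf.comp (by fun_prop)).aemeasurable

/-- The `L²` norm of a nonnegative function. -/
def l2n {X : Type*} [MeasurableSpace X] (μ : Measure X) (F : X → ℝ≥0∞) : ℝ≥0∞ :=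
  (∫⁻ x, F x ^ 2 ∂μ) ^ (1 / 2 : ℝ)

theorem lintegral_mul_le_l2n {X : Type*} [MeasurableSpace X] (μ : Measure X) {F G : X → ℝ≥0∞}
    (hF : AEMeasurable F μ) (hG : AEMeasurable G μ) :
    ∫⁻ x, F x * G x ∂μ ≤ l2n μ F * l2n μ G := by
  simpa [l2n] using ENNReal.lintegral_mul_le_Lp_mul_Lq μ Real.HolderConjugate.two_two hF hG

/-- The trilinear form with kernel `K` is bounded on `L²` by `C`. -/
def TriBound (K : ℝ² → ℝ² → ℝ) (C : NNReal) : Prop :=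
  ∀ F G H : ℝ² → ℝ≥0∞, Measurable F → Measurable G → Measurable H →
    ∫⁻ p, ∫⁻ q, F p * G q * H (p + q) * ofReal (K p q) ≤
      C * l2n volume F * l2n volume G * l2n volume H

theorem lintegral_mul_lintegral_le {Ψ K : ℝ² → ℝ² → ℝ≥0∞} {G : ℝ² → ℝ≥0∞}
    (hΨ : Measurable (uncurry Ψ)) (hK : Measurable (uncurry K))
    (hG : Measurable G) {C : NNReal} (hC : ∀ y, ∫⁻ x, K x y ^ 2 ≤ C) :
    ∫⁻ y, G y * ∫⁻ x, Ψ x y * K x y ≤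
      (C : ℝ≥0∞) ^ (1 / 2 : ℝ) * l2n volume G * (∫⁻ y, ∫⁻ x, Ψ x y ^ 2) ^ (1 / 2 : ℝ) := by
  have hm : Measurable fun y => ∫⁻ x, Ψ x y ^ 2 := by
    have : Measurable (uncurry fun x y => Ψ x y ^ 2) := hΨ.pow_const 2
    exact this.lintegral_prod_left'
  calc ∫⁻ y, G y * ∫⁻ x, Ψ x y * K x y
      ≤ ∫⁻ y, (C : ℝ≥0∞) ^ (1 / 2 : ℝ) * (G y * (∫⁻ x, Ψ x y ^ 2) ^ (1 / 2 : ℝ)) := by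
        refine lintegral_mono fun y => ?_
        have h1 := lintegral_mul_le_l2n 𝓛² (F := fun x => Ψ x y)
          (G := fun x => K x y) (hΨ.comp (measurable_id.prodMk measurable_const)).aemeasurable
          (hK.comp (measurable_id.prodMk measurable_const)).aemeasurable
        have h2 : l2n volume (fun x => K x y) ≤ (C : ℝ≥0∞) ^ (1 / 2 : ℝ) :=
          ENNReal.rpow_le_rpow (hC y) (by norm_num)
        calc G y * ∫⁻ x, Ψ x y * K x y
            ≤ G y * (l2n volume (fun x => Ψ x y) * (C : ℝ≥0∞) ^ (1 / 2 : ℝ)) := by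
              gcongr; exact h1.trans (by gcongr)
          _ = _ := by unfold l2n; ring
    _ = (C : ℝ≥0∞) ^ (1 / 2 : ℝ) * ∫⁻ y, G y * (∫⁻ x, Ψ x y ^ 2) ^ (1 / 2 : ℝ) := by
        exact lintegral_const_mul _ (hG.mul (hm.pow_const _))
    _ ≤ (C : ℝ≥0∞) ^ (1 / 2 : ℝ) * (l2n volume G *
          l2n volume (fun y => (∫⁻ x, Ψ x y ^ 2) ^ (1 / 2 : ℝ))) := by
        gcongr
        exact lintegral_mul_le_l2n _ hG.aemeasurable (hm.pow_const _).aemeasurable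
    _ = _ := by
        have : ∀ y, ((∫⁻ x, Ψ x y ^ 2) ^ (1 / 2 : ℝ)) ^ 2 = ∫⁻ x, Ψ x y ^ 2 := by
          intro y
          rw [← ENNReal.rpow_natCast, ← ENNReal.rpow_mul]; norm_num
        simp only [l2n, this]; ring

theorem lintegral_sq_mul_sq {F H : ℝ² → ℝ≥0∞} (hF : Measurable F) (hH : Measurable H) :
    (∫⁻ y, ∫⁻ x, (F x * H (x + y)) ^ 2) ^ (1 / 2 : ℝ) = l2n volume F * l2n volume H := by
  rw [lintegral_lintegral_swap]
  · have : ∀ x, ∫⁻ y, (F x * H (x + y)) ^ 2 = F x ^ 2 * ∫⁻ y, H y ^ 2 := by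
      intro x
      simp only [mul_pow]
      rw [lintegral_const_mul _ (by fun_prop), lintegral_add_left_eq_self (fun y => H y ^ 2) x]
    simp only [this]
    rw [lintegral_mul_const _ (by fun_prop), ENNReal.mul_rpow_of_nonneg _ _ (by norm_num)]
    rfl
  · have : Measurable (uncurry fun y x => (F x * H (x + y)) ^ 2) := by
      unfold uncurry; fun_prop
    exact this.aemeasurable

theorem TriBound.of_left {K : ℝ² → ℝ² → ℝ} (hK : Measurable (uncurry K))
    {C : NNReal} (hC : ∀ q, ∫⁻ p, ofReal (K p q) ^ 2 ≤ C) :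
    TriBound K (C ^ (1 / 2 : ℝ)) := by
  intro F G H hF hG hH
  have hK' : Measurable (uncurry fun p q => ofReal (K p q)) := hK.ennreal_ofReal
  have h := lintegral_mul_lintegral_le (Ψ := fun p q => F p * H (p + q))
    (by unfold uncurry; fun_prop) hK' hG hC
  rw [lintegral_sq_mul_sq hF hH] at h; rw [lintegral_lintegral_swap]
  · calc _ = ∫⁻ y, G y * ∫⁻ x, F x * H (x + y) * ofReal (K x y) := by
          refine lintegral_congr fun y => ?_
          rw [← lintegral_const_mul]
          · congr! 2; ring
          · fun_prop
      _ ≤ _ := h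
      _ = _ := by rw [ENNReal.coe_rpow_of_nonneg _ (by norm_num)]; ring
  · refine Measurable.aemeasurable ?_
    unfold uncurry; fun_prop

theorem TriBound.swap {K : ℝ² → ℝ² → ℝ} (hK : Measurable (uncurry K))
    {C : NNReal} (h : TriBound K C) : TriBound (fun p q => K q p) C := by
  intro F G H hF hG hH
  rw [lintegral_lintegral_swap]
  · refine le_trans (le_of_eq ?_) ((h G F H hG hF hH).trans (le_of_eq (by ring)))
    congr! 4 with x y
    rw [add_comm]; ring
  · refine Measurable.aemeasurable ?_
    unfold uncurry; fun_prop

theorem TriBound.of_add {K : ℝ² → ℝ² → ℝ} (hK : Measurable (uncurry K))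
    {C : NNReal} (hC : ∀ r, ∫⁻ p, ofReal (K p (r - p)) ^ 2 ≤ C) :
    TriBound K (C ^ (1 / 2 : ℝ)) := by
  intro F G H hF hG hH
  have hK2 : Measurable fun z : ℝ² × ℝ² => ofReal (K z.1 z.2) := hK.ennreal_ofReal
  have hK3 : Measurable fun z : ℝ² × ℝ² => ofReal (K z.1 (z.2 - z.1)) :=
    hK2.comp (f := fun z : ℝ² × ℝ² => (z.1, z.2 - z.1)) (by fun_prop)
  have h := lintegral_mul_lintegral_le (Ψ := fun p r => F p * G (r - p))
    (K := fun p r => ofReal (K p (r - p))) (by unfold uncurry; fun_prop) hK3 hH hC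
  have e : ∀ p, ∫⁻ q, F p * G q * H (p + q) * ofReal (K p q) =
      ∫⁻ r, F p * G (r - p) * H r * ofReal (K p (r - p)) := by
    intro p
    refine Eq.trans ?_ (lintegral_add_right_eq_self
      (fun r => F p * G (r - p) * H r * ofReal (K p (r - p))) p)
    refine lintegral_congr fun q => ?_
    simp only [add_sub_cancel_right, add_comm p q]
  simp only [e]
  have e2 : (∫⁻ y, ∫⁻ x, (F x * G (y - x)) ^ 2) ^ (1 / 2 : ℝ) = l2n volume F * l2n volume G := by
    have s1 := lintegral_lintegral_swap (μ := 𝓛²)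
      (ν := 𝓛²) (f := fun y x => (F x * G (y - x)) ^ 2)
      (by unfold uncurry; fun_prop)
    have s2 := lintegral_lintegral_swap (μ := 𝓛²)
      (ν := 𝓛²) (f := fun y x => (F x * G (x + y)) ^ 2)
      (by unfold uncurry; fun_prop)
    rw [← lintegral_sq_mul_sq hF hG, s1, s2]; congr 1
    refine lintegral_congr fun x => ?_
    exact (lintegral_sub_right_eq_self (fun y => (F x * G y) ^ 2) x).trans
      (lintegral_add_left_eq_self (fun y => (F x * G y) ^ 2) x).symm
  rw [e2] at h; rw [lintegral_lintegral_swap]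
  · calc _ = ∫⁻ y, H y * ∫⁻ x, F x * G (y - x) * ofReal (K x (y - x)) := by
          refine lintegral_congr fun y => ?_
          rw [← lintegral_const_mul]
          · congr! 2; ring
          · fun_prop
      _ ≤ _ := h
      _ = _ := by rw [ENNReal.coe_rpow_of_nonneg _ (by norm_num)]; ring
  · refine Measurable.aemeasurable ?_
    unfold uncurry; fun_prop

theorem TriBound.mono {K K' : ℝ² → ℝ² → ℝ} {C a : NNReal} (h : TriBound K C)
    (hle : ∀ p q, K' p q ≤ a * K p q) : TriBound K' (a * C) := by
  intro F G H hF hG hH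
  calc _ ≤ ∫⁻ p, ∫⁻ q, a * (F p * G q * H (p + q) * ofReal (K p q)) := by
        refine lintegral_mono fun p => lintegral_mono fun q => ?_
        calc _ ≤ F p * G q * H (p + q) * (a * ofReal (K p q)) := by
              gcongr
              refine (ofReal_le_ofReal (hle p q)).trans ?_
              rw [ofReal_mul (NNReal.coe_nonneg a)]; simp
          _ = _ := by ring
    _ = a * ∫⁻ p, ∫⁻ q, (F p * G q * H (p + q) * ofReal (K p q)) := by
        simp_rw [lintegral_const_mul' _ _ coe_ne_top]
    _ ≤ a * (C * l2n volume F * l2n volume G * l2n volume H) := by gcongr; exact h F G H hF hG hH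
    _ = _ := by push_cast; ring

theorem TriBound.add {K K' : ℝ² → ℝ² → ℝ} {C C' : NNReal}
    (hK : Measurable (uncurry K)) (h : TriBound K C) (h' : TriBound K' C') :
    TriBound (fun p q => K p q + K' p q) (C + C') := by
  intro F G H hF hG hH
  have m : Measurable fun z : ℝ² × ℝ² =>
      F z.1 * G z.2 * H (z.1 + z.2) * ofReal (K z.1 z.2) := by fun_prop
  calc _ ≤ ∫⁻ p, ∫⁻ q, (F p * G q * H (p + q) * ofReal (K p q) +
        F p * G q * H (p + q) * ofReal (K' p q)) := by
        gcongr with p q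
        rw [← mul_add]; gcongr
        exact ENNReal.ofReal_add_le
    _ = (∫⁻ p, ∫⁻ q, F p * G q * H (p + q) * ofReal (K p q)) +
        ∫⁻ p, ∫⁻ q, F p * G q * H (p + q) * ofReal (K' p q) := by
        rw [← lintegral_add_left m.lintegral_prod_right']
        congr! 2 with p
        exact lintegral_add_left (m.comp (measurable_const.prodMk measurable_id)) _
    _ ≤ C * l2n volume F * l2n volume G * l2n volume H +
        C' * l2n volume F * l2n volume G * l2n volume H :=
        add_le_add (h F G H hF hG hH) (h' F G H hF hG hH)
    _ = _ := by push_cast; ring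

/-- The modulation `τ + s ξ` at the frequency `p = (τ, ξ)`. -/
def sa (s : ℝ) (p : ℝ²) : ℝ := p.1 + s * p.2

@[fun_prop]
theorem measurable_sa (s : ℝ) : Measurable (sa s) := by unfold sa; fun_prop

@[fun_prop]
theorem continuous_sa (s : ℝ) : Continuous (sa s) := by unfold sa; fun_prop

theorem sa_add (s : ℝ) (p q : ℝ²) : sa s (p + q) = sa s p + sa s q := by simp [sa]; ring

theorem sa_sub (s : ℝ) (p q : ℝ²) : sa s (p - q) = sa s p - sa s q := by simp [sa]; ring

theorem jb_le_jb_of_sq {s : ℝ} (hs : s ^ 2 = 1) (x y : ℝ) :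
    jb (x + s * y / 2) ≤ jb (y + 2 * s * x) := by
  have h : |y + 2 * s * x| = 2 * |x + s * y / 2| := by
    have hs' : |s| = 1 := by
      have := sq_abs s
      rw [hs] at this
      nlinarith [abs_nonneg s]
    calc |y + 2 * s * x| = |s| * |y + 2 * s * x| := by rw [hs', one_mul]
      _ = |2 * (x + s * y / 2)| := by rw [← abs_mul]; congr 1; linear_combination 2 * x * hs
      _ = _ := by rw [abs_mul]; norm_num
  unfold jb; rw [h]
  linarith [abs_nonneg (x + s * y / 2)]

theorem exists_lintegral_plane_le {s E A B D : ℝ} (hs : s ^ 2 = 1) (hE : 1 < E) (hA : 0 ≤ A)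
    (hB : 0 ≤ B) (hD : 0 ≤ D) (h : 1 < A + B + D) :
    ∃ C : NNReal, ∀ y₁ y₂ y₃ : ℝ, ∫⁻ p : ℝ², ofReal (jb (sa (-s) p) ^ (-E) *
        (jb (p.2 + y₁) ^ (-A) * jb (p.2 + y₂) ^ (-B) * jb (sa s p + y₃) ^ (-D))) ≤ C := by
  obtain ⟨C₁, h₁⟩ := exists_lintegral_jb_le hE
  obtain ⟨C₂, h₂⟩ := exists_lintegral_jb_mul_le hA hB hD h
  refine ⟨C₁ * C₂, fun y₁ y₂ y₃ => ?_⟩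
  rw [lintegral_prod_shear s (by fun_prop)]
  calc _ ≤ ∫⁻ c, ∫⁻ ξ, ofReal (jb (c + 0) ^ (-E)) * ofReal
        (jb (ξ + y₁) ^ (-A) * jb (ξ + y₂) ^ (-B) * jb (ξ + s * (c + y₃) / 2) ^ (-D)) := by
        refine lintegral_mono fun c => lintegral_mono fun ξ => ?_
        have p0 := jb_pos (c + 0)
        have p1 := jb_pos (ξ + y₁)
        have p2 := jb_pos (ξ + y₂)
        have p3 := jb_pos (ξ + s * (c + y₃) / 2)
        rw [← ofReal_mul (by positivity)]
        refine ofReal_le_ofReal ?_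
        have e1 : sa (-s) (c + s * ξ, ξ) = c + 0 := by simp [sa]
        have e2 : sa s (c + s * ξ, ξ) + y₃ = (c + y₃) + 2 * s * ξ := by simp [sa]; ring
        have := rpow_le_rpow_of_nonpos p3 (jb_le_jb_of_sq hs ξ (c + y₃)) (neg_nonpos.2 hD)
        dsimp only
        rw [e1, e2]; gcongr
    _ ≤ ∫⁻ c, ofReal (jb (c + 0) ^ (-E)) * C₂ := by
        refine lintegral_mono fun c => ?_
        rw [lintegral_const_mul _ (by fun_prop)]
        gcongr
        apply h₂
    _ ≤ _ := by
        rw [lintegral_mul_const _ (by fun_prop)]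
        push_cast; gcongr
        exact h₁ 0

theorem jb_rpow_sq (x a : ℝ) : jb x ^ (-(2 * a)) = (jb x ^ (-a)) ^ 2 := by
  rw [← rpow_natCast, ← rpow_mul (jb_pos x).le]; congr 1; push_cast; ring

/-- The kernel of a product with one modulation of the first factor and one of the output. -/
def outKernel (s β κ₁ κ₂ κ₃ : ℝ) (p q : ℝ²) : ℝ := jb (sa (-s) p) ^ (-β) *
    (jb p.2 ^ (-κ₁) * jb (p + q).2 ^ (-κ₂) * jb (sa s (p + q)) ^ (-κ₃))

/-- The kernel of a product of two waves travelling in opposite directions. -/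
def transKernel (s β : ℝ) (p q : ℝ²) : ℝ := jb (sa s p) ^ (-β) * jb (sa (-s) q) ^ (-β)

theorem measurable_outKernel (s β κ₁ κ₂ κ₃ : ℝ) :
    Measurable (uncurry (outKernel s β κ₁ κ₂ κ₃)) := by
  unfold outKernel uncurry; fun_prop

theorem measurable_transKernel (s β : ℝ) : Measurable (uncurry (transKernel s β)) := by
  unfold transKernel uncurry; fun_prop

theorem outKernel_nonneg (s β κ₁ κ₂ κ₃ : ℝ) (p q : ℝ²) : 0 ≤ outKernel s β κ₁ κ₂ κ₃ p q := by
  have := jb_pos (sa (-s) p)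
  have := jb_pos p.2
  have := jb_pos (p + q).2
  have := jb_pos (sa s (p + q))
  unfold outKernel; positivity

theorem transKernel_nonneg (s β : ℝ) (p q : ℝ²) : 0 ≤ transKernel s β p q := by
  have := jb_pos (sa s p)
  have := jb_pos (sa (-s) q)
  unfold transKernel; positivity

theorem exists_triBound_outKernel {s β κ₁ κ₂ κ₃ : ℝ} (hs : s ^ 2 = 1) (hβ : 1 / 2 < β)
    (h₁ : 0 ≤ κ₁) (h₂ : 0 ≤ κ₂) (h₃ : 0 ≤ κ₃) (h : 1 / 2 < κ₁ + κ₂ + κ₃) :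
    ∃ C, TriBound (outKernel s β κ₁ κ₂ κ₃) C := by
  obtain ⟨C, hC⟩ := exists_lintegral_plane_le hs (E := 2 * β) (A := 2 * κ₁) (B := 2 * κ₂)
    (D := 2 * κ₃) (by linarith) (by linarith) (by linarith) (by linarith) (by linarith)
  refine ⟨_, TriBound.of_left (measurable_outKernel _ _ _ _ _) (C := C) fun q => ?_⟩
  refine le_trans (le_of_eq ?_) (hC 0 q.2 (sa s q))
  refine lintegral_congr fun p => ?_
  rw [← ofReal_pow (outKernel_nonneg _ _ _ _ _ _ _)]
  simp only [outKernel, jb_rpow_sq, sa_add, Prod.snd_add]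
  congr 1; ring_nf

theorem exists_triBound_transKernel {s β : ℝ} (hs : s ^ 2 = 1) (hβ : 1 / 2 < β) :
    ∃ C, TriBound (transKernel s β) C := by
  obtain ⟨C, hC⟩ := exists_lintegral_plane_le (by rw [neg_sq, hs]) (E := 2 * β)
    (D := 2 * β) (by linarith) le_rfl le_rfl (by linarith) (by linarith)
  refine ⟨_, TriBound.of_add (measurable_transKernel _ _) (C := C) fun r => ?_⟩
  refine le_trans (le_of_eq ?_) (hC 0 0 (-sa (-s) r))
  refine lintegral_congr fun p => ?_
  rw [← ofReal_pow (transKernel_nonneg _ _ _ _)]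
  have e : jb (sa (-s) (r - p)) = jb (sa (-s) p + -sa (-s) r) := by
    rw [sa_sub, ← jb_neg]; congr 1; ring
  simp only [transKernel, e, jb_rpow_sq, neg_neg, neg_zero, rpow_zero]
  congr 1; ring

theorem rpow_le_two_mul_add {x y z n : ℝ} (hn : 0 ≤ n) (hx : 0 ≤ x) (hy : 0 ≤ y) (hz : 0 ≤ z)
    (h : x ≤ y + z) : x ^ n ≤ 2 ^ n * (y ^ n + z ^ n) := by
  have py : 0 ≤ y ^ n := by positivity
  have pz : 0 ≤ z ^ n := by positivity
  rcases le_total y z with h' | h'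
  · calc x ^ n ≤ (2 * z) ^ n := rpow_le_rpow hx (by linarith) hn
      _ = 2 ^ n * z ^ n := mul_rpow (by norm_num) hz
      _ ≤ _ := by gcongr; linarith
  · calc x ^ n ≤ (2 * y) ^ n := rpow_le_rpow hx (by linarith) hn
      _ = 2 ^ n * y ^ n := mul_rpow (by norm_num) hy
      _ ≤ _ := by gcongr; linarith

/-- The conditions on the exponents under which the bilinear estimates hold. -/
structure Exponents (l k δ : ℝ) : Prop where
  k_pos : 0 < k
  abs_l_le : |l| ≤ k
  l_add_k_le : l + k ≤ 1
  two_l_add_k_lt : 2 * l + k < 1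
  δ_pos : 0 < δ
  δ_lt : 2 * δ < k
  δ_le : δ ≤ 1 / 2
  two_l_le : 2 * l ≤ 1 / 2 - δ
  δ_lt' : 0 < l → δ < 1 - k

theorem exists_exponents {l k : ℝ} (hl : l < 1 / 4) (hk : 0 < k) (hlk : 2 * l + k < 1)
    (hlk' : l + k ≤ 1) (hkl : |l| ≤ k) : ∃ δ, Exponents l k δ := by
  refine ⟨min (k / 4) (min (1 / 2) (min (1 / 2 - 2 * l) ((1 - k - 2 * l) / 2))), hk, hkl, hlk',
    hlk, ?_, ?_, ?_, ?_, ?_⟩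
  · simp only [lt_min_iff]; refine ⟨?_, ?_, ?_, ?_⟩ <;> linarith
  · linarith [min_le_left (k / 4) (min (1 / 2) (min (1 / 2 - 2 * l) ((1 - k - 2 * l) / 2)))]
  · exact (min_le_right _ _).trans (min_le_left _ _)
  · have := (min_le_right (k / 4) (min (1 / 2) (min (1 / 2 - 2 * l) ((1 - k - 2 * l) / 2)))).trans
      ((min_le_right _ _).trans (min_le_left _ _))
    linarith
  · intro h
    have := (min_le_right (k / 4) (min (1 / 2) (min (1 / 2 - 2 * l) ((1 - k - 2 * l) / 2)))).trans
      ((min_le_right _ _).trans (min_le_right _ _))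
    linarith

theorem jb_rpow_neg_le_one (x : ℝ) {a : ℝ} (ha : 0 ≤ a) : jb x ^ (-a) ≤ 1 :=
  Real.rpow_le_one_of_one_le_of_nonpos (one_le_jb x) (neg_nonpos.2 ha)

theorem jb_abs_rpow_le (σ s : ℝ) (hσ : σ ^ 2 = 1) (hs : s ^ 2 = 1) (p : ℝ²) (b : ℝ) :
    jb (p.1 + σ * |p.2|) ^ (-b) ≤ jb (sa s p) ^ (-b) + jb (sa (-s) p) ^ (-b) := by
  have p1 := jb_pos (sa s p)
  have p2 := jb_pos (sa (-s) p)
  have q1 : 0 ≤ jb (sa s p) ^ (-b) := by positivity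
  have q2 : 0 ≤ jb (sa (-s) p) ^ (-b) := by positivity
  have : p.1 + σ * |p.2| = sa s p ∨ p.1 + σ * |p.2| = sa (-s) p := by
    unfold sa
    rcases mul_self_eq_one_iff.1 ((sq σ).symm.trans hσ) with h | h <;>
    rcases mul_self_eq_one_iff.1 ((sq s).symm.trans hs) with h' | h' <;>
    rcases abs_cases p.2 with ⟨h'', -⟩ | ⟨h'', -⟩ <;> rw [h, h', h''] <;> simp
  rcases this with h | h <;> rw [h] <;> linarith

theorem yukawa_weight_le {l k x y z : ℝ} (hx : 1 ≤ x) (hy : 1 ≤ y)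
    (hz : 1 ≤ z) (h₁ : y ≤ x + z) (h₂ : z ≤ x + y) :
    x ^ (-k) * y ^ l * z ^ (-l) ≤ 2 ^ |l| * (x ^ (-(k - |l|)) * z ^ (-(max l 0)) *
      y ^ (-(max (-l) 0)) + x ^ (-k)) := by
  have x0 : 0 < x := by linarith
  have y0 : 0 < y := by linarith
  have z0 : 0 < z := by linarith
  rcases le_or_gt 0 l with hl | hl
  · rw [abs_of_nonneg hl, max_eq_left hl, max_eq_right (by linarith : -l ≤ 0)]
    have := rpow_le_two_mul_add hl y0.le x0.le z0.le h₁
    calc x ^ (-k) * y ^ l * z ^ (-l) ≤ x ^ (-k) * (2 ^ l * (x ^ l + z ^ l)) * z ^ (-l) := by gcongr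
      _ = 2 ^ l * ((x ^ (-k) * x ^ l) * z ^ (-l) + x ^ (-k) * (z ^ l * z ^ (-l))) := by ring
      _ = _ := by rw [← rpow_add x0, ← rpow_add z0, show -(k - l) = -k + l by ring]; simp
  · rw [abs_of_neg hl, max_eq_right hl.le, max_eq_left (by linarith : 0 ≤ -l)]
    have := rpow_le_two_mul_add (by linarith : 0 ≤ -l) z0.le x0.le y0.le h₂
    calc x ^ (-k) * y ^ l * z ^ (-l)
        ≤ x ^ (-k) * y ^ l * (2 ^ (-l) * (x ^ (-l) + y ^ (-l))) := by gcongr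
      _ = 2 ^ (-l) * ((x ^ (-k) * x ^ (-l)) * y ^ l + x ^ (-k) * (y ^ l * y ^ (-l))) := by ring
      _ = _ := by rw [← rpow_add x0, ← rpow_add y0, show -(k - -l) = -k + -l by ring]; simp

/-- The kernel of the Yukawa term. -/
def yukawaKernel (l k b δ s σ : ℝ) (p q : ℝ²) : ℝ :=
  (jb p.2 ^ (-k) * jb (p.1 + σ * |p.2|) ^ (-b)) * (jb q.2 ^ l * jb (sa (-s) q) ^ (-b)) *
    (jb (p + q).2 ^ (-l) * jb (sa s (p + q)) ^ (-(1 / 2 - δ)))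

/-- The kernel of the density. -/
def densityKernel (l k b δ s σ : ℝ) (p q : ℝ²) : ℝ :=
  (jb p.2 ^ l * jb (sa s p) ^ (-b)) * (jb q.2 ^ l * jb (sa (-s) q) ^ (-b)) *
    (jb (p + q).2 ^ (-(1 - k)) * jb ((p + q).1 + σ * |(p + q).2|) ^ (-(1 / 2 - δ)))

theorem exists_triBound_yukawa_aux {l k b δ s : ℝ} (h : Exponents l k δ) (hb : 1 / 2 < b)
    (hs : s ^ 2 = 1) :
    ∃ (K : ℝ² → ℝ² → ℝ) (C : NNReal), Measurable (uncurry K) ∧ TriBound K C ∧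
      ∀ p q, jb p.2 ^ (-(k - |l|)) * jb (p + q).2 ^ (-(max l 0)) * jb q.2 ^ (-(max (-l) 0)) *
        (jb (sa (-s) p) ^ (-b) * jb (sa (-s) q) ^ (-b) * jb (sa s (p + q)) ^ (-(1 / 2 - δ)))
        ≤ K p q := by
  have h1 := h.abs_l_le
  have h2 := h.δ_lt
  have h3 := h.δ_le
  have h4 := h.δ_pos
  have one := @jb_rpow_neg_le_one
  have nn := jb_rpow_nonneg
  rcases le_or_gt 0 l with hl | hl
  · obtain ⟨C, hC⟩ := exists_triBound_outKernel (κ₁ := k - |l|)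
      (κ₃ := 1 / 2 - δ) hs hb (by linarith) hl (by linarith)
      (by rw [abs_of_nonneg hl]; linarith)
    refine ⟨_, C, measurable_outKernel _ _ _ _ _, hC, fun p q => ?_⟩
    rw [max_eq_left hl, max_eq_right (by linarith : -l ≤ 0), neg_zero, rpow_zero, mul_one]
    calc _ ≤ jb p.2 ^ (-(k - |l|)) * jb (p + q).2 ^ (-l) *
        (jb (sa (-s) p) ^ (-b) * 1 * jb (sa s (p + q)) ^ (-(1 / 2 - δ))) := by
          gcongr
          all_goals first | exact nn _ _ | exact one _ (by linarith) | skip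
          exact mul_nonneg (nn _ _) (nn _ _)
      _ = _ := by simp only [outKernel]; ring
  · rw [max_eq_right hl.le, max_eq_left (by linarith : 0 ≤ -l), abs_of_neg hl]
    rw [abs_of_neg hl] at h1
    simp only [neg_zero, rpow_zero, mul_one]
    rcases lt_or_ge δ (k - -l) with h' | h'
    · obtain ⟨C, hC⟩ := exists_triBound_outKernel (κ₁ := k - -l)
        (κ₃ := 1 / 2 - δ) hs hb (by linarith) le_rfl (by linarith) (by linarith)
      refine ⟨_, C, measurable_outKernel _ _ _ _ _, hC, fun p q => ?_⟩
      calc _ ≤ jb p.2 ^ (-(k - -l)) * 1 *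
          (jb (sa (-s) p) ^ (-b) * 1 * jb (sa s (p + q)) ^ (-(1 / 2 - δ))) := by
            have key : ∀ x y B D E : ℝ, 0 ≤ x → 0 ≤ y → 0 ≤ B → 0 ≤ E → y ≤ 1 → D ≤ 1 →
                0 ≤ D → x * y * (B * D * E) ≤ x * 1 * (B * 1 * E) := by intros; gcongr
            exact key _ _ _ _ _ (nn _ _) (nn _ _) (nn _ _) (nn _ _) (one _ (by linarith))
              (one _ (by linarith)) (nn _ _)
        _ = _ := by simp only [outKernel, neg_zero, rpow_zero]; ring
    · obtain ⟨C, hC⟩ := exists_triBound_outKernel (κ₁ := -l)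
        (κ₃ := 1 / 2 - δ) hs hb (by linarith) le_rfl (by linarith) (by linarith)
      refine ⟨fun p q => outKernel s b (-l) 0 (1 / 2 - δ) q p, C,
        by unfold outKernel uncurry; fun_prop,
        hC.swap (measurable_outKernel _ _ _ _ _), fun p q => ?_⟩
      calc _ ≤ 1 * jb q.2 ^ (- -l) *
          (1 * jb (sa (-s) q) ^ (-b) * jb (sa s (p + q)) ^ (-(1 / 2 - δ))) := by
            have key : ∀ x y B D E : ℝ, 0 ≤ x → 0 ≤ y → 0 ≤ B → 0 ≤ E → x ≤ 1 → B ≤ 1 →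
                0 ≤ D → x * y * (B * D * E) ≤ 1 * y * (1 * D * E) := by intros; gcongr
            exact key _ _ _ _ _ (nn _ _) (nn _ _) (nn _ _) (nn _ _) (one _ (by linarith))
              (one _ (by linarith)) (nn _ _)
        _ = _ := by simp only [outKernel, neg_zero, rpow_zero, add_comm q p]; ring

theorem exists_triBound_yukawa {l k b δ s σ : ℝ} (h : Exponents l k δ) (hb : 1 / 2 < b)
    (hs : s ^ 2 = 1) (hσ : σ ^ 2 = 1) : ∃ C, TriBound (yukawaKernel l k b δ s σ) C := by
  have h1 := h.abs_l_le
  have h2 := h.δ_lt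
  have h3 := h.δ_le
  have h4 := h.δ_pos
  obtain ⟨K, C₁, mK, hK, hle⟩ := exists_triBound_yukawa_aux h hb hs
  obtain ⟨C₂, hC₂⟩ := exists_triBound_outKernel (κ₁ := k)
    (κ₃ := 1 / 2 - δ) hs hb (by linarith) le_rfl (by linarith) (by linarith)
  obtain ⟨C₃, hC₃⟩ := exists_triBound_transKernel hs hb
  refine ⟨_, ((TriBound.add (K := fun p q => K p q + outKernel s b k 0 (1 / 2 - δ) p q)
    (mK.add (measurable_outKernel _ _ _ _ _)) (TriBound.add mK hK hC₂) hC₃).mono (a := ⟨2 ^ |l| * 2, by positivity⟩) fun p q => ?_)⟩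
  have one := @jb_rpow_neg_le_one
  have nn := jb_rpow_nonneg
  have hw := yukawa_weight_le (l := l) (k := k) (one_le_jb p.2) (one_le_jb q.2) (one_le_jb (p + q).2)
    (by have := jb_add_le (-p.2) ((p + q).2)
        rw [jb_neg] at this; simpa using this)
    (by simpa using jb_add_le p.2 q.2)
  have ha := jb_abs_rpow_le σ s hσ hs p b
  have hK' := hle p q
  set w₁ := jb p.2 ^ (-(k - |l|)) * jb (p + q).2 ^ (-(max l 0)) * jb q.2 ^ (-(max (-l) 0))
  have w₁_nn : 0 ≤ w₁ := mul_nonneg (mul_nonneg (nn _ _) (nn _ _)) (nn _ _)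
  have w₁_le : w₁ ≤ 1 := by
    refine mul_le_one₀ (mul_le_one₀ (one _ (by linarith)) (nn _ _) (one _ (le_max_right _ _)))
      (nn _ _) (one _ (le_max_right _ _))
  have w₂_le : jb p.2 ^ (-k) ≤ 1 := one _ h.k_pos.le
  have w₂_nn := nn p.2 (-k)
  have A0 := nn (sa s p) (-b)
  have C0 := nn (sa (-s) p) (-b)
  have D0 := nn (sa (-s) q) (-b)
  have E0 := nn (sa s (p + q)) (-(1 / 2 - δ))
  have D1 := one (sa (-s) q) (a := b) (by linarith)
  have E1 := one (sa s (p + q)) (sub_nonneg.2 h3)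
  have out_eq : outKernel s b k 0 (1 / 2 - δ) p q =
      jb (sa (-s) p) ^ (-b) * (jb p.2 ^ (-k) * jb (sa s (p + q)) ^ (-(1 / 2 - δ))) := by
    simp [outKernel]
  have tr_eq : transKernel s b p q = jb (sa s p) ^ (-b) * jb (sa (-s) q) ^ (-b) := rfl
  have yk_eq : yukawaKernel l k b δ s σ p q =
      (jb p.2 ^ (-k) * jb q.2 ^ l * jb (p + q).2 ^ (-l)) * (jb (p.1 + σ * |p.2|) ^ (-b) *
      jb (sa (-s) q) ^ (-b) * jb (sa s (p + q)) ^ (-(1 / 2 - δ))) := by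
    unfold yukawaKernel; ring
  rw [yk_eq, out_eq, tr_eq]
  have X0 := nn (p.1 + σ * |p.2|) (-b)
  set A := jb (sa s p) ^ (-b)
  set B := jb (sa (-s) p) ^ (-b)
  set D := jb (sa (-s) q) ^ (-b)
  set E := jb (sa s (p + q)) ^ (-(1 / 2 - δ))
  set w₂ := jb p.2 ^ (-k)
  calc _ ≤ (2 ^ |l| * (w₁ + w₂)) * ((A + B) * D * E) := by gcongr
    _ = 2 ^ |l| * ((w₁ + w₂) * E * (A * D) + w₁ * (B * D * E) + w₂ * B * E * D) := by ring
    _ ≤ 2 ^ |l| * ((1 + 1) * 1 * (A * D) + K p q + w₂ * B * E * 1) := by gcongr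
    _ ≤ 2 ^ |l| * (2 * (K p q + B * (w₂ * E) + A * D)) := by
      have : 0 ≤ K p q := le_trans (by positivity) hK'
      have : 0 ≤ B * (w₂ * E) := by positivity
      gcongr; linarith
    _ = 2 ^ |l| * 2 * (K p q + B * (w₂ * E) + A * D) := by ring

theorem rpow_mul_rpow_neg_le {x y a b : ℝ} (hx : 1 ≤ x) (hy : 1 ≤ y) (ha : 0 ≤ a) (ha' : a ≤ 1)
    (hab : a ≤ b) (h : x ≤ 3 * y) : x ^ a * y ^ (-b) ≤ 3 := by
  have y0 : 0 < y := by linarith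
  calc x ^ a * y ^ (-b) ≤ (3 * y) ^ a * y ^ (-b) := by gcongr
    _ = 3 ^ a * y ^ (a + -b) := by rw [mul_rpow (by norm_num) y0.le, rpow_add y0, mul_assoc]
    _ ≤ 3 ^ (1 : ℝ) * 1 := by
      gcongr
      · norm_num
      · exact Real.rpow_le_one_of_one_le_of_nonpos hy (by linarith)
    _ = 3 := by norm_num

theorem exists_triBound_density_sa {l k b δ s : ℝ} (h : Exponents l k δ) (hb : 1 / 2 < b)
    (hs : s ^ 2 = 1) : ∃ C, TriBound (fun p q =>
      (jb p.2 ^ l * jb (sa s p) ^ (-b)) * (jb q.2 ^ l * jb (sa (-s) q) ^ (-b)) *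
        (jb (p + q).2 ^ (-(1 - k)) * jb (sa s (p + q)) ^ (-(1 / 2 - δ)))) C := by
  have h1 := h.l_add_k_le
  have h2 := h.two_l_le
  have h3 := h.δ_le
  have h4 := h.δ_pos
  have h5 := h.two_l_add_k_lt
  obtain ⟨C₃, hC₃⟩ := exists_triBound_transKernel hs hb
  have one := @jb_rpow_neg_le_one
  have nn := jb_rpow_nonneg
  rcases le_or_gt l 0 with hl | hl
  · refine ⟨_, hC₃.mono (a := 1) fun p q => ?_⟩
    have e : jb (p + q).2 ^ (-(1 - k)) ≤ jb p.2 ^ (-l) * jb q.2 ^ (-l) := by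
      rw [← mul_rpow (jb_pos _).le (jb_pos _).le]
      calc _ ≤ jb (p + q).2 ^ (-l) :=
            rpow_le_rpow_of_exponent_le (one_le_jb _) (by linarith)
        _ ≤ _ := rpow_le_rpow (jb_pos _).le (jb_add_le_mul _ _) (by linarith)
    have A0 := nn (sa s p) (-b)
    have D0 := nn (sa (-s) q) (-b)
    have E0 := nn (sa s (p + q)) (-(1 / 2 - δ))
    have E1 := one (sa s (p + q)) (sub_nonneg.2 h3)
    have c1 : jb p.2 ^ l * jb p.2 ^ (-l) = 1 := by rw [← rpow_add (jb_pos _)]; simp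
    have c2 : jb q.2 ^ l * jb q.2 ^ (-l) = 1 := by rw [← rpow_add (jb_pos _)]; simp
    have y0 := nn p.2 l
    have y1 := nn q.2 l
    have y2 := nn p.2 (-l)
    have y3 := nn q.2 (-l)
    unfold transKernel
    calc _ ≤ jb p.2 ^ l * jb (sa s p) ^ (-b) * (jb q.2 ^ l * jb (sa (-s) q) ^ (-b)) *
          (jb p.2 ^ (-l) * jb q.2 ^ (-l) * 1) := by gcongr
      _ = _ := by
        rw [NNReal.coe_one]
        linear_combination jb (sa s p) ^ (-b) * jb (sa (-s) q) ^ (-b) * (jb q.2 ^ l *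
          jb q.2 ^ (-l) * c1 + c2)
  · have h6 := h.δ_lt' hl
    obtain ⟨C₁, hC₁⟩ := exists_triBound_outKernel (κ₂ := 1 - k)
      (κ₃ := 1 / 2 - δ) hs hb le_rfl (by linarith) (by linarith) (by linarith)
    obtain ⟨C₂, hC₂⟩ := exists_triBound_outKernel
      (κ₂ := 1 / 2 + (1 - k - 2 * l)) (by rw [neg_sq, hs]) hb le_rfl
      (by linarith) le_rfl (by linarith)
    refine ⟨_, ((hC₃.add (measurable_transKernel _ _)
      (hC₂.add (measurable_outKernel _ _ _ _ _) (hC₁.swap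
        (measurable_outKernel _ _ _ _ _)))).mono (a := 6) fun p q => ?_)⟩
    have t0 := transKernel_nonneg s b p q
    have t1 := outKernel_nonneg (-s) b 0 (1 / 2 + (1 - k - 2 * l)) 0 p q
    have t2 := outKernel_nonneg s b 0 (1 - k) (1 / 2 - δ) q p
    have e1 : outKernel (-s) b 0 (1 / 2 + (1 - k - 2 * l)) 0 p q =
        jb (sa s p) ^ (-b) * jb (p + q).2 ^ (-(1 / 2 + (1 - k - 2 * l))) := by simp [outKernel]
    have e2 : outKernel s b 0 (1 - k) (1 / 2 - δ) q p = jb (sa (-s) q) ^ (-b) *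
        (jb (p + q).2 ^ (-(1 - k)) * jb (sa s (p + q)) ^ (-(1 / 2 - δ))) := by
      simp [outKernel, add_comm]
    rw [e1] at t1
    rw [e2] at t2; rw [e1, e2]
    unfold transKernel at t0 ⊢
    have E0 := nn (sa s (p + q)) (-(1 / 2 - δ))
    have E1 := one (sa s (p + q)) (sub_nonneg.2 h3)
    have tri : jb p.2 ≤ jb q.2 + jb (p + q).2 := by
      have := jb_add_le (-q.2) ((p + q).2)
      rw [jb_neg] at this; simpa using this
    have split : jb q.2 ≤ jb (sa s (p + q)) + jb (sa s p) + jb (sa (-s) q) := by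
      have e : sa s (p + q) + -(sa s p) + -(sa (-s) q) = 0 + 2 * s * q.2 := by simp [sa]; ring
      have i1 := jb_le_jb_of_sq hs q.2 0
      rw [← e] at i1
      simp only [mul_zero, zero_div, add_zero] at i1
      have i2 := jb_add_le (sa s (p + q) + -(sa s p)) (-(sa (-s) q))
      have i3 := jb_add_le (sa s (p + q)) (-(sa s p))
      rw [jb_neg] at i2 i3; linarith
    have R1 := one (p + q).2 (a := 1 - k) (by linarith)
    have F1 : ∀ {a : ℝ} (r : ℝ), 0 ≤ a → a ≤ 1 → a ≤ r → ∀ m, jb q.2 ≤ 3 * jb m →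
        jb q.2 ^ a * jb m ^ (-r) ≤ 3 := fun r h h' h'' m =>
      rpow_mul_rpow_neg_le (one_le_jb _) (one_le_jb _) h h' h''
    have Fp := F1 (a := 2 * l) b (by linarith) (by linarith) (by linarith) (sa s p)
    have Fq := F1 (a := 1 / 2) b (by linarith) (by linarith) (by linarith) (sa (-s) q)
    have Fr := F1 (a := 2 * l) (1 / 2 - δ) (by linarith) (by linarith) (by linarith) (sa s (p + q))
    have y0 := jb_pos q.2
    have z0 := jb_pos (p + q).2
    have z1 := one_le_jb (p + q).2
    have x0 := jb_pos p.2
    set A := jb (sa s p) ^ (-b)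
    set D := jb (sa (-s) q) ^ (-b)
    set E := jb (sa s (p + q)) ^ (-(1 / 2 - δ))
    set x := jb p.2
    set y := jb q.2
    set z := jb (p + q).2
    have two : (2 : ℝ) ^ l ≤ 2 := by
      simpa using rpow_le_rpow_of_exponent_le one_le_two (by linarith : l ≤ 1)
    have xle : ∀ m, x ≤ 2 * m → y ≤ m → 0 < m → x ^ l * y ^ l ≤ 2 * m ^ (2 * l) := by
      intro m h h' hm
      calc x ^ l * y ^ l ≤ (2 * m) ^ l * m ^ l := by gcongr
        _ = 2 ^ l * (m ^ l * m ^ l) := by rw [mul_rpow (by norm_num) hm.le]; ring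
        _ = 2 ^ l * m ^ (2 * l) := by rw [← rpow_add hm]; ring_nf
        _ ≤ _ := by gcongr
    have six : ((6 : NNReal) : ℝ) = 6 := rfl
    rw [six, show x ^ l * A * (y ^ l * D) * (z ^ (-(1 - k)) * E) =
      x ^ l * y ^ l * z ^ (-(1 - k)) * (A * D * E) by ring]
    rcases le_total y z with hc | hc
    · have := xle _ (by linarith) hc z0
      calc _ ≤ (2 * z ^ (2 * l)) * z ^ (-(1 - k)) * (A * D * 1) := by gcongr
        _ = 2 * z ^ (2 * l + -(1 - k)) * (A * D) := by rw [rpow_add z0]; ring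
        _ ≤ 2 * 1 * (A * D) := by
          gcongr
          exact Real.rpow_le_one_of_one_le_of_nonpos z1 (by linarith)
        _ ≤ _ := by linarith
    · have hx := xle _ (by linarith) le_rfl y0
      refine le_trans (b := 2 * y ^ (2 * l) * z ^ (-(1 - k)) * (A * D * E)) (by gcongr) ?_
      have hcase : y ≤ 3 * jb (sa s (p + q)) ∨ y ≤ 3 * jb (sa s p) ∨ y ≤ 3 * jb (sa (-s) q) := by
        by_contra! hcon; linarith [hcon.1, hcon.2.1, hcon.2.2]
      rcases hcase with hm | hm | hm
      · have i := Fr hm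
        calc _ = 2 * (y ^ (2 * l) * E) * z ^ (-(1 - k)) * (A * D) := by ring
          _ ≤ 2 * 3 * 1 * (A * D) := by gcongr
          _ ≤ _ := by linarith
      · have i := Fp hm
        calc _ = 2 * (y ^ (2 * l) * A) * (D * (z ^ (-(1 - k)) * E)) := by ring
          _ ≤ 2 * 3 * (D * (z ^ (-(1 - k)) * E)) := by gcongr
          _ ≤ _ := by linarith
      · have i := Fq hm
        set Z := z ^ (-(1 / 2 + (1 - k - 2 * l)))
        have j : z ^ (-(1 - k)) ≤ y ^ (1 / 2 - 2 * l) * Z := by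
          calc _ = z ^ (1 / 2 - 2 * l) * Z := by rw [← rpow_add z0]; ring_nf
            _ ≤ _ := by gcongr; linarith
        have j' : y ^ (2 * l) * y ^ (1 / 2 - 2 * l) = y ^ (1 / 2 : ℝ) := by
          rw [← rpow_add y0]; ring_nf
        calc _ ≤ 2 * y ^ (2 * l) * (y ^ (1 / 2 - 2 * l) * Z) * (A * D * 1) := by gcongr
          _ = 2 * ((y ^ (2 * l) * y ^ (1 / 2 - 2 * l)) * D) * (A * Z) := by ring
          _ ≤ 2 * 3 * (A * Z) := by rw [j']; gcongr
          _ ≤ _ := by linarith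

theorem exists_triBound_density {l k b δ s σ : ℝ} (h : Exponents l k δ) (hb : 1 / 2 < b)
    (hs : s ^ 2 = 1) (hσ : σ ^ 2 = 1) : ∃ C, TriBound (densityKernel l k b δ s σ) C := by
  obtain ⟨C₁, hC₁⟩ := exists_triBound_density_sa h hb hs
  obtain ⟨C₂, hC₂⟩ := exists_triBound_density_sa h hb (by rw [neg_sq, hs])
  refine ⟨_, (hC₁.add (by unfold uncurry; fun_prop)
    (hC₂.swap (by unfold uncurry; fun_prop))).mono (a := 1) fun p q => ?_⟩
  have nn := jb_rpow_nonneg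
  have := jb_abs_rpow_le σ s hσ hs (p + q) (1 / 2 - δ)
  have n1 := nn p.2 l
  have n2 := nn q.2 l
  have n3 := nn (sa s p) (-b)
  have n4 := nn (sa (-s) q) (-b)
  have n5 := nn (p + q).2 (-(1 - k))
  calc densityKernel l k b δ s σ p q
      ≤ (jb p.2 ^ l * jb (sa s p) ^ (-b)) * (jb q.2 ^ l * jb (sa (-s) q) ^ (-b)) *
        (jb (p + q).2 ^ (-(1 - k)) * (jb (sa s (p + q)) ^ (-(1 / 2 - δ)) +
          jb (sa (-s) (p + q)) ^ (-(1 / 2 - δ)))) := by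
        unfold densityKernel; gcongr
    _ = _ := by simp only [NNReal.coe_one, one_mul, neg_neg, add_comm q p]; ring

/-- The Hilbert space `L²(X; ℂ)`. -/
abbrev L2 (X : Type*) [MeasureSpace X] := Lp ℂ 2 (volume : Measure X)

section Basic

variable {X Y : Type*} [MeasureSpace X] [MeasureSpace Y]

theorem eLpNorm_two_eq_l2n {E : Type*} [ENorm E] (μ : Measure X) (f : X → E) :
    eLpNorm f 2 μ = l2n μ (fun x => ‖f x‖ₑ) := by
  rw [eLpNorm_eq_lintegral_rpow_enorm_toReal (by norm_num) (by norm_num)]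
  simp [l2n]

theorem l2n_sq {X : Type*} [MeasurableSpace X] (μ : Measure X) (F : X → ℝ≥0∞) :
    l2n μ F ^ 2 = ∫⁻ x, F x ^ 2 ∂μ := by
  unfold l2n
  rw [← ENNReal.rpow_natCast, ← ENNReal.rpow_mul]; norm_num

theorem l2n_le_of_sq_le {X : Type*} [MeasurableSpace X] {μ : Measure X} {F : X → ℝ≥0∞}
    {a : ℝ≥0∞} (h : ∫⁻ x, F x ^ 2 ∂μ ≤ a ^ 2) : l2n μ F ≤ a := by
  unfold l2n
  calc _ ≤ (a ^ 2) ^ (1 / 2 : ℝ) := ENNReal.rpow_le_rpow h (by norm_num)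
    _ = a := by rw [← ENNReal.rpow_natCast, ← ENNReal.rpow_mul]; norm_num

theorem L2.enorm_eq (F : L2 X) : ‖F‖ₑ = l2n volume (fun x => ‖F x‖ₑ) := by
  rw [Lp.enorm_def, eLpNorm_two_eq_l2n]

theorem exists_L2op {T : L2 X → Y → ℂ} {C : NNReal} (hm : ∀ F, AEStronglyMeasurable (T F) volume)
    (hadd : ∀ F G, T (F + G) =ᵐ[volume] T F + T G)
    (hC : ∀ F, eLpNorm (T F) 2 volume ≤ C * ‖F‖ₑ) :
    ∃ S : L2 X →+ L2 Y, (∀ F, S F =ᵐ[volume] T F) ∧ ∀ F, ‖S F‖ ≤ C * ‖F‖ := by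
  have h : ∀ F, MemLp (T F) 2 volume := fun F =>
    ⟨hm F, (hC F).trans_lt (mul_lt_top coe_lt_top enorm_lt_top)⟩
  refine ⟨AddMonoidHom.mk' (fun F => (h F).toLp) fun F G => ?_, fun F => (h F).coeFn_toLp,
    fun F => ?_⟩
  · rw [← MemLp.toLp_add]
    exact (MemLp.toLp_eq_toLp_iff _ _).2 (hadd F G)
  · have h1 : ‖(h F).toLp‖ₑ ≤ C * ‖F‖ₑ := (Lp.enorm_toLp (h F)).trans_le (hC F)
    have h2 := toReal_mono (mul_ne_top coe_ne_top enorm_ne_top) h1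
    simpa using h2

theorem exists_mulOp {m : X → ℂ} (hm : Measurable m) {C : NNReal} (hC : ∀ x, ‖m x‖ ≤ C) :
    ∃ T : L2 X →+ L2 X, (∀ F, T F =ᵐ[volume] fun x => m x * F x) ∧ ∀ F, ‖T F‖ ≤ C * ‖F‖ := by
  have h1 : ∀ F : L2 X, AEStronglyMeasurable (fun x => m x * F x) volume := fun F =>
    hm.aestronglyMeasurable.mul (Lp.aestronglyMeasurable F)
  have h2 : ∀ F G : L2 X, (fun x => m x * (F + G) x) =ᵐ[volume]
      (fun x => m x * F x) + fun x => m x * G x := fun F G => by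
    filter_upwards [Lp.coeFn_add F G] with x hx
    simp only [hx, Pi.add_apply, mul_add]
  have h3 : ∀ F : L2 X, eLpNorm (fun x => m x * F x) 2 volume ≤ C * ‖F‖ₑ := fun F => by
    rw [Lp.enorm_def]
    have := eLpNorm_le_nnreal_smul_eLpNorm_of_ae_le_mul (f := fun x => m x * F x) (g := F) (c := C)
      (μ := volume) (.of_forall fun x => ?_) 2
    · simpa [ENNReal.smul_def] using this
    · rw [nnnorm_mul]; gcongr; exact hC x
  exact exists_L2op h1 h2 h3

theorem L2.ext_integral {F G : L2 X} (h : ∀ H : L2 X, ∫ x, F x * H x = ∫ x, G x * H x) : F = G := by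
  have key : ∀ F H : L2 X, inner ℂ (star H) F = ∫ x, F x * H x := by
    intro F H; rw [L2.inner_def]
    refine integral_congr_ae ?_
    filter_upwards [Lp.coeFn_star H] with x hx
    simp [hx, Pi.star_apply]
  refine ext_inner_left ℂ fun v => ?_
  have := h (star v)
  rw [← key, ← key, star_star] at this
  exact this

theorem L2.integrable_mul (F G : L2 X) : Integrable (fun x => F x * G x) volume := by
  have h := MemLp.integrable_mul (Lp.memLp F) (Lp.memLp G)
  exact h

theorem L2.exists_of_bound {T : L2 X → ℂ} {C : ℝ} (hadd : ∀ F G, T (F + G) = T F + T G)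
    (hsmul : ∀ (c : ℂ) F, T (c • F) = c * T F) (hC : ∀ F, ‖T F‖ ≤ C * ‖F‖) (hC0 : 0 ≤ C) :
    ∃ N : L2 X, (∀ H, ∫ x, N x * H x = T H) ∧ ‖N‖ ≤ C := by
  let L : L2 X →L[ℂ] ℂ := LinearMap.mkContinuous ⟨⟨T, hadd⟩, hsmul⟩ C hC
  refine ⟨star ((InnerProductSpace.toDual ℂ (L2 X)).symm L), fun H => ?_, ?_⟩
  · have h1 : inner ℂ ((InnerProductSpace.toDual ℂ (L2 X)).symm L) H = T H :=
      InnerProductSpace.toDual_symm_apply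
    rw [← h1, L2.inner_def]
    refine integral_congr_ae ?_
    filter_upwards [Lp.coeFn_star ((InnerProductSpace.toDual ℂ (L2 X)).symm L)] with x hx
    simp [hx, mul_comm]
  · have e : ∀ F : L2 X, ‖star F‖ = ‖F‖ := by
      intro F; rw [Lp.norm_def, Lp.norm_def]
      congr 1
      refine eLpNorm_congr_norm_ae ?_
      filter_upwards [Lp.coeFn_star F] with x hx
      simp [hx, Pi.star_apply]
    rw [e, LinearIsometryEquiv.norm_map]
    exact LinearMap.mkContinuous_norm_le _ hC0 _

end Basic

section Bilin

variable {w : ℝ² → ℝ² → ℂ} {C : NNReal}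

theorem aestronglyMeasurable_tri (hw : Measurable (uncurry w)) (F G H : L2 ℝ²) :
    AEStronglyMeasurable (fun z : ℝ² × ℝ² =>
      F z.1 * G z.2 * H (z.1 + z.2) * w z.1 z.2) (volume.prod volume) := by
  fun_prop

theorem lintegral_enorm_tri_le (hw : Measurable (uncurry w))
    (hb : TriBound (fun p q => ‖w p q‖) C) (F G H : L2 ℝ²) :
    ∫⁻ z : ℝ² × ℝ², ‖F z.1 * G z.2 * H (z.1 + z.2) * w z.1 z.2‖ₑ ∂(volume.prod volume) ≤
      C * ‖F‖ₑ * ‖G‖ₑ * ‖H‖ₑ := by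
  rw [lintegral_prod _ (aestronglyMeasurable_tri hw F G H).enorm]
  refine le_trans (le_of_eq ?_) ((hb (fun p => ‖F p‖ₑ) (fun p => ‖G p‖ₑ) (fun p => ‖H p‖ₑ)
    (Lp.stronglyMeasurable F).measurable.enorm (Lp.stronglyMeasurable G).measurable.enorm
    (Lp.stronglyMeasurable H).measurable.enorm).trans (le_of_eq ?_))
  · simp [enorm_mul]
  · rw [L2.enorm_eq, L2.enorm_eq, L2.enorm_eq]

theorem integrable_tri (hw : Measurable (uncurry w))
    (hb : TriBound (fun p q => ‖w p q‖) C) (F G H : L2 ℝ²) :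
    Integrable (fun z : ℝ² × ℝ² => F z.1 * G z.2 * H (z.1 + z.2) * w z.1 z.2)
      (volume.prod volume) :=
  ⟨aestronglyMeasurable_tri hw F G H, (lintegral_enorm_tri_le hw hb F G H).trans_lt
    (by finiteness)⟩

/-- The trilinear form with kernel `w`. -/
def triForm (w : ℝ² → ℝ² → ℂ) (F G H : ℝ² → ℂ) : ℂ :=
  ∫ z : ℝ² × ℝ², F z.1 * G z.2 * H (z.1 + z.2) * w z.1 z.2 ∂(volume.prod volume)

theorem norm_triForm_le (hw : Measurable (uncurry w))
    (hb : TriBound (fun p q => ‖w p q‖) C) (F G H : L2 ℝ²) :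
    ‖triForm w F G H‖ ≤ C * ‖F‖ * ‖G‖ * ‖H‖ := by
  have h := (enorm_integral_le_lintegral_enorm _).trans (lintegral_enorm_tri_le hw hb F G H)
  have h2 := toReal_mono (by finiteness) h
  simpa [triForm] using h2

theorem quasiMeasurePreserving_add_prod :
    Measure.QuasiMeasurePreserving (fun z : ℝ² × ℝ² => z.1 + z.2)
      (volume.prod volume) volume := by
  have h := measurePreserving_prod_add 𝓛² 𝓛²
  exact Measure.quasiMeasurePreserving_snd.comp h.quasiMeasurePreserving

theorem triForm_congr {F F' G G' H H' : ℝ² → ℂ} (hF : F =ᵐ[volume] F') (hG : G =ᵐ[volume] G')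
    (hH : H =ᵐ[volume] H') : triForm w F G H = triForm w F' G' H' := by
  refine integral_congr_ae ?_
  have h1 := Measure.quasiMeasurePreserving_fst.ae_eq_comp (μ := 𝓛².prod 𝓛²) hF
  have h2 := Measure.quasiMeasurePreserving_snd.ae_eq_comp (μ := 𝓛².prod 𝓛²) hG
  have h3 := quasiMeasurePreserving_add_prod.ae_eq_comp hH
  filter_upwards [h1, h2, h3] with z e1 e2 e3
  simp only [comp_apply] at e1 e2 e3; rw [e1, e2, e3]

theorem exists_bilinOp (hw : Measurable (uncurry w))
    (hb : TriBound (fun p q => ‖w p q‖) C) :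
    ∃ B : L2 ℝ² →+ L2 ℝ² →+ L2 ℝ², (∀ F G H : L2 ℝ², ∫ r, B F G r * H r = triForm w F G H) ∧
      ∀ F G, ‖B F G‖ ≤ C * ‖F‖ * ‖G‖ := by
  have int := integrable_tri hw hb
  have add₁ : ∀ F F' G H : L2 ℝ²,
      triForm w (F + F' : L2 ℝ²) G H = triForm w F G H + triForm w F' G H := by
    intro F F' G H
    rw [triForm_congr (Lp.coeFn_add F F') (ae_eq_refl _) (ae_eq_refl _)]; unfold triForm
    rw [← integral_add (int F G H) (int F' G H)]
    congr 1; ext z; simp only [Pi.add_apply]; ring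
  have add₂ : ∀ F G G' H : L2 ℝ²,
      triForm w F (G + G' : L2 ℝ²) H = triForm w F G H + triForm w F G' H := by
    intro F G G' H
    rw [triForm_congr (ae_eq_refl _) (Lp.coeFn_add G G') (ae_eq_refl _)]; unfold triForm
    rw [← integral_add (int F G H) (int F G' H)]
    congr 1; ext z; simp only [Pi.add_apply]; ring
  have add₃ : ∀ F G H H' : L2 ℝ²,
      triForm w F G (H + H' : L2 ℝ²) = triForm w F G H + triForm w F G H' := by
    intro F G H H'
    rw [triForm_congr (ae_eq_refl _) (ae_eq_refl _) (Lp.coeFn_add H H')]; unfold triForm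
    rw [← integral_add (int F G H) (int F G H')]
    congr 1; ext z; simp only [Pi.add_apply]; ring
  have smul₃ : ∀ (F G : L2 ℝ²) (c : ℂ) (H : L2 ℝ²),
      triForm w F G (c • H : L2 ℝ²) = c * triForm w F G H := by
    intro F G c H
    rw [triForm_congr (ae_eq_refl _) (ae_eq_refl _) (Lp.coeFn_smul c H)]; unfold triForm
    rw [← integral_const_mul]
    congr 1; ext z; simp only [Pi.smul_apply, smul_eq_mul]; ring
  have ex : ∀ F G : L2 ℝ², ∃ N : L2 ℝ²,
      (∀ H : L2 ℝ², ∫ r, N r * H r = triForm w F G H) ∧ ‖N‖ ≤ C * ‖F‖ * ‖G‖ := fun F G =>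
    L2.exists_of_bound (add₃ F G) (smul₃ F G)
      (norm_triForm_le hw hb F G) (by positivity)
  choose N hN hN' using ex
  have intadd : ∀ A B H : L2 ℝ², ∫ r, (A + B : L2 ℝ²) r * H r =
      (∫ r, A r * H r) + ∫ r, B r * H r := by
    intro A B H
    rw [← integral_add (L2.integrable_mul A H) (L2.integrable_mul B H)]
    refine integral_congr_ae ?_
    filter_upwards [Lp.coeFn_add A B] with x hx
    simp only [hx, Pi.add_apply, add_mul]
  refine ⟨AddMonoidHom.mk' (fun F => AddMonoidHom.mk' (N F) fun G G' => ?_) fun F F' => ?_, hN, hN'⟩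
  · refine L2.ext_integral fun H => ?_
    rw [hN, intadd, hN, hN, add₂]
  · ext1 G
    refine L2.ext_integral fun H => ?_
    simp only [AddMonoidHom.mk'_apply, AddMonoidHom.add_apply]; rw [hN, intadd, hN, hN, add₁]

end Bilin

theorem lintegral_enorm_mul_sq_le {X : Type*} [MeasurableSpace X] {μ : Measure X} {e f : X → ℝ≥0∞}
    (he : AEMeasurable e μ) (hf : AEMeasurable f μ) :
    (∫⁻ x, e x * f x ∂μ) ^ 2 ≤ (∫⁻ x, e x ^ 2 ∂μ) * ∫⁻ x, f x ^ 2 ∂μ := by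
  calc _ ≤ (l2n μ e * l2n μ f) ^ 2 := by gcongr; exact lintegral_mul_le_l2n μ he hf
    _ = _ := by rw [mul_pow, l2n_sq, l2n_sq]

theorem L2.lintegral_slices (F : L2 ℝ²) : ∫⁻ ξ : ℝ, ∫⁻ τ : ℝ, ‖F (τ, ξ)‖ₑ ^ 2 = ‖F‖ₑ ^ 2 := by
  rw [L2.enorm_eq, l2n_sq]
  exact (lintegral_prod_symm
    (fun p => ‖F p‖ₑ ^ 2)
    ((Lp.stronglyMeasurable F).measurable.enorm.pow_const 2).aemeasurable).symm

theorem L2.ae_lintegral_slice_lt_top (F : L2 ℝ²) : ∀ᵐ ξ : ℝ, ∫⁻ τ : ℝ, ‖F (τ, ξ)‖ₑ ^ 2 < ∞ := by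
  have hm : Measurable fun p => ‖F p‖ₑ ^ 2 :=
    (Lp.stronglyMeasurable F).measurable.enorm.pow_const 2
  refine ae_lt_top hm.lintegral_prod_left' ?_
  rw [L2.lintegral_slices]
  exact pow_ne_top enorm_ne_top

theorem measurable_slice {f : ℝ² → ℂ} (hf : Measurable f) (ξ : ℝ) :
    Measurable fun τ : ℝ => f (τ, ξ) := hf.comp (by fun_prop)

theorem ae_integrable_slice {e : ℝ² → ℂ} (he : Measurable e)
    (hC : ∀ ξ, ∫⁻ τ : ℝ, ‖e (τ, ξ)‖ₑ ^ 2 < ∞) (F : L2 ℝ²) :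
    ∀ᵐ ξ : ℝ, Integrable fun τ : ℝ => e (τ, ξ) * F (τ, ξ) := by
  filter_upwards [L2.ae_lintegral_slice_lt_top F] with ξ hξ
  have m1 := measurable_slice he ξ
  have m2 := measurable_slice (Lp.stronglyMeasurable F).measurable ξ
  refine ⟨(m1.mul m2).aestronglyMeasurable, ?_⟩
  have h := lintegral_enorm_mul_sq_le (μ := volume) m1.enorm.aemeasurable m2.enorm.aemeasurable
  have h2 := h.trans_lt (mul_lt_top (hC ξ) hξ)
  simp only [HasFiniteIntegral, enorm_mul]
  by_contra hcon
  rw [not_lt, top_le_iff] at hcon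
  rw [hcon] at h2
  simp at h2

theorem ae_prod_slice {P : ℝ² → Prop} (h : ∀ᵐ p : ℝ², P p) : ∀ᵐ ξ : ℝ, ∀ᵐ τ : ℝ, P (τ, ξ) := by
  have h' : ∀ᵐ p : ℝ², P p.swap := by
    have := (Measure.measurePreserving_swap
     ).quasiMeasurePreserving.ae h
    exact this
  exact Measure.ae_ae_of_ae_prod h'

theorem exists_sliceInt {e : ℝ² → ℂ} (he : Measurable e) {C : NNReal}
    (hC : ∀ ξ, ∫⁻ τ : ℝ, ‖e (τ, ξ)‖ₑ ^ 2 ≤ (C : ℝ≥0∞) ^ 2) :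
    ∃ T : L2 ℝ² →+ L2 ℝ,
      (∀ F, T F =ᵐ[volume] fun ξ => ∫ τ : ℝ, e (τ, ξ) * F (τ, ξ)) ∧ ∀ F, ‖T F‖ ≤ C * ‖F‖ := by
  have hC' : ∀ ξ, ∫⁻ τ, ‖e (τ, ξ)‖ₑ ^ 2 < ∞ := fun ξ => (hC ξ).trans_lt (pow_lt_top coe_lt_top)
  refine exists_L2op (fun F => ?_) (fun F G => ?_) fun F => ?_
  · exact (StronglyMeasurable.integral_prod_left'
      (he.mul (Lp.stronglyMeasurable F).measurable).stronglyMeasurable).aestronglyMeasurable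
  · filter_upwards [ae_integrable_slice he hC' F, ae_integrable_slice he hC' G,
      ae_prod_slice (Lp.coeFn_add F G)] with ξ h1 h2 h3
    rw [Pi.add_apply, ← integral_add h1 h2]
    refine integral_congr_ae ?_
    filter_upwards [h3] with τ h
    rw [h, Pi.add_apply, mul_add]
  · rw [eLpNorm_two_eq_l2n]
    refine l2n_le_of_sq_le ?_
    calc ∫⁻ ξ, ‖∫ τ, e (τ, ξ) * F (τ, ξ)‖ₑ ^ 2
        ≤ ∫⁻ ξ, (C : ℝ≥0∞) ^ 2 * ∫⁻ τ, ‖F (τ, ξ)‖ₑ ^ 2 := by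
          refine lintegral_mono fun ξ => ?_
          have m1 := measurable_slice he ξ
          have m2 := measurable_slice (Lp.stronglyMeasurable F).measurable ξ
          calc _ ≤ (∫⁻ τ, ‖e (τ, ξ)‖ₑ * ‖F (τ, ξ)‖ₑ) ^ 2 := by
                gcongr
                refine (enorm_integral_le_lintegral_enorm _).trans (le_of_eq ?_)
                simp only [enorm_mul]
            _ ≤ _ := lintegral_enorm_mul_sq_le m1.enorm.aemeasurable m2.enorm.aemeasurable
            _ ≤ _ := by gcongr; exact hC ξ
      _ = _ := by
          rw [lintegral_const_mul', L2.lintegral_slices, mul_pow]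
          exact pow_ne_top coe_ne_top

theorem exists_sliceExt {e : ℝ² → ℂ} (he : Measurable e) {C : NNReal}
    (hC : ∀ ξ, ∫⁻ τ : ℝ, ‖e (τ, ξ)‖ₑ ^ 2 ≤ (C : ℝ≥0∞) ^ 2) :
    ∃ T : L2 ℝ →+ L2 ℝ², (∀ G, T G =ᵐ[volume] fun p => e p * G p.2) ∧ ∀ G, ‖T G‖ ≤ C * ‖G‖ := by
  have hsnd : Measure.QuasiMeasurePreserving (Prod.snd : ℝ² → ℝ) volume volume :=
    Measure.quasiMeasurePreserving_snd
  have hm : ∀ G : L2 ℝ, Measurable fun p => e p * G p.2 := fun G =>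
    he.mul ((Lp.stronglyMeasurable G).measurable.comp measurable_snd)
  refine exists_L2op (fun G => (hm G).aestronglyMeasurable) (fun F G => ?_) fun G => ?_
  · filter_upwards [hsnd.ae_eq_comp (Lp.coeFn_add F G)] with p hp
    simp only [comp_apply] at hp
    simp only [hp, Pi.add_apply, mul_add]
  · rw [eLpNorm_two_eq_l2n]
    refine l2n_le_of_sq_le ?_
    calc _ = ∫⁻ ξ, ∫⁻ τ, ‖e (τ, ξ) * G ξ‖ₑ ^ 2 :=
          lintegral_prod_symm
            (fun p => ‖e p * G p.2‖ₑ ^ 2) ((hm G).enorm.pow_const 2).aemeasurable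
      _ = ∫⁻ ξ, ∫⁻ τ, ‖G ξ‖ₑ ^ 2 * ‖e (τ, ξ)‖ₑ ^ 2 := by
          simp only [enorm_mul, mul_pow, mul_comm]
      _ = ∫⁻ ξ, ‖G ξ‖ₑ ^ 2 * ∫⁻ τ, ‖e (τ, ξ)‖ₑ ^ 2 := by
          refine lintegral_congr fun ξ => ?_
          rw [lintegral_const_mul' _ _ (pow_ne_top enorm_ne_top)]
      _ ≤ ∫⁻ ξ, ‖G ξ‖ₑ ^ 2 * (C : ℝ≥0∞) ^ 2 := by gcongr with ξ; exact hC ξ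
      _ = _ := by
          rw [lintegral_mul_const' _ _ (pow_ne_top coe_ne_top), mul_pow,
            L2.enorm_eq, l2n_sq, mul_comm]

theorem measurePreserving_shift : MeasurePreserving (fun z : ℝ × ℝ² => (z.1, (z.2.1 - z.1, z.2.2)))
      (volume.prod volume) (volume.prod volume) := by
  refine (MeasurePreserving.id 𝓛¹).skew_product
    (g := fun (y : ℝ) (p : ℝ²) => (p.1 - y, p.2)) (by fun_prop) (.of_forall fun y => ?_)
  exact ((measurePreserving_sub_right 𝓛¹ y).prod
    (MeasurePreserving.id 𝓛¹)).map_eq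

theorem exists_sliceConv {K : ℝ → ℝ² → ℂ} (hK : Measurable (uncurry K))
    {K₀ : ℝ → ℝ≥0∞} (hK₀ : Measurable K₀) (hle : ∀ y p, ‖K y p‖ₑ ≤ K₀ y) {C : NNReal}
    (hC : ∫⁻ y, K₀ y ≤ C) :
    ∃ T : L2 ℝ² →+ L2 ℝ², (∀ F, T F =ᵐ[volume] fun p => ∫ y : ℝ, K y p * F (p.1 - y, p.2)) ∧
      ∀ F, ‖T F‖ ≤ C * ‖F‖ := by
  have hm : ∀ F : L2 ℝ², Measurable fun z : ℝ × ℝ² =>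
      K z.1 z.2 * F (z.2.1 - z.1, z.2.2) := fun F => by
    have h1 : Measurable fun z : ℝ × ℝ² => K z.1 z.2 := hK
    have h2 := (Lp.stronglyMeasurable F).measurable
    fun_prop
  have hm' : ∀ F : L2 ℝ², Measurable fun z : ℝ × ℝ² =>
      K₀ z.1 * ‖F (z.2.1 - z.1, z.2.2)‖ₑ ^ 2 := fun F => by
    have h2 := (Lp.stronglyMeasurable F).measurable
    fun_prop
  have hsq : ∀ (F : L2 ℝ²) (p : ℝ²), (∫⁻ y, ‖K y p * F (p.1 - y, p.2)‖ₑ) ^ 2 ≤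
      C * ∫⁻ y, K₀ y * ‖F (p.1 - y, p.2)‖ₑ ^ 2 := by
    intro F p
    have h2 := (Lp.stronglyMeasurable F).measurable
    have h3 : Measurable fun y => F (p.1 - y, p.2) := by fun_prop
    have root : ∀ x : ℝ≥0∞, (x ^ (1 / 2 : ℝ)) ^ 2 = x := fun x => by
      rw [← ENNReal.rpow_natCast, ← ENNReal.rpow_mul]; norm_num
    have := lintegral_enorm_mul_sq_le (μ := 𝓛¹) (e := fun y => K₀ y ^ (1 / 2 : ℝ))
      (f := fun y => K₀ y ^ (1 / 2 : ℝ) * ‖F (p.1 - y, p.2)‖ₑ) (by fun_prop) (by fun_prop)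
    simp only [mul_pow, root, ← mul_assoc, ← sq] at this
    calc _ ≤ (∫⁻ y, K₀ y * ‖F (p.1 - y, p.2)‖ₑ) ^ 2 := by
          gcongr with y
          rw [enorm_mul]; gcongr
          exact hle y p
      _ ≤ _ := this
      _ ≤ _ := by gcongr
  have hint : ∀ F : L2 ℝ², ∫⁻ p : ℝ², ∫⁻ y, K₀ y * ‖F (p.1 - y, p.2)‖ₑ ^ 2 ≤ C * ‖F‖ₑ ^ 2 := by
    intro F
    rw [lintegral_lintegral_swap
      (f := fun (p : ℝ²) (y : ℝ) => K₀ y * ‖F (p.1 - y, p.2)‖ₑ ^ 2)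
      ((hm' F).comp measurable_swap).aemeasurable]
    have : ∀ y, ∫⁻ p : ℝ², K₀ y * ‖F (p.1 - y, p.2)‖ₑ ^ 2 = K₀ y * ‖F‖ₑ ^ 2 := by
      intro y
      have h2 : Measurable fun p => ‖F p‖ₑ ^ 2 :=
        (Lp.stronglyMeasurable F).measurable.enorm.pow_const 2
      have mp : MeasurePreserving (fun p : ℝ² => (p.1 - y, p.2)) volume volume :=
        (measurePreserving_sub_right 𝓛¹ y).prod
          (MeasurePreserving.id 𝓛¹)
      rw [lintegral_const_mul _ (f := fun p : ℝ² => ‖F (p.1 - y, p.2)‖ₑ ^ 2)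
        (h2.comp mp.measurable), L2.enorm_eq, l2n_sq, ← mp.lintegral_comp h2]
    simp only [this]; rw [lintegral_mul_const _ hK₀]; gcongr
  have hfin : ∀ F : L2 ℝ², ∀ᵐ p : ℝ², Integrable fun y => K y p * F (p.1 - y, p.2) := by
    intro F
    have h1 : ∀ᵐ p : ℝ², ∫⁻ y, K₀ y * ‖F (p.1 - y, p.2)‖ₑ ^ 2 < ∞ := by
      refine ae_lt_top (hm' F).lintegral_prod_left' ?_
      exact ((hint F).trans_lt (mul_lt_top coe_lt_top
        (pow_lt_top enorm_lt_top))).ne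
    filter_upwards [h1] with p hp
    refine ⟨((hm F).comp
      (f := fun y => (y, p)) (by fun_prop)).aestronglyMeasurable, ?_⟩
    have h2 := (hsq F p).trans_lt (mul_lt_top coe_lt_top hp)
    by_contra hcon
    rw [HasFiniteIntegral, not_lt, top_le_iff] at hcon
    rw [hcon] at h2
    simp at h2
  refine exists_L2op (fun F => ?_) (fun F G => ?_) fun F => ?_
  · exact ((hm F).stronglyMeasurable.integral_prod_left').aestronglyMeasurable
  · have h0 : ∀ᵐ z : ℝ × ℝ² ∂(volume.prod volume), (F + G : L2 ℝ²) (z.2.1 - z.1, z.2.2) =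
          F (z.2.1 - z.1, z.2.2) + G (z.2.1 - z.1, z.2.2) :=
      (Measure.quasiMeasurePreserving_snd.comp
        measurePreserving_shift.quasiMeasurePreserving).ae (Lp.coeFn_add F G)
    have h3 : ∀ᵐ p : ℝ², ∀ᵐ y : ℝ, (F + G : L2 ℝ²) (p.1 - y, p.2) =
        F (p.1 - y, p.2) + G (p.1 - y, p.2) := by
      refine Measure.ae_ae_of_ae_prod (p := fun z : ℝ² × ℝ =>
        (F + G : L2 ℝ²) (z.1.1 - z.2, z.1.2) = F (z.1.1 - z.2, z.1.2) + G (z.1.1 - z.2, z.1.2)) ?_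
      exact (Measure.measurePreserving_swap
       ).quasiMeasurePreserving.ae h0
    filter_upwards [hfin F, hfin G, h3] with p h1 h2 h3
    rw [Pi.add_apply, ← integral_add h1 h2]
    refine integral_congr_ae ?_
    filter_upwards [h3] with y h
    rw [h, mul_add]
  · rw [eLpNorm_two_eq_l2n]
    refine l2n_le_of_sq_le ?_
    calc _ ≤ ∫⁻ p : ℝ², C * ∫⁻ y, K₀ y * ‖F (p.1 - y, p.2)‖ₑ ^ 2 := by
          refine lintegral_mono fun p => le_trans ?_ (hsq F p)
          gcongr
          exact enorm_integral_le_lintegral_enorm _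
      _ = C * ∫⁻ p : ℝ², ∫⁻ y, K₀ y * ‖F (p.1 - y, p.2)‖ₑ ^ 2 :=
          lintegral_const_mul' _ _ coe_ne_top
      _ ≤ C * (C * ‖F‖ₑ ^ 2) := by gcongr; exact hint F
      _ = _ := by ring

theorem exists_reflect : ∃ T : L2 ℝ² →+ L2 ℝ²,
      (∀ F, T F =ᵐ[volume] fun p => conj (F (-p))) ∧ ∀ F, ‖T F‖ ≤ ‖F‖ := by
  have mp : MeasurePreserving (fun p : ℝ² => -p) volume volume := Measure.measurePreserving_neg 𝓛²
  have := exists_L2op (T := fun (F : L2 ℝ²) p => conj (F (-p))) (C := 1)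
    (fun F => ?_) (fun F G => ?_) fun F => ?_
  · simpa using this
  · have h2 := (Lp.stronglyMeasurable F).measurable
    have h3 : Measurable fun p => F (-p) := h2.comp measurable_neg
    exact (continuous_conj.measurable.comp h3).aestronglyMeasurable
  · filter_upwards [mp.quasiMeasurePreserving.ae_eq_comp (Lp.coeFn_add F G)] with p hp
    simp only [comp_apply] at hp
    simp only [hp, Pi.add_apply, map_add]
  · rw [L2.enorm_eq, eLpNorm_two_eq_l2n]
    refine le_of_eq ?_
    unfold l2n; rw [ENNReal.coe_one, one_mul]
    congr 1
    rw [← mp.lintegral_comp ((Lp.stronglyMeasurable F).measurable.enorm.pow_const 2)]; simp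

/-- The character `e^{2πix}`. -/
def ex (x : ℝ) : ℂ := Complex.exp ((2 * π * x : ℝ) * I)

@[fun_prop]
theorem continuous_ex : Continuous ex := by unfold ex; fun_prop

@[fun_prop]
theorem measurable_ex : Measurable ex := continuous_ex.measurable

@[simp] theorem ex_zero : ex 0 = 1 := by simp [ex]

theorem ex_add (x y : ℝ) : ex (x + y) = ex x * ex y := by
  rw [ex, ex, ex, ← exp_add]; congr 1; push_cast; ring

@[simp] theorem norm_ex (x : ℝ) : ‖ex x‖ = 1 := Complex.norm_exp_ofReal_mul_I _

theorem enorm_ex (x : ℝ) : ‖ex x‖ₑ = 1 := by rw [← ofReal_norm, norm_ex]; simp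

theorem conj_ex (x : ℝ) : conj (ex x) = ex (-x) := by
  rw [ex, ex, ← Complex.exp_conj, map_mul, conj_ofReal, conj_I]
  congr 1; push_cast; ring

theorem fourier_eq_ex {E : Type*} [NormedAddCommGroup E] [NormedSpace ℂ E] (f : ℝ → E) (w : ℝ) :
    𝓕 f w = ∫ v, ex (-(v * w)) • f v := by
  rw [Real.fourier_real_eq_integral_exp_smul]
  congr 1; ext v; rw [ex]; congr 3; ring_nf

theorem fourierInv_eq_ex {E : Type*} [NormedAddCommGroup E] [NormedSpace ℂ E] (f : ℝ → E)
    (w : ℝ) : 𝓕⁻ f w = ∫ v, ex (v * w) • f v := by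
  rw [Real.fourierInv_eq_fourier_neg, fourier_eq_ex]
  congr 1; ext v; simp

theorem integral_ex_mul_integral_ex_neg {g : ℝ → ℂ} (hc : Continuous g) (hi : Integrable g)
    (hF : Integrable fun σ : ℝ => ∫ t, ex (-(t * σ)) * g t) (t : ℝ) :
    ∫ σ : ℝ, ex (t * σ) * ∫ t', ex (-(t' * σ)) * g t' = g t := by
  have h1 : 𝓕 g = fun σ => ∫ t, ex (-(t * σ)) * g t := by
    ext σ; rw [fourier_eq_ex]; simp only [smul_eq_mul]
  have h2 := hc.fourierInv_fourier_eq hi (by rw [h1]; exact hF)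
  have h3 := congrFun h2 t
  rw [fourierInv_eq_ex, h1] at h3
  simpa only [smul_eq_mul, mul_comm _ t] using h3

/-- The weight `λ + |x|`. -/
def lb (lam x : ℝ) : ℝ := lam + |x|

@[fun_prop]
theorem continuous_lb (lam : ℝ) : Continuous (lb lam) := by unfold lb; fun_prop

@[fun_prop]
theorem measurable_lb (lam : ℝ) : Measurable (lb lam) := (continuous_lb lam).measurable

theorem le_lb (lam x : ℝ) : lam ≤ lb lam x := by unfold lb; linarith [abs_nonneg x]

theorem lb_pos {lam : ℝ} (h : 0 < lam) (x : ℝ) : 0 < lb lam x := h.trans_le (le_lb lam x)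

theorem jb_le_lb {lam : ℝ} (h : 1 ≤ lam) (x : ℝ) : jb x ≤ lb lam x := by unfold lb jb; linarith

theorem lb_neg (lam x : ℝ) : lb lam (-x) = lb lam x := by simp [lb]

theorem lb_add_le {lam : ℝ} (h : 0 < lam) (x y : ℝ) :
    lb lam (x + y) ≤ lb lam x * (lb lam y / lam) := by
  have h1 : lb lam x * (lb lam y / lam) = lam + |x| + |y| + |x| * |y| / lam := by
    unfold lb; field_simp; ring
  rw [h1, lb]
  have := abs_add_le x y
  have : 0 ≤ |x| * |y| / lam := by positivity
  linarith

theorem lb_eq_mul_jb {lam : ℝ} (h : 0 < lam) (x : ℝ) : lb lam x = lam * jb (lam⁻¹ * x) := by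
  unfold lb jb; rw [abs_mul, abs_inv, abs_of_pos h]
  field_simp

theorem lintegral_comp_mul_left_real {a : ℝ} (ha : 0 < a) {f : ℝ → ℝ≥0∞} (hf : Measurable f) :
    ∫⁻ x, f (a * x) = ofReal a⁻¹ * ∫⁻ x, f x := by
  rw [← lintegral_map hf (by fun_prop),
    Real.map_volume_mul_left ha.ne', lintegral_smul_measure, abs_of_pos (inv_pos.2 ha), smul_eq_mul]

theorem exists_lintegral_lb_le {A : ℝ} (hA : 1 < A) : ∃ C : NNReal, ∀ lam : ℝ, 0 < lam → ∀ y : ℝ,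
      ∫⁻ x, ofReal (lb lam (x + y) ^ (-A)) ≤ C * ofReal (lam ^ (1 - A)) := by
  obtain ⟨C, hC⟩ := exists_lintegral_jb_le hA
  refine ⟨C, fun lam hl y => ?_⟩
  rw [lintegral_add_right_eq_self (fun x => ofReal (lb lam x ^ (-A))) y]
  have h1 : ∀ x, ofReal (lb lam x ^ (-A)) =
      ofReal (lam ^ (-A)) * ofReal (jb (lam⁻¹ * x) ^ (-A)) := by
    intro x
    rw [lb_eq_mul_jb hl, mul_rpow hl.le (jb_pos _).le, ofReal_mul (by positivity)]
  simp only [h1]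
  rw [lintegral_const_mul _ (by fun_prop),
    lintegral_comp_mul_left_real (inv_pos.2 hl) (f := fun x => ofReal (jb x ^ (-A)))
      (by fun_prop), inv_inv, ← mul_assoc, ← ofReal_mul (by positivity), mul_comm]
  have h2 : lam ^ (-A) * lam = lam ^ (1 - A) := by
    nth_rewrite 2 [← rpow_one lam]
    rw [← rpow_add hl]; congr 1; ring
  rw [h2]; gcongr
  simpa using hC 0

/-- The Fourier transform of `e^{-λ|t|}`. -/
def lz (lam σ : ℝ) : ℝ := 2 * lam / (lam ^ 2 + (2 * π * σ) ^ 2)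

theorem lz_nonneg {lam : ℝ} (h : 0 ≤ lam) (σ : ℝ) : 0 ≤ lz lam σ := by unfold lz; positivity

@[fun_prop]
theorem measurable_lz (lam : ℝ) : Measurable (lz lam) := by unfold lz; fun_prop

theorem lz_le {lam : ℝ} (h : 0 < lam) (σ : ℝ) : lz lam σ ≤ 4 * lam * lb lam σ ^ (-2 : ℝ) := by
  have h0 := lb_pos h σ
  have h1 : lb lam σ ^ (-2 : ℝ) = (lb lam σ ^ 2)⁻¹ := by rw [rpow_neg h0.le]; norm_cast
  rw [h1, lz, ← div_eq_mul_inv, div_le_div_iff₀ (by positivity) (by positivity)]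
  have h2 : lb lam σ ^ 2 ≤ 2 * (lam ^ 2 + (2 * π * σ) ^ 2) := by
    have h3 : σ ^ 2 ≤ (2 * π * σ) ^ 2 := by
      rw [mul_pow]
      have : 1 ≤ (2 * π) ^ 2 := by nlinarith [pi_gt_three]
      nlinarith [sq_nonneg σ]
    unfold lb
    nlinarith [sq_nonneg (lam - |σ|), sq_abs σ]
  nlinarith

theorem integrable_lz {lam : ℝ} (h : 0 < lam) : Integrable (lz lam) := by
  obtain ⟨C, hC⟩ := exists_lintegral_lb_le (A := 2) (by norm_num)
  refine ⟨(measurable_lz lam).aestronglyMeasurable, ?_⟩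
  calc ∫⁻ σ, ‖lz lam σ‖ₑ ≤ ∫⁻ σ, ofReal (4 * lam) *
        ofReal (lb lam (σ + 0) ^ (-2 : ℝ)) := by
        refine lintegral_mono fun σ => ?_
        rw [← ofReal_norm, norm_of_nonneg (lz_nonneg h.le σ), add_zero,
          ← ofReal_mul (by positivity)]
        exact ofReal_le_ofReal (lz_le h σ)
    _ = ofReal (4 * lam) * ∫⁻ σ, ofReal (lb lam (σ + 0) ^ (-2 : ℝ)) :=
        lintegral_const_mul' _ _ ofReal_ne_top
    _ < ∞ := mul_lt_top ofReal_lt_top ((hC lam h 0).trans_lt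
        (mul_lt_top coe_lt_top ofReal_lt_top))

/-- The symbol `λ + 2πiσ`. -/
def sy (lam σ : ℝ) : ℂ := lam + (2 * π * σ : ℝ) * I

@[fun_prop]
theorem continuous_sy (lam : ℝ) : Continuous (sy lam) := by unfold sy; fun_prop

@[fun_prop]
theorem measurable_sy (lam : ℝ) : Measurable (sy lam) := (continuous_sy lam).measurable

theorem sy_ne_zero {lam : ℝ} (h : 0 < lam) (σ : ℝ) : sy lam σ ≠ 0 := by
  intro h0
  have := congrArg Complex.re h0
  simp [sy] at this
  exact h.ne' this

theorem le_norm_sy {lam : ℝ} (h : 0 < lam) (σ : ℝ) : lam ≤ ‖sy lam σ‖ := by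
  have := Complex.abs_re_le_norm (sy lam σ)
  have h3 : (sy lam σ).re = lam := by simp [sy]
  rwa [h3, abs_of_pos h] at this

theorem lb_le_norm_sy {lam : ℝ} (h : 0 < lam) (σ : ℝ) : lb lam σ ≤ 2 * ‖sy lam σ‖ := by
  have h1 := le_norm_sy h σ
  have h2 : |σ| ≤ ‖sy lam σ‖ := by
    have := Complex.abs_im_le_norm (sy lam σ)
    simp only [sy, Complex.add_im, ofReal_im, Complex.mul_im, Complex.ofReal_re,
      Complex.I_im, mul_one, Complex.I_re, mul_zero, add_zero, zero_add] at this
    rw [abs_mul, abs_of_pos (by positivity)] at this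
    exact le_trans (by nlinarith [pi_gt_three, abs_nonneg σ]) this
  unfold lb; linarith

theorem sy_mul_lz {lam : ℝ} (h : 0 < lam) (σ : ℝ) :
    sy lam σ * lz lam σ = 2 * lam / sy lam (-σ) := by
  have h1 : (lam ^ 2 + (2 * π * σ) ^ 2 : ℂ) = sy lam σ * sy lam (-σ) := by
    unfold sy; push_cast; ring_nf; rw [I_sq]; ring
  rw [lz]; push_cast; rw [h1]
  field_simp [sy_ne_zero h σ, sy_ne_zero h (-σ)]

theorem integrableOn_exp_ex_Iic {lam : ℝ} (h : 0 < lam) (σ : ℝ) :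
    IntegrableOn (fun t : ℝ => ex (-(t * σ)) * Complex.exp (lam * t)) (Iic 0) := by
  have h1 := integrableOn_exp_mul_complex_Iic (a := sy lam (-σ)) (by simpa [sy] using h) 0
  refine h1.congr_fun (fun t _ => ?_) measurableSet_Iic
  simp only [ex, sy, ← exp_add]; congr 1; push_cast; ring

theorem integral_exp_ex_Iic {lam : ℝ} (h : 0 < lam) (σ : ℝ) :
    ∫ t in Iic (0 : ℝ), ex (-(t * σ)) * Complex.exp (lam * t) = 1 / sy lam (-σ) := by
  have h1 := integral_exp_mul_complex_Iic (a := sy lam (-σ)) (by simpa [sy] using h) 0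
  simp only [ofReal_zero, mul_zero, Complex.exp_zero] at h1; rw [← h1]
  refine setIntegral_congr_fun measurableSet_Iic fun t _ => ?_
  simp only [ex, sy, ← exp_add]; congr 1; push_cast; ring

theorem integrableOn_exp_ex_Ioi {lam : ℝ} (h : 0 < lam) (σ : ℝ) :
    IntegrableOn (fun t : ℝ => ex (-(t * σ)) * Complex.exp (-(lam * t))) (Ioi 0) := by
  have h1 := integrableOn_exp_mul_complex_Ioi (a := -sy lam σ) (by simpa [sy] using h) 0
  refine h1.congr_fun (fun t _ => ?_) measurableSet_Ioi
  simp only [ex, sy, ← exp_add]; congr 1; push_cast; ring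

theorem integral_exp_ex_Ioi {lam : ℝ} (h : 0 < lam) (σ : ℝ) :
    ∫ t in Ioi (0 : ℝ), ex (-(t * σ)) * Complex.exp (-(lam * t)) = 1 / sy lam σ := by
  have h1 := integral_exp_mul_complex_Ioi (a := -sy lam σ) (by simpa [sy] using h) 0
  simp only [ofReal_zero, mul_zero, Complex.exp_zero, neg_div_neg_eq] at h1; rw [← h1]
  refine setIntegral_congr_fun measurableSet_Ioi fun t _ => ?_
  simp only [ex, sy, ← exp_add]; congr 1; push_cast; ring

theorem integral_ex_mul_lz {lam : ℝ} (h : 0 < lam) (t : ℝ) :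
    ∫ σ : ℝ, ex (t * σ) * lz lam σ = (exp (-(lam * |t|)) : ℂ) := by
  set g : ℝ → ℂ := fun t => (exp (-(lam * |t|)) : ℂ) with hg
  have e1 : Set.EqOn (fun t : ℝ => Complex.exp (lam * t)) g (Iic 0) := fun t ht => by
    simp only [hg, abs_of_nonpos (Set.mem_Iic.1 ht)]; push_cast; congr 1; ring
  have e2 : Set.EqOn (fun t : ℝ => Complex.exp (-(lam * t))) g (Ioi 0) := fun t ht => by
    simp only [hg, abs_of_pos (Set.mem_Ioi.1 ht)]; push_cast; rfl
  have i1 : ∀ σ, IntegrableOn (fun t => ex (-(t * σ)) * g t) (Iic 0) := fun σ =>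
    (integrableOn_exp_ex_Iic h σ).congr_fun (fun t ht => by simp only [← e1 ht]) measurableSet_Iic
  have i2 : ∀ σ, IntegrableOn (fun t => ex (-(t * σ)) * g t) (Ioi 0) := fun σ =>
    (integrableOn_exp_ex_Ioi h σ).congr_fun (fun t ht => by simp only [← e2 ht]) measurableSet_Ioi
  have key : ∀ σ, ∫ t, ex (-(t * σ)) * g t = (lz lam σ : ℂ) := by
    intro σ
    rw [← intervalIntegral.integral_Iic_add_Ioi (i1 σ) (i2 σ),
      setIntegral_congr_fun (g := fun t => ex (-(t * σ)) * Complex.exp (lam * t))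
        measurableSet_Iic (fun t ht => by simp only [← e1 ht]), integral_exp_ex_Iic h,
      setIntegral_congr_fun (g := fun t => ex (-(t * σ)) * Complex.exp (-(lam * t)))
        measurableSet_Ioi (fun t ht => by simp only [← e2 ht]), integral_exp_ex_Ioi h]
    have h1 := sy_mul_lz h σ
    have h2 := sy_ne_zero h σ
    have h3 := sy_ne_zero h (-σ)
    have h4 : sy lam σ + sy lam (-σ) = 2 * lam := by unfold sy; push_cast; ring
    have : (lz lam σ : ℂ) = 2 * lam / sy lam (-σ) / sy lam σ := by rw [← h1]; field_simp
    rw [this, ← h4]; field_simp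
  have hgi : Integrable g := by
    have := (i1 0).union (i2 0)
    rw [Set.Iic_union_Ioi, integrableOn_univ] at this
    simpa using this
  have := integral_ex_mul_integral_ex_neg (by simp only [hg]; fun_prop) hgi
    (by simp only [key]; exact (integrable_lz h).ofReal) t
  simpa only [key] using this

/-- The weight `⟨ξ⟩^s (λ + |τ + h(ξ)|)^b`. -/
def wt (s b lam : ℝ) (h : ℝ → ℝ) (p : ℝ²) : ℝ := jb p.2 ^ s * lb lam (p.1 + h p.2) ^ b

/-- The function whose product with the weight `W` is `F`. -/
def den (W : ℝ² → ℝ) (F : ℝ² → ℂ) (p : ℝ²) : ℂ := ((W p)⁻¹ : ℝ) * F p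

/-- The partial Fourier transform in time. -/
def hat {F : Type*} [NormedAddCommGroup F] [NormedSpace ℂ F] (f : ℝ² → F) (t ξ : ℝ) : F :=
  ∫ τ : ℝ, ex (t * τ) • f (τ, ξ)

theorem wt_pos {s b lam : ℝ} (hl : 0 < lam) (h : ℝ → ℝ) (p : ℝ²) : 0 < wt s b lam h p :=
  mul_pos (jb_rpow_pos _ _) (rpow_pos_of_pos (lb_pos hl _) _)

theorem measurable_wt (s b lam : ℝ) {h : ℝ → ℝ} (hh : Measurable h) :
    Measurable (wt s b lam h) := by unfold wt; fun_prop

theorem measurable_den {W : ℝ² → ℝ} (hW : Measurable W) (F : L2 ℝ²) : Measurable (den W F) := by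
  unfold den; fun_prop

theorem den_add (W : ℝ² → ℝ) (F G : L2 ℝ²) :
    den W (F + G : L2 ℝ²) =ᵐ[volume] den W F + den W G := by
  filter_upwards [Lp.coeFn_add F G] with p hp
  simp only [den, hp, Pi.add_apply, mul_add]

theorem den_sub (W : ℝ² → ℝ) (F G : L2 ℝ²) :
    den W (F - G : L2 ℝ²) =ᵐ[volume] den W F - den W G := by
  filter_upwards [Lp.coeFn_sub F G] with p hp
  simp only [den, hp, Pi.sub_apply, mul_sub]

theorem lintegral_inv_wt_sq {s b : ℝ} (hb : 1 / 2 < b) {h : ℝ → ℝ} :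
    ∃ C : NNReal, ∀ lam : ℝ, 1 ≤ lam → ∀ ξ : ℝ,
      ∫⁻ τ : ℝ, ‖(((wt s b lam h (τ, ξ))⁻¹ : ℝ) : ℂ)‖ₑ ^ 2 ≤ C * ofReal (jb ξ ^ (-2 * s)) := by
  obtain ⟨C, hC⟩ := exists_lintegral_jb_le (A := 2 * b) (by linarith)
  refine ⟨C, fun lam hl ξ => ?_⟩
  have hl0 : 0 < lam := by linarith
  calc _ ≤ ∫⁻ τ, ofReal (jb ξ ^ (-2 * s)) *
        ofReal (jb (τ + h ξ) ^ (-(2 * b))) := by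
        refine lintegral_mono fun τ => ?_
        have hp := wt_pos (s := s) (b := b) hl0 h (τ, ξ)
        rw [← ofReal_norm, norm_ofReal_of_nonneg (inv_nonneg.2 hp.le),
          ← ofReal_pow (inv_nonneg.2 hp.le), ← ofReal_mul
            (jb_rpow_nonneg _ _)]
        refine ofReal_le_ofReal ?_
        have h1 : jb (τ + h ξ) ^ b ≤ lb lam (τ + h ξ) ^ b :=
          rpow_le_rpow (jb_pos _).le (jb_le_lb hl _) (by linarith)
        have h2 := jb_rpow_pos (τ + h ξ) b
        have e1 : jb ξ ^ (-2 * s) = ((jb ξ ^ s) ^ 2)⁻¹ := by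
          rw [← rpow_natCast, ← rpow_mul (jb_pos _).le, ← rpow_neg (jb_pos _).le]
          congr 1; push_cast; ring
        have e2 : jb (τ + h ξ) ^ (-(2 * b)) = ((jb (τ + h ξ) ^ b) ^ 2)⁻¹ := by
          rw [← rpow_natCast, ← rpow_mul (jb_pos _).le, ← rpow_neg (jb_pos _).le]
          congr 1; push_cast; ring
        rw [e1, e2, ← mul_inv, inv_pow, wt, mul_pow]
        have h3 := jb_rpow_pos ξ s
        gcongr
    _ = ofReal (jb ξ ^ (-2 * s)) * ∫⁻ τ, ofReal (jb (τ + h ξ) ^ (-(2 * b))) :=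
        lintegral_const_mul' _ _ ofReal_ne_top
    _ ≤ _ := by rw [mul_comm]; gcongr; exact hC _

theorem ae_integrable_den {s b lam : ℝ} (hb : 1 / 2 < b) (hl : 1 ≤ lam) {h : ℝ → ℝ}
    (hh : Measurable h) (F : L2 ℝ²) :
    ∀ᵐ ξ : ℝ, Integrable fun τ : ℝ => den (wt s b lam h) F (τ, ξ) := by
  obtain ⟨C, hC⟩ := lintegral_inv_wt_sq hb
  have m := (measurable_wt s b lam hh).inv
  exact ae_integrable_slice (e := fun p => (((wt s b lam h p)⁻¹ : ℝ) : ℂ))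
    (measurable_ofReal.comp m)
    (fun ξ => (hC lam hl ξ).trans_lt (mul_lt_top coe_lt_top ofReal_lt_top)) F

/-- A function with polynomial growth in frequency, integrable in the modulation. -/
def Tame {F : Type*} [NormedAddCommGroup F] [NormedSpace ℂ F] (f : ℝ² → F) : Prop :=
  AEStronglyMeasurable f volume ∧ ∃ N : ℝ, Integrable (fun p => jc p.2 (-N) • f p)

theorem tame_den {s b lam : ℝ} (hb : 1 / 2 < b) (hl : 1 ≤ lam) {h : ℝ → ℝ}
    (hh : Measurable h) (F : L2 ℝ²) : Tame (den (wt s b lam h) F) := by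
  obtain ⟨C, hC⟩ := lintegral_inv_wt_sq hb
  obtain ⟨C', hC'⟩ := exists_lintegral_jb_le (A := 2) (by norm_num)
  have mW := measurable_wt s b lam hh
  refine ⟨(measurable_den mW F).aestronglyMeasurable, 1 - s, ?_⟩
  have m : Measurable fun p =>
      ((jb p.2 ^ (-(1 - s)) : ℝ) : ℂ) * (((wt s b lam h p)⁻¹ : ℝ) : ℂ) := by fun_prop
  have hmem : MemLp (fun p =>
      ((jb p.2 ^ (-(1 - s)) : ℝ) : ℂ) * (((wt s b lam h p)⁻¹ : ℝ) : ℂ)) 2 volume := by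
    refine ⟨m.aestronglyMeasurable, ?_⟩
    have hfin : ∫⁻ p, ‖((jb p.2 ^ (-(1 - s)) : ℝ) : ℂ) *
        (((wt s b lam h p)⁻¹ : ℝ) : ℂ)‖ₑ ^ 2 ≤ C * C' := by
      calc _ = ∫⁻ ξ, ∫⁻ τ, ‖((jb ξ ^ (-(1 - s)) : ℝ) : ℂ) *
            (((wt s b lam h (τ, ξ))⁻¹ : ℝ) : ℂ)‖ₑ ^ 2 :=
            lintegral_prod_symm
              (fun p => ‖((jb p.2 ^ (-(1 - s)) : ℝ) : ℂ) *
                (((wt s b lam h p)⁻¹ : ℝ) : ℂ)‖ₑ ^ 2) (m.enorm.pow_const 2).aemeasurable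
        _ ≤ ∫⁻ ξ, C * ofReal (jb (ξ + 0) ^ (-2 : ℝ)) := by
            refine lintegral_mono fun ξ => ?_
            simp only [enorm_mul, mul_pow]
            rw [lintegral_const_mul' _ _ (by simp)]
            refine (mul_le_mul_right (hC lam hl ξ) _).trans (le_of_eq ?_)
            have h3 := jb_rpow_pos ξ (-(1 - s))
            rw [← ofReal_norm, norm_ofReal_of_nonneg h3.le,
              ← ofReal_pow h3.le, mul_left_comm, ← ofReal_mul (by positivity),
              add_zero, ← rpow_natCast, ← rpow_mul (jb_pos _).le,
              ← rpow_add (jb_pos _)]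
            congr 3; push_cast; ring
        _ = C * ∫⁻ ξ, ofReal (jb (ξ + 0) ^ (-2 : ℝ)) := lintegral_const_mul' _ _ coe_ne_top
        _ ≤ _ := by gcongr; exact hC' 0
    rw [eLpNorm_two_eq_l2n, l2n]
    exact ENNReal.rpow_lt_top_of_nonneg (by norm_num)
      (hfin.trans_lt (mul_lt_top coe_lt_top coe_lt_top)).ne
  refine (hmem.integrable_mul (Lp.memLp F)).congr (.of_forall fun p => ?_)
  simp only [den, smul_eq_mul, Pi.mul_apply, mul_assoc]

theorem exists_duhamel (s : ℝ) {b : ℝ} (hb : 1 / 2 < b) (hb' : b < 3 / 2) {h : ℝ → ℝ}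
    (hh : Measurable h) :
    ∃ C : NNReal, ∀ lam : ℝ, 1 ≤ lam → ∃ (K : L2 ℝ² →+ L2 ℝ²) (E : L2 ℝ →+ L2 ℝ²),
        (∀ N, ‖K N‖ ≤ C * lam ^ (b - 1 / 2) * ‖N‖) ∧ (∀ c, ‖E c‖ ≤ C * lam ^ (b - 1 / 2) * ‖c‖) ∧
        ∀ N c, ∃ d : L2 ℝ,
          (∀ᵐ p : ℝ², sy lam (p.1 + h p.2) * den (wt s b lam h) (K N + E c : L2 ℝ²) p =
            den (wt s (b - 1) lam h) N p +
              jc p.2 (-s) * d p.2 * (2 * lam / sy lam (-(p.1 + h p.2)))) ∧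
          ∀ᵐ ξ : ℝ, ∫ τ : ℝ, den (wt s b lam h) (K N + E c : L2 ℝ²) (τ, ξ) = jc ξ (-s) * c ξ := by
  obtain ⟨C₁, hC₁⟩ := exists_lintegral_jb_le (A := 2 * b) (by linarith)
  obtain ⟨C₂, hC₂⟩ := exists_lintegral_lb_le (A := 4 - 2 * b) (by linarith)
  set A₁ : NNReal := NNReal.sqrt C₁ with hA₁
  set A₂ : NNReal := 4 * NNReal.sqrt C₂ with hA₂
  refine ⟨2 + A₂ * (A₁ * 2) + A₂, fun lam hl => ?_⟩
  have hl0 : 0 < lam := by linarith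
  set P : NNReal := ⟨lam ^ (b - 1 / 2), by positivity⟩
  have hP1 : 1 ≤ lam ^ (b - 1 / 2) := one_le_rpow hl (by linarith)
  obtain ⟨R, hR, hRn⟩ := exists_mulOp (X := ℝ²)
    (m := fun p => (lb lam (p.1 + h p.2) : ℂ) / sy lam (p.1 + h p.2)) (by fun_prop) (C := 2)
    (fun p => by
      rw [norm_div, norm_ofReal_of_nonneg (lb_pos hl0 _).le,
        div_le_iff₀ (norm_pos_iff.2 (sy_ne_zero hl0 _))]
      exact lb_le_norm_sy hl0 _)
  obtain ⟨V, hV, hVn⟩ := exists_sliceInt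
    (e := fun p => ((lb lam (p.1 + h p.2) ^ (-b) : ℝ) : ℂ)) (by fun_prop) (C := A₁) (fun ξ => by
      refine le_trans (lintegral_mono fun τ => ?_) ((hC₁ (h ξ)).trans (le_of_eq ?_))
      · have h0 := rpow_pos_of_pos (lb_pos hl0 (τ + h ξ)) (-b)
        rw [← ofReal_norm, norm_ofReal_of_nonneg h0.le,
          ← ofReal_pow h0.le, ← rpow_natCast, ← rpow_mul (lb_pos hl0 _).le]
        refine ofReal_le_ofReal ?_
        have : -b * (2 : ℕ) = -(2 * b) := by push_cast; ring
        rw [this]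
        exact rpow_le_rpow_of_nonpos (jb_pos _) (jb_le_lb hl _) (by linarith)
      · rw [hA₁]; norm_cast; rw [NNReal.sq_sqrt])
  obtain ⟨X, hX, hXn⟩ := exists_sliceExt
    (e := fun p => ((lb lam (p.1 + h p.2) ^ b * lz lam (p.1 + h p.2) : ℝ) : ℂ)) (by fun_prop)
    (C := A₂ * P) (fun ξ => by
      have hle : ∀ τ, ‖((lb lam (τ + h ξ) ^ b * lz lam (τ + h ξ) : ℝ) : ℂ)‖ₑ ^ 2 ≤
          ofReal (16 * lam ^ 2) * ofReal (lb lam (τ + h ξ) ^ (-(4 - 2 * b))) := by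
        intro τ
        have h0 := lb_pos hl0 (τ + h ξ)
        have h1 := rpow_pos_of_pos h0 b
        have h2 := lz_nonneg hl0.le (τ + h ξ)
        rw [← ofReal_norm, norm_ofReal_of_nonneg (by positivity),
          ← ofReal_pow (by positivity), ← ofReal_mul (by positivity)]
        refine ofReal_le_ofReal ?_
        calc _ ≤ (lb lam (τ + h ξ) ^ b * (4 * lam * lb lam (τ + h ξ) ^ (-2 : ℝ))) ^ 2 := by
              gcongr; exact lz_le hl0 _
          _ = 16 * lam ^ 2 * (lb lam (τ + h ξ) ^ b * lb lam (τ + h ξ) ^ (-2 : ℝ)) ^ 2 := by ring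
          _ = _ := by
              rw [← rpow_add h0, ← rpow_natCast (lb lam (τ + h ξ) ^ (b + -2)) 2, ← rpow_mul h0.le]
              congr 2; push_cast; ring
      refine (lintegral_mono hle).trans ?_
      rw [lintegral_const_mul' _ _ ofReal_ne_top]
      refine (mul_le_mul_right (hC₂ lam hl0 (h ξ)) _).trans (le_of_eq ?_)
      have e1 : lam ^ 2 * lam ^ (1 - (4 - 2 * b)) = (lam ^ (b - 1 / 2)) ^ 2 := by
        rw [← rpow_natCast, ← rpow_natCast, ← rpow_mul hl0.le, ← rpow_add hl0]
        congr 1; push_cast; ring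
      rw [mul_left_comm, ← ofReal_mul (by positivity), mul_assoc, e1]
      have e2 : ofReal (16 * (lam ^ (b - 1 / 2)) ^ 2) = ((16 * P ^ 2 : NNReal) : ℝ≥0∞) := by
        rw [ENNReal.ofReal_eq_coe_nnreal (by positivity)]; rfl
      rw [e2, hA₂]; norm_cast
      rw [mul_pow, mul_pow, NNReal.sq_sqrt]
      ring)
  have hXn' : ∀ c, ‖X c‖ ≤ A₂ * lam ^ (b - 1 / 2) * ‖c‖ := fun c => by
    have := hXn c
    rwa [NNReal.coe_mul] at this
  refine ⟨R - X.comp (V.comp R), X, fun N => ?_, fun c => ?_, fun N c => ⟨c - V (R N), ?_, ?_⟩⟩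
  · simp only [AddMonoidHom.sub_apply, AddMonoidHom.comp_apply]
    have h1 := hRn N
    have h2 := hVn (R N)
    have h3 := hXn' (V (R N))
    calc _ ≤ ‖R N‖ + ‖X (V (R N))‖ := norm_sub_le _ _
      _ ≤ 2 * lam ^ (b - 1 / 2) * ‖N‖ + A₂ * lam ^ (b - 1 / 2) * (A₁ * (2 * ‖N‖)) := by
          refine add_le_add (h1.trans ?_) (h3.trans ?_)
          · rw [mul_assoc]; push_cast
            have := mul_le_mul_of_nonneg_right hP1 (norm_nonneg N)
            linarith
          · gcongr; exact h2.trans (by gcongr; exact h1)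
      _ ≤ _ := by
          push_cast
          have : 0 ≤ A₂ * lam ^ (b - 1 / 2) * ‖N‖ := by positivity
          nlinarith
  · refine (hXn' c).trans ?_
    push_cast
    have : 0 ≤ (2 + A₂ * (A₁ * 2)) * lam ^ (b - 1 / 2) * ‖c‖ := by positivity
    nlinarith
  all_goals
    have e0 : (R - X.comp (V.comp R)) N + X c = R N + X (c - V (R N)) := by
      simp only [AddMonoidHom.sub_apply, AddMonoidHom.comp_apply, map_sub]; abel
    have key : ∀ᵐ p : ℝ², den (wt s b lam h) (R N + X (c - V (R N)) : L2 ℝ²) p =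
        jc p.2 (-s) * (((lb lam (p.1 + h p.2) ^ (-b) : ℝ) : ℂ) * R N p +
          lz lam (p.1 + h p.2) * (c - V (R N) : L2 ℝ) p.2) := by
      filter_upwards [Lp.coeFn_add (R N) (X (c - V (R N))), hX (c - V (R N))] with p h1 h2
      rw [den, h1, Pi.add_apply, h2, wt, mul_inv, ← rpow_neg (jb_pos _).le,
        ← rpow_neg (lb_pos hl0 _).le]
      have h3 : lb lam (p.1 + h p.2) ^ (-b) * lb lam (p.1 + h p.2) ^ b = 1 := by
        rw [← rpow_add (lb_pos hl0 _)]; simp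
      have h4 : ((lb lam (p.1 + h p.2) ^ (-b) : ℝ) : ℂ) * ((lb lam (p.1 + h p.2) ^ b : ℝ) : ℂ)
          = 1 := by exact_mod_cast h3
      push_cast at h4 ⊢
      linear_combination (jc p.2 (-s) * (lz lam (p.1 + h p.2) : ℂ) * (c - V (R N) : L2 ℝ) p.2) * h4
    rw [e0]
  · filter_upwards [key, hR N] with p h1 h2
    rw [h1, h2, den, wt, mul_inv, ← rpow_neg (jb_pos _).le, ← rpow_neg (lb_pos hl0 _).le]
    have h3 := sy_mul_lz hl0 (p.1 + h p.2)
    have h4 := sy_ne_zero hl0 (p.1 + h p.2)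
    have h5 : lb lam (p.1 + h p.2) ^ (-(b - 1)) =
        lb lam (p.1 + h p.2) ^ (-b) * lb lam (p.1 + h p.2) := by
      nth_rewrite 3 [← rpow_one (lb lam (p.1 + h p.2))]
      rw [← rpow_add (lb_pos hl0 _)]; congr 1; ring
    rw [h5, ← h3]; push_cast; field_simp
  · have hfin : ∀ ξ, ∫⁻ τ, ‖((lb lam (τ + h ξ) ^ (-b) : ℝ) : ℂ)‖ₑ ^ 2 < ∞ := fun ξ => by
      refine lt_of_le_of_lt (lintegral_mono fun τ => ?_) ((hC₁ (h ξ)).trans_lt coe_lt_top)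
      have h0 := rpow_pos_of_pos (lb_pos hl0 (τ + h ξ)) (-b)
      rw [← ofReal_norm, norm_ofReal_of_nonneg h0.le,
        ← ofReal_pow h0.le, ← rpow_natCast, ← rpow_mul (lb_pos hl0 _).le]
      refine ofReal_le_ofReal ?_
      have : -b * (2 : ℕ) = -(2 * b) := by push_cast; ring
      rw [this]
      exact rpow_le_rpow_of_nonpos (jb_pos _) (jb_le_lb hl _) (by linarith)
    filter_upwards [ae_prod_slice key, hV (R N), ae_integrable_slice
      (e := fun p => ((lb lam (p.1 + h p.2) ^ (-b) : ℝ) : ℂ)) (by fun_prop) hfin (R N),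
      Lp.coeFn_sub c (V (R N))] with ξ h1 h2 h3 h4
    have h6 : Integrable fun τ => (lz lam (τ + h ξ) : ℂ) * (c - V (R N) : L2 ℝ) ξ :=
      ((integrable_lz hl0).comp_add_right (h ξ)).ofReal.mul_const _
    rw [integral_congr_ae h1, integral_const_mul, integral_add h3 h6, ← h2, integral_mul_const, h4, Pi.sub_apply]
    have h5 : ∫ τ, (lz lam (τ + h ξ) : ℂ) = 1 := by
      rw [integral_add_right_eq_self (fun τ => (lz lam τ : ℂ)) (h ξ)]
      simpa using integral_ex_mul_lz hl0 0
    rw [h5]; ring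

theorem exists_timeCut (s : ℝ) {b : ℝ} (hb : 1 / 2 < b) (hb' : b < 1) {h : ℝ → ℝ}
    (hh : Measurable h) :
    ∃ C : NNReal, ∀ lam : ℝ, 1 ≤ lam → ∀ a : ℝ, ∃ M : L2 ℝ² →+ L2 ℝ²,
      (∀ F, ‖M F‖ ≤ C * ‖F‖) ∧ ∀ F, ∀ᵐ ξ : ℝ, ∀ t : ℝ, hat (den (wt s b lam h) (M F)) t ξ =
          (exp (-(lam * |t - a|)) : ℂ) * hat (den (wt s b lam h) F) t ξ := by
  obtain ⟨C, hC⟩ := exists_lintegral_lb_le (A := 2 - b) (by linarith)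
  refine ⟨4 * C, fun lam hl a => ?_⟩
  have hl0 : 0 < lam := by linarith
  set k : ℝ → ℂ := fun y => ex (-(a * y)) * lz lam y with hk
  set K : ℝ → ℝ² → ℂ := fun y p => k y *
    ((lb lam (p.1 + h p.2) ^ b * lb lam (p.1 - y + h p.2) ^ (-b) : ℝ) : ℂ) with hK
  set K₀ : ℝ → ℝ≥0∞ := fun y => ofReal (4 * lam ^ (1 - b)) *
    ofReal (lb lam (y + 0) ^ (-(2 - b))) with hK₀
  obtain ⟨M, hM, hMn⟩ := exists_sliceConv (K := K) (by unfold uncurry; fun_prop)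
    (K₀ := K₀) (by fun_prop) (C := 4 * C) (fun y p => by
      have h0 := lb_pos hl0 (p.1 + h p.2)
      have h0' := lb_pos hl0 (p.1 - y + h p.2)
      have h1 := rpow_pos_of_pos h0 b
      have h1' := rpow_pos_of_pos h0' (-b)
      have h2 := lz_nonneg hl0.le y
      have h3 := lb_pos hl0 y
      rw [hK, hK₀, hk]; simp only
      rw [enorm_mul, enorm_mul, enorm_ex, one_mul, ← ofReal_norm, ← ofReal_norm,
        norm_ofReal_of_nonneg h2, norm_ofReal_of_nonneg (by positivity),
        ← ofReal_mul h2, ← ofReal_mul (by positivity), add_zero]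
      refine ofReal_le_ofReal ?_
      have h4 : lb lam (p.1 + h p.2) ^ b * lb lam (p.1 - y + h p.2) ^ (-b) ≤ (lb lam y / lam) ^ b := by
        rw [rpow_neg h0'.le, ← div_eq_mul_inv, div_le_iff₀ (by positivity),
          ← mul_rpow (by positivity) h0'.le]
        refine rpow_le_rpow h0.le ?_ (by linarith)
        have := lb_add_le hl0 (p.1 - y + h p.2) y
        rw [mul_comm]
        convert this using 2; ring
      calc _ ≤ 4 * lam * lb lam y ^ (-2 : ℝ) * (lb lam y / lam) ^ b := by
            gcongr; exact lz_le hl0 y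
        _ = _ := by
            rw [Real.div_rpow h3.le hl0.le, div_eq_mul_inv, ← rpow_neg hl0.le]
            have e1 : lam * lam ^ (-b) = lam ^ (1 - b) := by
              nth_rewrite 1 [← rpow_one lam]
              rw [← rpow_add hl0]; congr 1
            have e2 : lb lam y ^ (-2 : ℝ) * lb lam y ^ b = lb lam y ^ (-(2 - b)) := by
              rw [← rpow_add h3]; congr 1; ring
            rw [← e1, ← e2]; ring)
    (by
      rw [hK₀, lintegral_const_mul' _ _ ofReal_ne_top]
      refine (mul_le_mul_right (hC lam hl0 0) _).trans (le_of_eq ?_)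
      rw [mul_left_comm, ← ofReal_mul (by positivity), mul_assoc 4, ← rpow_add hl0]
      have : 1 - b + (1 - (2 - b)) = 0 := by ring
      rw [this, rpow_zero, mul_comm, mul_one]; push_cast
      simp)
  refine ⟨M, hMn, fun F => ?_⟩
  have hki : Integrable k := by
    refine ((integrable_lz hl0).ofReal).bdd_mul (c := 1)
      (by fun_prop) (.of_forall fun y => ?_)
    simp
  filter_upwards [ae_prod_slice (hM F), ae_integrable_den hb hl hh F] with ξ h1 h2 t
  set f : ℝ → ℂ := fun τ => den (wt s b lam h) F (τ, ξ) with hf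
  have e1 : ∀ᵐ τ : ℝ, den (wt s b lam h) (M F) (τ, ξ) = ∫ y, k y * f (τ - y) := by
    filter_upwards [h1] with τ hτ
    rw [den, hτ, ← integral_const_mul]
    congr 1; ext y
    rw [hK, hf]
    simp only [den, wt]
    have h0 := rpow_pos_of_pos (lb_pos hl0 (τ + h ξ)) b
    rw [rpow_neg (lb_pos hl0 _).le, mul_inv, mul_inv]
    have : (lb lam (τ + h ξ) ^ b)⁻¹ * (lb lam (τ + h ξ) ^ b) = 1 := inv_mul_cancel₀ h0.ne'
    have h4 : (((lb lam (τ + h ξ) ^ b)⁻¹ : ℝ) : ℂ) * ((lb lam (τ + h ξ) ^ b : ℝ) : ℂ) = 1 := by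
      exact_mod_cast this
    push_cast at h4 ⊢
    linear_combination ((jc ξ s)⁻¹ * k y * ((lb lam (τ - y + h ξ) ^ b : ℝ) : ℂ)⁻¹ *
      F (τ - y, ξ)) * h4
  have hk' : Integrable fun y => ex (t * y) * k y := by
    refine hki.bdd_mul (c := 1) (by fun_prop) (.of_forall fun y => by simp)
  have hf' : Integrable fun y => ex (t * y) * f y := by
    refine h2.bdd_mul (c := 1) (by fun_prop) (.of_forall fun y => by simp)
  have e2 := integral_convolution (ContinuousLinearMap.mul ℂ ℂ) hk' hf'
  simp only [convolution_def, ContinuousLinearMap.mul_apply'] at e2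
  have e3 : ∫ y, ex (t * y) * k y = (exp (-(lam * |t - a|)) : ℂ) := by
    rw [← integral_ex_mul_lz hl0 (t - a)]
    congr 1; ext y
    rw [hk]; simp only; rw [← mul_assoc, ← ex_add]
    congr 2; ring
  rw [e3] at e2
  simp only [hat, smul_eq_mul]; rw [← e2]
  refine integral_congr_ae ?_
  filter_upwards [e1] with τ hτ
  rw [hτ, ← integral_const_mul]
  congr 1; ext y
  have : ex (t * τ) = ex (t * y) * ex (t * (τ - y)) := by rw [← ex_add]; congr 1; ring
  rw [this]; ring

/-- The reflection corresponding to complex conjugation in physical space. -/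
def refl (f : ℝ² → ℂ) (p : ℝ²) : ℂ := conj (f (-p))

theorem hat_refl (f : ℝ² → ℂ) (t ξ : ℝ) : hat (refl f) t ξ = conj (hat f t (-ξ)) := by
  simp only [hat, refl, smul_eq_mul, Prod.neg_mk]
  rw [← integral_conj, ← integral_neg_eq_self (fun τ => conj (ex (t * τ) * f (τ, -ξ)))]
  congr 1; ext τ
  rw [map_mul, conj_ex]; congr 2; ring

theorem den_refl {s b lam : ℝ} {h h' : ℝ → ℝ} (hh : ∀ ξ, h' ξ = -h (-ξ)) {F G : ℝ² → ℂ}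
    (hG : G =ᵐ[volume] refl F) :
    den (wt s b lam h') G =ᵐ[volume] refl (den (wt s b lam h) F) := by
  filter_upwards [hG] with p hp
  simp only [den, hp, refl, map_mul, conj_ofReal, wt]
  simp only [Prod.fst_neg, Prod.snd_neg, jb_neg]
  have : -p.1 + h (-p.2) = -(p.1 + h' p.2) := by rw [hh]; ring
  rw [this, lb_neg]

/-- Rapidly decreasing functions on frequency space whose inverse Fourier transform in time is
supported in positive times. -/
structure IsSym (κ : ℝ² → ℂ) : Prop where
  measurable : Measurable κ
  decay : ∀ N : ℝ, ∃ C : ℝ, ∀ p, ‖κ p‖ ≤ C * (jb p.1 ^ (-N) * jb p.2 ^ (-N))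
  support : ∀ t ≤ 0, ∀ ξ, ∫ τ : ℝ, ex (-(t * τ)) * κ (τ, ξ) = 0

theorem IsSym.decay_pos {κ : ℝ² → ℂ} (h : IsSym κ) (N : ℝ) :
    ∃ C : ℝ, 0 < C ∧ ∀ p, ‖κ p‖ ≤ C * (jb p.1 ^ (-N) * jb p.2 ^ (-N)) := by
  obtain ⟨C, hC⟩ := h.decay N
  refine ⟨max C 1, by positivity, fun p => (hC p).trans ?_⟩
  have := jb_rpow_pos p.1 (-N)
  have := jb_rpow_pos p.2 (-N)
  gcongr
  exact le_max_left _ _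

theorem IsSym.mul_left {κ : ℝ² → ℂ} (h : IsSym κ) {a : ℝ → ℂ} (ha : Measurable a) {n C : ℝ}
    (hC : ∀ ξ, ‖a ξ‖ ≤ C * jb ξ ^ n) : IsSym fun p => a p.2 * κ p where
  measurable := by have := h.measurable; fun_prop
  decay N := by
    obtain ⟨D, hD0, hD⟩ := h.decay_pos (max N (N + n))
    refine ⟨C * D, fun p => ?_⟩
    have hC0 : 0 ≤ C * jb p.2 ^ n := (norm_nonneg _).trans (hC p.2)
    have p1 := jb_rpow_pos p.1 (-N)
    rw [norm_mul]
    calc _ ≤ (C * jb p.2 ^ n) * (D * (jb p.1 ^ (-N) * jb p.2 ^ (-(N + n)))) := by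
          refine mul_le_mul (hC _) ((hD p).trans ?_) (norm_nonneg _) hC0
          gcongr
          · exact jb_rpow_nonneg _ _
          · exact one_le_jb _
          · exact le_max_left _ _
          · exact one_le_jb _
          · exact le_max_right _ _
      _ = C * D * (jb p.1 ^ (-N) * (jb p.2 ^ n * jb p.2 ^ (-(N + n)))) := by ring
      _ = _ := by rw [← rpow_add (jb_pos _)]; congr 4; ring
  support t ht ξ := by
    have := h.support t ht ξ
    simp only [mul_left_comm _ (a ξ)]
    rw [integral_const_mul, this, mul_zero]

theorem IsSym.refl {κ : ℝ² → ℂ} (h : IsSym κ) : IsSym (refl κ) where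
  measurable := continuous_conj.measurable.comp (h.measurable.comp measurable_neg)
  decay N := by
    obtain ⟨C, hC⟩ := h.decay N
    refine ⟨C, fun p => ?_⟩
    have := hC (-p)
    rw [Prod.fst_neg, Prod.snd_neg, jb_neg, jb_neg] at this
    simpa [DKG.refl] using this
  support t ht ξ := by
    have h1 := h.support t ht (-ξ)
    have h2 := congrArg (conj) h1
    rw [← integral_conj, map_zero,
      ← integral_neg_eq_self (fun τ => conj (ex (-(t * τ)) * κ (τ, -ξ)))] at h2
    rw [← h2]
    congr 1; ext τ
    rw [map_mul, conj_ex]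
    simp only [DKG.refl, Prod.neg_mk]
    congr 2; ring

theorem integrable_jb_rpow {A : ℝ} (hA : 1 < A) : Integrable fun x : ℝ => jb x ^ (-A) := by
  simpa [jb] using integrable_one_add_norm (E := ℝ) (by simpa using hA)

theorem IsSym.integrable_slice {κ : ℝ² → ℂ} (h : IsSym κ) (ξ : ℝ) :
    Integrable fun τ : ℝ => κ (τ, ξ) := by
  obtain ⟨C, hC⟩ := h.decay 2
  have hm : Measurable fun τ => κ (τ, ξ) := measurable_slice h.measurable ξ
  refine ((integrable_jb_rpow (A := 2) (by norm_num)).const_mul (C * jb ξ ^ (-2 : ℝ))).mono'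
    hm.aestronglyMeasurable (.of_forall fun τ => (hC _).trans (le_of_eq ?_))
  simp only; ring

theorem wt_le {s b lam : ℝ} (hl : 1 ≤ lam) {h : ℝ → ℝ} (hh : ∀ ξ, |h ξ| ≤ |ξ|) (p : ℝ²) :
    wt s b lam h p ≤ lam ^ |b| * (jb p.1 ^ |b| * jb p.2 ^ (s + |b|)) := by
  have hl0 : 0 < lam := by linarith
  have h1 : lb lam (p.1 + h p.2) ≤ lam * (jb p.1 * jb p.2) := by
    calc _ ≤ lam * jb (p.1 + h p.2) := by
          unfold lb jb; nlinarith [abs_nonneg (p.1 + h p.2)]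
      _ ≤ lam * (jb p.1 * jb (h p.2)) := by gcongr; exact jb_add_le_mul _ _
      _ ≤ _ := by
          have := jb_pos p.1
          gcongr
          unfold jb; linarith [hh p.2]
  have h2 : lb lam (p.1 + h p.2) ^ b ≤ (lam * (jb p.1 * jb p.2)) ^ |b| :=
    (rpow_le_rpow_of_exponent_le (hl.trans (le_lb _ _)) (le_abs_self b)).trans
      (rpow_le_rpow (lb_pos hl0 _).le h1 (abs_nonneg b))
  have h3 := jb_rpow_pos p.2 s
  calc _ ≤ jb p.2 ^ s * (lam * (jb p.1 * jb p.2)) ^ |b| := by unfold wt; gcongr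
    _ = _ := by
        rw [mul_rpow hl0.le (mul_pos (jb_pos _) (jb_pos _)).le,
          mul_rpow (jb_pos _).le (jb_pos _).le, rpow_add (jb_pos _)]
        ring

theorem wt_inv {s b lam : ℝ} (hl : 1 ≤ lam) (h : ℝ → ℝ) (p : ℝ²) :
    (wt s b lam h p)⁻¹ = wt (-s) (-b) lam h p := by
  unfold wt
  rw [mul_inv, rpow_neg (jb_pos _).le, rpow_neg (lb_pos (by linarith) _).le]

theorem memLp_jb_prod : MemLp (fun p : ℝ² => (jb p.1 ^ (-1 : ℝ) * jb p.2 ^ (-1 : ℝ))) 2 volume := by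
  have h1 := integrable_jb_rpow (A := 2) (by norm_num)
  rw [memLp_two_iff_integrable_sq (by fun_prop)]
  refine (h1.mul_prod h1).congr (.of_forall fun p => ?_)
  simp only
  rw [mul_pow, ← rpow_natCast, ← rpow_natCast, ← rpow_mul (jb_pos _).le, ← rpow_mul (jb_pos _).le]
  norm_num

theorem IsSym.memLp_wt {κ : ℝ² → ℂ} (hκ : IsSym κ) (s b : ℝ) {lam : ℝ} (hl : 1 ≤ lam)
    {h : ℝ → ℝ} (hm : Measurable h) (hh : ∀ ξ, |h ξ| ≤ |ξ|) :
    MemLp (fun p => (wt s b lam h p : ℂ) * κ p) 2 volume := by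
  obtain ⟨C, hC0, hC⟩ := hκ.decay_pos (|b| + |(s + |b|)| + 1)
  have m := measurable_wt s b lam hm
  have mκ := hκ.measurable
  refine (memLp_jb_prod.const_mul (lam ^ |b| * C)).mono
    (by fun_prop) (.of_forall fun p => ?_)
  have hl0 : 0 < lam := by linarith
  have p0 := wt_pos (s := s) (b := b) hl0 h p
  have j1 := jb_pos p.1
  have j2 := jb_pos p.2
  rw [norm_mul, norm_ofReal_of_nonneg p0.le]; rw [norm_of_nonneg (by positivity)]
  calc _ ≤ (lam ^ |b| * (jb p.1 ^ |b| * jb p.2 ^ (s + |b|))) * (C *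
        (jb p.1 ^ (-(|b| + |(s + |b|)| + 1)) * jb p.2 ^ (-(|b| + |(s + |b|)| + 1)))) := by
        gcongr
        · exact wt_le hl hh p
        · exact hC p
    _ = lam ^ |b| * C * ((jb p.1 ^ |b| * jb p.1 ^ (-(|b| + |(s + |b|)| + 1))) *
        (jb p.2 ^ (s + |b|) * jb p.2 ^ (-(|b| + |(s + |b|)| + 1)))) := by ring
    _ ≤ _ := by
        rw [← rpow_add j1, ← rpow_add j2]; gcongr
        · exact one_le_jb _
        · linarith [abs_nonneg (s + |b|)]
        · exact one_le_jb _
        · linarith [le_abs_self (s + |b|), abs_nonneg b]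

theorem IsSym.integrable_den_mul {κ : ℝ² → ℂ} (hκ : IsSym κ) (s b : ℝ) {lam : ℝ} (hl : 1 ≤ lam)
    {h : ℝ → ℝ} (hm : Measurable h) (hh : ∀ ξ, |h ξ| ≤ |ξ|) (F : L2 ℝ²) :
    Integrable fun p => den (wt s b lam h) F p * κ p := by
  refine ((Lp.memLp F).integrable_mul (hκ.memLp_wt (-s) (-b) hl hm hh)).congr
    (.of_forall fun p => ?_)
  simp only [den, wt_inv hl, Pi.mul_apply]; ring

theorem integral_div_sy_eq_zero {κ : ℝ → ℂ} (hi : Integrable κ)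
    (hs : ∀ t ≤ 0, ∫ τ : ℝ, ex (-(t * τ)) * κ τ = 0) {lam : ℝ} (hl : 0 < lam) (y : ℝ) :
    ∫ τ : ℝ, κ τ * (1 / sy lam (-(τ + y))) = 0 := by
  simp only [← integral_exp_ex_Iic hl, ← integral_const_mul]
  have hE : IntegrableOn (fun t : ℝ => Complex.exp (lam * t)) (Iic 0) := by
    simpa using integrableOn_exp_ex_Iic hl 0
  have hint : Integrable (uncurry fun (τ t : ℝ) =>
      κ τ * (ex (-(t * (τ + y))) * Complex.exp (lam * t)))
      (volume.prod (volume.restrict (Iic 0))) := by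
    have h1 := hi.mul_prod hE
    refine (h1.bdd_mul (c := 1) (f := fun z => ex (-(z.2 * (z.1 + y))))
      (by fun_prop) (.of_forall fun z => by simp)).congr
      (.of_forall fun z => ?_)
    simp only [uncurry]; ring
  rw [integral_integral_swap hint]
  refine (setIntegral_congr_fun (g := fun _ => (0 : ℂ)) measurableSet_Iic fun t ht => ?_).trans
    (by simp)
  have : ∀ τ, κ τ * (ex (-(t * (τ + y))) * Complex.exp (lam * t)) =
      (ex (-(t * y)) * Complex.exp (lam * t)) * (ex (-(t * τ)) * κ τ) := fun τ => by
    rw [mul_add, neg_add, ex_add]; ring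
  simp only [this]
  rw [integral_const_mul, hs t ht, mul_zero]

theorem L2.integrable_jb_mul (d : L2 ℝ) (s N : ℝ) (h : 1 ≤ s + N) :
    Integrable fun ξ : ℝ => jb ξ ^ (-s) * jb ξ ^ (-N) * ‖d ξ‖ := by
  have h1 : MemLp (fun ξ => jb ξ ^ (-s) * jb ξ ^ (-N)) 2 volume := by
    rw [memLp_two_iff_integrable_sq (by fun_prop)]
    refine (integrable_jb_rpow (A := 2 * (s + N)) (by linarith)).congr (.of_forall fun ξ => ?_)
    simp only
    rw [← rpow_add (jb_pos _), ← rpow_natCast, ← rpow_mul (jb_pos _).le]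
    congr 1; push_cast; ring
  exact h1.integrable_mul (Lp.memLp d).norm

theorem integral_sy_mul {s b lam : ℝ} (hl : 1 ≤ lam) {h : ℝ → ℝ} (hm : Measurable h)
    (hh : ∀ ξ, |h ξ| ≤ |ξ|) {f : ℝ² → ℂ} {N : L2 ℝ²} {d : L2 ℝ}
    (hf : ∀ᵐ p : ℝ², sy lam (p.1 + h p.2) * f p = den (wt s b lam h) N p +
      jc p.2 (-s) * d p.2 * (2 * lam / sy lam (-(p.1 + h p.2))))
    {κ : ℝ² → ℂ} (hκ : IsSym κ) :
    ∫ p, sy lam (p.1 + h p.2) * f p * κ p = ∫ p, den (wt s b lam h) N p * κ p := by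
  have hl0 : 0 < lam := by linarith
  have i1 := hκ.integrable_den_mul s b hl hm hh N
  have i2 : Integrable fun p => jc p.2 (-s) * d p.2 *
      (2 * lam / sy lam (-(p.1 + h p.2))) * κ p := by
    obtain ⟨C, hC0, hC⟩ := hκ.decay_pos (2 + |s|)
    have h1 := (integrable_jb_rpow (A := 2 + |s|) (by linarith [abs_nonneg s])).mul_prod
      (L2.integrable_jb_mul d s (2 + |s|) (by linarith [neg_abs_le s]))
    have mκ := hκ.measurable
    refine (h1.const_mul (2 * C)).mono' (by fun_prop)
      (.of_forall fun p => ?_)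
    have p1 := jb_rpow_pos p.2 (-s)
    rw [norm_mul, norm_mul, norm_mul, norm_div, norm_mul, norm_real, norm_real,
      norm_of_nonneg p1.le, norm_of_nonneg hl0.le]
    have h2 : ‖(2 : ℂ)‖ * lam / ‖sy lam (-(p.1 + h p.2))‖ ≤ 2 := by
      have h3 := le_norm_sy hl0 (-(p.1 + h p.2))
      rw [div_le_iff₀ (by linarith)]
      simp only [norm_ofNat]; linarith
    calc _ ≤ jb p.2 ^ (-s) * ‖d p.2‖ * 2 * (C * (jb p.1 ^ (-(2 + |s|)) * jb p.2 ^ (-(2 + |s|)))) := by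
          gcongr
          exact hC p
      _ = _ := by ring
  have e0 : (fun p => sy lam (p.1 + h p.2) * f p * κ p) =ᵐ[volume] fun p =>
      den (wt s b lam h) N p * κ p + jc p.2 (-s) * d p.2 *
      (2 * lam / sy lam (-(p.1 + h p.2))) * κ p := by filter_upwards [hf] with p hp; rw [hp]; ring
  rw [integral_congr_ae e0, integral_add i1 i2]
  have : ∫ p, jc p.2 (-s) * d p.2 * (2 * lam / sy lam (-(p.1 + h p.2))) * κ p = 0 := by
    rw [show 𝓛² = volume.prod volume from rfl] at i2 ⊢; rw [integral_prod_symm _ i2]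
    refine (integral_congr fun ξ => ?_).trans (integral_zero _ _)
    have := integral_div_sy_eq_zero (hκ.integrable_slice ξ) (fun t ht => hκ.support t ht ξ) hl0 (h ξ)
    calc _ = ∫ τ, jc ξ (-s) * d ξ * (2 * lam) *
          (κ (τ, ξ) * (1 / sy lam (-(τ + h ξ)))) := by congr 1; ext τ; ring
      _ = 0 := by rw [integral_const_mul, this, mul_zero]
  rw [this, add_zero]

theorem exists_transfer {W W' : ℝ² → ℝ} (hW : Measurable W) (hW' : Measurable W')
    (pW : ∀ p, 0 < W p) (pW' : ∀ p, 0 < W' p) {m : ℝ² → ℂ} (hm : Measurable m) {a : NNReal}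
    (hle : ∀ p, ‖m p‖ * W' p ≤ a * W p) :
    ∃ S : L2 ℝ² →+ L2 ℝ², (∀ F, ‖S F‖ ≤ a * ‖F‖) ∧
      ∀ F, den W' (S F) =ᵐ[volume] fun p => m p * den W F p := by
  obtain ⟨S, hS, hSn⟩ := exists_mulOp (m := fun p => m p * (W' p / W p : ℝ))
    (by fun_prop) (fun p => by
      rw [norm_mul, norm_ofReal_of_nonneg (div_pos (pW' p) (pW p)).le,
        ← mul_div_assoc, div_le_iff₀ (pW p)]
      exact hle p)
  refine ⟨S, hSn, fun F => ?_⟩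
  filter_upwards [hS F] with p hp
  rw [den, den, hp]
  have h1 : (W' p : ℂ) ≠ 0 := by exact_mod_cast (pW' p).ne'
  push_cast; field_simp

/-- The convolution `f * g`, tested against `κ`. -/
def conv (f g κ : ℝ² → ℂ) : ℂ := ∫ z : ℝ² × ℝ², f z.1 * g z.2 * κ (z.1 + z.2) ∂(volume.prod volume)

/-- The integral defining the convolution converges absolutely. -/
def ConvInt (f g κ : ℝ² → ℂ) : Prop :=
  Integrable (fun z : ℝ² × ℝ² => f z.1 * g z.2 * κ (z.1 + z.2)) (volume.prod volume)

theorem exists_convOp {W₁ W₂ W₃ : ℝ² → ℝ} (m₁ : Measurable W₁) (m₂ : Measurable W₂)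
    (m₃ : Measurable W₃) (p₁ : ∀ p, 0 < W₁ p) (p₂ : ∀ p, 0 < W₂ p) (p₃ : ∀ p, 0 < W₃ p)
    {K : ℝ² → ℝ² → ℝ} {C a : NNReal} (hK : TriBound K C)
    (hle : ∀ p q, W₃ (p + q) * ((W₁ p)⁻¹ * (W₂ q)⁻¹) ≤ a * K p q) :
    ∃ B : L2 ℝ² →+ L2 ℝ² →+ L2 ℝ², (∀ F G, ‖B F G‖ ≤ a * C * ‖F‖ * ‖G‖) ∧
      ∀ (F G : L2 ℝ²) (κ : ℝ² → ℂ), MemLp (fun p => ((W₃ p)⁻¹ : ℝ) * κ p) 2 volume →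
        ConvInt (den W₁ F) (den W₂ G) κ ∧
        ∫ p, den W₃ (B F G) p * κ p = conv (den W₁ F) (den W₂ G) κ := by
  set w : ℝ² → ℝ² → ℂ := fun p q => ((W₃ (p + q) * ((W₁ p)⁻¹ * (W₂ q)⁻¹) : ℝ) : ℂ) with hw
  have mw : Measurable (uncurry w) := by unfold uncurry; fun_prop
  have hb : TriBound (fun p q => ‖w p q‖) (a * C) := hK.mono fun p q => by
    have := p₃ (p + q)
    have := p₁ p
    have := p₂ q
    rw [hw, norm_ofReal_of_nonneg (by positivity)]
    exact hle p q
  obtain ⟨B, hB, hBn⟩ := exists_bilinOp mw hb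
  refine ⟨B, hBn, fun F G κ hκ => ?_⟩
  have hH := hκ.coeFn_toLp
  have e : (fun z : ℝ² × ℝ² => F z.1 * G z.2 * (hκ.toLp _ : L2 ℝ²) (z.1 + z.2) *
      w z.1 z.2) =ᵐ[volume.prod volume] fun z => den W₁ F z.1 * den W₂ G z.2 * κ (z.1 + z.2) := by
    filter_upwards [quasiMeasurePreserving_add_prod.ae_eq_comp hH] with z hz
    simp only [comp_apply] at hz; rw [hz, hw]
    simp only [den]
    have h1 : (W₃ (z.1 + z.2) : ℂ) ≠ 0 := by exact_mod_cast (p₃ (z.1 + z.2)).ne'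
    push_cast; field_simp
  refine ⟨(integrable_tri mw hb F G (hκ.toLp _)).congr e, ?_⟩
  have := hB F G (hκ.toLp _)
  rw [triForm, integral_congr_ae e] at this; rw [conv, ← this]
  refine integral_congr_ae ?_
  filter_upwards [hH] with p hp
  rw [hp, den]; ring

/-- The characteristic function of a transport equation. -/
def hu (s ξ : ℝ) : ℝ := s * ξ

/-- The characteristic function of a half wave equation. -/
def hz (σ ξ : ℝ) : ℝ := σ * |ξ|

@[fun_prop]
theorem measurable_hu (s : ℝ) : Measurable (hu s) := by unfold hu; fun_prop

@[fun_prop]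
theorem measurable_hz (s : ℝ) : Measurable (hz s) := by unfold hz; fun_prop

theorem abs_eq_one_of_sq {s : ℝ} (hs : s ^ 2 = 1) : |s| = 1 := by
  rw [← Real.sqrt_sq_eq_abs, hs, Real.sqrt_one]

theorem abs_hu_le {s : ℝ} (hs : s ^ 2 = 1) (ξ : ℝ) : |hu s ξ| ≤ |ξ| := by
  rw [hu, abs_mul, abs_eq_one_of_sq hs, one_mul]

theorem abs_hz_le {s : ℝ} (hs : s ^ 2 = 1) (ξ : ℝ) : |hz s ξ| ≤ |ξ| := by
  rw [hz, abs_mul, abs_eq_one_of_sq hs, one_mul, abs_abs]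

theorem hu_refl (s ξ : ℝ) : hu s ξ = -hu s (-ξ) := by unfold hu; ring

theorem hz_refl (s ξ : ℝ) : hz (-s) ξ = -hz s (-ξ) := by unfold hz; rw [abs_neg]; ring

/-- The symbol of `A^{1/2}`. -/
def om (ξ : ℝ) : ℝ := √(1 + (2 * π * ξ) ^ 2)

@[fun_prop]
theorem continuous_om : Continuous om := by unfold om; fun_prop

@[fun_prop]
theorem measurable_om : Measurable om := continuous_om.measurable

theorem one_le_om (ξ : ℝ) : 1 ≤ om ξ := by
  unfold om; rw [one_le_sqrt]; nlinarith [sq_nonneg (2 * π * ξ)]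

theorem om_pos (ξ : ℝ) : 0 < om ξ := one_pos.trans_le (one_le_om ξ)

theorem om_neg (ξ : ℝ) : om (-ξ) = om ξ := by simp [om]

theorem om_sq (ξ : ℝ) : om ξ ^ 2 = 1 + (2 * π * ξ) ^ 2 := Real.sq_sqrt (by positivity)

theorem le_om (ξ : ℝ) : 2 * π * |ξ| ≤ om ξ := by
  refine abs_le_of_sq_le_sq' ?_ (om_pos ξ).le |>.2
  rw [om_sq, mul_pow, mul_pow, mul_pow, sq_abs]; nlinarith

theorem om_le (ξ : ℝ) : om ξ ≤ 1 + 2 * π * |ξ| := by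
  refine abs_le_of_sq_le_sq' ?_ (by positivity) |>.2
  have : 0 ≤ 2 * π * |ξ| := by positivity
  have h2 : (2 * π * |ξ|) ^ 2 = (2 * π * ξ) ^ 2 := by rw [mul_pow, sq_abs, ← mul_pow]
  rw [om_sq]; nlinarith

theorem jb_le_om (ξ : ℝ) : jb ξ ≤ 2 * om ξ := by
  have h1 := le_om ξ
  have h2 := one_le_om ξ
  unfold jb
  nlinarith [pi_gt_three, abs_nonneg ξ]

theorem om_le_jb (ξ : ℝ) : om ξ ≤ 8 * jb ξ := by
  have h1 := om_le ξ
  unfold jb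
  nlinarith [Real.pi_le_four, abs_nonneg ξ]

theorem lb_rpow_sub_one_le {b δ lam : ℝ} (hbδ : b - 1 / 2 ≤ δ) (hδ : δ ≤ 1 / 2) (hl : 1 ≤ lam)
    (x : ℝ) : lb lam x ^ (b - 1) ≤ lam ^ (-(δ - (b - 1 / 2))) * jb x ^ (-(1 / 2 - δ)) := by
  have hl0 : 0 < lam := by linarith
  have h0 := lb_pos hl0 x
  have e : b - 1 = -(δ - (b - 1 / 2)) + -(1 / 2 - δ) := by ring
  rw [e, rpow_add h0]
  have h1 := rpow_pos_of_pos h0 (-(1 / 2 - δ))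
  have h2 := rpow_pos_of_pos hl0 (-(δ - (b - 1 / 2)))
  refine mul_le_mul ?_ ?_ h1.le h2.le
  · exact rpow_le_rpow_of_nonpos hl0 (le_lb _ _) (by linarith)
  · exact rpow_le_rpow_of_nonpos (jb_pos _) (jb_le_lb hl _) (by linarith)

theorem inv_wt_le {s b lam : ℝ} (hb : 0 ≤ b) (hl : 1 ≤ lam) (h : ℝ → ℝ) (p : ℝ²) :
    (wt s b lam h p)⁻¹ ≤ jb p.2 ^ (-s) * jb (p.1 + h p.2) ^ (-b) := by
  rw [wt_inv hl, wt]
  have := jb_rpow_pos p.2 (-s)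
  gcongr 1
  exact rpow_le_rpow_of_nonpos (jb_pos _) (jb_le_lb hl _) (by linarith)

theorem exists_convOp_wt {s₁ s₂ s₃ b δ : ℝ} {h₁ h₂ h₃ : ℝ → ℝ} (m₁ : Measurable h₁)
    (m₂ : Measurable h₂) (m₃ : Measurable h₃) (hh₃ : ∀ ξ, |h₃ ξ| ≤ |ξ|) (hb : 0 ≤ b)
    (hbδ : b - 1 / 2 ≤ δ) (hδ : δ ≤ 1 / 2) {C : NNReal}
    (hK : TriBound (fun p q => (jb p.2 ^ (-s₁) * jb (p.1 + h₁ p.2) ^ (-b)) *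
      (jb q.2 ^ (-s₂) * jb (q.1 + h₂ q.2) ^ (-b)) *
        (jb (p + q).2 ^ s₃ * jb ((p + q).1 + h₃ (p + q).2) ^ (-(1 / 2 - δ)))) C)
    {lam lam₁ lam₂ : ℝ} (hl : 1 ≤ lam) (hl₁ : 1 ≤ lam₁) (hl₂ : 1 ≤ lam₂) :
    ∃ B : L2 ℝ² →+ L2 ℝ² →+ L2 ℝ², (∀ F G, ‖B F G‖ ≤ C * lam ^ (-(δ - (b - 1 / 2))) * ‖F‖ * ‖G‖) ∧
      ∀ (F G : L2 ℝ²) (κ : ℝ² → ℂ), IsSym κ →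
        ConvInt (den (wt s₁ b lam₁ h₁) F) (den (wt s₂ b lam₂ h₂) G) κ ∧
        ∫ p, den (wt s₃ (b - 1) lam h₃) (B F G) p * κ p =
          conv (den (wt s₁ b lam₁ h₁) F) (den (wt s₂ b lam₂ h₂) G) κ := by
  have hl0 : 0 < lam := by linarith
  obtain ⟨P, hP⟩ : ∃ P : NNReal, (P : ℝ) = lam ^ (-(δ - (b - 1 / 2))) :=
    ⟨⟨lam ^ (-(δ - (b - 1 / 2))), by positivity⟩, rfl⟩
  obtain ⟨B, hB, hB'⟩ := exists_convOp
    (measurable_wt s₁ b lam₁ m₁) (measurable_wt s₂ b lam₂ m₂)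
    (measurable_wt s₃ (b - 1) lam m₃) (wt_pos (by linarith) _) (wt_pos (by linarith) _)
    (wt_pos hl0 _) hK (fun p q => by
      have q1 := wt_pos (s := s₁) (b := b) (lam := lam₁) (by linarith) h₁ p
      have q2 := wt_pos (s := s₂) (b := b) (lam := lam₂) (by linarith) h₂ q
      have q3 := jb_rpow_pos p.2 (-s₁)
      have q4 := jb_rpow_pos (p.1 + h₁ p.2) (-b)
      have q5 := rpow_pos_of_pos (jb_pos (p + q).2) s₃
      have q6 := jb_rpow_pos ((p + q).1 + h₃ (p + q).2) (-(1 / 2 - δ))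
      calc _ ≤ (jb (p + q).2 ^ s₃ * (lam ^ (-(δ - (b - 1 / 2))) *
            jb ((p + q).1 + h₃ (p + q).2) ^ (-(1 / 2 - δ)))) *
            ((jb p.2 ^ (-s₁) * jb (p.1 + h₁ p.2) ^ (-b)) *
              (jb q.2 ^ (-s₂) * jb (q.1 + h₂ q.2) ^ (-b))) := by
            refine mul_le_mul ?_ ?_ (by positivity) (by positivity)
            · rw [wt]; gcongr
              exact lb_rpow_sub_one_le hbδ hδ hl _
            · exact mul_le_mul (inv_wt_le hb hl₁ _ _) (inv_wt_le hb hl₂ _ _) (by positivity)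
                (by positivity)
        _ = _ := by rw [hP]; ring)
  refine ⟨B, fun F G => (hB F G).trans (le_of_eq ?_), fun F G κ hκ => hB' F G κ ?_⟩
  · rw [hP]; ring
  · convert hκ.memLp_wt (-s₃) (-(b - 1)) hl m₃ hh₃ using 3 with p
    rw [wt_inv hl]

theorem conv_eq_triForm (f g κ : ℝ² → ℂ) : conv f g κ = triForm (fun _ _ => 1) f g κ := by
  simp [conv, triForm]

theorem conv_congr {f f' g g' κ : ℝ² → ℂ} (hf : f =ᵐ[volume] f') (hg : g =ᵐ[volume] g') :
    conv f g κ = conv f' g' κ := by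
  rw [conv_eq_triForm, conv_eq_triForm, triForm_congr hf hg (ae_eq_refl _)]

theorem ConvInt.congr {f f' g g' κ : ℝ² → ℂ} (h : ConvInt f g κ) (hf : f =ᵐ[volume] f')
    (hg : g =ᵐ[volume] g') : ConvInt f' g' κ := by
  refine Integrable.congr h ?_
  have h1 := Measure.quasiMeasurePreserving_fst.ae_eq_comp (μ := 𝓛².prod
    𝓛²) hf
  have h2 := Measure.quasiMeasurePreserving_snd.ae_eq_comp (μ := 𝓛².prod
    𝓛²) hg
  filter_upwards [h1, h2] with z e1 e2
  simp only [comp_apply] at e1 e2; rw [e1, e2]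

/-- The density of the real part. -/
def ph (f : ℝ² → ℂ) (p : ℝ²) : ℂ := (f p + refl f p) / 2

theorem conv_ph {f g κ : ℝ² → ℂ} (h : ConvInt f g κ) (h' : ConvInt (refl f) g κ) :
    ConvInt (ph f) g κ ∧ conv (ph f) g κ = (conv f g κ + conv (refl f) g κ) / 2 := by
  have e : (fun z : ℝ² × ℝ² => ph f z.1 * g z.2 * κ (z.1 + z.2)) = fun z =>
      (f z.1 * g z.2 * κ (z.1 + z.2) + refl f z.1 * g z.2 * κ (z.1 + z.2)) / 2 := by
    ext z; simp only [ph]; ring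
  refine ⟨?_, ?_⟩
  · unfold ConvInt; rw [e]; exact (Integrable.add h h').div_const 2
  · unfold conv; rw [e, integral_div, integral_add h h']

/-- Triples of elements of `L²`. -/
abbrev E3 := L2 ℝ² × L2 ℝ² × L2 ℝ²

/-- The first component of the spinor. -/
def du (l b lam : ℝ) (F : E3) : ℝ² → ℂ := den (wt (-l) b lam (hu 1)) F.1

/-- The second component of the spinor. -/
def dv (l b lam : ℝ) (F : E3) : ℝ² → ℂ := den (wt (-l) b lam (hu (-1))) F.2.1

/-- The half wave. -/
def dz (k b lam : ℝ) (F : E3) : ℝ² → ℂ := den (wt k b lam (hz 1)) F.2.2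

/-- The three densities. -/
abbrev T3 := (ℝ² → ℂ) × (ℝ² → ℂ) × (ℝ² → ℂ)

abbrev dn (l k b lam : ℝ) (F : E3) : T3 := (du l b lam F, dv l b lam F, dz k b lam F)

/-- The quadratic term of the wave equation. -/
def quad (f g κ : ℝ² → ℂ) : ℂ := conv f (refl g) κ + conv (refl f) g κ

/-- The nonlinear terms, tested against `κ`. -/
def nl (g : ℝ) (X Y : T3) (κ : ℝ² → ℂ) : ℂ × ℂ × ℂ :=
  (I * g * conv (ph X.2.2) Y.2.1 κ, I * g * conv (ph X.2.2) Y.1 κ, quad X.1 Y.2.1 κ)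

def NlInt (X Y : T3) (κ : ℝ² → ℂ) : Prop :=
  ConvInt (ph X.2.2) Y.2.1 κ ∧ ConvInt (ph X.2.2) Y.1 κ ∧ ConvInt X.1 (refl Y.2.1) κ ∧
    ConvInt (refl X.1) Y.2.1 κ

/-- The inhomogeneity of the half wave system given by `N` consists of the functionals `n`. -/
def Represents (l k b lam : ℝ) (N : E3) (n : (ℝ² → ℂ) → ℂ × ℂ × ℂ) : Prop :=
  ∀ κ, IsSym κ → ∫ p, du l (b - 1) lam N p * κ p = (n κ).1 ∧
    ∫ p, dv l (b - 1) lam N p * κ p = (n κ).2.1 ∧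
    ∫ p, dz k (b - 1) lam N p * κ p = I * (n fun p => ((om p.2)⁻¹ : ℂ) * κ p).2.2

theorem E3.norm_fst_le (F : E3) : ‖F.1‖ ≤ ‖F‖ := _root_.norm_fst_le F
theorem E3.norm_snd_fst_le (F : E3) : ‖F.2.1‖ ≤ ‖F‖ := (_root_.norm_fst_le F.2).trans (_root_.norm_snd_le F)
theorem E3.norm_snd_snd_le (F : E3) : ‖F.2.2‖ ≤ ‖F‖ := (_root_.norm_snd_le F.2).trans (_root_.norm_snd_le F)

theorem E3.norm_le {F : E3} {a : ℝ} (h1 : ‖F.1‖ ≤ a) (h2 : ‖F.2.1‖ ≤ a) (h3 : ‖F.2.2‖ ≤ a) :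
    ‖F‖ ≤ a := by
  rw [Prod.norm_def, Prod.norm_def]; exact max_le h1 (max_le h2 h3)

theorem isSym_om_inv {κ : ℝ² → ℂ} (hκ : IsSym κ) : IsSym fun p => ((om p.2)⁻¹ : ℂ) * κ p :=
  hκ.mul_left (a := fun ξ => ((om ξ)⁻¹ : ℂ)) (by fun_prop) fun ξ => by
    rw [norm_inv, norm_ofReal_of_nonneg (om_pos ξ).le, rpow_zero, mul_one]
    exact inv_le_one_of_one_le₀ (one_le_om ξ)

theorem exists_biadditive {E F G : Type*} [AddCommGroup E] [AddCommGroup F] [AddCommGroup G]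
    (f : E → F → G) (h₁ : ∀ x x' y, f (x + x') y = f x y + f x' y)
    (h₂ : ∀ x y y', f x (y + y') = f x y + f x y') : ∃ B : E →+ F →+ G, ∀ x y, B x y = f x y :=
  ⟨AddMonoidHom.mk' (fun x => AddMonoidHom.mk' (f x) (h₂ x)) fun x x' => by ext y; exact h₁ x x' y,
    fun _ _ => rfl⟩

section

variable {l k δ b : ℝ}

theorem exists_yukawaOp (h : Exponents l k δ) (hb : 1 / 2 < b) (hbδ : b - 1 / 2 ≤ δ) (g : ℝ)
    {s s' : ℝ} (hs : s ^ 2 = 1) (hs' : s' = -s) :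
    ∃ C : NNReal, ∀ lam lam₁ lam₂ : ℝ, 1 ≤ lam → 1 ≤ lam₁ → 1 ≤ lam₂ →
      ∃ B : L2 ℝ² →+ L2 ℝ² →+ L2 ℝ², (∀ Z W, ‖B Z W‖ ≤ C * lam ^ (-(δ - (b - 1 / 2))) * ‖Z‖ * ‖W‖) ∧
        ∀ (Z W : L2 ℝ²) (κ : ℝ² → ℂ), IsSym κ →
          ConvInt (ph (den (wt k b lam₁ (hz 1)) Z)) (den (wt (-l) b lam₂ (hu s')) W) κ ∧
          ∫ p, den (wt (-l) (b - 1) lam (hu s)) (B Z W) p * κ p = I * g *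
            conv (ph (den (wt k b lam₁ (hz 1)) Z)) (den (wt (-l) b lam₂ (hu s')) W) κ := by
  subst hs'
  obtain ⟨T, hT, hTn⟩ := exists_reflect
  have yk : ∀ σ, σ ^ 2 = 1 → ∃ C : NNReal,
      TriBound (fun p q => (jb p.2 ^ (-k) * jb (p.1 + hz σ p.2) ^ (-b)) *
      (jb q.2 ^ (-(-l)) * jb (q.1 + hu (-s) q.2) ^ (-b)) *
        (jb (p + q).2 ^ (-l) * jb ((p + q).1 + hu s (p + q).2) ^ (-(1 / 2 - δ)))) C := by
    intro σ hσ
    obtain ⟨C, hC⟩ := exists_triBound_yukawa h hb hs hσ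
    refine ⟨C, ?_⟩
    convert hC using 3 with p q
    rw [yukawaKernel, neg_neg]; rfl
  obtain ⟨C₁, h₁⟩ := yk 1 (by norm_num)
  obtain ⟨C₂, h₂⟩ := yk (-1) (by norm_num)
  refine ⟨‖g‖₊ * (C₁ + C₂), fun lam lam₁ lam₂ hl hl₁ hl₂ => ?_⟩
  obtain ⟨B₁, n₁, e₁⟩ := exists_convOp_wt (measurable_hz 1) (measurable_hu (-s)) (measurable_hu s)
    (abs_hu_le hs) (by linarith) hbδ h.δ_le h₁ hl hl₁ hl₂
  obtain ⟨B₂, n₂, e₂⟩ := exists_convOp_wt (measurable_hz (-1)) (measurable_hu (-s))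
    (measurable_hu s) (abs_hu_le hs) (by linarith) hbδ h.δ_le h₂ hl hl₁ hl₂
  set c : ℂ := I * g / 2 with hc
  have hcn : ‖c‖ ≤ ‖g‖ := by
    rw [hc, norm_div, norm_mul, norm_I, norm_real, one_mul, norm_ofNat]; linarith [norm_nonneg g]
  obtain ⟨B, hB⟩ := exists_biadditive (fun Z W => c • (B₁ Z W + B₂ (T Z) W))
    (fun Z Z' W => by simp only [AddMonoidHom.add_apply, map_add, smul_add]; abel)
    (fun Z W W' => by simp only [map_add, smul_add]; abel)
  refine ⟨B, fun Z W => ?_, fun Z W κ hκ => ?_⟩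
  · have h1 := n₁ Z W
    have h2 : ‖B₂ (T Z) W‖ ≤ C₂ * lam ^ (-(δ - (b - 1 / 2))) * ‖Z‖ * ‖W‖ :=
      (n₂ _ _).trans (by gcongr; exact hTn Z)
    rw [hB, norm_smul]
    calc _ ≤ ‖g‖ * (C₁ * lam ^ (-(δ - (b - 1 / 2))) * ‖Z‖ * ‖W‖ +
          C₂ * lam ^ (-(δ - (b - 1 / 2))) * ‖Z‖ * ‖W‖) :=
          mul_le_mul hcn ((norm_add_le _ _).trans (add_le_add h1 h2)) (norm_nonneg _) (norm_nonneg _)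
      _ = _ := by push_cast; ring
  · have rz : den (wt k b lam₁ (hz (-1))) (T Z) =ᵐ[volume] refl (den (wt k b lam₁ (hz 1)) Z) :=
      den_refl (fun ξ => hz_refl 1 ξ) (hT Z)
    obtain ⟨i1, v1⟩ := e₁ Z W κ hκ
    obtain ⟨i2, v2⟩ := e₂ (T Z) W κ hκ
    obtain ⟨i3, v3⟩ := conv_ph i1 (i2.congr rz (ae_eq_refl _))
    refine ⟨i3, ?_⟩
    have j1 := hκ.integrable_den_mul (-l) (b - 1) hl (measurable_hu s) (abs_hu_le hs)
    rw [v3, ← v1, ← conv_congr rz (ae_eq_refl _), ← v2, ← integral_add (j1 _) (j1 _),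
      ← integral_div, ← integral_const_mul]
    refine integral_congr_ae ?_
    filter_upwards [Lp.coeFn_smul c (B₁ Z W + B₂ (T Z) W), Lp.coeFn_add (B₁ Z W) (B₂ (T Z) W)]
      with p h1 h2
    rw [hB, den, h1, Pi.smul_apply, h2, Pi.add_apply, smul_eq_mul, den, den, hc]; ring

theorem exists_densityOp (h : Exponents l k δ) (hb : 1 / 2 < b) (hbδ : b - 1 / 2 ≤ δ) :
    ∃ C : NNReal, ∀ lam lam₁ lam₂ : ℝ, 1 ≤ lam → 1 ≤ lam₁ → 1 ≤ lam₂ → ∃ B : E3 →+ E3 →+ L2 ℝ²,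
        (∀ F G, ‖B F G‖ ≤ C * lam ^ (-(δ - (b - 1 / 2))) * ‖F‖ * ‖G‖) ∧
        ∀ (F G : E3) (κ : ℝ² → ℂ), IsSym κ → ConvInt (du l b lam₁ F) (refl (dv l b lam₂ G)) κ ∧
          ConvInt (refl (du l b lam₁ F)) (dv l b lam₂ G) κ ∧
          ∫ p, den (wt k (b - 1) lam (hz 1)) (B F G) p * κ p = I *
            quad (du l b lam₁ F) (dv l b lam₂ G) (fun p => ((om p.2)⁻¹ : ℂ) * κ p) := by
  have s1 : (1 : ℝ) ^ 2 = 1 := by norm_num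
  obtain ⟨T, hT, hTn⟩ := exists_reflect
  obtain ⟨C, hC⟩ : ∃ C : NNReal,
      TriBound (fun p q => (jb p.2 ^ (-(-l)) * jb (p.1 + hu 1 p.2) ^ (-b)) *
      (jb q.2 ^ (-(-l)) * jb (q.1 + hu (-1) q.2) ^ (-b)) *
        (jb (p + q).2 ^ (k - 1) * jb ((p + q).1 + hz 1 (p + q).2) ^ (-(1 / 2 - δ)))) C := by
    obtain ⟨C, hC⟩ := exists_triBound_density h hb s1 s1
    refine ⟨C, ?_⟩
    convert hC using 3 with p q
    rw [densityKernel, neg_neg, neg_sub 1 k]; rfl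
  refine ⟨4 * C, fun lam lam₁ lam₂ hl hl₁ hl₂ => ?_⟩
  have hl0 : 0 < lam := by linarith
  obtain ⟨B, n, e⟩ := exists_convOp_wt (measurable_hu 1) (measurable_hu (-1)) (measurable_hz 1)
    (abs_hz_le s1) (by linarith) hbδ h.δ_le hC hl hl₁ hl₂
  obtain ⟨S, nS, eS⟩ := exists_transfer (a := 2) (measurable_wt (k - 1) (b - 1) lam (measurable_hz 1))
    (measurable_wt k (b - 1) lam (measurable_hz 1)) (wt_pos hl0 _) (wt_pos hl0 _)
    (m := fun p => I * (om p.2 : ℂ)⁻¹) (by fun_prop) (fun p => by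
      rw [norm_mul, norm_I, one_mul, norm_inv, norm_real,
        norm_of_nonneg (om_pos _).le, wt, wt, rpow_sub_one (jb_pos _).ne']
      have h1 := rpow_pos_of_pos (lb_pos hl0 (p.1 + hz 1 p.2)) (b - 1)
      have h2 := jb_rpow_pos p.2 k
      have h3 : (om p.2)⁻¹ ≤ 2 * (jb p.2)⁻¹ := by
        rw [inv_le_iff_one_le_mul₀ (om_pos _), mul_assoc, ← div_eq_inv_mul, ← mul_div_assoc,
          le_div_iff₀ (jb_pos _), one_mul]
        exact jb_le_om _
      calc _ ≤ 2 * (jb p.2)⁻¹ * (jb p.2 ^ k * lb lam (p.1 + hz 1 p.2) ^ (b - 1)) := by gcongr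
        _ = _ := by rw [div_eq_mul_inv]; push_cast; ring)
  obtain ⟨B', hB⟩ := exists_biadditive (fun F G : E3 => S (B F.1 (T G.2.1) + B (T F.1) G.2.1))
    (fun F F' G => by simp only [AddMonoidHom.add_apply, Prod.fst_add, map_add]; abel)
    (fun F G G' => by simp only [Prod.fst_add, Prod.snd_add, map_add]; abel)
  refine ⟨B', fun F G => ?_, fun F G κ hκ => ?_⟩
  · have f1 := E3.norm_fst_le F
    have g2 := E3.norm_snd_fst_le G
    have bd : ∀ A A' : L2 ℝ², ‖A‖ ≤ ‖F‖ → ‖A'‖ ≤ ‖G‖ →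
        ‖B A A'‖ ≤ C * lam ^ (-(δ - (b - 1 / 2))) * ‖F‖ * ‖G‖ := fun A A' hA hA' =>
      (n A A').trans (by gcongr)
    rw [hB]
    refine (nS _).trans ?_
    have h1 := bd _ _ f1 ((hTn _).trans g2)
    have h2 := bd _ _ ((hTn _).trans f1) g2
    have h3 := norm_add_le (B F.1 (T G.2.1)) (B (T F.1) G.2.1)
    push_cast; linarith
  · have hκ' := isSym_om_inv hκ
    have ru : den (wt (-l) b lam₁ (hu 1)) (T F.1) =ᵐ[volume] refl (du l b lam₁ F) :=
      den_refl (fun ξ => hu_refl 1 ξ) (hT F.1)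
    have rv : den (wt (-l) b lam₂ (hu (-1))) (T G.2.1) =ᵐ[volume] refl (dv l b lam₂ G) :=
      den_refl (fun ξ => hu_refl (-1) ξ) (hT G.2.1)
    refine ⟨(e F.1 (T G.2.1) κ hκ).1.congr (ae_eq_refl _) rv,
      (e (T F.1) G.2.1 κ hκ).1.congr ru (ae_eq_refl _), ?_⟩
    have j1 := hκ'.integrable_den_mul (k - 1) (b - 1) hl (measurable_hz 1) (abs_hz_le s1)
    rw [quad, ← conv_congr (ae_eq_refl _) rv, ← conv_congr ru (ae_eq_refl _), du, dv,
      ← (e _ _ _ hκ').2, ← (e _ _ _ hκ').2, ← integral_add (j1 _) (j1 _), ← integral_const_mul]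
    refine integral_congr_ae ?_
    filter_upwards [eS (B F.1 (T G.2.1) + B (T F.1) G.2.1),
      den_add (wt (k - 1) (b - 1) lam (hz 1)) (B F.1 (T G.2.1)) (B (T F.1) G.2.1)] with p h1 h2
    rw [hB, h1, h2, Pi.add_apply]; ring

theorem exists_nonlinearity (h : Exponents l k δ) (hb : 1 / 2 < b) (hbδ : b - 1 / 2 ≤ δ) (g : ℝ) :
    ∃ C : NNReal, ∀ lam lam₁ lam₂ : ℝ, 1 ≤ lam → 1 ≤ lam₁ → 1 ≤ lam₂ → ∃ B : E3 →+ E3 →+ E3,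
        (∀ F G, ‖B F G‖ ≤ C * lam ^ (-(δ - (b - 1 / 2))) * ‖F‖ * ‖G‖) ∧
        ∀ F G : E3, Represents l k b lam (B F G) (nl g (dn l k b lam₁ F) (dn l k b lam₂ G)) ∧
          ∀ κ, IsSym κ → NlInt (dn l k b lam₁ F) (dn l k b lam₂ G) κ := by
  obtain ⟨C₁, h₁⟩ := exists_yukawaOp h hb hbδ g (s := 1) (by norm_num) rfl
  obtain ⟨C₂, h₂⟩ := exists_yukawaOp h hb hbδ g (by norm_num) (neg_neg 1).symm
  obtain ⟨C₃, h₃⟩ := exists_densityOp h hb hbδ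
  refine ⟨C₁ + C₂ + C₃, fun lam lam₁ lam₂ hl hl₁ hl₂ => ?_⟩
  obtain ⟨B₁, n₁, e₁⟩ := h₁ lam lam₁ lam₂ hl hl₁ hl₂
  obtain ⟨B₂, n₂, e₂⟩ := h₂ lam lam₁ lam₂ hl hl₁ hl₂
  obtain ⟨B₃, n₃, e₃⟩ := h₃ lam lam₁ lam₂ hl hl₁ hl₂
  obtain ⟨B, hB⟩ := exists_biadditive (fun F G : E3 =>
    ((B₁ F.2.2 G.2.1, B₂ F.2.2 G.1, B₃ F G) : E3)) (fun F F' G => by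
    simp only [AddMonoidHom.add_apply, Prod.snd_add, map_add, Prod.mk_add_mk])
    (fun F G G' => by simp only [Prod.fst_add, Prod.snd_add, map_add, Prod.mk_add_mk])
  refine ⟨B, fun F G => ?_, fun F G => ⟨fun κ hκ => ?_, fun κ hκ => ?_⟩⟩
  · have f2 := E3.norm_snd_snd_le F
    have g1 := E3.norm_fst_le G
    have g2 := E3.norm_snd_fst_le G
    have bd : ∀ {x y z : ℝ} (D : NNReal), x ≤ D * lam ^ (-(δ - (b - 1 / 2))) * y * z → y ≤ ‖F‖ →
        z ≤ ‖G‖ → 0 ≤ y → 0 ≤ z → D ≤ C₁ + C₂ + C₃ →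
        x ≤ (C₁ + C₂ + C₃ : NNReal) * lam ^ (-(δ - (b - 1 / 2))) * ‖F‖ * ‖G‖ :=
      fun D h1 h2 h3 h4 h5 h6 => h1.trans (by gcongr)
    rw [hB]
    exact E3.norm_le (bd C₁ (n₁ _ _) f2 g2 (norm_nonneg _) (norm_nonneg _) (by rw [add_assoc]; exact le_self_add))
      (bd C₂ (n₂ _ _) f2 g1 (norm_nonneg _) (norm_nonneg _) (by rw [add_right_comm]; exact le_add_self))
      (bd C₃ (n₃ _ _) le_rfl le_rfl (norm_nonneg _) (norm_nonneg _) le_add_self)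
  · rw [hB]
    exact ⟨(e₁ _ _ κ hκ).2, (e₂ _ _ κ hκ).2, (e₃ _ _ κ hκ).2.2⟩
  · exact ⟨(e₁ _ _ κ hκ).1, (e₂ _ _ κ hκ).1, (e₃ _ _ κ hκ).1, (e₃ _ _ κ hκ).2.1⟩

end

theorem wt_sub_one_le {s b lam : ℝ} (hb : 0 ≤ b) (hb' : b ≤ 1) (hl : 1 ≤ lam) (h h' : ℝ → ℝ)
    (p : ℝ²) : wt s (b - 1) lam h p ≤ lam⁻¹ * wt s b lam h' p := by
  have hl0 : 0 < lam := by linarith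
  have h1 := jb_rpow_pos p.2 s
  have h2 : lb lam (p.1 + h p.2) ^ (b - 1) ≤ lam ^ (b - 1) :=
    rpow_le_rpow_of_nonpos hl0 (le_lb _ _) (by linarith)
  have h3 : lam ^ b ≤ lb lam (p.1 + h' p.2) ^ b := rpow_le_rpow hl0.le (le_lb _ _) hb
  rw [rpow_sub_one hl0.ne'] at h2
  calc wt s (b - 1) lam h p ≤ jb p.2 ^ s * (lam ^ b / lam) := by unfold wt; gcongr
    _ ≤ jb p.2 ^ s * (lb lam (p.1 + h' p.2) ^ b / lam) := by gcongr
    _ = _ := by rw [wt]; ring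

theorem exists_lowerOrder {l k b : ℝ} (hb : 0 ≤ b) (hb' : b ≤ 1) (M m : ℝ) :
    ∃ C : NNReal, ∀ lam : ℝ, 1 ≤ lam → ∃ L : E3 →+ E3, (∀ F, ‖L F‖ ≤ C * lam⁻¹ * ‖F‖) ∧ ∀ F,
        du l (b - 1) lam (L F) =ᵐ[volume] (fun p => -(I * M) * dv l b lam F p) ∧
        dv l (b - 1) lam (L F) =ᵐ[volume] (fun p => -(I * M) * du l b lam F p) ∧
        dz k (b - 1) lam (L F) =ᵐ[volume] (fun p =>
          -(I * (om p.2 - 2 * π * |p.2| : ℝ)) * dz k b lam F p +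
            I * (1 - m ^ 2 : ℝ) * (om p.2 : ℂ)⁻¹ * ph (dz k b lam F) p) := by
  obtain ⟨T, hT, hTn⟩ := exists_reflect
  refine ⟨‖M‖₊ + 1 + ‖1 - m ^ 2‖₊, fun lam hl => ?_⟩
  have hl0 : 0 < lam := by linarith
  set P : NNReal := ⟨lam⁻¹, by positivity⟩
  have tr : ∀ (s : ℝ) (h h' : ℝ → ℝ), Measurable h → Measurable h' → ∀ (c : ℝ → ℂ) (a : NNReal),
      Measurable c → (∀ ξ, ‖c ξ‖ ≤ a) → ∃ S : L2 ℝ² →+ L2 ℝ²,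
        (∀ F, ‖S F‖ ≤ a * lam⁻¹ * ‖F‖) ∧ ∀ F, den (wt s (b - 1) lam h') (S F) =ᵐ[volume]
          fun p => c p.2 * den (wt s b lam h) F p := by
    intro s h h' mh mh' c a mc hc
    obtain ⟨S, h1, h2⟩ := exists_transfer (a := a * P) (measurable_wt s b lam mh)
      (measurable_wt s (b - 1) lam mh') (wt_pos hl0 _) (wt_pos hl0 _) (m := fun p => c p.2)
      (by fun_prop) (fun p => by
        have := wt_pos (s := s) (b := b - 1) hl0 h' p
        rw [NNReal.coe_mul, mul_assoc]
        exact mul_le_mul (hc _) (wt_sub_one_le hb hb' hl _ _ _) this.le a.2)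
    exact ⟨S, fun F => by have := h1 F; rwa [NNReal.coe_mul] at this, h2⟩
  obtain ⟨S₁, n₁, e₁⟩ := tr (-l) (hu (-1)) (hu 1) (by fun_prop) (by fun_prop)
    (fun _ => -(I * M)) ‖M‖₊ (by fun_prop) (fun ξ => by simp)
  obtain ⟨S₂, n₂, e₂⟩ := tr (-l) (hu 1) (hu (-1)) (by fun_prop) (by fun_prop)
    (fun _ => -(I * M)) ‖M‖₊ (by fun_prop) (fun ξ => by simp)
  obtain ⟨S₃, n₃, e₃⟩ := tr k (hz 1) (hz 1) (by fun_prop) (by fun_prop)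
    (fun ξ => -(I * (om ξ - 2 * π * |ξ| : ℝ))) 1 (by fun_prop) (fun ξ => by
      rw [norm_neg, norm_mul, norm_I, one_mul, norm_real, norm_eq_abs, NNReal.coe_one, abs_le]
      constructor <;> linarith [om_le ξ, le_om ξ])
  have bd4 : ∀ ξ, ‖I * (1 - m ^ 2 : ℝ) * (om ξ : ℂ)⁻¹ / 2‖ ≤
      ((‖1 - m ^ 2‖₊ / 2 : NNReal) : ℝ) := fun ξ => by
    rw [norm_div, norm_mul, norm_mul, norm_I, one_mul, norm_inv, norm_real,
      norm_ofReal_of_nonneg (om_pos ξ).le, norm_ofNat, NNReal.coe_div,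
      coe_nnnorm, NNReal.coe_ofNat]
    gcongr
    exact mul_le_of_le_one_right (norm_nonneg _) (inv_le_one_of_one_le₀ (one_le_om ξ))
  obtain ⟨S₄, n₄, e₄⟩ := tr k (hz 1) (hz 1) (by fun_prop) (by fun_prop)
    (fun ξ => I * (1 - m ^ 2 : ℝ) * (om ξ : ℂ)⁻¹ / 2) _ (by fun_prop) bd4
  obtain ⟨S₅, n₅, e₅⟩ := tr k (hz (-1)) (hz 1) (by fun_prop) (by fun_prop)
    (fun ξ => I * (1 - m ^ 2 : ℝ) * (om ξ : ℂ)⁻¹ / 2) _ (by fun_prop) bd4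
  refine ⟨AddMonoidHom.mk' (fun F => (S₁ F.2.1, S₂ F.1, S₃ F.2.2 + S₄ F.2.2 + S₅ (T F.2.2))) ?_,
    ?_, fun F => ⟨e₁ _, e₂ _, ?_⟩⟩
  · intro F F'
    refine Prod.ext ?_ (Prod.ext ?_ ?_) <;>
    (simp only [Prod.fst_add, Prod.snd_add, map_add]; try abel)
  · intro F
    simp only [AddMonoidHom.mk'_apply]
    have f1 := E3.norm_fst_le F
    have f2 := E3.norm_snd_fst_le F
    have f3 := E3.norm_snd_snd_le F
    have f4 := (hTn F.2.2).trans f3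
    have X0 : 0 ≤ lam⁻¹ * ‖F‖ := by positivity
    have bd : ∀ (S : L2 ℝ² →+ L2 ℝ²) (a : NNReal) (A : L2 ℝ²),
        (∀ F, ‖S F‖ ≤ a * lam⁻¹ * ‖F‖) → ‖A‖ ≤ ‖F‖ → ‖S A‖ ≤ a * (lam⁻¹ * ‖F‖) :=
      fun S a A hS hA => (hS A).trans (by rw [mul_assoc]; gcongr)
    have expand : (‖M‖₊ + 1 + ‖1 - m ^ 2‖₊ : NNReal) * lam⁻¹ * ‖F‖ = ‖M‖ * (lam⁻¹ * ‖F‖) +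
        lam⁻¹ * ‖F‖ + ‖1 - m ^ 2‖ * (lam⁻¹ * ‖F‖) := by push_cast; ring
    rw [expand]
    have t1 : 0 ≤ ‖M‖ * (lam⁻¹ * ‖F‖) := by positivity
    have t2 : 0 ≤ ‖1 - m ^ 2‖ * (lam⁻¹ * ‖F‖) := by positivity
    have b1 := bd S₁ _ _ n₁ f2
    have b2 := bd S₂ _ _ n₂ f1
    have b3 := bd S₃ _ _ n₃ f3
    have b4 := bd S₄ _ _ n₄ f3
    have b5 := bd S₅ _ _ n₅ f4
    push_cast at b1 b2 b3 b4 b5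
    refine E3.norm_le (by simp only; linarith) (by simp only; linarith) ?_
    have h1 := norm_add₃_le (a := S₃ F.2.2) (b := S₄ F.2.2) (c := S₅ (T F.2.2))
    simp only; linarith
  · have rz : den (wt k b lam (hz (-1))) (T F.2.2) =ᵐ[volume] refl (dz k b lam F) :=
      den_refl (fun ξ => hz_refl 1 ξ) (hT F.2.2)
    filter_upwards [e₃ F.2.2, e₄ F.2.2, e₅ (T F.2.2), rz,
      den_add (wt k (b - 1) lam (hz 1)) (S₃ F.2.2 + S₄ F.2.2) (S₅ (T F.2.2)),
      den_add (wt k (b - 1) lam (hz 1)) (S₃ F.2.2) (S₄ F.2.2)] with p h3 h4 h5 hr a1 a2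
    simp only [dz, AddMonoidHom.mk'_apply]
    rw [a1, Pi.add_apply, a2, Pi.add_apply, h3, h4, h5, hr, ph, dz]; ring

theorem exists_fixedPoint {E : Type*} [NormedAddCommGroup E] [CompleteSpace E] (P : E →+ E)
    (B : E →+ E →+ E) (e : E) {a β ρ : ℝ} (hP : ∀ F, ‖P F‖ ≤ a * ‖F‖)
    (hB : ∀ F G, ‖B F G‖ ≤ β * ‖F‖ * ‖G‖) (he : ‖e‖ ≤ ρ) (ha : 0 ≤ a) (hβ : 0 ≤ β)
    (h : 2 * a + 8 * β * ρ ≤ 1) : ∃ F, F = P F + B F F + e := by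
  have hρ : 0 ≤ ρ := (norm_nonneg e).trans he
  set Φ : E → E := fun F => P F + B F F + e with hΦ
  have hmaps : Set.MapsTo Φ (Metric.closedBall 0 (2 * ρ)) (Metric.closedBall 0 (2 * ρ)) := by
    intro F hF
    rw [mem_closedBall_zero_iff] at hF ⊢
    have h1 := hP F
    have h2 := hB F F
    have h3 : a * ‖F‖ ≤ a * (2 * ρ) := by gcongr
    have h4 : β * ‖F‖ * ‖F‖ ≤ β * (2 * ρ) * (2 * ρ) := by gcongr
    have h5 : ‖Φ F‖ ≤ ‖P F‖ + ‖B F F‖ + ‖e‖ := norm_add₃_le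
    have : 0 ≤ β * ρ := by positivity
    nlinarith
  have hlip : LipschitzWith (1 / 2) (hmaps.restrict Φ _ _) := by
    refine LipschitzWith.of_dist_le_mul fun F G => ?_
    have hF := mem_closedBall_zero_iff.1 F.2
    have hG := mem_closedBall_zero_iff.1 G.2
    rw [Subtype.dist_eq, Subtype.dist_eq, Set.MapsTo.val_restrict_apply,
      Set.MapsTo.val_restrict_apply, dist_eq_norm, dist_eq_norm]
    set x : E := F.1
    set y : E := G.1
    have e1 : Φ x - Φ y = P (x - y) + B (x - y) x + B y (x - y) := by
      simp only [hΦ, map_sub, AddMonoidHom.sub_apply]; abel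
    rw [e1]
    have h1 := hP (x - y)
    have h2 := hB (x - y) x
    have h3 := hB y (x - y)
    have h4 : β * ‖x - y‖ * ‖x‖ ≤ β * ‖x - y‖ * (2 * ρ) := by gcongr
    have h5 : β * ‖y‖ * ‖x - y‖ ≤ β * (2 * ρ) * ‖x - y‖ := by gcongr
    have h6 := norm_add₃_le (a := P (x - y)) (b := B (x - y) x) (c := B y (x - y))
    have h7 : (a + 4 * β * ρ) * ‖x - y‖ ≤ 1 / 2 * ‖x - y‖ := by gcongr; linarith
    have e2 : (((1 / 2 : NNReal)) : ℝ) = 1 / 2 := by norm_num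
    rw [e2]; nlinarith
  obtain ⟨F, -, hF, -⟩ := ContractingWith.exists_fixedPoint' (K := 1 / 2)
    (Metric.isClosed_closedBall.isComplete (s := Metric.closedBall (0 : E) (2 * ρ))) hmaps
    ⟨by rw [← NNReal.coe_lt_coe]; norm_num, hlip⟩
    (x := 0) (by simp [hρ]) (edist_ne_top _ _)
  exact ⟨F, hF.symm⟩

theorem hat_zero (f : ℝ² → ℂ) (ξ : ℝ) : hat f 0 ξ = ∫ τ : ℝ, f (τ, ξ) := by simp [hat]

/-- The weak form of the equation `(∂_t + λ + 2πi h) u = n`. -/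
def WeakEq (lam : ℝ) (h : ℝ → ℝ) (f n : ℝ² → ℂ) : Prop :=
  ∀ κ, IsSym κ → ∫ p, sy lam (p.1 + h p.2) * f p * κ p = ∫ p, n p * κ p

/-- Triples of initial data. -/
abbrev D3 := L2 ℝ × L2 ℝ × L2 ℝ

/-- The initial values of the densities `X` are given by `c`. -/
def Init (l k : ℝ) (X : T3) (c : D3) : Prop := ∀ᵐ ξ : ℝ, hat X.1 0 ξ = jc ξ l * c.1 ξ ∧
  hat X.2.1 0 ξ = jc ξ l * c.2.1 ξ ∧ hat X.2.2 0 ξ = jc ξ (-k) * c.2.2 ξ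

theorem exists_duhamel3 (l k : ℝ) {b : ℝ} (hb : 1 / 2 < b) (hb' : b < 3 / 2) :
    ∃ C : NNReal, ∀ lam : ℝ, 1 ≤ lam → ∃ (K : E3 →+ E3) (E : D3 →+ E3),
      (∀ N, ‖K N‖ ≤ C * lam ^ (b - 1 / 2) * ‖N‖) ∧ (∀ c, ‖E c‖ ≤ C * lam ^ (b - 1 / 2) * ‖c‖) ∧
      ∀ N c, WeakEq lam (hu 1) (du l b lam (K N + E c)) (du l (b - 1) lam N) ∧
        WeakEq lam (hu (-1)) (dv l b lam (K N + E c)) (dv l (b - 1) lam N) ∧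
        WeakEq lam (hz 1) (dz k b lam (K N + E c)) (dz k (b - 1) lam N) ∧
        Init l k (dn l k b lam (K N + E c)) c := by
  have s1 : (1 : ℝ) ^ 2 = 1 := by norm_num
  have s2 : (-1 : ℝ) ^ 2 = 1 := by norm_num
  obtain ⟨C₁, h₁⟩ := exists_duhamel (-l) hb hb' (measurable_hu 1)
  obtain ⟨C₂, h₂⟩ := exists_duhamel (-l) hb hb' (measurable_hu (-1))
  obtain ⟨C₃, h₃⟩ := exists_duhamel k hb hb' (measurable_hz 1)
  refine ⟨C₁ + C₂ + C₃, fun lam hl => ?_⟩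
  obtain ⟨K₁, E₁, k₁, e₁, w₁⟩ := h₁ lam hl
  obtain ⟨K₂, E₂, k₂, e₂, w₂⟩ := h₂ lam hl
  obtain ⟨K₃, E₃, k₃, e₃, w₃⟩ := h₃ lam hl
  have hC : ∀ {V : Type} [NormedAddCommGroup V] (x : V × V × V), ‖x.1‖ ≤ ‖x‖ ∧ ‖x.2.1‖ ≤ ‖x‖ ∧
      ‖x.2.2‖ ≤ ‖x‖ := fun x => ⟨norm_fst_le _, (norm_fst_le x.2).trans (norm_snd_le x),
      (norm_snd_le x.2).trans (norm_snd_le x)⟩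
  have bd : ∀ {y z : ℝ} (D : NNReal), (D : ℝ) ≤ C₁ + C₂ + C₃ → y ≤ z →
      0 ≤ y → D * lam ^ (b - 1 / 2) * y ≤ (C₁ + C₂ + C₃ : ℝ) * lam ^ (b - 1 / 2) * z := by
    intro y z D h1 h2 h3; gcongr
  refine ⟨K₁.prodMap (K₂.prodMap K₃), E₁.prodMap (E₂.prodMap E₃), fun N => ?_, fun c => ?_,
    fun N c => ?_⟩
  · obtain ⟨n1, n2, n3⟩ := hC N
    refine E3.norm_le ((k₁ N.1).trans (bd _ (by linarith [C₂.2, C₃.2]) n1 (norm_nonneg _)))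
      ((k₂ N.2.1).trans (bd _ (by linarith [C₁.2, C₃.2]) n2 (norm_nonneg _)))
      ((k₃ N.2.2).trans (bd _ (by linarith [C₁.2, C₂.2]) n3 (norm_nonneg _)))
  · obtain ⟨n1, n2, n3⟩ := hC c
    refine E3.norm_le ((e₁ c.1).trans (bd _ (by linarith [C₂.2, C₃.2]) n1 (norm_nonneg _)))
      ((e₂ c.2.1).trans (bd _ (by linarith [C₁.2, C₃.2]) n2 (norm_nonneg _)))
      ((e₃ c.2.2).trans (bd _ (by linarith [C₁.2, C₂.2]) n3 (norm_nonneg _)))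
  · obtain ⟨d₁, a₁, b₁⟩ := w₁ N.1 c.1
    obtain ⟨d₂, a₂, b₂⟩ := w₂ N.2.1 c.2.1
    obtain ⟨d₃, a₃, b₃⟩ := w₃ N.2.2 c.2.2
    refine ⟨fun κ => ?_, fun κ => ?_, fun κ => ?_, ?_⟩
    · exact integral_sy_mul hl (measurable_hu 1) (abs_hu_le s1) a₁
    · exact integral_sy_mul hl (measurable_hu (-1)) (abs_hu_le s2) a₂
    · exact integral_sy_mul hl (measurable_hz 1) (abs_hz_le s1) a₃
    · filter_upwards [b₁, b₂, b₃] with ξ q₁ q₂ q₃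
      rw [neg_neg] at q₁ q₂
      exact ⟨(hat_zero _ _).trans q₁, (hat_zero _ _).trans q₂, (hat_zero _ _).trans q₃⟩

theorem hat_den_smul (W : ℝ² → ℝ) (c : ℂ) (F : L2 ℝ²) :
    ∀ᵐ ξ : ℝ, ∀ t : ℝ, hat (den W (c • F : L2 ℝ²)) t ξ = c * hat (den W F) t ξ := by
  filter_upwards [ae_prod_slice (Lp.coeFn_smul c F)] with ξ h t
  simp only [hat]; rw [← integral_const_mul]
  refine integral_congr_ae ?_
  filter_upwards [h] with τ hτ
  simp only [den, hτ, Pi.smul_apply, smul_eq_mul]; ring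

theorem exists_timeCut3 (l k : ℝ) {b : ℝ} (hb : 1 / 2 < b) (hb' : b < 1) (c : ℂ) :
    ∃ C : NNReal, ∀ lam : ℝ, 1 ≤ lam → ∀ a : ℝ, ∃ M : E3 →+ E3,
      (∀ F, ‖M F‖ ≤ C * ‖F‖) ∧ ∀ F, ∀ᵐ ξ : ℝ, ∀ t : ℝ,
        hat (du l b lam (M F)) t ξ = c * exp (-(lam * |t - a|)) * hat (du l b lam F) t ξ ∧
        hat (dv l b lam (M F)) t ξ = c * exp (-(lam * |t - a|)) * hat (dv l b lam F) t ξ ∧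
        hat (dz k b lam (M F)) t ξ = c * exp (-(lam * |t - a|)) * hat (dz k b lam F) t ξ := by
  obtain ⟨C₁, h₁⟩ := exists_timeCut (-l) hb hb' (measurable_hu 1)
  obtain ⟨C₂, h₂⟩ := exists_timeCut (-l) hb hb' (measurable_hu (-1))
  obtain ⟨C₃, h₃⟩ := exists_timeCut k hb hb' (measurable_hz 1)
  refine ⟨‖c‖₊ * (C₁ + C₂ + C₃), fun lam hl a => ?_⟩
  obtain ⟨M₁, m₁, e₁⟩ := h₁ lam hl a
  obtain ⟨M₂, m₂, e₂⟩ := h₂ lam hl a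
  obtain ⟨M₃, m₃, e₃⟩ := h₃ lam hl a
  have n := fun F : E3 => And.intro (E3.norm_fst_le F)
    (And.intro (E3.norm_snd_fst_le F) (E3.norm_snd_snd_le F))
  refine ⟨AddMonoidHom.mk' (fun F => (c • M₁ F.1, c • M₂ F.2.1, c • M₃ F.2.2)) fun F G => ?_,
    fun F => ?_, fun F => ?_⟩
  · refine Prod.ext ?_ (Prod.ext ?_ ?_) <;> simp only [Prod.fst_add, Prod.snd_add, map_add, smul_add]
  · obtain ⟨n1, n2, n3⟩ := n F
    have bd : ∀ (x y : L2 ℝ²) (D : ℝ), ‖x‖ ≤ D * ‖y‖ → 0 ≤ D → D ≤ C₁ + C₂ + C₃ →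
        ‖y‖ ≤ ‖F‖ → ‖c • x‖ ≤ ‖c‖ * (C₁ + C₂ + C₃) * ‖F‖ := by
      intro x y D h1 h0 h2 h3; rw [norm_smul, mul_assoc]
      gcongr
      exact h1.trans (by gcongr)
    refine E3.norm_le (bd _ _ _ (m₁ _) C₁.2 (by linarith [C₂.2, C₃.2]) n1)
      (bd _ _ _ (m₂ _) C₂.2 (by linarith [C₁.2, C₃.2]) n2)
      (bd _ _ _ (m₃ _) C₃.2 (by linarith [C₁.2, C₂.2]) n3)
  · filter_upwards [e₁ F.1, e₂ F.2.1, e₃ F.2.2, hat_den_smul (wt (-l) b lam (hu 1)) c (M₁ F.1),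
      hat_den_smul (wt (-l) b lam (hu (-1))) c (M₂ F.2.1),
      hat_den_smul (wt k b lam (hz 1)) c (M₃ F.2.2)] with ξ a₁ a₂ a₃ c₁ c₂ c₃ t
    refine ⟨?_, ?_, ?_⟩
    · exact (c₁ t).trans (by rw [a₁ t, mul_assoc]; rfl)
    · exact (c₂ t).trans (by rw [a₂ t, mul_assoc]; rfl)
    · exact (c₃ t).trans (by rw [a₃ t, mul_assoc]; rfl)

theorem exists_param {γ : ℝ} (hγ : 0 < γ) (X : ℝ) : ∃ lam : ℝ, 1 ≤ lam ∧ X * lam ^ (-γ) ≤ 1 := by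
  refine ⟨(max 1 X) ^ (1 / γ), one_le_rpow (le_max_left _ _) (by positivity), ?_⟩
  have h0 : 0 < max 1 X := by positivity
  rw [← rpow_mul h0.le]
  have : 1 / γ * -γ = -1 := by field_simp
  rw [this, Real.rpow_neg_one, ← div_eq_mul_inv, div_le_one h0]
  exact le_max_right _ _

/-- The weak form of the system for the densities `X`, with the inhomogeneity `n`. -/
def HalfWave (M m lam : ℝ) (X : T3) (n : (ℝ² → ℂ) → ℂ × ℂ × ℂ) (κ : ℝ² → ℂ) : Prop :=
  (∫ p, sy lam (p.1 + hu 1 p.2) * X.1 p * κ p = -(I * M) * (∫ p, X.2.1 p * κ p) + (n κ).1) ∧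
  (∫ p, sy lam (p.1 + hu (-1) p.2) * X.2.1 p * κ p = -(I * M) * (∫ p, X.1 p * κ p) + (n κ).2.1) ∧
  ∫ p, sy lam (p.1 + hz 1 p.2) * X.2.2 p * κ p =
    (∫ p, (-(I * (om p.2 - 2 * π * |p.2| : ℝ)) * X.2.2 p +
      I * (1 - m ^ 2 : ℝ) * (om p.2 : ℂ)⁻¹ * ph X.2.2 p) * κ p) +
    I * (n fun p => ((om p.2)⁻¹ : ℂ) * κ p).2.2

/-- `X` and `Y` are densities of curves related by the factor `r` on `[0,T]`. -/
def Rel (T : ℝ) (r : ℝ → ℝ) (X Y : T3) : Prop :=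
  ∀ᵐ ξ : ℝ, ∀ t ∈ Icc 0 T, hat X.1 t ξ = r t * hat Y.1 t ξ ∧
    hat X.2.1 t ξ = r t * hat Y.2.1 t ξ ∧ hat X.2.2 t ξ = r t * hat Y.2.2 t ξ

theorem IsSym.integral_den_add {κ : ℝ² → ℂ} (hκ : IsSym κ) (s b : ℝ) {lam : ℝ} (hl : 1 ≤ lam)
    {h : ℝ → ℝ} (mh : Measurable h) (hh : ∀ ξ, |h ξ| ≤ |ξ|) (X Y : L2 ℝ²) :
    ∫ p, den (wt s b lam h) (X + Y : L2 ℝ²) p * κ p =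
      (∫ p, den (wt s b lam h) X p * κ p) + ∫ p, den (wt s b lam h) Y p * κ p := by
  rw [← integral_add (hκ.integrable_den_mul s b hl mh hh X) (hκ.integrable_den_mul s b hl mh hh Y)]
  refine integral_congr_ae ?_
  filter_upwards [den_add (wt s b lam h) X Y] with p hp
  rw [hp, Pi.add_apply, add_mul]

theorem Represents.add {l k b lam : ℝ} (hl : 1 ≤ lam) {N N' : E3}
    {n n' : (ℝ² → ℂ) → ℂ × ℂ × ℂ} (h : Represents l k b lam N n)
    (h' : Represents l k b lam N' n') : Represents l k b lam (N + N') (n + n') := fun κ hκ => by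
  obtain ⟨h1, h2, h3⟩ := h κ hκ
  obtain ⟨h1', h2', h3'⟩ := h' κ hκ
  refine ⟨?_, ?_, ?_⟩
  · exact (hκ.integral_den_add _ _ hl (measurable_hu 1) (abs_hu_le (by norm_num)) _ _).trans
      (congrArg₂ _ h1 h1')
  · exact (hκ.integral_den_add _ _ hl (measurable_hu (-1)) (abs_hu_le (by norm_num)) _ _).trans
      (congrArg₂ _ h2 h2')
  · exact (hκ.integral_den_add _ _ hl (measurable_hz 1) (abs_hz_le (by norm_num)) _ _).trans
      ((congrArg₂ _ h3 h3').trans (mul_add _ _ _).symm)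

theorem exists_linear (l k : ℝ) {b : ℝ} (hb : 1 / 2 < b) (hb' : b ≤ 1) (M m : ℝ) :
    ∃ C : NNReal, ∀ lam : ℝ, 1 ≤ lam → ∃ (K P : E3 →+ E3) (E : D3 →+ E3),
      (∀ N, ‖K N‖ ≤ C * lam ^ (b - 1 / 2) * ‖N‖) ∧
      (∀ F, ‖P F‖ ≤ C * lam ^ (b - 1 / 2 - 1) * ‖F‖) ∧
      (∀ c, ‖E c‖ ≤ C * lam ^ (b - 1 / 2) * ‖c‖) ∧
      ∀ F N c, F = P F + K N + E c →
        (∀ n, Represents l k b lam N n → ∀ κ, IsSym κ → HalfWave M m lam (dn l k b lam F) n κ) ∧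
        Init l k (dn l k b lam F) c := by
  obtain ⟨C, hK⟩ := exists_duhamel3 l k hb (by linarith)
  obtain ⟨C', hL⟩ := exists_lowerOrder (by linarith) hb' M m
  refine ⟨C + C * C', fun lam hl => ?_⟩
  have hl0 : 0 < lam := by linarith
  obtain ⟨K, E, nK, nE, wK⟩ := hK lam hl
  obtain ⟨L, nL, eL⟩ := hL lam hl
  refine ⟨K, K.comp L, E, fun N => (nK N).trans (by gcongr; exact le_self_add), fun F => ?_,
    fun c => (nE c).trans (by gcongr; exact le_self_add), fun F N c hF => ?_⟩
  · calc ‖K (L F)‖ ≤ C * lam ^ (b - 1 / 2) * (C' * lam⁻¹ * ‖F‖) :=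
          (nK _).trans (by gcongr; exact nL F)
      _ = (C * C' : NNReal) * lam ^ (b - 1 / 2 - 1) * ‖F‖ := by
          rw [rpow_sub_one hl0.ne']; push_cast; ring
      _ ≤ _ := by gcongr; exact le_add_self
  · obtain ⟨wu, wv, wz, w0⟩ := wK (L F + N) c
    have hF' : K (L F + N) + E c = F := by rw [map_add]; exact hF.symm
    rw [hF'] at wu wv wz w0
    refine ⟨fun n hn κ hκ => ?_, w0⟩
    obtain ⟨nu, nv, nz⟩ := hn κ hκ
    obtain ⟨lu, lv, lz'⟩ := eL F
    have e : ∀ {f g : ℝ² → ℂ}, f =ᵐ[volume] g → ∫ p, f p * κ p = ∫ p, g p * κ p := fun h =>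
      integral_congr_ae (by filter_upwards [h] with p hp; rw [hp])
    refine ⟨(wu κ hκ).trans ?_, (wv κ hκ).trans ?_, (wz κ hκ).trans ?_⟩
    · rw [← nu, ← integral_const_mul]
      simp_rw [← mul_assoc]
      exact (hκ.integral_den_add _ _ hl (measurable_hu 1) (abs_hu_le (by norm_num)) _ _).trans
        (congrArg (· + _) (e lu))
    · rw [← nv, ← integral_const_mul]
      simp_rw [← mul_assoc]
      exact (hκ.integral_den_add _ _ hl (measurable_hu (-1)) (abs_hu_le (by norm_num)) _ _).trans
        (congrArg (· + _) (e lv))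
    · rw [← nz]
      exact (hκ.integral_den_add _ _ hl (measurable_hz 1) (abs_hz_le (by norm_num)) _ _).trans
        (congrArg (· + _) (e lz'))

theorem exists_mildSolution {l k δ b : ℝ} (h : Exponents l k δ) (hb : 1 / 2 < b)
    (hbδ : b - 1 / 2 < δ / 4) (M m g : ℝ) (R : ℝ) :
    ∃ lam : ℝ, 1 ≤ lam ∧ ∀ c : D3, ‖c‖ ≤ R → ∃ F G : E3,
      Rel lam⁻¹ (fun t => exp (lam * t)) (dn l k b lam G) (dn l k b lam F) ∧
      Init l k (dn l k b lam F) c ∧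
      ∀ κ, IsSym κ → HalfWave M m lam (dn l k b lam F)
        (nl g (dn l k b lam G) (dn l k b lam F)) κ := by
  have hδ := h.δ_le
  obtain ⟨CK, hK⟩ := exists_linear l k hb (by linarith) M m
  obtain ⟨CM, hM⟩ := exists_timeCut3 l k hb (by linarith) (exp 1)
  obtain ⟨CB, hB⟩ := exists_nonlinearity h hb (by linarith) g
  set ε := b - 1 / 2 with hε
  set R' := max R 0
  obtain ⟨lam, hl, hX⟩ := exists_param (γ := δ - 3 * ε) (by linarith)
    (2 * CK + 8 * (CK * CB * CM) * (CK * R'))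
  refine ⟨lam, hl, fun c hc => ?_⟩
  have hl0 : 0 < lam := by linarith
  obtain ⟨K, P, E, nK, nP, nE, wK⟩ := hK lam hl
  obtain ⟨ℳ, nM, eM⟩ := hM lam hl lam⁻¹
  obtain ⟨B, nB, eB⟩ := hB lam lam lam hl hl hl
  have pw : ∀ x y : ℝ, lam ^ x * lam ^ y = lam ^ (x + y) := fun x y => (rpow_add hl0 x y).symm
  obtain ⟨F, hF⟩ := exists_fixedPoint P
    (AddMonoidHom.mk' (fun F => K.comp (B (ℳ F))) fun F G => by
      ext1 x
      simp only [map_add, AddMonoidHom.coe_comp, comp_apply, AddMonoidHom.add_apply])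
    (E c) (ρ := CK * R' * lam ^ ε) nP (fun F G => by
      refine (nK _).trans ?_
      calc CK * lam ^ ε * ‖B (ℳ F) G‖
          ≤ CK * lam ^ ε * (CB * lam ^ (-(δ - ε)) * (CM * ‖F‖) * ‖G‖) := by
            gcongr; exact (nB _ _).trans (by gcongr; exact nM F)
        _ = CK * CB * CM * (lam ^ ε * lam ^ (-(δ - ε))) * ‖F‖ * ‖G‖ := by ring
        _ = _ := by rw [pw, show ε + -(δ - ε) = 2 * ε - δ by ring])
    ((nE c).trans (by
      calc CK * lam ^ ε * ‖c‖ ≤ CK * lam ^ ε * R' := by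
            gcongr; exact hc.trans (le_max_left _ _)
        _ = _ := by ring)) (by positivity) (by positivity) (by
      have h1 : lam ^ (ε - 1) ≤ lam ^ (-(δ - 3 * ε)) := rpow_le_rpow_of_exponent_le hl (by linarith)
      calc 2 * (CK * lam ^ (ε - 1)) + 8 * (CK * CB * CM * lam ^ (2 * ε - δ)) * (CK * R' * lam ^ ε)
          = 2 * CK * lam ^ (ε - 1) + 8 * (CK * CB * CM) * (CK * R') *
            (lam ^ (2 * ε - δ) * lam ^ ε) := by ring
        _ ≤ 2 * CK * lam ^ (-(δ - 3 * ε)) + 8 * (CK * CB * CM) * (CK * R') *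
            lam ^ (-(δ - 3 * ε)) := by
            rw [pw, show 2 * ε - δ + ε = -(δ - 3 * ε) by ring]; gcongr
        _ = _ := by ring
        _ ≤ 1 := hX)
  obtain ⟨w, w0⟩ := wK F (B (ℳ F) F) c hF
  refine ⟨F, ℳ F, ?_, w0, w _ (eB (ℳ F) F).1⟩
  filter_upwards [eM F] with ξ hξ t ht
  have : (exp 1 : ℂ) * (exp (-(lam * |t - lam⁻¹|)) : ℝ) = (exp (lam * t) : ℝ) := by
    rw [← Complex.ofReal_mul, ← Real.exp_add, abs_of_nonpos (by linarith [ht.2])]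
    congr 2; field_simp
    ring
  rw [← this]
  exact hξ t

/-- The point with coordinates `p`. -/
def pt (p : ℝ²) : Spacetime := !₂[p.1, p.2]

/-- The coordinates of a point. -/
def co (q : Spacetime) : ℝ² := (q 0, q 1)

@[simp] theorem pt_zero (p : ℝ²) : pt p 0 = p.1 := rfl
@[simp] theorem pt_one (p : ℝ²) : pt p 1 = p.2 := rfl
@[simp] theorem co_pt (p : ℝ²) : co (pt p) = p := rfl
@[simp] theorem pt_co (q : Spacetime) : pt (co q) = q := by ext i; fin_cases i <;> rfl

theorem pt_eq (p : ℝ²) : pt p = p.1 • eT + p.2 • eX := by ext i; fin_cases i <;> simp [pt]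

theorem continuous_pt : Continuous pt := by
  have : pt = fun p => p.1 • eT + p.2 • eX := funext pt_eq
  rw [this]; fun_prop

theorem continuous_co : Continuous co := by unfold co; fun_prop

theorem measurable_pt : Measurable pt := continuous_pt.measurable
theorem measurable_co : Measurable co := continuous_co.measurable

theorem measurePreserving_co : MeasurePreserving co volume volume := by
  have h1 := EuclideanSpace.volume_preserving_symm_measurableEquiv_toLp (Fin 2)
  have h2 := volume_preserving_finTwoArrow ℝ
  exact h2.comp h1

/-- The coordinates as an equivalence. -/
def coEquiv : Spacetime ≃ᵐ ℝ² where
  toFun := co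
  invFun := pt
  left_inv := pt_co
  right_inv := co_pt
  measurable_toFun := measurable_co
  measurable_invFun := measurable_pt

theorem measurePreserving_pt : MeasurePreserving pt volume volume :=
  MeasurePreserving.symm coEquiv measurePreserving_co

theorem measurableEmbedding_pt : MeasurableEmbedding pt := coEquiv.symm.measurableEmbedding
theorem inner_pt (p q : ℝ²) : inner ℝ (pt p) (pt q) = p.1 * q.1 + p.2 * q.2 := by
  simp [pt, PiLp.inner_apply, Fin.sum_univ_two]; ring

theorem jb_fst_le (p : ℝ²) : jb p.1 ≤ 1 + ‖pt p‖ := by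
  have := PiLp.norm_apply_le (pt p) 0
  rw [pt_zero, norm_eq_abs] at this
  unfold jb; linarith

theorem jb_snd_le (p : ℝ²) : jb p.2 ≤ 1 + ‖pt p‖ := by
  have := PiLp.norm_apply_le (pt p) 1
  rw [pt_one, norm_eq_abs] at this
  unfold jb; linarith

theorem schwartz_decay {E : Type*} [NormedAddCommGroup E] [NormedSpace ℝ E]
    (f : 𝓢(E, ℂ)) (N : ℝ) : ∃ C : ℝ, 0 < C ∧ ∀ x, ‖f x‖ ≤ C * (1 + ‖x‖) ^ (-N) := by
  obtain ⟨n, hn⟩ := exists_nat_ge N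
  refine ⟨2 ^ n * ((Finset.Iic (n, 0)).sup fun m => SchwartzMap.seminorm ℝ m.1 m.2) f + 1,
    by positivity, fun x => ?_⟩
  have h := SchwartzMap.one_add_le_sup_seminorm_apply (𝕜 := ℝ) (m := (n, 0))
    le_rfl le_rfl f x
  rw [norm_iteratedFDeriv_zero] at h
  have h1 : (0 : ℝ) < 1 + ‖x‖ := by positivity
  rw [rpow_neg h1.le, ← div_eq_mul_inv, le_div_iff₀ (by positivity), mul_comm]
  have h2 : (1 + ‖x‖) ^ N ≤ (1 + ‖x‖) ^ n := by
    rw [← rpow_natCast]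
    exact rpow_le_rpow_of_exponent_le (by linarith [norm_nonneg x]) hn
  calc (1 + ‖x‖) ^ N * ‖f x‖ ≤ (1 + ‖x‖) ^ n * ‖f x‖ := by gcongr
    _ ≤ _ := h
    _ ≤ _ := by linarith

/-- The symbol of a test function: its inverse Fourier transform. -/
def kap (η : 𝓢²) (p : ℝ²) : ℂ := (𝓕⁻ η) (pt p)

/-- The inverse Fourier transform in space. -/
def mot (η : 𝓢²) (t ξ : ℝ) : ℂ := (𝓕⁻ (slice t η)) ξ

@[simp] theorem slice_apply (t x : ℝ) (η : 𝓢²) : slice t η x = η (pt (t, x)) := by rw [pt_eq]; rfl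

theorem continuous_kap (η : 𝓢²) : Continuous (kap η) := (𝓕⁻ η).continuous.comp continuous_pt

theorem kap_decay (η : 𝓢²) (N : ℝ) :
    ∃ C : ℝ, 0 < C ∧ ∀ p, ‖kap η p‖ ≤ C * (jb p.1 ^ (-N) * jb p.2 ^ (-N)) := by
  set N' := max N 0
  obtain ⟨C, hC0, hC⟩ := schwartz_decay (𝓕⁻ η) (2 * N')
  refine ⟨C, hC0, fun p => (hC _).trans ?_⟩
  have h1 := jb_pos p.1
  have h2 := jb_pos p.2
  have h0 : (0 : ℝ) < 1 + ‖pt p‖ := by positivity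
  have e : (1 + ‖pt p‖) ^ (-(2 * N')) = (1 + ‖pt p‖) ^ (-N') * (1 + ‖pt p‖) ^ (-N') := by
    rw [← rpow_add h0]; ring_nf
  rw [e]
  have hN : -N' ≤ 0 := by simp [N']
  have hN' : -N' ≤ -N := by simp [N']
  gcongr
  · exact (rpow_le_rpow_of_nonpos h1 (jb_fst_le p) hN).trans
      (rpow_le_rpow_of_exponent_le (one_le_jb _) hN')
  · exact (rpow_le_rpow_of_nonpos h2 (jb_snd_le p) hN).trans
      (rpow_le_rpow_of_exponent_le (one_le_jb _) hN')

theorem integrable_jb_mul_jb {N : ℝ} (hN : 1 < N) :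
    Integrable fun p : ℝ² => jb p.1 ^ (-N) * jb p.2 ^ (-N) :=
  (integrable_jb_rpow hN).mul_prod (integrable_jb_rpow hN)

theorem integrable_kap (η : 𝓢²) : Integrable (kap η) := by
  obtain ⟨C, -, hC⟩ := kap_decay η 2
  exact ((integrable_jb_mul_jb (by norm_num)).const_mul C).mono'
    (continuous_kap η).aestronglyMeasurable (.of_forall hC)

theorem apply_pt (η : 𝓢²) (z : ℝ²) : η (pt z) = ∫ p, ex (-(p.1 * z.1 + p.2 * z.2)) * kap η p := by
  have h : η = 𝓕 (𝓕⁻ η) := (FourierTransform.fourier_fourierInv_eq η).symm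
  conv_lhs => rw [h]
  rw [SchwartzMap.fourier_coe, Real.fourier_eq', ← measurePreserving_pt.integral_comp
    measurableEmbedding_pt]
  refine integral_congr fun p => ?_
  simp only [inner_pt, kap, ex]; congr 2
  push_cast; ring

/-- The partial Fourier transform in time of the symbol. -/
def mos (η : 𝓢²) (t ξ : ℝ) : ℂ := ∫ τ, ex (-(t * τ)) * kap η (τ, ξ)

theorem continuous_mos (η : 𝓢²) : Continuous fun z : ℝ² => mos η z.1 z.2 := by
  obtain ⟨C, hC0, hC⟩ := kap_decay η 2
  have hk := continuous_kap η
  refine continuous_of_dominated (bound := fun τ => C * jb τ ^ (-2 : ℝ)) (fun z => ?_) (fun z => ?_)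
    ((integrable_jb_rpow (by norm_num)).const_mul C) ?_
  · exact Continuous.aestronglyMeasurable (by fun_prop)
  · refine .of_forall fun τ => ?_
    rw [norm_mul, norm_ex, one_mul]
    refine (hC _).trans ?_
    have := Real.rpow_le_one_of_one_le_of_nonpos (one_le_jb z.2) (by norm_num : (-2 : ℝ) ≤ 0)
    have h2 := jb_rpow_pos τ (-2)
    gcongr
    exact mul_le_of_le_one_right h2.le this
  · exact .of_forall fun τ => by fun_prop

theorem mos_decay (η : 𝓢²) (N : ℝ) : ∃ C : ℝ, 0 < C ∧ ∀ t ξ, ‖mos η t ξ‖ ≤ C * jb ξ ^ (-N) := by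
  set N' := max N 2
  obtain ⟨C, hC0, hC⟩ := kap_decay η N'
  have hN' : 1 < N' := lt_of_lt_of_le (by norm_num) (le_max_right N 2)
  refine ⟨C * (∫ τ, jb τ ^ (-N')) + 1, ?_, fun t ξ => ?_⟩
  · have : 0 ≤ ∫ τ, jb τ ^ (-N') := integral_nonneg fun τ => jb_rpow_nonneg τ _
    positivity
  · have h1 := jb_rpow_pos ξ (-N)
    have h2 : jb ξ ^ (-N') ≤ jb ξ ^ (-N) := rpow_le_rpow_of_exponent_le (one_le_jb _) (by simp [N'])
    have h0 : 0 ≤ ∫ τ, jb τ ^ (-N') := integral_nonneg fun τ => jb_rpow_nonneg τ _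
    calc ‖mos η t ξ‖ ≤ ∫ τ, C * (jb τ ^ (-N') * jb ξ ^ (-N')) := by
          refine norm_integral_le_of_norm_le
            (((integrable_jb_rpow hN').mul_const _).const_mul C) (.of_forall fun τ => ?_)
          rw [norm_mul, norm_ex, one_mul]
          exact hC _
      _ = C * (∫ τ, jb τ ^ (-N')) * jb ξ ^ (-N') := by
          rw [integral_const_mul, integral_mul_const, mul_assoc]
      _ ≤ C * (∫ τ, jb τ ^ (-N')) * jb ξ ^ (-N) := by gcongr
      _ ≤ _ := by nlinarith

theorem integrable_mos (η : 𝓢²) (t : ℝ) : Integrable (mos η t) := by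
  obtain ⟨C, -, hC⟩ := mos_decay η 2
  have := continuous_mos η
  exact ((integrable_jb_rpow (by norm_num)).const_mul C).mono'
    (Continuous.aestronglyMeasurable (by fun_prop)) (.of_forall (hC t))

theorem slice_eq_fourier (η : 𝓢²) (t : ℝ) : (slice t η : ℝ → ℂ) = 𝓕 (mos η t) := by
  ext x
  rw [slice_apply, apply_pt, fourier_eq_ex, Measure.volume_eq_prod, integral_prod_symm]
  · refine integral_congr fun ξ => ?_
    simp only [mos, smul_eq_mul]; rw [← integral_const_mul]
    refine integral_congr fun τ => ?_
    rw [← mul_assoc, ← ex_add]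
    congr 2; ring
  · refine (integrable_kap η).bdd_mul (c := 1) ?_ (.of_forall fun p => ?_)
    · exact Continuous.aestronglyMeasurable (by fun_prop)
    · rw [norm_ex]

theorem mot_eq_mos (η : 𝓢²) (t : ℝ) : mot η t = mos η t := by
  have h := slice_eq_fourier η t
  have hc := continuous_mos η
  have : 𝓕⁻ (𝓕 (mos η t)) = mos η t :=
    Continuous.fourierInv_fourier_eq (by fun_prop) (integrable_mos η t)
      (by rw [← h]; exact (slice t η).integrable)
  rw [← this, ← h, ← SchwartzMap.fourierInv_coe]; rfl

theorem mot_decay (η : 𝓢²) (N : ℝ) : ∃ C : ℝ, 0 < C ∧ ∀ t ξ, ‖mot η t ξ‖ ≤ C * jb ξ ^ (-N) := by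
  simpa only [mot_eq_mos] using mos_decay η N

theorem continuous_mot (η : 𝓢²) : Continuous fun z : ℝ² => mot η z.1 z.2 := by
  simpa only [mot_eq_mos] using continuous_mos η

theorem mot_eq_integral (η : 𝓢²) (t ξ : ℝ) :
    mot η t ξ = ∫ τ, ex (-(t * τ)) * kap η (τ, ξ) := by rw [mot_eq_mos]; rfl

theorem IsTest.slice_eq_zero {T : ℝ} {η : 𝓢²} (h : IsTest T η) {t : ℝ}
    (ht : t ∉ Ioo 0 T) : slice t η = 0 := by
  ext x; rw [slice_apply]
  by_contra hne
  exact ht (h.2 (subset_tsupport η hne))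

theorem IsTest.mot_eq_zero {T : ℝ} {η : 𝓢²} (h : IsTest T η) {t : ℝ}
    (ht : t ∉ Ioo 0 T) (ξ : ℝ) : mot η t ξ = 0 := by
  rw [mot, h.slice_eq_zero ht]
  rw [show (𝓕⁻ (0 : 𝓢(ℝ, ℂ))) = 0 from map_zero (FourierTransform.fourierInvCLM ℂ 𝓢(ℝ, ℂ))]; rfl

theorem IsTest.isSym {T : ℝ} {η : 𝓢²} (h : IsTest T η) : IsSym (kap η) where
  measurable := (continuous_kap η).measurable
  decay N := by obtain ⟨C, -, hC⟩ := kap_decay η N; exact ⟨C, hC⟩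
  support t ht ξ := by
    rw [← mot_eq_integral]
    exact h.mot_eq_zero (fun h' => absurd h'.1 (not_lt.2 ht)) ξ

theorem IsTest.kap_eq {T : ℝ} {η : 𝓢²} (h : IsTest T η) (τ ξ : ℝ) :
    kap η (τ, ξ) = ∫ t in Ioc 0 T, ex (t * τ) * mot η t ξ := by
  have hc := continuous_kap η
  have hm := continuous_mot η
  have hi : Integrable fun τ => kap η (τ, ξ) := by
    have := h.isSym.integrable_slice ξ
    exact this
  have hi' : Integrable fun t => mot η t ξ := by
    have : IntegrableOn (fun t => mot η t ξ) (Icc 0 T) := Continuous.integrableOn_Icc (by fun_prop)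
    exact (integrableOn_iff_integrable_of_support_subset fun t ht => by
      by_contra hn
      exact ht (h.mot_eq_zero (fun h' => hn (Set.Ioo_subset_Icc_self h')) ξ)).1 this
  have key := integral_ex_mul_integral_ex_neg (by fun_prop) hi (by
    refine hi'.congr (.of_forall fun t => ?_)
    simp only [mot_eq_integral]
    simp_rw [mul_comm]) τ
  rw [← key, setIntegral_eq_integral_of_forall_compl_eq_zero]
  · refine integral_congr fun t => ?_
    simp only [mot_eq_integral]
    simp_rw [mul_comm]
  · intro t ht
    rw [h.mot_eq_zero (fun h' => ht (Set.Ioo_subset_Ioc_self h')), mul_zero]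

theorem kap_add (η η' : 𝓢²) (p : ℝ²) : kap (η + η') p = kap η p + kap η' p := by
  have : 𝓕⁻ (η + η') = 𝓕⁻ η + 𝓕⁻ η' := map_add (FourierTransform.fourierInvCLM ℂ _) _ _
  rw [kap, this]; rfl

theorem kap_smul (c : ℂ) (η : 𝓢²) (p : ℝ²) : kap (c • η) p = c * kap η p := by
  have : 𝓕⁻ (c • η) = c • 𝓕⁻ η := map_smul (FourierTransform.fourierInvCLM ℂ _) _ _
  rw [kap, this]; rfl

theorem mot_smul (c : ℂ) {η η' : 𝓢²} {t : ℝ} (h : slice t η' = c • slice t η)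
    (ξ : ℝ) : mot η' t ξ = c * mot η t ξ := by
  have : 𝓕⁻ (c • slice t η) = c • 𝓕⁻ (slice t η) :=
    map_smul (FourierTransform.fourierInvCLM ℂ _) _ _
  rw [mot, h, this]; rfl

theorem kap_lineDeriv (η : 𝓢²) (q p : ℝ²) :
    kap (∂_{pt q} η) p = -(2 * π * I) * (p.1 * q.1 + p.2 * q.2 : ℝ) * kap η p := by
  have hg : (fun x : Spacetime => inner ℝ x (pt q)).HasTemperateGrowth := by fun_prop
  rw [kap, SchwartzMap.fourierInv_lineDerivOp_eq, smul_apply,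
    SchwartzMap.smulLeftCLM_apply_apply hg, inner_pt]
  simp only [kap, real_smul]; ring

theorem eT_eq : eT = pt (1, 0) := by rw [pt_eq]; simp
theorem eX_eq : eX = pt (0, 1) := by rw [pt_eq]; simp

theorem kap_eT (η : 𝓢²) (p : ℝ²) : kap (∂_{eT} η) p = -(2 * π * I) * (p.1 : ℂ) * kap η p := by
  rw [eT_eq, kap_lineDeriv]; simp

theorem kap_eX (η : 𝓢²) (p : ℝ²) : kap (∂_{eX} η) p = -(2 * π * I) * (p.2 : ℂ) * kap η p := by
  rw [eX_eq, kap_lineDeriv]; simp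

theorem IsTest.lineDeriv {T : ℝ} {η : 𝓢²} (h : IsTest T η) (v : Spacetime) : IsTest T (∂_{v} η) :=
  ⟨h.1.of_isClosed_subset (isClosed_tsupport _) (SchwartzMap.tsupport_lineDerivOp_subset v η),
    (SchwartzMap.tsupport_lineDerivOp_subset v η).trans h.2⟩

theorem IsTest.add_smul {T : ℝ} {η η' : 𝓢²} (h : IsTest T η) (h' : IsTest T η')
    (c : ℂ) : IsTest T (η + c • η') := by
  have h4 : tsupport ⇑(η + c • η') ⊆ tsupport ⇑η ∪ tsupport ⇑η' := by
    refine (tsupport_add (f := ⇑η) (g := fun q => c • η' q)).trans ?_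
    exact Set.union_subset_union_right _
      (closure_mono (Function.support_const_smul_subset c ⇑η'))
  exact ⟨HasCompactSupport.of_support_subset_isCompact (h.1.isCompact.union h'.1.isCompact)
    ((subset_tsupport _).trans h4), h4.trans (Set.union_subset h.2 h'.2)⟩

theorem IsTest.exists_exp_mul {T : ℝ} {η : 𝓢²} (h : IsTest T η) (a : ℝ) : ∃ η' : 𝓢², IsTest T η' ∧
      (∀ t, slice t η' = (exp (a * t) : ℂ) • slice t η) ∧
      ∀ t, slice t (∂_{eT} η' - (a : ℂ) • η') = (exp (a * t) : ℂ) • slice t (∂_{eT} η) := by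
  set f : Spacetime → ℂ := fun q => Complex.exp ((a * q 0 : ℝ) : ℂ) * η q
  have sm : ContDiff ℝ (⊤ : ℕ∞) f := by
    have h1 : ContDiff ℝ (⊤ : ℕ∞) η := η.smooth ⊤
    have h2 : ContDiff ℝ (⊤ : ℕ∞) (fun q : Spacetime => ((a * q 0 : ℝ) : ℂ)) :=
      (ofRealCLM.comp (a • (EuclideanSpace.proj 0 : Spacetime →L[ℝ] ℝ))).contDiff
    exact h2.cexp.mul h1
  have cs : HasCompactSupport f := h.1.mul_left
  have hv : ∀ q, cs.toSchwartzMap sm q = Complex.exp ((a * q 0 : ℝ) : ℂ) * η q := fun q => rfl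
  refine ⟨cs.toSchwartzMap sm, ⟨cs, ?_⟩, fun t => ?_, fun t => ?_⟩
  · exact (closure_mono (Function.support_mul_subset_right _ _)).trans h.2
  · ext x
    rw [slice_apply, hv, smul_apply, slice_apply, pt_zero, Complex.ofReal_exp, smul_eq_mul]
  · ext x
    set q := pt (t, x) with hq
    have hd1 : HasFDerivAt η (fderiv ℝ η q) q := η.hasFDerivAt q
    have hd2 : HasFDerivAt (fun q : Spacetime => ((a * q 0 : ℝ) : ℂ))
        (ofRealCLM.comp (a • (EuclideanSpace.proj 0 : Spacetime →L[ℝ] ℝ))) q :=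
      (ofRealCLM.comp (a • (EuclideanSpace.proj 0 : Spacetime →L[ℝ] ℝ))).hasFDerivAt
    have hd := hd2.cexp.mul hd1
    have e1 : ∂_{eT} (cs.toSchwartzMap sm) q = Complex.exp ((a * q 0 : ℝ) : ℂ) *
        (∂_{eT} η q + a * η q) := by
      rw [SchwartzMap.lineDerivOp_apply_eq_fderiv, SchwartzMap.lineDerivOp_apply_eq_fderiv]
      have : fderiv ℝ (cs.toSchwartzMap sm) q = _ := hd.fderiv
      rw [this]; simp; ring
    rw [slice_apply, sub_apply, smul_apply, smul_apply,
      slice_apply, ← hq, e1, hv, Complex.ofReal_exp, hq, pt_zero]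
    simp only [smul_eq_mul]; ring

/-- Functions of frequency decreasing faster than any power. -/
def RapidDecay (a : ℝ → ℂ) : Prop := Measurable a ∧ ∀ N : ℝ, ∃ C : ℝ, ∀ ξ, ‖a ξ‖ ≤ C * jb ξ ^ (-N)

/-- Functions of frequency of polynomial growth. -/
def SlowGrowth (a : ℝ → ℂ) : Prop := Measurable a ∧ ∃ N C : ℝ, ∀ ξ, ‖a ξ‖ ≤ C * jb ξ ^ N

section

variable {F : Type*} [NormedAddCommGroup F] [NormedSpace ℂ F]

theorem integrable_ex_smul {X : Type*} [MeasurableSpace X] {μ : Measure X} {u : X → ℝ}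
    (hu : Measurable u) {f : X → F} (hf : Integrable f μ) :
    Integrable (fun x => ex (u x) • f x) μ := by
  refine hf.norm.mono' (AEStronglyMeasurable.smul
    (measurable_ex.comp hu).aestronglyMeasurable hf.1) (.of_forall fun x => ?_)
  rw [norm_smul, norm_ex, one_mul]

theorem Tame.integrable_smul {f : ℝ² → F} (hf : Tame f) {a : ℝ → ℂ} (ha : RapidDecay a) :
    Integrable fun p => a p.2 • f p := by
  obtain ⟨mf, N, hN⟩ := hf
  obtain ⟨ma, hC⟩ := ha
  obtain ⟨C, hC⟩ := hC N
  refine (hN.norm.const_mul C).mono' (AEStronglyMeasurable.smul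
    (ma.comp measurable_snd).aestronglyMeasurable mf) (.of_forall fun p => ?_)
  have := jb_rpow_pos p.2 (-N)
  rw [norm_smul, norm_smul, norm_ofReal_of_nonneg this.le, ← mul_assoc]; gcongr
  exact hC _

theorem Tame.slow_smul {f : ℝ² → F} (hf : Tame f) {a : ℝ → ℂ} (ha : SlowGrowth a) :
    Tame fun p => a p.2 • f p := by
  obtain ⟨mf, N, hN⟩ := hf
  obtain ⟨ma, N', C, hC⟩ := ha
  have mp : AEStronglyMeasurable (fun p => a p.2 • f p) volume :=
    AEStronglyMeasurable.smul (ma.comp measurable_snd).aestronglyMeasurable mf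
  refine ⟨mp, N + N', (hN.norm.const_mul C).mono' ?_ (.of_forall fun p => ?_)⟩
  · exact AEStronglyMeasurable.smul (Measurable.aestronglyMeasurable (by fun_prop)) mp
  · have h1 := jb_rpow_pos p.2 (-N)
    have h2 := jb_rpow_pos p.2 (-(N + N'))
    rw [norm_smul, norm_smul, norm_smul, norm_real, norm_real,
      norm_of_nonneg h1.le, norm_of_nonneg h2.le, ← mul_assoc, ← mul_assoc]
    refine mul_le_mul_of_nonneg_right ?_ (norm_nonneg _)
    calc jb p.2 ^ (-(N + N')) * ‖a p.2‖ ≤ jb p.2 ^ (-(N + N')) * (C * jb p.2 ^ N') := by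
          gcongr; exact hC _
      _ = C * (jb p.2 ^ (-(N + N')) * jb p.2 ^ N') := by ring
      _ = C * jb p.2 ^ (-N) := by rw [← rpow_add (jb_pos _)]; ring_nf

theorem Tame.add {f g : ℝ² → F} (hf : Tame f) (hg : Tame g) : Tame fun p => f p + g p := by
  obtain ⟨mf, N, hN⟩ := hf
  obtain ⟨mg, N', hN'⟩ := hg
  refine ⟨mf.add mg, max N N', ?_⟩
  have key : ∀ (h : ℝ² → F) (n : ℝ), AEStronglyMeasurable h → n ≤ max N N' →
      Integrable (fun p => jc p.2 (-n) • h p) →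
      Integrable (fun p => jc p.2 (-max N N') • h p) := by
    intro h n mh hn hi
    refine hi.norm.mono' (AEStronglyMeasurable.smul
      (Measurable.aestronglyMeasurable (by fun_prop)) mh) (.of_forall fun p => ?_)
    have h1 := jb_rpow_pos p.2 (-n)
    have h2 := jb_rpow_pos p.2 (-max N N')
    rw [norm_smul, norm_smul, norm_real, norm_ofReal_of_nonneg h1.le, norm_of_nonneg h2.le]; gcongr
    exact one_le_jb _
  refine ((key f N mf (le_max_left _ _) hN).add (key g N' mg (le_max_right _ _) hN')).congr
    (.of_forall fun p => ?_)
  exact (smul_add _ _ _).symm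

theorem SlowGrowth.const (c : ℂ) : SlowGrowth fun _ => c :=
  ⟨measurable_const, 0, ‖c‖, fun _ => by rw [rpow_zero, mul_one]⟩

theorem Tame.const_smul {f : ℝ² → F} (hf : Tame f) (c : ℂ) : Tame fun p => c • f p :=
  hf.slow_smul (SlowGrowth.const c)

theorem hat_smul (a : ℝ → ℂ) (f : ℝ² → F) (t ξ : ℝ) :
    hat (fun p => a p.2 • f p) t ξ = a ξ • hat f t ξ := by
  simp only [hat]; rw [← integral_smul]
  exact integral_congr_ae (.of_forall fun τ => smul_comm _ _ _)

theorem Tame.integrable_slice {f : ℝ² → F} (hf : Tame f) :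
    ∀ᵐ ξ : ℝ, Integrable fun τ => f (τ, ξ) := by
  obtain ⟨-, N, hN⟩ := hf
  have := hN.swap.prod_right_ae
  filter_upwards [this] with ξ hξ
  have h1 := jb_rpow_pos ξ (-N)
  have h2 : jc ξ (-N) ≠ 0 := by exact_mod_cast h1.ne'
  refine (hξ.smul (jc ξ (-N))⁻¹).congr (.of_forall fun τ => ?_)
  simp only [Function.comp, Prod.swap, smul_smul, Pi.smul_apply]; rw [inv_mul_cancel₀ h2, one_smul]

theorem Tame.hat_add {f g : ℝ² → F} (hf : Tame f) (hg : Tame g) :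
    ∀ᵐ ξ : ℝ, ∀ t, hat (fun p => f p + g p) t ξ = hat f t ξ + hat g t ξ := by
  have bd : ∀ (h : ℝ → F) (t : ℝ), Integrable h → Integrable fun τ => ex (t * τ) • h τ := by
    intro h t hi
    exact integrable_ex_smul (by fun_prop) hi
  filter_upwards [hf.integrable_slice, hg.integrable_slice] with ξ h1 h2 t
  simp only [hat, smul_add]
  exact integral_add (bd _ t h1) (bd _ t h2)

theorem Tame.smul_const {f : ℝ² → ℂ} (hf : Tame f) (v : F) : Tame fun p => f p • v := by
  obtain ⟨mf, N, hN⟩ := hf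
  refine ⟨mf.smul_const v, N, ?_⟩
  refine (hN.smul_const v).congr (.of_forall fun p => ?_)
  simp only [smul_smul, smul_eq_mul]

theorem hat_smul_const [CompleteSpace F] (f : ℝ² → ℂ) (v : F) (t ξ : ℝ) :
    hat (fun p => f p • v) t ξ = hat f t ξ • v := by
  simp only [hat]; rw [← integral_smul_const]
  simp only [smul_smul, smul_eq_mul]

theorem RapidDecay.mot (η : 𝓢²) (t : ℝ) : RapidDecay (mot η t) := by
  have hc := continuous_mot η
  refine ⟨Continuous.measurable (by fun_prop), fun N => ?_⟩
  obtain ⟨C, -, hC⟩ := mot_decay η N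
  exact ⟨C, hC t⟩

theorem Tame.integrable_kap_smul {f : ℝ² → F} (hf : Tame f) (η : 𝓢²) :
    Integrable fun p => kap η p • f p := by
  obtain ⟨mf, N, hN⟩ := hf
  have hk := continuous_kap η
  obtain ⟨C, hC0, hC⟩ := kap_decay η (max N 0)
  refine (hN.norm.const_mul C).mono' (AEStronglyMeasurable.smul hk.aestronglyMeasurable mf)
    (.of_forall fun p => ?_)
  have := jb_rpow_pos p.2 (-N)
  rw [norm_smul, norm_smul, norm_ofReal_of_nonneg this.le, ← mul_assoc]; gcongr
  refine (hC p).trans ?_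
  gcongr
  have h1 : jb p.1 ^ (-max N 0) ≤ 1 := Real.rpow_le_one_of_one_le_of_nonpos (one_le_jb _) (by simp)
  have h2 : jb p.2 ^ (-max N 0) ≤ jb p.2 ^ (-N) :=
    rpow_le_rpow_of_exponent_le (one_le_jb _) (by simp)
  have h3 := jb_rpow_pos p.2 (-max N 0)
  nlinarith

theorem IsTest.integral_kap_smul [CompleteSpace F] {T : ℝ} {η : 𝓢²} (hη : IsTest T η)
    {f : ℝ² → F} (hf : Tame f) :
    ∫ p, kap η p • f p = ∫ t in Ioc 0 T, ∫ ξ, mot η t ξ • hat f t ξ := by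
  have hm := continuous_mot η
  obtain ⟨mf, N, hN⟩ := id hf
  obtain ⟨C, hC0, hC⟩ := mot_decay η N
  have hint : Integrable (uncurry fun (p : ℝ²) (t : ℝ) => (ex (t * p.1) * mot η t p.2) • f p)
      (𝓛².prod (volume.restrict (Ioc 0 T))) := by
    refine ((hN.norm.const_mul C).comp_fst _).mono' ?_ (.of_forall fun z => ?_)
    · refine AEStronglyMeasurable.smul (Continuous.aestronglyMeasurable ?_) mf.comp_fst
      fun_prop
    · have := jb_rpow_pos z.1.2 (-N)
      simp only [uncurry]
      rw [norm_smul, norm_mul, norm_ex, one_mul, norm_smul, norm_real,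
        norm_of_nonneg this.le, ← mul_assoc]
      gcongr
      exact hC _ _
  have hsm : ∀ t, Integrable (fun p => (ex (t * p.1) * mot η t p.2) • f p) := by
    intro t
    have := integrable_ex_smul (u := fun p => t * p.1) (by fun_prop)
      (hf.integrable_smul (RapidDecay.mot η t))
    simpa only [smul_smul] using this
  calc ∫ p, kap η p • f p
      = ∫ p, ∫ t in Ioc 0 T, (ex (t * p.1) * mot η t p.2) • f p := by
        refine integral_congr fun p => ?_
        rw [integral_smul_const, ← hη.kap_eq]
    _ = ∫ t in Ioc 0 T, ∫ p, (ex (t * p.1) * mot η t p.2) • f p := integral_integral_swap hint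
    _ = _ := by
        refine integral_congr fun t => ?_
        rw [Measure.volume_eq_prod, integral_prod_symm _ (by
          rw [← Measure.volume_eq_prod]; exact hsm t)]
        refine integral_congr fun ξ => ?_
        simp only [hat]; rw [← integral_smul]
        refine integral_congr fun τ => ?_
        simp only [smul_smul]; rw [mul_comm]

end

theorem IsTest.integral_kap_exp {T : ℝ} {η η' : 𝓢²} (hη : IsTest T η)
    (hη' : IsTest T η') {a : ℝ}
    (h1 : ∀ t, slice t η' = (exp (a * t) : ℂ) • slice t η)
    (h2 : ∀ t, slice t (∂_{eT} η' - (a : ℂ) • η') = (exp (a * t) : ℂ) • slice t (∂_{eT} η))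
    {f g : ℝ² → ℂ} (hf : Tame f) (hg : Tame g)
    (hfg : ∀ t ∈ Ioc 0 T, ∀ᵐ ξ : ℝ, hat f t ξ = exp (a * t) * hat g t ξ) :
    ∫ p, kap η p * f p = ∫ p, kap η' p * g p ∧
      ∫ p, kap (∂_{eT} η) p * f p = -∫ p, sy a p.1 * g p * kap η' p := by
  have key : ∀ {θ θ' : 𝓢²}, IsTest T θ → IsTest T θ' →
      (∀ t, slice t θ' = (exp (a * t) : ℂ) • slice t θ) →
      ∫ p, kap θ p * f p = ∫ p, kap θ' p * g p := by
    intro θ θ' hθ hθ' h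
    have e1 := hθ.integral_kap_smul hf
    have e2 := hθ'.integral_kap_smul hg
    simp only [smul_eq_mul] at e1 e2; rw [e1, e2]
    refine setIntegral_congr_fun measurableSet_Ioc fun t ht => ?_
    refine integral_congr_ae ?_
    filter_upwards [hfg t ht] with ξ hξ
    rw [mot_smul _ (h t), hξ]; ring
  refine ⟨key hη hη' h1, ?_⟩
  have ht : IsTest T (∂_{eT} η' - (a : ℂ) • η') := by
    rw [sub_eq_add_neg, ← neg_smul]
    exact (hη'.lineDeriv eT).add_smul hη' _
  rw [key (hη.lineDeriv eT) ht h2, ← integral_neg]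
  refine integral_congr fun p => ?_
  rw [sub_eq_add_neg, ← neg_smul, kap_add, kap_smul, kap_eT, sy]; push_cast; ring

/-- The function of space-time with density `f`. -/
def spc (f : ℝ² → ℂ) (t x : ℝ) : ℂ := ∫ ξ, ex (x * ξ) * hat f t ξ

theorem spc_eq {f : ℝ² → ℂ} (hf : Integrable f) (t x : ℝ) :
    spc f t x = ∫ p : ℝ², ex (t * p.1 + x * p.2) * f p := by
  have hi := integrable_ex_smul (u := fun p => t * p.1 + x * p.2) (by fun_prop) hf
  simp only [smul_eq_mul] at hi
  rw [Measure.volume_eq_prod, integral_prod_symm _ (by rw [← Measure.volume_eq_prod]; exact hi)]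
  refine integral_congr fun ξ => ?_
  simp only [hat, smul_eq_mul]; rw [← integral_const_mul]
  refine integral_congr fun τ => ?_
  rw [ex_add]; ring

theorem spc_mul_spc {f g : ℝ² → ℂ} (hf : Integrable f) (hg : Integrable g) (t x : ℝ) :
    spc f t x * spc g t x = ∫ z : ℝ² × ℝ²,
      ex (t * (z.1 + z.2).1 + x * (z.1 + z.2).2) * (f z.1 * g z.2) ∂(volume.prod volume) := by
  rw [spc_eq hf, spc_eq hg, ← integral_prod_mul]
  refine integral_congr fun z => ?_
  have : t * (z.1 + z.2).1 + x * (z.1 + z.2).2 =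
      (t * z.1.1 + x * z.1.2) + (t * z.2.1 + x * z.2.2) := by
    simp only [Prod.fst_add, Prod.snd_add]; ring
  rw [this, ex_add (t * z.1.1 + x * z.1.2)]; ring

theorem mot_eq_integral_slice (η : 𝓢²) (t ξ : ℝ) : mot η t ξ = ∫ x, ex (x * ξ) * slice t η x := by
  rw [mot, SchwartzMap.fourierInv_coe, fourierInv_eq_ex]; rfl

theorem IsTest.conv_eq {T : ℝ} {η : 𝓢²} (hη : IsTest T η) {f g : ℝ² → ℂ}
    (hf : Integrable f) (hg : Integrable g) :
    conv f g (kap η) = ∫ t in Ioc 0 T, ∫ x, slice t η x * (spc f t x * spc g t x) := by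
  have hm := continuous_mot η
  have hfg : Integrable (fun z : ℝ² × ℝ² => f z.1 * g z.2)
    (𝓛².prod 𝓛²) := hf.mul_prod hg
  obtain ⟨C, hC0, hC⟩ := mot_decay η 0
  simp only [neg_zero, rpow_zero, mul_one] at hC
  have h1 : Integrable (uncurry fun (z : ℝ² × ℝ²) (t : ℝ) =>
      (ex (t * (z.1 + z.2).1) * mot η t (z.1 + z.2).2) * (f z.1 * g z.2))
      ((𝓛².prod 𝓛²).prod
        (volume.restrict (Ioc 0 T))) := by
    refine ((hfg.norm.const_mul C).comp_fst _).mono' ?_ (.of_forall fun z => ?_)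
    · refine AEStronglyMeasurable.mul (Continuous.aestronglyMeasurable ?_) hfg.1.comp_fst
      fun_prop
    · simp only [uncurry]
      rw [norm_mul, norm_mul, norm_ex, one_mul]; gcongr
      exact hC _ _
  have h2 : ∀ t, Integrable (uncurry fun (z : ℝ² × ℝ²) (x : ℝ) =>
      (ex (t * (z.1 + z.2).1 + x * (z.1 + z.2).2)) * ((f z.1 * g z.2) * slice t η x))
      ((𝓛².prod 𝓛²).prod volume) := by
    intro t
    have := integrable_ex_smul (u := fun w : (ℝ² × ℝ²) × ℝ =>
      t * (w.1.1 + w.1.2).1 + w.2 * (w.1.1 + w.1.2).2) (by fun_prop)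
      (hfg.mul_prod ((slice t η).integrable (μ := volume)))
    exact this
  calc conv f g (kap η)
      = ∫ z : ℝ² × ℝ², (∫ t in Ioc 0 T,
          (ex (t * (z.1 + z.2).1) * mot η t (z.1 + z.2).2) * (f z.1 * g z.2))
          ∂(volume.prod volume) := by
        refine integral_congr fun z => ?_
        rw [integral_mul_const, ← hη.kap_eq]; ring
    _ = ∫ t in Ioc 0 T, ∫ z : ℝ² × ℝ²,
          (ex (t * (z.1 + z.2).1) * mot η t (z.1 + z.2).2) * (f z.1 * g z.2)
          ∂(volume.prod volume) := integral_integral_swap h1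
    _ = ∫ t in Ioc 0 T, ∫ z : ℝ² × ℝ², (∫ x,
          (ex (t * (z.1 + z.2).1 + x * (z.1 + z.2).2)) * ((f z.1 * g z.2) * slice t η x))
          ∂(volume.prod volume) := by
        refine integral_congr fun t => ?_
        refine integral_congr fun z => ?_
        rw [mot_eq_integral_slice, ← integral_const_mul, ← integral_mul_const]
        refine integral_congr fun x => ?_
        rw [ex_add]; ring
    _ = _ := by
        refine integral_congr fun t => ?_
        rw [integral_integral_swap (h2 t)]
        refine integral_congr fun x => ?_
        rw [spc_mul_spc hf hg, ← integral_const_mul]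
        refine integral_congr fun z => ?_
        ring

theorem tendsto_conv {ι : Type*} {l : Filter ι} [l.IsCountablyGenerated] {φ ψ : ι → ℝ → ℂ}
    (hφ : ∀ i, Measurable (φ i)) (hψ : ∀ i, Measurable (ψ i)) {C : ℝ} (bφ : ∀ i ξ, ‖φ i ξ‖ ≤ C)
    (bψ : ∀ i ξ, ‖ψ i ξ‖ ≤ C) (tφ : ∀ ξ, Tendsto (fun i => φ i ξ) l (𝓝 1))
    (tψ : ∀ ξ, Tendsto (fun i => ψ i ξ) l (𝓝 1)) {f g κ : ℝ² → ℂ} (h : ConvInt f g κ) :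
    Tendsto (fun i => conv (fun p => φ i p.2 * f p) (fun p => ψ i p.2 * g p) κ) l
      (𝓝 (conv f g κ)) := by
  have e : ∀ i, conv (fun p => φ i p.2 * f p) (fun p => ψ i p.2 * g p) κ =
      ∫ z : ℝ² × ℝ², (φ i z.1.2 * ψ i z.2.2) * (f z.1 * g z.2 * κ (z.1 + z.2))
        ∂(volume.prod volume) := by
    intro i
    refine integral_congr fun z => ?_
    simp only; ring
  simp_rw [e]
  refine tendsto_integral_filter_of_dominated_convergence
    (fun z => C * C * ‖f z.1 * g z.2 * κ (z.1 + z.2)‖) (.of_forall fun i => ?_)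
    (.of_forall fun i => .of_forall fun z => ?_) (Integrable.norm h |>.const_mul _)
    (.of_forall fun z => ?_)
  · refine AEStronglyMeasurable.mul (Measurable.aestronglyMeasurable ?_) h.1
    fun_prop
  · rw [norm_mul, norm_mul]
    have := (norm_nonneg _).trans (bφ i z.1.2)
    gcongr
    · exact bφ i _
    · exact bψ i _
  · have := ((tφ z.1.2).mul (tψ z.2.2)).mul_const (f z.1 * g z.2 * κ (z.1 + z.2))
    simpa using this

/-- Cutting off high frequencies. -/
def cut (n : ℕ) (ξ : ℝ) : ℂ := if |ξ| ≤ n then 1 else 0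

theorem measurable_cut (n : ℕ) : Measurable (cut n) := by
  unfold cut
  exact Measurable.ite (measurableSet_le (by fun_prop) measurable_const) measurable_const
    measurable_const

theorem norm_cut_le (n : ℕ) (ξ : ℝ) : ‖cut n ξ‖ ≤ 1 := by unfold cut; split_ifs <;> simp

theorem tendsto_cut (ξ : ℝ) : Tendsto (fun n => cut n ξ) atTop (𝓝 1) := by
  obtain ⟨n, hn⟩ := exists_nat_ge |ξ|
  refine tendsto_const_nhds.congr' ?_
  filter_upwards [eventually_ge_atTop n] with m hm
  rw [cut, if_pos (hn.trans (by exact_mod_cast hm))]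

theorem RapidDecay.cut (n : ℕ) : RapidDecay (cut n) := by
  refine ⟨measurable_cut n, fun N => ⟨(1 + n) ^ |N|, fun ξ => ?_⟩⟩
  have h := jb_rpow_pos ξ (-N)
  unfold DKG.cut
  split_ifs
  · have h1 : jb ξ ≤ 1 + n := by unfold jb; linarith
    have h2 : jb ξ ^ N ≤ (1 + n : ℝ) ^ |N| :=
      (rpow_le_rpow_of_exponent_le (one_le_jb _) (le_abs_self N)).trans
        (rpow_le_rpow (jb_pos _).le h1 (abs_nonneg _))
    rw [norm_one, rpow_neg (jb_pos _).le, ← div_eq_mul_inv, one_le_div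
      (jb_rpow_pos _ _)]
    exact h2
  · rw [norm_zero]; positivity

theorem IsTest.conv_eq_conv {T : ℝ} {η η' : 𝓢²} (hη : IsTest T η)
    (hη' : IsTest T η') {f g f' g' : ℝ² → ℂ} (hf : Tame f) (hg : Tame g) (hf' : Tame f')
    (hg' : Tame g') (h : ConvInt f g (kap η)) (h' : ConvInt f' g' (kap η')) {c d : ℝ → ℂ}
    (e₁ : ∀ t ∈ Ioc 0 T, ∀ᵐ ξ : ℝ, hat f t ξ = c t * hat f' t ξ)
    (e₂ : ∀ t ∈ Ioc 0 T, ∀ᵐ ξ : ℝ, hat g t ξ = d t * hat g' t ξ)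
    (e₃ : ∀ t ∈ Ioc 0 T, slice t η' = (c t * d t) • slice t η) :
    conv f g (kap η) = conv f' g' (kap η') := by
  have lim := fun {f g κ : ℝ² → ℂ} (h : ConvInt f g κ) =>
    tendsto_conv measurable_cut measurable_cut norm_cut_le norm_cut_le tendsto_cut tendsto_cut h
  refine tendsto_nhds_unique (lim h) ((lim h').congr fun n => ?_)
  have i := fun {f : ℝ² → ℂ} (h : Tame f) => h.integrable_smul (RapidDecay.cut n)
  simp only [smul_eq_mul] at i
  rw [hη.conv_eq (i hf) (i hg), hη'.conv_eq (i hf') (i hg')]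
  refine setIntegral_congr_fun measurableSet_Ioc fun t ht => ?_
  have sp : ∀ {f f' : ℝ² → ℂ} {c : ℂ}, (∀ᵐ ξ : ℝ, hat f t ξ = c * hat f' t ξ) → ∀ x,
      spc (fun p => cut n p.2 * f p) t x = c * spc (fun p => cut n p.2 * f' p) t x := by
    intro f f' c h x; rw [spc, spc, ← integral_const_mul]
    refine integral_congr_ae ?_
    filter_upwards [h] with ξ hξ
    have e := fun f : ℝ² → ℂ => hat_smul (cut n) f t ξ
    simp only [smul_eq_mul] at e
    rw [e, e, hξ]; ring
  refine integral_congr fun x => ?_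
  rw [sp (e₁ t ht), sp (e₂ t ht), e₃ t ht, smul_apply, smul_eq_mul]; ring

section

variable {F : Type*} [NormedAddCommGroup F] [NormedSpace ℂ F]

theorem HasFourierDensity.apply {V : Type*} [NormedAddCommGroup V] [InnerProductSpace ℝ V]
    [FiniteDimensional ℝ V] [MeasurableSpace V] [BorelSpace V] {u : 𝓢'(V, F)} {f : V → F}
    (h : HasFourierDensity u f) (χ : 𝓢(V, ℂ)) :
    Integrable (fun ξ => 𝓕⁻ χ ξ • f ξ) ∧ u χ = ∫ ξ, 𝓕⁻ χ ξ • f ξ := by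
  refine ⟨(h.2 _).1, ?_⟩
  rw [← (h.2 _).2, TemperedDistribution.fourier_apply, FourierTransform.fourier_fourierInv_eq]

theorem fourierInv_kernelAt (ρ : 𝓢(ℝ, ℂ)) {ε : ℝ} (hε : 0 < ε) (x ξ : ℝ) :
    𝓕⁻ (kernelAt ρ ε x) ξ = ex (x * ξ) * 𝓕 ρ (ε * ξ) := by
  rw [SchwartzMap.fourierInv_coe, fourierInv_eq_ex, SchwartzMap.fourier_coe, fourier_eq_ex]
  have e : ∀ y, kernelAt ρ ε x y = (ε⁻¹ : ℂ) * ρ (ε⁻¹ * (x - y)) := by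
    intro y; rw [kernelAt, dif_pos hε]; rfl
  simp_rw [e, smul_eq_mul]
  have h1 := integral_sub_left_eq_self (fun w => ex ((x - w) * ξ) * ((ε⁻¹ : ℂ) * ρ (ε⁻¹ * w)))
    volume x
  simp only [sub_sub_cancel] at h1; rw [h1]
  have h2 := Measure.integral_comp_mul_left
    (fun w => ex ((x - ε * w) * ξ) * ((ε⁻¹ : ℂ) * ρ w)) ε⁻¹
  rw [inv_inv, abs_of_pos hε] at h2
  have h3 : ∀ w, ε * (ε⁻¹ * w) = w := fun w => by field_simp
  simp only [h3] at h2
  rw [h2, real_smul, ← integral_const_mul, ← integral_const_mul]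
  refine integral_congr fun w => ?_
  rw [show (x - ε * w) * ξ = x * ξ + -(w * (ε * ξ)) by ring, ex_add]
  have : (ε : ℂ) ≠ 0 := by exact_mod_cast hε.ne'
  field_simp

theorem HasFourierDensity.mollify {u : 𝓢'(ℝ, F)} {f : ℝ → F} (h : HasFourierDensity u f)
    (ρ : 𝓢(ℝ, ℂ)) {ε : ℝ} (hε : 0 < ε) (x : ℝ) :
    mollify ρ ε u x = ∫ ξ, (ex (x * ξ) * 𝓕 ρ (ε * ξ)) • f ξ := by
  rw [DKG.mollify, (h.apply _).2]
  simp_rw [fourierInv_kernelAt ρ hε]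

end

theorem RapidDecay.fourier (ρ : 𝓢(ℝ, ℂ)) {ε : ℝ} (hε : 0 < ε) :
    RapidDecay fun ξ => 𝓕 ρ (ε * ξ) := by
  refine ⟨((𝓕 ρ).continuous.comp (continuous_const_mul ε)).measurable, fun N => ?_⟩
  set N' := max N 0
  obtain ⟨C, hC0, hC⟩ := schwartz_decay (𝓕 ρ) N'
  set a := min ε 1
  have ha : 0 < a := lt_min hε one_pos
  refine ⟨C * a ^ (-N'), fun ξ => (hC _).trans ?_⟩
  have h1 : a * jb ξ ≤ 1 + ‖ε * ξ‖ := by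
    rw [norm_eq_abs, abs_mul, abs_of_pos hε, jb, mul_add, mul_one]
    have := mul_le_mul_of_nonneg_right (min_le_left ε 1) (abs_nonneg ξ)
    linarith [min_le_right ε 1]
  rw [mul_assoc]; gcongr
  calc (1 + ‖ε * ξ‖) ^ (-N') ≤ (a * jb ξ) ^ (-N') :=
        rpow_le_rpow_of_nonpos (mul_pos ha (jb_pos _)) h1 (by simp [N'])
    _ = a ^ (-N') * jb ξ ^ (-N') := mul_rpow ha.le (jb_pos _).le
    _ ≤ _ := by
      gcongr
      · exact one_le_jb _
      · exact le_max_left _ _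

theorem tendsto_fourier_mul {ρ : 𝓢(ℝ, ℂ)} (hρ : ∫ x, ρ x = 1) (ξ : ℝ) :
    Tendsto (fun ε : ℝ => 𝓕 ρ (ε * ξ)) (𝓝[>] 0) (𝓝 1) := by
  have h0 : 𝓕 ρ 0 = 1 := by
    rw [SchwartzMap.fourier_coe, fourier_eq_ex]
    simpa using hρ
  have hc : Continuous fun ε => 𝓕 ρ (ε * ξ) := (𝓕 ρ).continuous.comp (continuous_mul_const ξ)
  have := hc.tendsto 0
  rw [zero_mul, h0] at this
  exact this.mono_left nhdsWithin_le_nhds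

theorem RapidDecay.refl {a : ℝ → ℂ} (h : RapidDecay a) : RapidDecay fun ξ => conj (a (-ξ)) := by
  refine ⟨continuous_conj.measurable.comp (h.1.comp measurable_neg), fun N => ?_⟩
  obtain ⟨C, hC⟩ := h.2 N
  refine ⟨C, fun ξ => ?_⟩
  rw [RCLike.norm_conj, ← jb_neg]
  exact hC _

theorem IsTest.tendsto_mollified {T : ℝ} {η : 𝓢²} (hη : IsTest T η)
    {f g : ℝ² → ℂ} (hf : Tame f) (hg : Tame g) (h : ConvInt f g (kap η)) {φ ψ : ℝ → ℝ → ℂ}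
    (hφ : ∀ ε > 0, RapidDecay (φ ε)) (hψ : ∀ ε > 0, RapidDecay (ψ ε)) {C : ℝ}
    (bφ : ∀ ε ξ, ‖φ ε ξ‖ ≤ C) (bψ : ∀ ε ξ, ‖ψ ε ξ‖ ≤ C)
    (tφ : ∀ ξ, Tendsto (fun ε => φ ε ξ) (𝓝[>] 0) (𝓝 1))
    (tψ : ∀ ξ, Tendsto (fun ε => ψ ε ξ) (𝓝[>] 0) (𝓝 1)) :
    Tendsto (fun ε => ∫ t in Ioc 0 T, ∫ x, slice t η x *
      (spc (fun p => φ ε p.2 * f p) t x * spc (fun p => ψ ε p.2 * g p) t x)) (𝓝[>] 0)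
      (𝓝 (conv f g (kap η))) := by
  have key := tendsto_conv (l := comap (fun ε : Ioi (0 : ℝ) => (ε : ℝ)) (𝓝[>] 0))
    (fun ε => (hφ ε ε.2).1)
    (fun ε => (hψ ε ε.2).1) (fun ε => bφ ε) (fun ε => bψ ε)
    (fun ξ => (tφ ξ).comp tendsto_comap) (fun ξ => (tψ ξ).comp tendsto_comap) h
  have h1 : map (fun ε : Ioi (0 : ℝ) => (ε : ℝ))
      (comap (fun ε : Ioi (0 : ℝ) => (ε : ℝ)) (𝓝[>] 0)) = 𝓝[>] 0 := by
    rw [Filter.map_comap, Subtype.range_coe, inf_eq_left]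
    exact le_principal_iff.2 self_mem_nhdsWithin
  rw [← h1, tendsto_map'_iff]
  refine key.congr fun ε => ?_
  have i₁ := hf.integrable_smul (hφ ε ε.2)
  have i₂ := hg.integrable_smul (hψ ε ε.2)
  exact hη.conv_eq i₁ i₂

section

variable {V : Type*} [NormedAddCommGroup V] [InnerProductSpace ℝ V] [FiniteDimensional ℝ V]
  [MeasurableSpace V] [BorelSpace V]
variable {F : Type*} [NormedAddCommGroup F] [NormedSpace ℂ F]

theorem exists_hasFourierDensity {f : V → F} (mf : AEStronglyMeasurable f volume) {N : ℝ}
    (h : Integrable fun ξ => (1 + ‖ξ‖) ^ (-N) * ‖f ξ‖) : ∃ u : 𝓢'(V, F), HasFourierDensity u f := by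
  obtain ⟨n, hn⟩ := exists_nat_ge N
  have bd : ∀ (η : 𝓢(V, ℂ)) ξ, ‖η ξ • f ξ‖ ≤
      (2 ^ n * ((Finset.Iic (n, 0)).sup (schwartzSeminormFamily ℂ V ℂ)) η) *
        ((1 + ‖ξ‖) ^ (-N) * ‖f ξ‖) := by
    intro η ξ
    have h1 := SchwartzMap.one_add_le_sup_seminorm_apply (𝕜 := ℂ) (m := (n, 0))
      le_rfl le_rfl η ξ
    rw [norm_iteratedFDeriv_zero] at h1
    have h2 : (0 : ℝ) < 1 + ‖ξ‖ := by positivity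
    have h3 : 1 ≤ (1 + ‖ξ‖) ^ n * (1 + ‖ξ‖) ^ (-N) := by
      rw [← rpow_natCast, ← rpow_add h2]
      exact one_le_rpow (by linarith [norm_nonneg ξ]) (by linarith)
    rw [norm_smul, ← mul_assoc]; gcongr
    calc ‖η ξ‖ ≤ ‖η ξ‖ * ((1 + ‖ξ‖) ^ n * (1 + ‖ξ‖) ^ (-N)) :=
          le_mul_of_one_le_right (norm_nonneg _) h3
      _ = ((1 + ‖ξ‖) ^ n * ‖η ξ‖) * (1 + ‖ξ‖) ^ (-N) := by ring
      _ ≤ _ := by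
          refine mul_le_mul_of_nonneg_right ?_ (by positivity)
          exact h1
  have int : ∀ η : 𝓢(V, ℂ), Integrable fun ξ => η ξ • f ξ := fun η =>
    (h.const_mul _).mono' (η.continuous.aestronglyMeasurable.smul mf) (.of_forall (bd η))
  set A : 𝓢(V, ℂ) →L[ℂ] F := SchwartzMap.mkCLMtoNormedSpace (fun η => ∫ ξ, η ξ • f ξ)
    (fun η θ => by
      rw [← integral_add (int η) (int θ)]
      exact integral_congr_ae (.of_forall fun ξ => add_smul _ _ _))
    (fun c η => by
      rw [RingHom.id_apply, ← integral_smul]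
      exact integral_congr_ae (.of_forall fun ξ => smul_assoc c (η ξ) (f ξ)))
    ⟨Finset.Iic (n, 0), 2 ^ n * ∫ ξ, (1 + ‖ξ‖) ^ (-N) * ‖f ξ‖, by
      positivity, fun η => by
      refine (norm_integral_le_of_norm_le (h.const_mul _) (.of_forall (bd η))).trans ?_
      rw [integral_const_mul]
      apply le_of_eq; ring⟩
  refine ⟨𝓕⁻ (ContinuousLinearMap.toPointwiseConvergenceCLM _ _ _ _ A : 𝓢'(V, F)), mf,
    fun η => ⟨int η, ?_⟩⟩
  rw [FourierTransform.fourier_fourierInv_eq]; rfl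

theorem HasFourierDensity.congr {u : 𝓢'(V, F)} {f g : V → F} (h : HasFourierDensity u f)
    (hfg : f =ᵐ[volume] g) : HasFourierDensity u g := by
  refine ⟨h.1.congr hfg, fun η => ⟨(h.2 η).1.congr ?_, (h.2 η).2.trans (integral_congr_ae ?_)⟩⟩ <;>
  · filter_upwards [hfg] with ξ hξ
    rw [hξ]

theorem HasFourierDensity.ext {u v : 𝓢'(V, F)} {f : V → F} (h : HasFourierDensity u f)
    (h' : HasFourierDensity v f) : u = v := by
  ext η; rw [(h.apply η).2, (h'.apply η).2]

theorem HasFourierDensity.add {u v : 𝓢'(V, F)} {f g : V → F} (h : HasFourierDensity u f)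
    (h' : HasFourierDensity v g) : HasFourierDensity (u + v) fun ξ => f ξ + g ξ := by
  refine ⟨h.1.add h'.1, fun η => ?_⟩
  simp_rw [smul_add]
  refine ⟨(h.2 η).1.add (h'.2 η).1, ?_⟩
  rw [integral_add (h.2 η).1 (h'.2 η).1, ← (h.2 η).2, ← (h'.2 η).2]; rfl

theorem HasFourierDensity.smul {u : 𝓢'(V, F)} {f : V → F} (h : HasFourierDensity u f) (c : ℂ) :
    HasFourierDensity (c • u) fun ξ => c • f ξ := by
  refine ⟨h.1.const_smul c, fun η => ?_⟩
  simp_rw [smul_comm _ c]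
  refine ⟨(h.2 η).1.smul c, ?_⟩
  rw [integral_smul, ← (h.2 η).2]; rfl

theorem HasFourierDensity.sub {u v : 𝓢'(V, F)} {f g : V → F} (h : HasFourierDensity u f)
    (h' : HasFourierDensity v g) : HasFourierDensity (u - v) fun ξ => f ξ - g ξ := by
  have := h.add (h'.smul (-1))
  simpa only [neg_smul, one_smul, ← sub_eq_add_neg] using this

theorem HasFourierDensity.locallyIntegrable {u : 𝓢'(V, F)} {f : V → F}
    (h : HasFourierDensity u f) : LocallyIntegrable f := by
  intro x
  set b : ContDiffBump x := ⟨1, 2, one_pos, one_lt_two⟩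
  have cs : HasCompactSupport (ofRealCLM ∘ b) := b.hasCompactSupport.comp_left rfl
  have sm : ContDiff ℝ (⊤ : ℕ∞) (ofRealCLM ∘ b) := ofRealCLM.contDiff.comp b.contDiff
  refine ⟨Metric.closedBall x 1, Metric.closedBall_mem_nhds x one_pos, ?_⟩
  refine ((h.2 (cs.toSchwartzMap sm)).1.integrableOn).congr ?_
  filter_upwards [ae_restrict_mem Metric.isClosed_closedBall.measurableSet] with y hy
  have : cs.toSchwartzMap sm y = 1 := by
    have := b.one_of_mem_closedBall hy
    show (b y : ℂ) = 1
    rw [this, ofReal_one]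
  rw [this, one_smul]

theorem HasFourierDensity.unique [CompleteSpace F] {u : 𝓢'(V, F)} {f g : V → F}
    (h : HasFourierDensity u f) (h' : HasFourierDensity u g) : f =ᵐ[volume] g := by
  refine ae_eq_of_integral_contDiff_smul_eq h.locallyIntegrable h'.locallyIntegrable
    fun b sm cs => ?_
  have cs' : HasCompactSupport (ofRealCLM ∘ b) := cs.comp_left rfl
  have sm' : ContDiff ℝ (⊤ : ℕ∞) (ofRealCLM ∘ b) := ofRealCLM.contDiff.comp sm
  exact (h.2 (cs'.toSchwartzMap sm')).2.symm.trans (h'.2 (cs'.toSchwartzMap sm')).2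

theorem HasFourierDensity.multiplier {u : 𝓢'(V, F)} {f : V → F}
    (h : HasFourierDensity u f) {a : V → ℂ} (ha : a.HasTemperateGrowth) :
    HasFourierDensity (TemperedDistribution.fourierMultiplierCLM F a u) fun ξ => a ξ • f ξ := by
  refine ⟨ha.1.continuous.aestronglyMeasurable.smul h.1, fun η => ?_⟩
  have e : ∀ ξ, (SchwartzMap.smulLeftCLM ℂ a η) ξ • f ξ = η ξ • a ξ • f ξ := by
    intro ξ
    rw [SchwartzMap.smulLeftCLM_apply_apply ha, smul_eq_mul, mul_comm, smul_smul]
  obtain ⟨h1, h2⟩ := h.2 (SchwartzMap.smulLeftCLM ℂ a η)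
  simp_rw [e] at h1 h2
  refine ⟨h1, ?_⟩
  rw [← h2, TemperedDistribution.fourierMultiplierCLM_apply, FourierTransform.fourier_fourierInv_eq]
  rfl

end

section

variable {F : Type*} [NormedAddCommGroup F] [InnerProductSpace ℂ F] [CompleteSpace F]

/-- The weight of the Sobolev space `H^s`. -/
def sw (s ξ : ℝ) : ℝ := (1 + ‖ξ‖ ^ 2) ^ (s / 2)

theorem sw_temperate (s : ℝ) : (fun ξ : ℝ => ((sw s ξ : ℝ) : ℂ)).HasTemperateGrowth := by
  unfold sw; fun_prop

theorem sw_pos (s ξ : ℝ) : 0 < sw s ξ := by unfold sw; positivity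

theorem sobolevENorm_le {s : ℝ} {u : 𝓢'(ℝ, F)} {f : ℝ → F} (h : HasFourierDensity u f)
    (hf : MemLp (fun ξ => (sw s ξ : ℂ) • f ξ) 2 volume) :
    TemperedDistribution.MemSobolev s 2 u ∧
      sobolevENorm s u ≤ eLpNorm (fun ξ => (sw s ξ : ℂ) • f ξ) 2 volume := by
  have e : TemperedDistribution.besselPotential ℝ F s u =
      ((𝓕⁻ (hf.toLp _) : Lp F 2 𝓛¹) : 𝓢'(ℝ, F)) := by
    rw [← Lp.fourierInv_toTemperedDistribution_eq]
    have h1 : HasFourierDensity (TemperedDistribution.besselPotential ℝ F s u)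
        (fun ξ => (sw s ξ : ℂ) • f ξ) := h.multiplier (sw_temperate s)
    refine h1.ext ⟨h1.1, fun η => ⟨(h1.2 η).1, ?_⟩⟩
    rw [FourierTransform.fourier_fourierInv_eq, Lp.toTemperedDistribution_apply]
    refine integral_congr_ae ?_
    filter_upwards [hf.coeFn_toLp] with ξ hξ
    rw [hξ]
  refine ⟨⟨_, e⟩, le_trans
    (iInf_le_of_le _ (iInf_le _ e)) (le_of_eq ?_)⟩
  have : ‖(𝓕⁻ (hf.toLp _) : Lp F 2 𝓛¹)‖ = ‖hf.toLp _‖ := by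
    rw [← Lp.norm_fourier_eq, FourierTransform.fourier_fourierInv_eq]
  rw [← ofReal_norm, this, ofReal_norm, Lp.enorm_toLp]

theorem exists_density {s : ℝ} {u : 𝓢'(ℝ, F)} (h : TemperedDistribution.MemSobolev s 2 u) :
    ∃ f : ℝ → F, HasFourierDensity u f ∧ MemLp (fun ξ => (sw s ξ : ℂ) • f ξ) 2 volume ∧
      eLpNorm (fun ξ => (sw s ξ : ℂ) • f ξ) 2 volume = sobolevENorm s u := by
  obtain ⟨g, hg⟩ := h
  set f : ℝ → F := fun ξ => (sw (-s) ξ : ℂ) • (𝓕 g : Lp F 2 𝓛¹) ξ with hf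
  have e1 : ∀ ξ, (sw s ξ : ℂ) • f ξ = (𝓕 g : Lp F 2 𝓛¹) ξ := by
    intro ξ
    have : sw s ξ * sw (-s) ξ = 1 := by
      unfold sw; rw [← rpow_add (by positivity)]
      simp [neg_div]
    rw [hf]
    simp only [smul_smul]
    rw [← Complex.ofReal_mul, this, ofReal_one, one_smul]
  have hd : HasFourierDensity (g : 𝓢'(ℝ, F)) (𝓕 g : Lp F 2 𝓛¹) := by
    refine ⟨(Lp.memLp _).1, fun η => ⟨?_, ?_⟩⟩
    · exact memLp_one_iff_integrable.1 (MemLp.smul (Lp.memLp _) (η.memLp 2))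
    · rw [Lp.fourier_toTemperedDistribution_eq, Lp.toTemperedDistribution_apply]
  have e2 : (fun ξ => (sw s ξ : ℂ) • f ξ) = (𝓕 g : Lp F 2 𝓛¹) := funext e1
  have e3 : sobolevENorm s u = ‖g‖ₑ := by
    refine le_antisymm (iInf_le_of_le g (iInf_le _ hg)) (le_iInf₂ fun g' hg' => ?_)
    have : g - g' = 0 := by
      have hk := Lp.ker_toTemperedDistributionCLM_eq_bot (F := F)
        (μ := 𝓛¹) (p := 2)
      have : g - g' ∈ (Lp.toTemperedDistributionCLM F 𝓛¹ 2).ker := by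
        rw [LinearMap.mem_ker]
        show Lp.toTemperedDistributionCLM F 𝓛¹ 2 (g - g') = 0
        rw [map_sub, Lp.toTemperedDistributionCLM_apply, Lp.toTemperedDistributionCLM_apply,
          ← hg, ← hg', sub_self]
      rw [hk] at this
      simpa using this
    rw [sub_eq_zero.1 this]
  refine ⟨f, ?_, ?_, ?_⟩
  · have := hd.multiplier (sw_temperate (-s))
    rw [← hg] at this
    have e4 : TemperedDistribution.fourierMultiplierCLM F (fun ξ => (sw (-s) ξ : ℂ))
        (TemperedDistribution.besselPotential ℝ F s u) = u := by
      have := TemperedDistribution.besselPotential_besselPotential_apply s (-s) u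
      rw [add_neg_cancel, TemperedDistribution.besselPotential_zero] at this
      exact this
    rw [e4] at this
    exact this
  · rw [e2]; exact Lp.memLp _
  · rw [e2, e3, ← Lp.enorm_def, ← ofReal_norm, ← ofReal_norm, Lp.norm_fourier_eq]

theorem exists_sw_le (s : ℝ) : ∃ C : ℝ, 0 < C ∧ ∀ ξ, sw s ξ ≤ C * jb ξ ^ s ∧
    jb ξ ^ s ≤ C * sw s ξ := by
  have h1 : ∀ ξ, (1 + ‖ξ‖ ^ 2) ^ (1 / 2 : ℝ) ≤ jb ξ := by
    intro ξ
    rw [← sqrt_eq_rpow, norm_eq_abs, jb]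
    exact Real.sqrt_le_iff.2 ⟨by positivity, by nlinarith [abs_nonneg ξ]⟩
  have h2 : ∀ ξ, jb ξ ≤ 2 * (1 + ‖ξ‖ ^ 2) ^ (1 / 2 : ℝ) := by
    intro ξ
    rw [← sqrt_eq_rpow, norm_eq_abs, jb]
    have a1 : (1 : ℝ) ≤ √(1 + |ξ| ^ 2) := one_le_sqrt.2 (by nlinarith [sq_nonneg |ξ|])
    have a2 : |ξ| ≤ √(1 + |ξ| ^ 2) := Real.le_sqrt_of_sq_le (by linarith)
    linarith
  have e : ∀ ξ, sw s ξ = ((1 + ‖ξ‖ ^ 2) ^ (1 / 2 : ℝ)) ^ s := by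
    intro ξ
    rw [sw, ← rpow_mul (by positivity)]; ring_nf
  have h0 : ∀ ξ : ℝ, 0 < (1 + ‖ξ‖ ^ 2) ^ (1 / 2 : ℝ) := fun ξ => by positivity
  refine ⟨2 ^ |s|, by positivity, fun ξ => ?_⟩
  rw [e]
  have h2s : (1 : ℝ) ≤ 2 ^ |s| := one_le_rpow one_le_two (abs_nonneg s)
  have hj := jb_rpow_pos ξ s
  have hw := rpow_pos_of_pos (h0 ξ) s
  rcases le_total 0 s with hs | hs
  · refine ⟨?_, ?_⟩
    · exact (rpow_le_rpow (h0 ξ).le (h1 ξ) hs).trans (by nlinarith)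
    · rw [abs_of_nonneg hs, ← mul_rpow (by norm_num) (h0 ξ).le]
      exact rpow_le_rpow (jb_pos _).le (h2 ξ) hs
  · refine ⟨?_, ?_⟩
    · have h3 : jb ξ / 2 ≤ (1 + ‖ξ‖ ^ 2) ^ (1 / 2 : ℝ) := by linarith [h2 ξ]
      refine (rpow_le_rpow_of_nonpos (by linarith [jb_pos ξ]) h3 hs).trans (le_of_eq ?_)
      rw [Real.div_rpow (jb_pos _).le (by norm_num), abs_of_nonpos hs,
        rpow_neg (by norm_num), div_eq_inv_mul]
    · exact (rpow_le_rpow_of_nonpos (h0 ξ) (h1 ξ) hs).trans (by nlinarith)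

end

section

variable {F : Type*} [NormedAddCommGroup F] [NormedSpace ℂ F]

theorem Tame.aestronglyMeasurable_hat {f : ℝ² → F} (hf : Tame f) (t : ℝ) :
    AEStronglyMeasurable (hat f t) volume := by
  have h : AEStronglyMeasurable (fun p => ex (t * p.2) • f (p.2, p.1))
      (𝓛¹.prod 𝓛¹) := by
    refine AEStronglyMeasurable.smul (by fun_prop) ?_
    exact AEStronglyMeasurable.prod_swap
      hf.1
  exact h.integral_prod_right'

/-- The supremum bound for the curve with density `f`. -/
def hatBound (f : ℝ² → F) (ξ : ℝ) : ℝ := ∫ τ : ℝ, ‖f (τ, ξ)‖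

theorem norm_hat_le (f : ℝ² → F) (t ξ : ℝ) : ‖hat f t ξ‖ ≤ hatBound f ξ := by
  refine (norm_integral_le_integral_norm _).trans (le_of_eq ?_)
  refine integral_congr fun τ => ?_
  rw [norm_smul, norm_ex, one_mul]

theorem Tame.integrable_hatBound {f : ℝ² → F} (hf : Tame f) :
    ∃ N : ℝ, 0 ≤ N ∧ Integrable fun ξ => jb ξ ^ (-N) * hatBound f ξ := by
  obtain ⟨-, N, hN⟩ := hf
  have h1 := hN.swap.norm.integral_prod_left
   
  have e : ∀ ξ, ∫ τ, ‖((fun p => jc p.2 (-N) • f p) ∘ Prod.swap) (ξ, τ)‖ =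
      jb ξ ^ (-N) * hatBound f ξ := by
    intro ξ; rw [hatBound, ← integral_const_mul]
    refine integral_congr fun τ => ?_
    simp only [Function.comp, Prod.swap]
    rw [norm_smul, norm_ofReal_of_nonneg (jb_rpow_pos _ _).le]
  simp_rw [e] at h1
  refine ⟨max N 0, le_max_right _ _, ?_⟩
  have h2 : Integrable fun ξ => jb ξ ^ (-max N 0 + N) * (jb ξ ^ (-N) * hatBound f ξ) := by
    refine h1.bdd_mul (c := 1) ?_ (.of_forall fun ξ => ?_)
    · exact Measurable.aestronglyMeasurable (by fun_prop)
    · rw [norm_of_nonneg (jb_rpow_pos _ _).le]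
      exact Real.rpow_le_one_of_one_le_of_nonpos (one_le_jb _) (by linarith [le_max_left N 0])
  refine h2.congr (.of_forall fun ξ => ?_)
  simp only
  rw [← mul_assoc, ← rpow_add (jb_pos _)]
  congr 2; ring

theorem Tame.continuous_hat {f : ℝ² → F} (hf : Tame f) :
    ∀ᵐ ξ : ℝ, Continuous fun t => hat f t ξ := by
  filter_upwards [hf.integrable_slice] with ξ hξ
  refine continuous_of_dominated
    (fun t => (integrable_ex_smul (by fun_prop) hξ).1) (fun t => .of_forall fun τ => ?_) hξ.norm
    (.of_forall fun τ => by fun_prop)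
  rw [norm_smul, norm_ex, one_mul]

theorem Tame.exists_curve {f : ℝ² → F} (hf : Tame f) :
    ∃ u : ℝ → 𝓢'(ℝ, F), Continuous u ∧ ∀ t, HasFourierDensity (u t) (hat f t) := by
  obtain ⟨N, hN0, hN⟩ := hf.integrable_hatBound
  have hu : ∀ t, ∃ u : 𝓢'(ℝ, F), HasFourierDensity u (hat f t) := by
    intro t
    refine exists_hasFourierDensity (N := N) (hf.aestronglyMeasurable_hat t) (hN.mono' ?_ ?_)
    · have h1 : Continuous fun ξ : ℝ => (1 + ‖ξ‖) ^ (-N) :=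
        Continuous.rpow_const (by fun_prop) fun ξ => .inl (by positivity)
      exact h1.aestronglyMeasurable.mul (hf.aestronglyMeasurable_hat t).norm
    · refine .of_forall fun ξ => ?_
      rw [norm_of_nonneg (by positivity)]
      have := norm_hat_le f t ξ
      have h2 : (1 + ‖ξ‖) ^ (-N) = jb ξ ^ (-N) := rfl
      rw [h2]
      have := jb_rpow_pos ξ (-N)
      gcongr
  choose u hu using hu
  refine ⟨u, ?_, hu⟩
  apply PointwiseConvergenceCLM.continuous_of_continuous_eval
  intro χ
  obtain ⟨C, hC0, hC⟩ := schwartz_decay (𝓕⁻ χ) N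
  have e : (fun t => u t χ) = fun t => ∫ ξ, 𝓕⁻ χ ξ • hat f t ξ := funext fun t => ((hu t).apply χ).2
  rw [e]
  refine continuous_of_dominated
    (fun t => ((hu t).apply χ).1.1) (fun t => .of_forall fun ξ => ?_) (hN.const_mul C) ?_
  · rw [norm_smul, ← mul_assoc]
    exact mul_le_mul (hC ξ) (norm_hat_le f t ξ) (norm_nonneg _)
      (mul_nonneg hC0.le (jb_rpow_pos ξ _).le)
  · filter_upwards [hf.continuous_hat] with ξ hξ
    exact hξ.const_smul _

/-- The curve with density `f` is continuous with values in `H^s`. -/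
def SobCurve (s : ℝ) (f : ℝ² → F) : Prop :=
  (∀ t, MemLp (fun ξ => jc ξ s • hat f t ξ) 2 volume) ∧ ∀ t₀,
    Tendsto (fun t => eLpNorm (fun ξ => jc ξ s • (hat f t ξ - hat f t₀ ξ)) 2 volume)
      (𝓝 t₀) (𝓝 0)

theorem SobCurve.of_le {G : Type*} [NormedAddCommGroup G] [NormedSpace ℂ G] {s s' C : ℝ}
    {f : ℝ² → F} {g : ℝ² → G} (hf : SobCurve s f) (hg : Tame g)
    (h : ∀ t, ∀ᵐ ξ : ℝ, jb ξ ^ s' * ‖hat g t ξ‖ ≤ C * (jb ξ ^ s * ‖hat f t ξ‖))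
    (h' : ∀ t t', ∀ᵐ ξ : ℝ, jb ξ ^ s' * ‖hat g t ξ - hat g t' ξ‖ ≤
      C * (jb ξ ^ s * ‖hat f t ξ - hat f t' ξ‖)) : SobCurve s' g := by
  have mj : ∀ s : ℝ, AEStronglyMeasurable (fun ξ => jc ξ s) volume := by
    intro s
    exact Measurable.aestronglyMeasurable (by fun_prop)
  have nj : ∀ (s ξ : ℝ), ‖jc ξ s‖ = jb ξ ^ s := fun s ξ => by
    rw [norm_ofReal_of_nonneg (jb_rpow_pos _ _).le]
  refine ⟨fun t => (hf.1 t).of_le_mul (c := C) ((mj s').smul (hg.aestronglyMeasurable_hat t)) ?_,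
    fun t₀ => ?_⟩
  · filter_upwards [h t] with ξ hξ
    rw [norm_smul, norm_smul, nj, nj]
    exact hξ
  · have h1 := ENNReal.Tendsto.const_mul (a := ofReal C) (hf.2 t₀) (.inr ofReal_ne_top)
    rw [mul_zero] at h1
    refine tendsto_of_tendsto_of_tendsto_of_le_of_le tendsto_const_nhds h1
      (fun _ => zero_le) fun t => ?_
    refine eLpNorm_le_mul_eLpNorm_of_ae_le_mul ?_ 2
    filter_upwards [h' t t₀] with ξ hξ
    rw [norm_smul, norm_smul, nj, nj]
    exact hξ

theorem SobCurve.add {s : ℝ} {f g : ℝ² → F} (hf : SobCurve s f) (hg : SobCurve s g)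
    (tf : Tame f) (tg : Tame g) : SobCurve s fun p => f p + g p := by
  have mj : AEStronglyMeasurable (fun ξ => jc ξ s) volume := by
    exact Measurable.aestronglyMeasurable (by fun_prop)
  have ha := tf.hat_add tg
  refine ⟨fun t => ((hf.1 t).add (hg.1 t)).ae_eq ?_, fun t₀ => ?_⟩
  · filter_upwards [ha] with ξ hξ
    rw [hξ t, smul_add]; rfl
  · have h1 := (hf.2 t₀).add (hg.2 t₀)
    rw [add_zero] at h1
    refine tendsto_of_tendsto_of_tendsto_of_le_of_le tendsto_const_nhds h1
      (fun _ => zero_le) fun t => ?_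
    refine le_trans (le_of_eq (eLpNorm_congr_ae ?_)) (eLpNorm_add_le
      (mj.smul ((tf.aestronglyMeasurable_hat t).sub (tf.aestronglyMeasurable_hat t₀)))
      (mj.smul ((tg.aestronglyMeasurable_hat t).sub (tg.aestronglyMeasurable_hat t₀)))
      one_le_two)
    filter_upwards [ha] with ξ hξ
    rw [hξ t, hξ t₀, Pi.add_apply]
    simp only [← smul_add]
    congr 1; abel

end

theorem exists_enorm_hat_den_le (s : ℝ) {b : ℝ} (hb : 1 / 2 < b) {h : ℝ → ℝ} (hh : Measurable h) :
    ∃ C : NNReal, ∀ lam : ℝ, 1 ≤ lam → ∀ (F : L2 ℝ²) (t ξ : ℝ),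
      ‖jc ξ s • hat (den (wt s b lam h) F) t ξ‖ₑ ^ 2 ≤ C * ∫⁻ τ : ℝ, ‖F (τ, ξ)‖ₑ ^ 2 := by
  obtain ⟨C, hC⟩ := lintegral_inv_wt_sq hb
  refine ⟨C, fun lam hl F t ξ => ?_⟩
  have h1 : ‖hat (den (wt s b lam h) F) t ξ‖ₑ ≤ ∫⁻ τ, ‖(((wt s b lam h (τ, ξ))⁻¹ : ℝ) : ℂ)‖ₑ * ‖F (τ, ξ)‖ₑ := by
    refine (enorm_integral_le_lintegral_enorm _).trans (le_of_eq ?_)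
    refine lintegral_congr fun τ => ?_
    rw [enorm_smul, enorm_ex, one_mul, den, enorm_mul]
  have h2 := lintegral_enorm_mul_sq_le (μ := 𝓛¹)
    (e := fun τ => ‖(((wt s b lam h (τ, ξ))⁻¹ : ℝ) : ℂ)‖ₑ)
    (Measurable.aemeasurable (by
      have := (measurable_wt s b lam hh).inv
      have h3 : Measurable fun τ => (wt s b lam h (τ, ξ))⁻¹ := this.comp (by fun_prop)
      exact (measurable_ofReal.comp h3).enorm))
    (measurable_slice (Lp.stronglyMeasurable F).measurable ξ).enorm.aemeasurable
  have hp := jb_rpow_pos ξ s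
  have e1 : ‖jc ξ s‖ₑ ^ 2 * ofReal (jb ξ ^ (-2 * s)) = 1 := by
    rw [← ofReal_norm, norm_ofReal_of_nonneg hp.le, ← ofReal_pow hp.le,
      ← ofReal_mul (by positivity), ← rpow_natCast, ← rpow_mul (jb_pos _).le,
      ← rpow_add (jb_pos _)]
    rw [show s * ((2 : ℕ) : ℝ) + -2 * s = 0 by push_cast; ring, rpow_zero, ENNReal.ofReal_one]
  calc ‖jc ξ s • hat (den (wt s b lam h) F) t ξ‖ₑ ^ 2
      = ‖jc ξ s‖ₑ ^ 2 * ‖hat (den (wt s b lam h) F) t ξ‖ₑ ^ 2 := by rw [enorm_smul, mul_pow]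
    _ ≤ ‖jc ξ s‖ₑ ^ 2 * ((C * ofReal (jb ξ ^ (-2 * s))) * ∫⁻ τ, ‖F (τ, ξ)‖ₑ ^ 2) := by
        gcongr
        exact (pow_le_pow_left' h1 2).trans (h2.trans (mul_le_mul_left (hC lam hl ξ) _))
    _ = (‖jc ξ s‖ₑ ^ 2 * ofReal (jb ξ ^ (-2 * s))) * (C * ∫⁻ τ, ‖F (τ, ξ)‖ₑ ^ 2) := by ring
    _ = _ := by rw [e1, one_mul]

theorem sobCurve_den {s b lam : ℝ} (hb : 1 / 2 < b) (hl : 1 ≤ lam) {h : ℝ → ℝ}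
    (hh : Measurable h) (F : L2 ℝ²) : SobCurve s (den (wt s b lam h) F) := by
  set f := den (wt s b lam h) F
  have tf : Tame f := tame_den hb hl hh F
  obtain ⟨C, hC⟩ := exists_enorm_hat_den_le s hb hh
  have mj : AEStronglyMeasurable (fun ξ => jc ξ s) volume := by
    have := measurable_jb
    exact Measurable.aestronglyMeasurable (by fun_prop)
  set S : ℝ → ℝ≥0∞ := fun ξ => C * ∫⁻ τ, ‖F (τ, ξ)‖ₑ ^ 2 with hS
  have hSi : ∫⁻ ξ, S ξ < ∞ := by
    rw [hS, lintegral_const_mul' _ _ coe_ne_top, L2.lintegral_slices]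
    exact mul_lt_top coe_lt_top (pow_lt_top enorm_lt_top)
  have bd : ∀ t ξ, ‖jc ξ s • hat f t ξ‖ₑ ^ 2 ≤ S ξ := hC lam hl F
  have fin : ∀ g : ℝ → ℂ, (∫⁻ ξ, ‖g ξ‖ₑ ^ 2) < ∞ → eLpNorm g 2 volume < ∞ := by
    intro g hg; rw [eLpNorm_two_eq_l2n, l2n]
    exact ENNReal.rpow_lt_top_of_nonneg (by norm_num) hg.ne
  refine ⟨fun t => ⟨mj.smul (tf.aestronglyMeasurable_hat t), fin _
    ((lintegral_mono (bd t)).trans_lt hSi)⟩, fun t₀ => ?_⟩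
  have key : Tendsto (fun t => ∫⁻ ξ, ‖jc ξ s • (hat f t ξ - hat f t₀ ξ)‖ₑ ^ 2) (𝓝 t₀)
      (𝓝 (∫⁻ _ : ℝ, 0)) := by
    refine tendsto_lintegral_filter_of_dominated_convergence' (fun ξ => 4 * S ξ)
      (.of_forall fun t => ?_) (.of_forall fun t => .of_forall fun ξ => ?_) ?_ ?_
    · exact (mj.smul ((tf.aestronglyMeasurable_hat t).sub
        (tf.aestronglyMeasurable_hat t₀))).enorm.pow_const 2
    · rw [smul_sub]
      calc ‖jc ξ s • hat f t ξ - jc ξ s • hat f t₀ ξ‖ₑ ^ 2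
          ≤ (‖jc ξ s • hat f t ξ‖ₑ + ‖jc ξ s • hat f t₀ ξ‖ₑ) ^ 2 := by gcongr; exact enorm_sub_le
        _ ≤ (2 * max ‖jc ξ s • hat f t ξ‖ₑ
            ‖jc ξ s • hat f t₀ ξ‖ₑ) ^ 2 := by
            gcongr; rw [two_mul]
            exact add_le_add (le_max_left _ _) (le_max_right _ _)
        _ ≤ 4 * S ξ := by
            rw [mul_pow]
            refine mul_le_mul' (by norm_num) ?_
            rcases max_choice ‖jc ξ s • hat f t ξ‖ₑ
              ‖jc ξ s • hat f t₀ ξ‖ₑ with h' | h' <;> rw [h']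
            · exact bd t ξ
            · exact bd t₀ ξ
    · rw [lintegral_const_mul' _ _ (by norm_num)]
      exact (mul_lt_top (by norm_num) hSi).ne
    · filter_upwards [tf.continuous_hat] with ξ hξ
      have : Continuous fun t => ‖jc ξ s • (hat f t ξ - hat f t₀ ξ)‖ₑ ^ 2 := by
        have h1 : Continuous fun t => jc ξ s • (hat f t ξ - hat f t₀ ξ) := by
          have h0 := (hξ.sub (continuous_const (y := hat f t₀ ξ))).const_smul
            jc ξ s
          exact h0
        exact (ENNReal.continuous_pow 2).comp h1.enorm
      have h2 := this.tendsto t₀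
      simpa using h2
  rw [lintegral_zero] at key
  simp only [eLpNorm_two_eq_l2n, l2n]
  have h3 := (ENNReal.continuous_rpow_const (y := 1 / 2)).tendsto 0
  rw [ENNReal.zero_rpow_of_pos (by norm_num)] at h3
  exact h3.comp key

/-- An orthonormal basis of eigenvectors of `α`, exchanged by `β`. -/
structure DiracBasis (α β : Matrix (Fin 2) (Fin 2) ℂ) (e e' : Spinor) : Prop where
  norm_fst : ‖e‖ = 1
  norm_snd : ‖e'‖ = 1
  inner_eq : inner ℂ e e' = 0
  alpha_fst : act α e = e
  alpha_snd : act α e' = -e'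
  beta_fst : act β e = e'
  beta_snd : act β e' = e

theorem act_mul (a b : Matrix (Fin 2) (Fin 2) ℂ) (v : Spinor) : act (a * b) v = act a (act b v) := by
  rw [act, map_mul]; rfl

theorem act_inner {a : Matrix (Fin 2) (Fin 2) ℂ} (ha : a.IsHermitian) (v w : Spinor) :
    inner ℂ (act a v) w = inner ℂ v (act a w) := by
  have h : star (act a) = act a := by rw [act, ← map_star]; congr 1
  rw [← ContinuousLinearMap.adjoint_inner_right, ← ContinuousLinearMap.star_eq_adjoint, h]

theorem exists_diracBasis {α β : Matrix (Fin 2) (Fin 2) ℂ} (hα : α.IsHermitian)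
    (hβ : β.IsHermitian) (hα2 : α * α = 1) (hβ2 : β * β = 1) (hαβ : α * β + β * α = 0) :
    ∃ e e' : Spinor, DiracBasis α β e e' := by
  have one : ∀ v : Spinor, act 1 v = v := fun v => by rw [act, map_one]; rfl
  have a2 : ∀ v, act α (act α v) = v := fun v => by rw [← act_mul, hα2, one]
  have b2 : ∀ v, act β (act β v) = v := fun v => by rw [← act_mul, hβ2, one]
  have ab : ∀ v, act α (act β v) = -act β (act α v) := fun v => by
    rw [← act_mul, ← act_mul, eq_neg_of_add_eq_zero_left hαβ, act, map_neg]; rfl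
  obtain ⟨v, hv0, hv⟩ : ∃ v : Spinor, v ≠ 0 ∧ act α v = v := by
    by_contra! H
    have h1 : ∀ w, act α w = -w := by
      intro w
      by_contra hw
      refine H (w + act α w) (fun h => hw (eq_neg_of_add_eq_zero_right h)) ?_
      rw [map_add, a2, add_comm]
    have w : Spinor := EuclideanSpace.single 0 1
    have h2 : ∀ w : Spinor, act β w = 0 := by
      intro w
      have h3 := ab w
      rw [h1, h1, map_neg, neg_neg] at h3
      have h4 : act β w + act β w = 0 := by nth_rw 1 [← h3]; simp
      rw [← two_smul ℂ, smul_eq_zero] at h4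
      exact h4.resolve_left two_ne_zero
    have h5 : (EuclideanSpace.single 0 1 : Spinor) = 0 := by
      rw [← b2 (EuclideanSpace.single 0 1), h2]
    have h6 := congrArg (fun v : Spinor => ‖v‖) h5
    simp at h6
  set e : Spinor := ((‖v‖⁻¹ : ℝ) : ℂ) • v with he
  have hn : ‖v‖ ≠ 0 := norm_ne_zero_iff.2 hv0
  have ne : ‖e‖ = 1 := by rw [he, norm_smul, norm_real, norm_inv, norm_norm, inv_mul_cancel₀ hn]
  have ae : act α e = e := by rw [he, map_smul, hv]
  have ae' : act α (act β e) = -act β e := by rw [ab, ae]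
  refine ⟨e, act β e, ne, ?_, ?_, ae, ae', rfl, b2 e⟩
  · have h1 : inner ℂ (act β e) (act β e) = inner ℂ e e := by rw [act_inner hβ, b2]
    rw [inner_self_eq_norm_sq_to_K, inner_self_eq_norm_sq_to_K, ne] at h1
    have h2 : ‖act β e‖ ^ 2 = 1 := by
      have : ((‖act β e‖ : ℂ)) ^ 2 = 1 := by simpa using h1
      exact_mod_cast this
    nlinarith [norm_nonneg (act β e)]
  · have h1 : inner ℂ e (act β e) = -inner ℂ e (act β e) := by
      nth_rw 1 [← ae]
      rw [act_inner hα, ae', inner_neg_right]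
    have h2 : (2 : ℂ) * inner ℂ e (act β e) = 0 := by rw [two_mul]; nth_rw 1 [h1]; simp
    exact (mul_eq_zero.1 h2).resolve_left two_ne_zero

namespace DiracBasis

variable {α β : Matrix (Fin 2) (Fin 2) ℂ} {e e' : Spinor}

theorem inner_fst (h : DiracBasis α β e e') (u v : ℂ) : inner ℂ e (u • e + v • e') = u := by
  rw [inner_add_right, inner_smul_right, inner_smul_right, h.inner_eq,
    inner_self_eq_norm_sq_to_K, h.norm_fst]
  simp

theorem inner_snd (h : DiracBasis α β e e') (u v : ℂ) : inner ℂ e' (u • e + v • e') = v := by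
  have : inner ℂ e' e = 0 := by rw [← inner_conj_symm, h.inner_eq, map_zero]
  rw [inner_add_right, inner_smul_right, inner_smul_right, this,
    inner_self_eq_norm_sq_to_K, h.norm_snd]
  simp

theorem eq_add (h : DiracBasis α β e e') (ψ : Spinor) : ψ = inner ℂ e ψ • e + inner ℂ e' ψ • e' := by
  have hon : Orthonormal ℂ ![e, e'] := by
    rw [orthonormal_iff_ite]; intro i j
    have h3 : inner ℂ e' e = 0 := by rw [← inner_conj_symm, h.inner_eq, map_zero]
    fin_cases i <;> fin_cases j <;> simp [h.norm_fst, h.norm_snd, h3, h.inner_eq]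
  have hc : Fintype.card (Fin 2) = Module.finrank ℂ Spinor := by simp
  set b := basisOfOrthonormalOfCardEqFinrank hon hc
  have hb : (b : Fin 2 → Spinor) = ![e, e'] := coe_basisOfOrthonormalOfCardEqFinrank hon hc
  have := (b.toOrthonormalBasis (by rw [hb]; exact hon)).sum_repr' ψ
  rw [Fin.sum_univ_two] at this
  simp only [Module.Basis.coe_toOrthonormalBasis, hb] at this
  exact this.symm

theorem act_beta (h : DiracBasis α β e e') (u v : ℂ) : act β (u • e + v • e') = v • e + u • e' := by
  rw [map_add, map_smul, map_smul, h.beta_fst, h.beta_snd, add_comm]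

theorem act_alpha_beta (h : DiracBasis α β e e')
    (u v : ℂ) : act (α * β) (u • e + v • e') = v • e + (-u) • e' := by
  rw [act_mul, h.act_beta, map_add, map_smul, map_smul, h.alpha_fst, h.alpha_snd, smul_neg,
    neg_smul]

theorem inner_beta (h : DiracBasis α β e e') (u v : ℂ) : inner ℂ (u • e + v • e') (act β (u • e + v • e')) =
    u * conj v + conj u * v := by
  rw [h.act_beta, inner_add_left, inner_smul_left, inner_smul_left, h.inner_fst, h.inner_snd]; ring

theorem diracSymbol_apply (h : DiracBasis α β e e')
    (σ ξ : ℝ) (u v : ℂ) : diracSymbol α σ ξ (u • e + v • e') =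
    (((1 + σ * Real.sign ξ) / 2 : ℝ) * u) • e + (((1 - σ * Real.sign ξ) / 2 : ℝ) * v) • e' := by
  have e1 : ∀ w, diracSymbol α σ ξ w = (1 / 2 : ℂ) • (w + ((σ * Real.sign ξ : ℝ) : ℂ) • act α w) := by
    intro w
    rw [diracSymbol, act, map_smul, map_add, map_smul, map_one]; rfl
  rw [e1, map_add, map_smul, map_smul, h.alpha_fst, h.alpha_snd]; push_cast
  module

end DiracBasis

section

variable {F : Type*} [NormedAddCommGroup F] [NormedSpace ℂ F] [CompleteSpace F]

theorem IsTest.pair_eq {T : ℝ} (hT : 0 ≤ T) {η : 𝓢²} (hη : IsTest T η)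
    {u : ℝ → 𝓢'(ℝ, F)} {f : ℝ² → F} (hf : Tame f)
    (hu : ∀ t ∈ Ioc 0 T, HasFourierDensity (u t) (hat f t)) :
    pair T u η = ∫ p, kap η p • f p := by
  rw [hη.integral_kap_smul hf, pair, intervalIntegral.integral_of_le hT]
  refine setIntegral_congr_fun measurableSet_Ioc fun t ht => ?_
  exact ((hu t ht).apply _).2

theorem Tame.exists_spacetime {f : ℝ² → F} (hf : Tame f) :
    ∃ U : 𝓢'(Spacetime, F), HasFourierDensity U (fun q => f (co q)) ∧
      ∀ η, U η = ∫ p, kap η p • f p := by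
  obtain ⟨mf, N, hN⟩ := id hf
  have mf' : AEStronglyMeasurable (fun q => f (co q)) volume :=
    mf.comp_measurePreserving measurePreserving_co
  have h1 : Integrable fun q : Spacetime => ((jb (co q).2 ^ (-N) : ℝ) : ℂ) • f (co q) :=
    measurePreserving_co.integrable_comp_of_integrable hN
  have h0 : Integrable fun q : Spacetime => (1 + ‖q‖) ^ (-max N 0) * ‖f (co q)‖ := by
    refine h1.norm.mono' ?_ (.of_forall fun q => ?_)
    · have : Continuous fun q : Spacetime => (1 + ‖q‖) ^ (-max N 0) :=
        Continuous.rpow_const (by fun_prop) fun q => .inl (by positivity)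
      exact this.aestronglyMeasurable.mul mf'.norm
    · have h2 := rpow_pos_of_pos (jb_pos (co q).2) (-N)
      have h4 := jb_snd_le (co q)
      rw [pt_co] at h4
      rw [norm_of_nonneg (by positivity), norm_smul, norm_ofReal_of_nonneg h2.le]
      gcongr
      calc (1 + ‖q‖) ^ (-max N 0) ≤ jb (co q).2 ^ (-max N 0) :=
            rpow_le_rpow_of_nonpos (jb_pos _) h4 (by simp)
        _ ≤ _ := rpow_le_rpow_of_exponent_le (one_le_jb _) (by simp)
  obtain ⟨U, hU⟩ := exists_hasFourierDensity mf' h0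
  refine ⟨U, hU, fun η => ?_⟩
  rw [(hU.apply η).2, ← measurePreserving_pt.integral_comp measurableEmbedding_pt]; rfl

theorem memXLoc_of_tame {s b σ T : ℝ} (hT : 0 ≤ T) {u : ℝ → 𝓢'(ℝ, F)} (hc : Continuous u)
    {f : ℝ² → F} (hf : Tame f) (hu : ∀ t, HasFourierDensity (u t) (hat f t))
    (hm : MemLp (fun p : ℝ² => (bracket (2 * π * p.2) ^ s *
      bracket (2 * π * (p.1 + σ * |p.2|)) ^ b) • f p) 2 volume) : MemXLoc s b σ T u := by
  obtain ⟨U, hU, hUe⟩ := hf.exists_spacetime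
  refine ⟨hc.continuousOn, U, ⟨_, hU, ?_⟩, fun η hη => ?_⟩
  · have := hm.comp_measurePreserving measurePreserving_co
    simpa only [Function.comp_def, co] using this
  · rw [hUe, hη.pair_eq hT hf fun t _ => hu t]

end

theorem one_le_bracket (y : ℝ) : 1 ≤ bracket y := one_le_sqrt.2 (by nlinarith [sq_nonneg y])

theorem bracket_eq_om (x : ℝ) : bracket (2 * π * x) = om x := by rw [bracket, om]

theorem jb_le_bracket (x : ℝ) : jb x ≤ 2 * bracket (2 * π * x) := by
  rw [bracket_eq_om]; exact jb_le_om x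

theorem exists_bracket_rpow_le (s : ℝ) : ∃ C : ℝ, 0 < C ∧ ∀ x : ℝ,
    bracket (2 * π * x) ^ s ≤ C * jb x ^ s ∧ jb x ^ s ≤ C * bracket (2 * π * x) ^ s := by
  have h1 := fun x => (bracket_eq_om x).trans_le (om_le_jb x)
  have h2 := jb_le_bracket
  have h0 : ∀ x, 0 < bracket (2 * π * x) := fun x => one_pos.trans_le (one_le_bracket _)
  refine ⟨8 ^ |s|, by positivity, fun x => ?_⟩
  have key : ∀ {a c : ℝ}, 0 < a → 0 < c → a ≤ 8 * c → c ≤ 8 * a → a ^ s ≤ 8 ^ |s| * c ^ s := by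
    intro a c ha hc h h'
    rcases le_total 0 s with hs | hs
    · rw [abs_of_nonneg hs, ← mul_rpow (by norm_num) hc.le]
      exact rpow_le_rpow ha.le h hs
    · rw [abs_of_nonpos hs, rpow_neg (by norm_num), ← Real.inv_rpow (by norm_num),
        ← mul_rpow (by norm_num) hc.le]
      exact rpow_le_rpow_of_nonpos (by positivity) (by linarith) hs
  have h1' := h1 x
  have h3 : jb x ≤ 8 * bracket (2 * π * x) := by linarith [h2 x, h0 x]
  exact ⟨key (h0 x) (jb_pos x) h1' h3, key (jb_pos x) (h0 x) h3 h1'⟩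

theorem conj_spc (f : ℝ² → ℂ) (t x : ℝ) : conj (spc f t x) = spc (refl f) t x := by
  rw [spc, ← integral_conj, ← integral_neg_eq_self, spc]
  refine integral_congr fun ξ => ?_
  simp only [hat_refl]
  rw [map_mul, conj_ex, mul_neg, neg_neg]

theorem Tame.refl {f : ℝ² → ℂ} (hf : Tame f) : Tame (refl f) := by
  obtain ⟨mf, N, hN⟩ := hf
  have mp := Measure.measurePreserving_neg 𝓛²
  have h1 : AEStronglyMeasurable (fun p => f (-p)) volume := mf.comp_measurePreserving mp
  refine ⟨continuous_conj.comp_aestronglyMeasurable h1, N, ?_⟩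
  have h2 : Integrable (fun p => ((jb (-p).2 ^ (-N) : ℝ) : ℂ) • f (-p)) :=
    mp.integrable_comp_of_integrable hN
  refine h2.norm.mono' ?_ (.of_forall fun p => ?_)
  · have : Continuous fun p : ℝ² => jc p.2 (-N) := Complex.continuous_ofReal.comp
        ((by unfold jb; fun_prop : Continuous fun p : ℝ² => jb p.2).rpow_const
          fun p => .inl (jb_pos _).ne')
    exact this.aestronglyMeasurable.smul (continuous_conj.comp_aestronglyMeasurable h1)
  · rw [norm_smul, norm_smul, DKG.refl, RCLike.norm_conj, Prod.snd_neg, jb, jb, abs_neg]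

theorem Tame.mul_integrable_hat {f : ℝ² → ℂ} (hf : Tame f) {a : ℝ → ℂ} (ha : RapidDecay a)
    (t : ℝ) : Integrable fun ξ => a ξ * hat f t ξ := by
  have h1 := integrable_ex_smul (u := fun p => t * p.1) (by fun_prop)
    (hf.integrable_smul ha)
  rw [Measure.volume_eq_prod] at h1
  refine h1.swap.integral_prod_left.congr (.of_forall fun ξ => ?_)
  simp only [← smul_eq_mul, ← hat_smul]; rfl

/-- A mollified function of space-time. -/
def mol (ρ : 𝓢(ℝ, ℂ)) (ε : ℝ) (f : ℝ² → ℂ) (p : ℝ²) : ℂ := 𝓕 ρ (ε * p.2) * f p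

theorem Tame.integrable_mol {f : ℝ² → ℂ} (hf : Tame f) (ρ : 𝓢(ℝ, ℂ)) {ε : ℝ} (hε : 0 < ε) :
    Integrable (mol ρ ε f) := hf.integrable_smul (RapidDecay.fourier ρ hε)

theorem spc_mol (ρ : 𝓢(ℝ, ℂ)) (ε : ℝ) (f : ℝ² → ℂ) (t x : ℝ) :
    spc (mol ρ ε f) t x = ∫ ξ, ex (x * ξ) * 𝓕 ρ (ε * ξ) * hat f t ξ := by
  refine integral_congr fun ξ => ?_
  have := hat_smul (fun ξ => 𝓕 ρ (ε * ξ)) f t ξ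
  simp only [smul_eq_mul] at this
  simp only [mul_assoc, ← this]; rfl

theorem refl_mol (ρ : 𝓢(ℝ, ℂ)) (ε : ℝ) (f : ℝ² → ℂ) :
    refl (mol ρ ε f) = fun p => conj (𝓕 ρ (ε * -p.2)) * refl f p := by
  ext p; simp [refl, mol]

theorem mollify_eq_spc {u : 𝓢'(ℝ, ℂ)} {f : ℝ² → ℂ} {t : ℝ} (h : HasFourierDensity u (hat f t))
    (ρ : 𝓢(ℝ, ℂ)) {ε : ℝ} (hε : 0 < ε) (x : ℝ) : mollify ρ ε u x = spc (mol ρ ε f) t x := by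
  rw [h.mollify ρ hε, spc_mol]; rfl

theorem mollify_spinor_eq {u : 𝓢'(ℝ, Spinor)} {f g : ℝ² → ℂ} (hf : Tame f) (hg : Tame g)
    {t : ℝ} {e e' : Spinor} (h : HasFourierDensity u fun ξ => hat f t ξ • e + hat g t ξ • e')
    (ρ : 𝓢(ℝ, ℂ)) {ε : ℝ} (hε : 0 < ε) (x : ℝ) :
    mollify ρ ε u x = spc (mol ρ ε f) t x • e + spc (mol ρ ε g) t x • e' := by
  have i : ∀ {f : ℝ² → ℂ}, Tame f →
      Integrable fun ξ => ex (x * ξ) * 𝓕 ρ (ε * ξ) * hat f t ξ := fun hf => by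
    have := integrable_ex_smul (u := fun ξ => x * ξ) (by fun_prop)
      (hf.mul_integrable_hat (RapidDecay.fourier ρ hε) t)
    simpa only [smul_eq_mul, mul_assoc] using this
  rw [h.mollify ρ hε, spc_mol, spc_mol, ← integral_smul_const, ← integral_smul_const,
    ← integral_add ((i hf).smul_const e) ((i hg).smul_const e')]
  simp only [smul_add, smul_smul]

theorem continuous_spc {f : ℝ² → ℂ} (hf : Integrable f) :
    Continuous fun z : ℝ² => spc f z.1 z.2 := by
  simp_rw [spc_eq hf]
  refine continuous_of_dominated (fun z => ?_) (fun z => .of_forall fun p => ?_)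
    hf.norm (.of_forall fun p => ?_)
  · exact (continuous_ex.comp (by fun_prop : Continuous fun p : ℝ² =>
      z.1 * p.1 + z.2 * p.2)).aestronglyMeasurable.mul hf.aestronglyMeasurable
  · rw [norm_mul, norm_ex, one_mul]
  · exact (continuous_ex.comp (by fun_prop : Continuous fun z : ℝ² =>
      z.1 * p.1 + z.2 * p.2)).mul continuous_const

theorem norm_spc_le {f : ℝ² → ℂ} (hf : Integrable f) (t x : ℝ) : ‖spc f t x‖ ≤ ∫ p, ‖f p‖ := by
  rw [spc_eq hf]
  refine (norm_integral_le_integral_norm _).trans (le_of_eq ?_)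
  refine integral_congr fun p => ?_
  simp only [norm_mul, norm_ex, one_mul]

theorem integrable_slice_mul_spc (η : 𝓢²) {f g : ℝ² → ℂ} (hf : Integrable f)
    (hg : Integrable g) :
    Integrable fun z : ℝ² => slice z.1 η z.2 * (spc f z.1 z.2 * spc g z.1 z.2) := by
  have h1 : Integrable fun z => η (pt z) :=
    measurePreserving_pt.integrable_comp_of_integrable η.integrable
  simp_rw [slice_apply]
  refine h1.mul_bdd (c := (∫ p, ‖f p‖) * ∫ p, ‖g p‖)
    ((continuous_spc hf).mul (continuous_spc hg)).aestronglyMeasurable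
    (.of_forall fun z => ?_)
  rw [norm_mul]
  have := norm_spc_le hf z.1 z.2
  have := norm_spc_le hg z.1 z.2
  gcongr

theorem integral_integral_smul_add {S : Set ℝ} {A B : ℝ → ℝ → ℂ}
    (hA : Integrable fun z : ℝ² => A z.1 z.2) (hB : Integrable fun z : ℝ² => B z.1 z.2)
    {F : Type*} [NormedAddCommGroup F] [NormedSpace ℂ F] [CompleteSpace F] (e e' : F) :
    ∫ t in S, (∫ x, A t x • e + B t x • e') =
      (∫ t in S, ∫ x, A t x) • e + (∫ t in S, ∫ x, B t x) • e' := by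
  rw [Measure.volume_eq_prod] at hA hB
  rw [← integral_smul_const, ← integral_smul_const,
    ← integral_add (hA.integral_prod_left.restrict.smul_const e)
      (hB.integral_prod_left.restrict.smul_const e')]
  refine integral_congr_ae (ae_restrict_of_ae ?_)
  filter_upwards [hA.prod_right_ae, hB.prod_right_ae] with t h1 h2
  rw [integral_add (h1.smul_const e) (h2.smul_const e'), integral_smul_const, integral_smul_const]

theorem exists_norm_fourier_le (ρ : 𝓢(ℝ, ℂ)) : ∃ C : ℝ, ∀ x, ‖𝓕 ρ x‖ ≤ C := by
  obtain ⟨C, hC0, hC⟩ := schwartz_decay (𝓕 ρ) 0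
  exact ⟨C, fun x => by simpa using hC x⟩

section

variable {T : ℝ} {η : 𝓢²} {ρ : 𝓢(ℝ, ℂ)} {fu fv fφ : ℝ² → ℂ} {e e' : Spinor}
  {ψ : ℝ → 𝓢'(ℝ, Spinor)} {φ : ℝ → 𝓢'(ℝ, ℂ)}

theorem tendsto_yukawa (hT : 0 ≤ T) (hη : IsTest T η) (hρ : ∫ x, ρ x = 1) (tu : Tame fu)
    (tv : Tame fv) (tφ : Tame fφ)
    (hψ : ∀ t ∈ Icc 0 T, HasFourierDensity (ψ t) fun ξ => hat fu t ξ • e + hat fv t ξ • e')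
    (hφ : ∀ t ∈ Icc 0 T, HasFourierDensity (φ t) (hat fφ t))
    (cu : ConvInt fφ fu (kap η)) (cv : ConvInt fφ fv (kap η)) :
    Tendsto (fun ε => yukawa T φ ψ ρ ε η) (𝓝[>] 0)
      (𝓝 (conv fφ fu (kap η) • e + conv fφ fv (kap η) • e')) := by
  obtain ⟨C, hC⟩ := exists_norm_fourier_le ρ
  have key : ∀ {f}, Tame f → ConvInt fφ f (kap η) → Tendsto (fun ε => ∫ t in Ioc 0 T, ∫ x,
      slice t η x * (spc (mol ρ ε fφ) t x * spc (mol ρ ε f) t x)) (𝓝[>] 0)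
      (𝓝 (conv fφ f (kap η))) := fun tf cf =>
    hη.tendsto_mollified (φ := fun ε ξ => 𝓕 ρ (ε * ξ)) (ψ := fun ε ξ => 𝓕 ρ (ε * ξ)) tφ tf cf
      (fun ε hε => RapidDecay.fourier ρ hε)
      (fun ε hε => RapidDecay.fourier ρ hε) (fun _ _ => hC _) (fun _ _ => hC _)
      (tendsto_fourier_mul hρ) (tendsto_fourier_mul hρ)
  have k := ((key tu cu).smul_const e).add ((key tv cv).smul_const e')
  refine k.congr' ?_
  filter_upwards [self_mem_nhdsWithin] with ε hε
  have h1 := integral_integral_smul_add (S := Ioc 0 T)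
    (A := fun t x => slice t η x * (spc (mol ρ ε fφ) t x * spc (mol ρ ε fu) t x))
    (B := fun t x => slice t η x * (spc (mol ρ ε fφ) t x * spc (mol ρ ε fv) t x))
    (integrable_slice_mul_spc η (tφ.integrable_mol ρ hε) (tu.integrable_mol ρ hε))
    (integrable_slice_mul_spc η (tφ.integrable_mol ρ hε) (tv.integrable_mol ρ hε)) e e'
  rw [← h1, yukawa, intervalIntegral.integral_of_le hT]
  refine setIntegral_congr_fun measurableSet_Ioc fun t ht => ?_
  refine integral_congr fun x => ?_
  have ht' : t ∈ Icc 0 T := ⟨ht.1.le, ht.2⟩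
  simp only [mollify_eq_spc (hφ t ht') ρ hε, mollify_spinor_eq tu tv (hψ t ht') ρ hε, smul_add,
    smul_smul]

theorem tendsto_density {α β : Matrix (Fin 2) (Fin 2) ℂ} (hb : DiracBasis α β e e') (hT : 0 ≤ T)
    (hη : IsTest T η) (hρ : ∫ x, ρ x = 1) (tu : Tame fu) (tv : Tame fv)
    (hψ : ∀ t ∈ Icc 0 T, HasFourierDensity (ψ t) fun ξ => hat fu t ξ • e + hat fv t ξ • e')
    (cu : ConvInt fu (refl fv) (kap η)) (cv : ConvInt (refl fu) fv (kap η)) :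
    Tendsto (fun ε => density β T ψ ρ ε η) (𝓝[>] 0)
      (𝓝 (conv fu (refl fv) (kap η) + conv (refl fu) fv (kap η))) := by
  obtain ⟨C, hC⟩ := exists_norm_fourier_le ρ
  have hC' : ∀ ε ξ : ℝ, ‖conj (𝓕 ρ (ε * -ξ))‖ ≤ C := fun ε ξ => by rw [RCLike.norm_conj]; exact hC _
  have hr : ∀ ξ, Tendsto (fun ε => conj (𝓕 ρ (ε * -ξ))) (𝓝[>] 0) (𝓝 1) := by
    intro ξ
    have := (continuous_conj.tendsto 1).comp (tendsto_fourier_mul hρ (-ξ))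
    rwa [map_one] at this
  have k1 := hη.tendsto_mollified tu tv.refl cu (fun ε hε => RapidDecay.fourier ρ hε)
      (fun ε hε => (RapidDecay.fourier ρ hε).refl) (fun _ _ => hC _) hC'
      (tendsto_fourier_mul hρ) hr
  have k2 := hη.tendsto_mollified tu.refl tv cv (fun ε hε => (RapidDecay.fourier ρ hε).refl)
      (fun ε hε => RapidDecay.fourier ρ hε) hC' (fun _ _ => hC _) hr (tendsto_fourier_mul hρ)
  refine (k1.add k2).congr' ?_
  filter_upwards [self_mem_nhdsWithin] with ε hε
  have iu := tu.integrable_mol ρ hε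
  have iv := tv.integrable_mol ρ hε
  have iu' : Integrable (refl (mol ρ ε fu)) := by
    rw [refl_mol]; exact tu.refl.integrable_smul (RapidDecay.fourier ρ hε).refl
  have iv' : Integrable (refl (mol ρ ε fv)) := by
    rw [refl_mol]; exact tv.refl.integrable_smul (RapidDecay.fourier ρ hε).refl
  have h1 := integral_integral_smul_add (S := Ioc 0 T)
    (A := fun t x => slice t η x * (spc (mol ρ ε fu) t x * spc (refl (mol ρ ε fv)) t x))
    (B := fun t x => slice t η x * (spc (refl (mol ρ ε fu)) t x * spc (mol ρ ε fv) t x))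
    (integrable_slice_mul_spc η iu iv') (integrable_slice_mul_spc η iu' iv) (1 : ℂ) 1
  simp only [smul_eq_mul, mul_one] at h1; rw [← refl_mol, ← refl_mol]
  refine h1.symm.trans ?_
  rw [density, intervalIntegral.integral_of_le hT]
  refine setIntegral_congr_fun measurableSet_Ioc fun t ht => ?_
  refine integral_congr fun x => ?_
  simp only [mollify_spinor_eq tu tv (hψ t ⟨ht.1.le, ht.2⟩) ρ hε, hb.inner_beta, conj_spc, mul_add]

end

theorem IsSym.integrable_mul_of_le {κ : ℝ² → ℂ} (hκ : IsSym κ) {f : ℝ² → ℂ} (hf : Tame f)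
    {a : ℝ → ℂ} (ha : Measurable a) {C : ℝ} (hC : ∀ τ, ‖a τ‖ ≤ C * jb τ) :
    Integrable fun p => a p.1 * f p * κ p := by
  obtain ⟨mf, N, hN⟩ := hf
  obtain ⟨D, hD0, hD⟩ := hκ.decay_pos (max N 1)
  have hm := hκ.measurable
  have hC0 : 0 ≤ C := by
    have := (norm_nonneg _).trans (hC 0)
    simpa [jb] using this
  refine (hN.norm.const_mul (C * D)).mono'
    (((by fun_prop : Measurable fun p : ℝ² => a p.1).aestronglyMeasurable.mul mf).mul
      hm.aestronglyMeasurable) (.of_forall fun p => ?_)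
  have j1 := jb_pos p.1
  have j2 := jb_rpow_pos p.2 (-N)
  have h1 : jb p.1 ^ (-max N 1) ≤ (jb p.1)⁻¹ := by
    rw [← Real.rpow_neg_one]
    exact rpow_le_rpow_of_exponent_le (one_le_jb _) (neg_le_neg (le_max_right _ _))
  have h2 : jb p.2 ^ (-max N 1) ≤ jb p.2 ^ (-N) :=
    rpow_le_rpow_of_exponent_le (one_le_jb _) (neg_le_neg (le_max_left _ _))
  rw [norm_mul, norm_mul, norm_smul, norm_ofReal_of_nonneg j2.le]
  calc ‖a p.1‖ * ‖f p‖ * ‖κ p‖ ≤ C * jb p.1 * ‖f p‖ * (D * ((jb p.1)⁻¹ * jb p.2 ^ (-N))) := by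
        have := hC p.1
        have := (hD p).trans (mul_le_mul_of_nonneg_left (mul_le_mul h1 h2
          (jb_rpow_pos p.2 _).le (inv_pos.2 j1).le) hD0.le)
        gcongr
    _ = _ := by field_simp

theorem IsSym.integrable_mul {κ : ℝ² → ℂ} (hκ : IsSym κ) {f : ℝ² → ℂ} (hf : Tame f) :
    Integrable fun p => f p * κ p := by
  have := hκ.integrable_mul_of_le hf (a := fun _ => 1) measurable_const (C := 1) (fun τ => by
    simpa using one_le_jb τ)
  simpa using this

theorem IsSym.integrable_sy_mul {κ : ℝ² → ℂ} (hκ : IsSym κ) {f : ℝ² → ℂ} (hf : Tame f)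
    (lam : ℝ) : Integrable fun p => sy lam p.1 * f p * κ p := by
  refine hκ.integrable_mul_of_le hf (measurable_sy lam) (C := |lam| + 2 * π) fun τ => ?_
  have hp := Real.pi_pos
  calc ‖sy lam τ‖ ≤ |lam| + 2 * π * |τ| := by
        refine (norm_add_le _ _).trans (le_of_eq ?_)
        rw [norm_mul, norm_I, norm_real, norm_real, mul_one, norm_eq_abs,
          norm_eq_abs, abs_mul, abs_of_pos (by positivity : 0 < 2 * π)]
    _ ≤ _ := by unfold jb; nlinarith [abs_nonneg lam, abs_nonneg τ, mul_nonneg (abs_nonneg lam) (abs_nonneg τ)]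

/-- The weak form of `(∂_t + λ) f = a₁(D) f₁ + a₂(D) f₂ + n`. -/
def Row (lam : ℝ) (f : ℝ² → ℂ) (a₁ : ℝ → ℂ) (f₁ : ℝ² → ℂ) (a₂ : ℝ → ℂ) (f₂ : ℝ² → ℂ)
    (n : ℂ) (κ : ℝ² → ℂ) : Prop :=
  ∫ p, sy lam p.1 * f p * κ p = (∫ p, (a₁ p.2 * f₁ p + a₂ p.2 * f₂ p) * κ p) + n

section

variable {lam : ℝ} {f f₁ f₂ g g₁ g₂ κ : ℝ² → ℂ} {a₁ a₂ : ℝ → ℂ} {n n' : ℂ}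

theorem Tame.sub (hf : Tame f) (hg : Tame g) : Tame fun p => f p - g p := by
  have := hf.add (hg.const_smul (-1))
  simpa [sub_eq_add_neg] using this

theorem Tame.comb (ha₁ : SlowGrowth a₁) (ha₂ : SlowGrowth a₂) (t₁ : Tame f₁) (t₂ : Tame f₂) :
    Tame fun p => a₁ p.2 * f₁ p + a₂ p.2 * f₂ p :=
  (t₁.slow_smul ha₁).add (t₂.slow_smul ha₂)

theorem Row.sub (hκ : IsSym κ) (ha₁ : SlowGrowth a₁) (ha₂ : SlowGrowth a₂) (tf : Tame f)
    (t₁ : Tame f₁) (t₂ : Tame f₂) (tg : Tame g) (s₁ : Tame g₁) (s₂ : Tame g₂)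
    (h : Row lam f a₁ f₁ a₂ f₂ n κ) (h' : Row lam g a₁ g₁ a₂ g₂ n' κ) :
    Row lam (fun p => f p - g p) a₁ (fun p => f₁ p - g₁ p) a₂ (fun p => f₂ p - g₂ p) (n - n') κ := by
  have e1 := integral_sub (hκ.integrable_sy_mul tf lam) (hκ.integrable_sy_mul tg lam)
  have e2 := integral_sub (hκ.integrable_mul (t₁.comb ha₁ ha₂ t₂))
    (hκ.integrable_mul (s₁.comb ha₁ ha₂ s₂))
  rw [h, h', add_sub_add_comm, ← e2] at e1; rw [Row]
  convert e1 using 4 <;> ring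

theorem IsTest.row_iff {T : ℝ} {η η' : 𝓢²} (hη : IsTest T η) (hη' : IsTest T η')
    (h1 : ∀ t, slice t η' = (exp (lam * t) : ℂ) • slice t η)
    (h2 : ∀ t, slice t (∂_{eT} η' - (lam : ℂ) • η') = (exp (lam * t) : ℂ) • slice t (∂_{eT} η))
    (ha₁ : SlowGrowth a₁) (ha₂ : SlowGrowth a₂) (tf : Tame f)
    (t₁ : Tame f₁) (t₂ : Tame f₂) (tg : Tame g) (s₁ : Tame g₁) (s₂ : Tame g₂)
    (e : ∀ t ∈ Ioc 0 T, ∀ᵐ ξ : ℝ, hat f t ξ = exp (lam * t) * hat g t ξ)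
    (e₁ : ∀ t ∈ Ioc 0 T, ∀ᵐ ξ : ℝ, hat f₁ t ξ = exp (lam * t) * hat g₁ t ξ)
    (e₂ : ∀ t ∈ Ioc 0 T, ∀ᵐ ξ : ℝ, hat f₂ t ξ = exp (lam * t) * hat g₂ t ξ) :
    Row 0 f a₁ f₁ a₂ f₂ n (kap η) ↔ Row lam g a₁ g₁ a₂ g₂ n (kap η') := by
  have k1 : ∫ p, sy 0 p.1 * f p * kap η p = ∫ p, sy lam p.1 * g p * kap η' p := by
    rw [← neg_neg (∫ p, sy lam p.1 * g p * kap η' p),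
      ← (hη.integral_kap_exp hη' h1 h2 tf tg e).2, ← integral_neg]
    refine integral_congr fun p => ?_
    simp only [kap_eT, sy]
    push_cast; ring
  have k2 : ∫ p, (a₁ p.2 * f₁ p + a₂ p.2 * f₂ p) * kap η p =
      ∫ p, (a₁ p.2 * g₁ p + a₂ p.2 * g₂ p) * kap η' p := by
    simp_rw [mul_comm _ (kap _ _)]
    refine (hη.integral_kap_exp hη' h1 h2 (t₁.comb ha₁ ha₂ t₂) (s₁.comb ha₁ ha₂ s₂) ?_).1
    intro t ht
    filter_upwards [e₁ t ht, e₂ t ht, (t₁.slow_smul ha₁).hat_add (t₂.slow_smul ha₂),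
      (s₁.slow_smul ha₁).hat_add (s₂.slow_smul ha₂)] with ξ h1 h2 h3 h4
    simp only [smul_eq_mul] at h3 h4
    have h5 := fun (f : ℝ² → ℂ) (a : ℝ → ℂ) => hat_smul a f t ξ
    simp only [smul_eq_mul] at h5; rw [h3, h4, h5, h5, h5, h5, h1, h2]; ring
  rw [Row, Row, k1, k2]

end

/-- The weak form of the equations for the components of the spinor, the scalar field and its time
derivative. -/
def FieldEq (M m lam : ℝ) (fu fv fφ ft : ℝ² → ℂ) (nu nv q : ℂ) (κ : ℝ² → ℂ) : Prop :=
  Row lam fu (fun ξ => -(2 * π * ξ * I)) fu (fun _ => -(I * M)) fv nu κ ∧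
  Row lam fv (fun _ => -(I * M)) fu (fun ξ => 2 * π * ξ * I) fv nv κ ∧
  Row lam fφ (fun _ => 0) fφ (fun _ => 1) ft 0 κ ∧
  Row lam ft (fun ξ => -((2 * π * ξ) ^ 2 + m ^ 2)) fφ (fun _ => 0) ft q κ

theorem slowGrowth_quadratic (c₁ c₂ c₃ : ℂ) : SlowGrowth fun ξ : ℝ => c₁ * ξ ^ 2 + c₂ * ξ + c₃ := by
  refine ⟨by fun_prop, 2, ‖c₁‖ + ‖c₂‖ + ‖c₃‖, fun ξ => ?_⟩
  have h1 : |ξ| ≤ jb ξ := by unfold jb; linarith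
  have h2 := one_le_jb ξ
  rw [Real.rpow_two]
  calc ‖c₁ * ξ ^ 2 + c₂ * ξ + c₃‖ ≤ ‖c₁‖ * |ξ| ^ 2 + ‖c₂‖ * |ξ| + ‖c₃‖ := by
        refine norm_add₃_le.trans (le_of_eq ?_)
        simp
    _ ≤ ‖c₁‖ * jb ξ ^ 2 + ‖c₂‖ * jb ξ ^ 2 + ‖c₃‖ * jb ξ ^ 2 := by
        gcongr
        · nlinarith
        · exact le_mul_of_one_le_right (norm_nonneg _) (by nlinarith)
    _ = _ := by ring

theorem slowGrowth_linear (c : ℂ) : SlowGrowth fun ξ : ℝ => c * ξ := by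
  simpa using slowGrowth_quadratic 0 c 0

theorem slow_coeff₁ : SlowGrowth fun ξ : ℝ => -(2 * π * ξ * I) := by
  convert slowGrowth_linear (-(2 * π * I)) using 2; ring

theorem slow_coeff₂ : SlowGrowth fun ξ : ℝ => 2 * π * ξ * I := by
  convert slowGrowth_linear (2 * π * I) using 2; ring

theorem slow_coeff₃ (m : ℝ) : SlowGrowth fun ξ : ℝ => -((2 * π * ξ) ^ 2 + (m : ℂ) ^ 2) := by
  convert slowGrowth_quadratic (-(2 * π) ^ 2) 0 (-m ^ 2) using 2; ring

section

variable {M m lam : ℝ} {fu fv fφ ft gu gv gφ gt κ : ℝ² → ℂ} {nu nv q nu' nv' q' : ℂ}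

theorem FieldEq.sub (hκ : IsSym κ) (tu : Tame fu) (tv : Tame fv) (tφ : Tame fφ) (tt : Tame ft)
    (su : Tame gu) (sv : Tame gv) (sφ : Tame gφ) (st : Tame gt)
    (h : FieldEq M m lam fu fv fφ ft nu nv q κ) (h' : FieldEq M m lam gu gv gφ gt nu' nv' q' κ) :
    FieldEq M m lam (fun p => fu p - gu p) (fun p => fv p - gv p) (fun p => fφ p - gφ p)
      (fun p => ft p - gt p) (nu - nu') (nv - nv') (q - q') κ :=
  ⟨h.1.sub hκ slow_coeff₁ (.const _) tu tu tv su su sv h'.1,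
    h.2.1.sub hκ (.const _) slow_coeff₂ tv tu tv sv su sv h'.2.1,
    by simpa using h.2.2.1.sub hκ (.const _) (.const _) tφ tφ tt sφ sφ st h'.2.2.1,
    h.2.2.2.sub hκ (slow_coeff₃ m) (.const _) tt tφ tt st sφ st h'.2.2.2⟩

theorem IsTest.fieldEq_iff {T : ℝ} {η η' : 𝓢²} (hη : IsTest T η) (hη' : IsTest T η')
    (h1 : ∀ t, slice t η' = (exp (lam * t) : ℂ) • slice t η)
    (h2 : ∀ t, slice t (∂_{eT} η' - (lam : ℂ) • η') = (exp (lam * t) : ℂ) • slice t (∂_{eT} η))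
    (tu : Tame fu) (tv : Tame fv) (tφ : Tame fφ) (tt : Tame ft)
    (su : Tame gu) (sv : Tame gv) (sφ : Tame gφ) (st : Tame gt)
    (eu : ∀ t ∈ Ioc 0 T, ∀ᵐ ξ : ℝ, hat fu t ξ = exp (lam * t) * hat gu t ξ)
    (ev : ∀ t ∈ Ioc 0 T, ∀ᵐ ξ : ℝ, hat fv t ξ = exp (lam * t) * hat gv t ξ)
    (eφ : ∀ t ∈ Ioc 0 T, ∀ᵐ ξ : ℝ, hat fφ t ξ = exp (lam * t) * hat gφ t ξ)
    (et : ∀ t ∈ Ioc 0 T, ∀ᵐ ξ : ℝ, hat ft t ξ = exp (lam * t) * hat gt t ξ) :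
    FieldEq M m 0 fu fv fφ ft nu nv q (kap η) ↔ FieldEq M m lam gu gv gφ gt nu nv q (kap η') := by
  rw [FieldEq, FieldEq, hη.row_iff hη' h1 h2 slow_coeff₁ (.const _) tu tu tv su su sv eu eu ev,
    hη.row_iff hη' h1 h2 (.const _) slow_coeff₂ tv tu tv sv su sv ev eu ev,
    hη.row_iff hη' h1 h2 (.const _) (.const _) tφ tφ tt sφ sφ st eφ eφ et,
    hη.row_iff hη' h1 h2 (slow_coeff₃ m) (.const _) tt tφ tt st sφ st et eφ et]

end

/-- The time derivative of the scalar field in terms of the half wave. -/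
def phd (f : ℝ² → ℂ) (p : ℝ²) : ℂ := om p.2 * ((f p - refl f p) / (2 * I))

theorem slow_abs : SlowGrowth fun ξ : ℝ => ((2 * π * |ξ| : ℝ) : ℂ) * I := by
  refine ⟨by fun_prop, 1, 2 * π, fun ξ => ?_⟩
  have := Real.pi_pos
  rw [norm_mul, norm_I, norm_real, mul_one, norm_of_nonneg (by positivity), rpow_one]
  unfold jb
  nlinarith [abs_nonneg ξ]

theorem slow_om : SlowGrowth fun ξ : ℝ => (om ξ : ℂ) := by
  refine ⟨measurable_ofReal.comp measurable_om, 1, 8, fun ξ => ?_⟩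
  rw [norm_ofReal_of_nonneg (om_pos ξ).le, rpow_one]
  exact om_le_jb ξ

theorem slow_om_inv : SlowGrowth fun ξ : ℝ => (om ξ : ℂ)⁻¹ := by
  refine ⟨(measurable_ofReal.comp measurable_om).inv, 0, 1, fun ξ => ?_⟩
  rw [norm_inv, norm_ofReal_of_nonneg (om_pos ξ).le, rpow_zero, one_mul]
  exact inv_le_one_of_one_le₀ (one_le_om ξ)

theorem Tame.ph {z : ℝ² → ℂ} (h : Tame z) : Tame (ph z) := by
  have := (h.add h.refl).const_smul (1 / 2)
  refine (congrArg Tame ?_).mp this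
  ext p; simp only [DKG.ph, smul_eq_mul]; ring

theorem Tame.phd {z : ℝ² → ℂ} (h : Tame z) : Tame (phd z) := by
  have := ((h.sub h.refl).const_smul (1 / (2 * I))).slow_smul slow_om
  refine (congrArg Tame ?_).mp this
  ext p; simp only [DKG.phd, smul_eq_mul]; ring

theorem conj_conv_refl (f g κ : ℝ² → ℂ) : conj (conv f g (refl κ)) = conv (refl f) (refl g) κ := by
  have mp := Measure.measurePreserving_neg 𝓛²
  rw [conv, ← integral_conj, ← (mp.prod mp).integral_comp
    ((MeasurableEquiv.neg _).prodCongr (MeasurableEquiv.neg _)).measurableEmbedding, conv]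
  refine integral_congr fun z => ?_
  simp only [refl, map_mul, Complex.conj_conj, Prod.map_fst, Prod.map_snd, neg_add_rev, neg_neg]
  rw [add_comm]

theorem refl_refl (f : ℝ² → ℂ) : refl (refl f) = f := by ext p; simp [refl]

theorem conj_integral_refl {a : ℝ² → ℂ} (z κ : ℝ² → ℂ) :
    conj (∫ p, a p * z p * refl κ p) = ∫ p, refl a p * refl z p * κ p := by
  rw [← integral_conj, ← integral_neg_eq_self]
  refine integral_congr fun p => ?_
  simp only [refl, map_mul, Complex.conj_conj, neg_neg]

theorem wave_of_halfWave {m lam : ℝ} {z : ℝ² → ℂ} (tz : Tame z) {Q : (ℝ² → ℂ) → ℂ}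
    (hQ : ∀ κ, conj (Q (refl κ)) = Q κ)
    (h : ∀ κ, IsSym κ → ∫ p, sy lam (p.1 + hz 1 p.2) * z p * κ p =
      (∫ p, (-(I * (om p.2 - 2 * π * |p.2| : ℝ)) * z p +
        I * (1 - m ^ 2 : ℝ) * (om p.2 : ℂ)⁻¹ * ph z p) * κ p) +
        I * Q (fun p => ((om p.2)⁻¹ : ℂ) * κ p)) {κ : ℝ² → ℂ} (hκ : IsSym κ) :
    Row lam (ph z) (fun _ => 0) (ph z) (fun _ => 1) (phd z) 0 κ ∧
      Row lam (phd z) (fun ξ => -((2 * π * ξ) ^ 2 + m ^ 2)) (ph z) (fun _ => 0) (phd z)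
        (Q κ) κ := by
  have om0 : ∀ ξ, (om ξ : ℂ) ≠ 0 := fun ξ => by exact_mod_cast (om_pos ξ).ne'
  obtain ⟨b, hb⟩ : ∃ b : ℝ² → ℂ, b = fun p => (-I) * ((om p.2 : ℂ) * z p) +
    (I * (1 - m ^ 2 : ℝ)) * ((om p.2 : ℂ)⁻¹ * ph z p) := ⟨_, rfl⟩
  have tb : Tame b := hb ▸ ((tz.slow_smul slow_om).const_smul _).add
    ((tz.ph.slow_smul slow_om_inv).const_smul _)
  have h1 : ∀ κ, IsSym κ → ∫ p, sy lam p.1 * z p * κ p = (∫ p, b p * κ p) +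
      I * Q (fun p => ((om p.2)⁻¹ : ℂ) * κ p) := by
    intro κ hκ
    have t1 := tz.slow_smul slow_abs
    have e := h κ hκ
    have e1 : ∫ p, sy lam (p.1 + hz 1 p.2) * z p * κ p = (∫ p, sy lam p.1 * z p * κ p) +
        ∫ p, (((2 * π * |p.2| : ℝ) : ℂ) * I) • z p * κ p := by
      rw [← integral_add (hκ.integrable_sy_mul tz lam) (hκ.integrable_mul t1)]
      refine integral_congr fun p => ?_
      simp only [sy, hz, smul_eq_mul]
      push_cast; ring
    have e2 : ∫ p, (-(I * (om p.2 - 2 * π * |p.2| : ℝ)) * z p +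
        I * (1 - m ^ 2 : ℝ) * (om p.2 : ℂ)⁻¹ * ph z p) * κ p = (∫ p, b p * κ p) +
        ∫ p, (((2 * π * |p.2| : ℝ) : ℂ) * I) • z p * κ p := by
      rw [← integral_add (hκ.integrable_mul tb) (hκ.integrable_mul t1)]
      refine integral_congr fun p => ?_
      simp only [hb, smul_eq_mul]
      push_cast; ring
    rw [e1, e2] at e
    linear_combination e
  have h2 : ∀ κ, IsSym κ → ∫ p, sy lam p.1 * refl z p * κ p = (∫ p, refl b p * κ p) -
      I * Q (fun p => ((om p.2)⁻¹ : ℂ) * κ p) := by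
    intro κ hκ
    have e := congrArg (conj) (h1 (refl κ) hκ.refl)
    have e3 := conj_integral_refl (a := fun _ => 1) b κ
    have e4 := conj_integral_refl (a := fun p => sy lam p.1) z κ
    have r1 : refl (fun p => sy lam p.1) = fun p => sy lam p.1 := by
      ext p
      simp only [refl, sy, map_add, map_mul, conj_ofReal, conj_I, Prod.fst_neg]
      push_cast; ring
    have r2 : (fun p => ((om p.2)⁻¹ : ℂ) * refl κ p) =
        refl fun p => ((om p.2)⁻¹ : ℂ) * κ p := by
      ext p; simp [refl, om_neg]
    simp only [refl, map_one, one_mul] at e3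
    rw [map_add, map_mul, e4, r1, conj_I, r2, hQ] at e
    simp only [refl] at e ⊢; rw [e, e3]; ring
  have hb' : ∀ p, refl b p = I * ((om p.2 : ℂ) * refl z p) -
      (I * (1 - m ^ 2 : ℝ)) * ((om p.2 : ℂ)⁻¹ * ph z p) := by
    intro p
    simp only [hb, refl, ph, map_add, map_mul, map_neg, conj_I, conj_ofReal,
      map_inv₀, map_div₀, Prod.snd_neg, om_neg, neg_neg, Complex.conj_conj, map_ofNat]
    ring
  constructor
  · have e1 := h1 κ hκ
    have e2 := h2 κ hκ
    have l : ∫ p, sy lam p.1 * ph z p * κ p =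
        ((∫ p, sy lam p.1 * z p * κ p) + ∫ p, sy lam p.1 * refl z p * κ p) / 2 := by
      rw [← integral_add (hκ.integrable_sy_mul tz lam) (hκ.integrable_sy_mul tz.refl lam),
        ← integral_div]
      refine integral_congr fun p => ?_
      simp only [ph]; ring
    have r : ∫ p, (0 * ph z p + 1 * phd z p) * κ p =
        ((∫ p, b p * κ p) + ∫ p, refl b p * κ p) / 2 := by
      rw [← integral_add (hκ.integrable_mul tb) (hκ.integrable_mul tb.refl), ← integral_div]
      refine integral_congr fun p => ?_
      simp only [hb', phd]; rw [hb]
      have hI : ∀ x, x / (2 * I) = -(I / 2) * x := fun x => by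
        rw [div_eq_iff (by simp)]
        linear_combination x * I_sq
      simp only [hI]; ring
    rw [Row, l, r, e1, e2]; ring
  · have hκ' : IsSym fun p => (om p.2 : ℂ) * κ p := by
      obtain ⟨mo, N, C, hC⟩ := slow_om
      exact hκ.mul_left mo hC
    have e1 := h1 _ hκ'
    have e2 := h2 _ hκ'
    have c : (fun p => ((om p.2)⁻¹ : ℂ) * ((om p.2 : ℂ) * κ p)) = κ := by
      ext p; rw [← mul_assoc, inv_mul_cancel₀ (om0 _), one_mul]
    rw [c] at e1 e2
    have l : ∫ p, sy lam p.1 * phd z p * κ p = ((∫ p, sy lam p.1 * z p * ((om p.2 : ℂ) * κ p)) -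
          ∫ p, sy lam p.1 * refl z p * ((om p.2 : ℂ) * κ p)) / (2 * I) := by
      rw [← integral_sub (hκ'.integrable_sy_mul tz lam) (hκ'.integrable_sy_mul tz.refl lam),
        ← integral_div]
      refine integral_congr fun p => ?_
      simp only [phd]; ring
    have r : ∫ p, (-((2 * π * p.2) ^ 2 + (m : ℂ) ^ 2) * ph z p + 0 * phd z p) * κ p =
        ((∫ p, b p * ((om p.2 : ℂ) * κ p)) - ∫ p, refl b p * ((om p.2 : ℂ) * κ p)) /
          (2 * I) := by
      rw [← integral_sub (hκ'.integrable_mul tb) (hκ'.integrable_mul tb.refl), ← integral_div]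
      refine integral_congr fun p => ?_
      have h3 : (om p.2 : ℂ) ^ 2 = 1 + (2 * π * p.2) ^ 2 := by exact_mod_cast om_sq p.2
      have h4 := om0 p.2
      simp only [hb']; rw [hb]
      rw [show ((2 * π * p.2) ^ 2 : ℂ) = om p.2 ^ 2 - 1 by rw [h3]; ring]
      simp only [ph]; field_simp
      push_cast; ring
    rw [Row, l, r, e1, e2]; field_simp; ring

theorem conj_quad_refl (f g κ : ℝ² → ℂ) : conj (quad f g (refl κ)) = quad f g κ := by
  rw [quad, map_add, conj_conv_refl, conj_conv_refl, refl_refl, refl_refl, quad, add_comm]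

theorem row_of_fst {lam s : ℝ} {f f' κ : ℝ² → ℂ} {M : ℝ} {n : ℂ} (hκ : IsSym κ) (tf : Tame f)
    (tf' : Tame f') (h : ∫ p, sy lam (p.1 + hu s p.2) * f p * κ p =
      -(I * M) * (∫ p, f' p * κ p) + n) :
    Row lam f (fun ξ => -(2 * π * s * I) * ξ) f (fun _ => -(I * M)) f' n κ := by
  have t1 := tf.slow_smul (slowGrowth_linear (2 * π * s * I))
  have t2 := tf'.const_smul (I * M)
  have e : ∫ p, sy lam (p.1 + hu s p.2) * f p * κ p = (∫ p, sy lam p.1 * f p * κ p) +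
      ∫ p, (2 * π * s * I * p.2) • f p * κ p := by
    rw [← integral_add (hκ.integrable_sy_mul tf lam) (hκ.integrable_mul t1)]
    refine integral_congr fun p => ?_
    simp only [sy, hu, smul_eq_mul]
    push_cast; ring
  have t1' := tf.slow_smul (slowGrowth_linear (-(2 * π * s * I)))
  have e' : ∫ p, (-(2 * π * s * I) * p.2 * f p + -(I * M) * f' p) * κ p =
      (∫ p, (-(2 * π * s * I) * p.2) • f p * κ p) - ∫ p, (I * M) • f' p * κ p := by
    rw [← integral_sub (hκ.integrable_mul t1') (hκ.integrable_mul t2)]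
    refine integral_congr fun p => ?_
    simp only [smul_eq_mul]; ring
  rw [e] at h; rw [Row, e']
  simp only [smul_eq_mul, mul_assoc] at h ⊢
  simp only [integral_const_mul] at h ⊢
  linear_combination h

/-- The weak form of the system in terms of the scalar field and its time derivative. -/
abbrev FE (M m lam : ℝ) (X : T3) (n : ℂ × ℂ × ℂ) (κ : ℝ² → ℂ) : Prop :=
  FieldEq M m lam X.1 X.2.1 (ph X.2.2) (phd X.2.2) n.1 n.2.1 n.2.2 κ

def Tame3 (X : T3) : Prop := Tame X.1 ∧ Tame X.2.1 ∧ Tame X.2.2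

theorem tame_dn {l k b lam : ℝ} (hb : 1 / 2 < b) (hl : 1 ≤ lam) (F : E3) : Tame3 (dn l k b lam F) :=
  ⟨tame_den hb hl (measurable_hu 1) F.1, tame_den hb hl (measurable_hu (-1)) F.2.1,
    tame_den hb hl (measurable_hz 1) F.2.2⟩

theorem Tame3.sub {X Y : T3} (h : Tame3 X) (h' : Tame3 Y) : Tame3 (X - Y) :=
  ⟨h.1.sub h'.1, h.2.1.sub h'.2.1, h.2.2.sub h'.2.2⟩

theorem refl_sub (f g : ℝ² → ℂ) : refl (f - g) = refl f - refl g := by ext p; simp [refl]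

theorem ph_sub (f g : ℝ² → ℂ) : ph (f - g) = ph f - ph g := by
  ext p; simp only [ph, refl_sub, Pi.sub_apply]; ring

theorem phd_sub (f g : ℝ² → ℂ) : phd (f - g) = phd f - phd g := by
  ext p; simp only [phd, refl_sub, Pi.sub_apply]; ring

theorem FE.sub {M m lam : ℝ} {X Y : T3} {n n' : ℂ × ℂ × ℂ} {κ : ℝ² → ℂ} (hκ : IsSym κ)
    (tX : Tame3 X) (tY : Tame3 Y) (h : FE M m lam X n κ) (h' : FE M m lam Y n' κ) :
    FE M m lam (X - Y) (n - n') κ := by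
  have := FieldEq.sub hκ tX.1 tX.2.1 tX.2.2.ph tX.2.2.phd tY.1 tY.2.1 tY.2.2.ph tY.2.2.phd h h'
  rw [FE, Prod.snd_sub, Prod.snd_sub, ph_sub, phd_sub]
  exact this

theorem HalfWave.fieldEq {M m lam : ℝ} {X : T3} (tX : Tame3 X) {n : (ℝ² → ℂ) → ℂ × ℂ × ℂ}
    (hn : ∀ κ, conj (n (refl κ)).2.2 = (n κ).2.2)
    (h : ∀ κ, IsSym κ → HalfWave M m lam X n κ) {κ : ℝ² → ℂ} (hκ : IsSym κ) :
    FE M m lam X (n κ) κ := by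
  obtain ⟨h1, h2, -⟩ := h κ hκ
  refine ⟨?_, ?_, wave_of_halfWave tX.2.2 (Q := fun κ => (n κ).2.2) hn (fun κ hκ => (h κ hκ).2.2) hκ⟩
  · have := row_of_fst hκ tX.1 tX.2.1 h1
    convert this using 2
    push_cast; ring
  · have := row_of_fst hκ tX.2.1 tX.1 h2
    rw [Row] at this ⊢; rw [this]; congr 1
    refine integral_congr fun p => ?_
    push_cast; ring

theorem exists_mollifier : ∃ ρ : 𝓢(ℝ, ℂ), ∫ x, ρ x = 1 := by
  let b : ContDiffBump (0 : ℝ) := ⟨1, 2, one_pos, one_lt_two⟩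
  have h1 : HasCompactSupport fun x : ℝ => ((b.normed volume x : ℝ) : ℂ) :=
    b.hasCompactSupport_normed.comp_left (g := fun x : ℝ => (x : ℂ)) rfl
  have h2 : ContDiff ℝ (⊤ : ℕ∞) fun x : ℝ => ((b.normed volume x : ℝ) : ℂ) :=
    ofRealCLM.contDiff.comp b.contDiff_normed
  refine ⟨h1.toSchwartzMap h2, ?_⟩
  have : ∫ x : ℝ, ((b.normed volume x : ℝ) : ℂ) = ((∫ x, b.normed volume x : ℝ) : ℂ) :=
    integral_ofReal
  rw [b.integral_normed, ofReal_one] at this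
  exact this

section

variable {α β : Matrix (Fin 2) (Fin 2) ℂ} {e e' : Spinor} {T M m g : ℝ} {η : 𝓢²}
  {fu fv fφ ft : ℝ² → ℂ} {ψ : ℝ → 𝓢'(ℝ, Spinor)} {φ φt : ℝ → 𝓢'(ℝ, ℂ)}

theorem Tame.integrable_kap_mul {f : ℝ² → ℂ} (hf : Tame f) (η : 𝓢²) :
    Integrable fun p => kap η p * f p := hf.integrable_kap_smul η

theorem pair_spinor (hT : 0 ≤ T) (hη : IsTest T η) (tu : Tame fu) (tv : Tame fv)
    (hψ : ∀ t ∈ Icc 0 T, HasFourierDensity (ψ t) fun ξ => hat fu t ξ • e + hat fv t ξ • e') :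
    pair T ψ η = (∫ p, kap η p * fu p) • e + (∫ p, kap η p * fv p) • e' := by
  have h1 := tu.smul_const e
  have h2 := tv.smul_const e'
  rw [hη.pair_eq hT (h1.add h2) fun t ht => (hψ t ⟨ht.1.le, ht.2⟩).congr ?_,
    ← integral_smul_const, ← integral_smul_const,
    ← integral_add ((tu.integrable_kap_mul η).smul_const e)
      ((tv.integrable_kap_mul η).smul_const e')]
  · simp only [smul_add, smul_smul]
  · filter_upwards [h1.hat_add h2] with ξ hξ
    rw [hξ, hat_smul_const, hat_smul_const]

theorem integral_kap_eT (f : ℝ² → ℂ) :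
    ∫ p, sy 0 p.1 * f p * kap η p = -∫ p, kap (∂_{eT} η) p * f p := by
  rw [← integral_neg]
  refine integral_congr fun p => ?_
  simp only [kap_eT, sy]
  push_cast; ring

theorem row_kap_iff {a₁ a₂ : ℝ → ℂ} (ha₁ : SlowGrowth a₁) (ha₂ : SlowGrowth a₂) {f f₁ f₂ : ℝ² → ℂ}
    (t₁ : Tame f₁) (t₂ : Tame f₂) {n : ℂ} (hη : IsTest T η) :
    Row 0 f a₁ f₁ a₂ f₂ n (kap η) ↔ -(∫ p, kap (∂_{eT} η) p * f p) =
      (∫ p, a₁ p.2 * kap η p * f₁ p) + (∫ p, a₂ p.2 * kap η p * f₂ p) + n := by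
  rw [Row, integral_kap_eT]
  have h1 := hη.isSym.integrable_mul (t₁.slow_smul ha₁)
  have h2 := hη.isSym.integrable_mul (t₂.slow_smul ha₂)
  have := integral_add h1 h2
  simp only [smul_eq_mul] at this
  simp only [add_mul, this, mul_right_comm _ (kap η _) _]

theorem dirac_iff (hb : DiracBasis α β e e') (hT : 0 ≤ T) (hη : IsTest T η) (tu : Tame fu)
    (tv : Tame fv)
    (hψ : ∀ t ∈ Icc 0 T, HasFourierDensity (ψ t) fun ξ => hat fu t ξ • e + hat fv t ξ • e')
    (A B : ℂ) :
    (g : ℂ) • (A • e + B • e') = I • act β (pair T ψ (∂_{eT} η)) -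
        I • act (α * β) (pair T ψ (∂_{eX} η)) + (M : ℂ) • pair T ψ η ↔
      Row 0 fu (fun ξ => -(2 * π * ξ * I)) fu (fun _ => -(I * M)) fv
          (I * g * B) (kap η) ∧
        Row 0 fv (fun _ => -(I * M)) fu (fun ξ => 2 * π * ξ * I) fv
          (I * g * A) (kap η) := by
  have I2 := I_sq
  rw [pair_spinor hT hη tu tv hψ, pair_spinor hT (hη.lineDeriv eT) tu tv hψ,
    pair_spinor hT (hη.lineDeriv eX) tu tv hψ, hb.act_beta, hb.act_alpha_beta,
    row_kap_iff slow_coeff₁ (.const _) tu tv hη, row_kap_iff (.const _) slow_coeff₂ tu tv hη]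
  have x : ∀ f : ℝ² → ℂ, ∫ p, 2 * π * (p.2 : ℂ) * I * kap η p * f p =
      -∫ p, kap (∂_{eX} η) p * f p := by
    intro f; rw [← integral_neg]
    refine integral_congr fun p => ?_
    simp only [kap_eX]; ring
  have y : ∀ f : ℝ² → ℂ, ∫ p, -(I * M) * kap η p * f p =
      -(I * M) * ∫ p, kap η p * f p := fun f => by
    simp only [mul_assoc _ (kap η _), integral_const_mul]
  have x' : ∀ f : ℝ² → ℂ, ∫ p, -(2 * π * (p.2 : ℂ) * I) * kap η p * f p =
      ∫ p, kap (∂_{eX} η) p * f p := fun f => by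
    simp only [neg_mul, integral_neg, x, neg_neg]
  rw [x, x', y, y]
  generalize (∫ p, kap η p * fu p) = U
  generalize (∫ p, kap η p * fv p) = V
  generalize (∫ p, kap (∂_{eT} η) p * fu p) = Ut
  generalize (∫ p, kap (∂_{eT} η) p * fv p) = Vt
  generalize (∫ p, kap (∂_{eX} η) p * fu p) = Ux
  generalize (∫ p, kap (∂_{eX} η) p * fv p) = Vx
  have eR : I • (Vt • e + Ut • e') - I • (Vx • e + (-Ux) • e') +
      (M : ℂ) • (U • e + V • e') = (I * Vt - I * Vx + M * U) • e +
        (I * Ut + I * Ux + M * V) • e' := by module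
  have eL : (g : ℂ) • (A • e + B • e') = (g * A) • e + (g * B) • e' := by module
  rw [eR, eL]
  constructor
  · intro h
    have h1 := congrArg (inner ℂ e) h
    have h2 := congrArg (inner ℂ e') h
    rw [hb.inner_fst, hb.inner_fst] at h1
    rw [hb.inner_snd, hb.inner_snd] at h2
    constructor
    · linear_combination -I * h2 - (Ut + Ux) * I2
    · linear_combination -I * h1 - (Vt - Vx) * I2
  · rintro ⟨h1, h2⟩
    congr 2
    · linear_combination I * h2 + (g * A - M * U) * I2
    · linear_combination I * h1 + (g * B - M * V) * I2

theorem deriv_iff (hT : 0 ≤ T) (hη : IsTest T η) (tφ : Tame fφ) (tt : Tame ft)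
    (hφ : ∀ t ∈ Icc 0 T, HasFourierDensity (φ t) (hat fφ t))
    (hφt : ∀ t ∈ Icc 0 T, HasFourierDensity (φt t) (hat ft t)) :
    pair T φ (∂_{eT} η) = -pair T φt η ↔ Row 0 fφ (fun _ => 0) fφ (fun _ => 1) ft 0 (kap η) := by
  rw [row_kap_iff (.const _) (.const _) tφ tt hη,
    (hη.lineDeriv eT).pair_eq hT tφ fun t ht => hφ t ⟨ht.1.le, ht.2⟩,
    hη.pair_eq hT tt fun t ht => hφt t ⟨ht.1.le, ht.2⟩]
  simp only [smul_eq_mul, zero_mul, one_mul, integral_zero, zero_add, add_zero, neg_eq_iff_eq_neg]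

theorem kleinGordon_iff (hT : 0 ≤ T) (hη : IsTest T η) (tφ : Tame fφ) (tt : Tame ft)
    (hφ : ∀ t ∈ Icc 0 T, HasFourierDensity (φ t) (hat fφ t))
    (hφt : ∀ t ∈ Icc 0 T, HasFourierDensity (φt t) (hat ft t))
    (h : ∀ η, IsTest T η → pair T φ (∂_{eT} η) = -pair T φt η) (q : ℂ) :
    q = pair T φ (∂_{eT} (∂_{eT} η)) - pair T φ (∂_{eX} (∂_{eX} η)) + (m : ℂ) ^ 2 * pair T φ η ↔
      Row 0 ft (fun ξ => -((2 * π * ξ) ^ 2 + m ^ 2)) fφ (fun _ => 0) ft q (kap η) := by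
  rw [h _ (hη.lineDeriv eT), row_kap_iff (slow_coeff₃ m) (.const _) tφ tt hη,
    (hη.lineDeriv eT).pair_eq hT tt fun t ht => hφt t ⟨ht.1.le, ht.2⟩,
    ((hη.lineDeriv eX).lineDeriv eX).pair_eq hT tφ fun t ht => hφ t ⟨ht.1.le, ht.2⟩,
    hη.pair_eq hT tφ fun t ht => hφ t ⟨ht.1.le, ht.2⟩]
  have e : ∫ p, -((2 * π * (p.2 : ℂ)) ^ 2 + (m : ℂ) ^ 2) * kap η p * fφ p =
      (∫ p, kap (∂_{eX} (∂_{eX} η)) p * fφ p) - m ^ 2 * ∫ p, kap η p * fφ p := by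
    rw [← integral_const_mul, ← integral_sub (tφ.integrable_kap_mul _)
      ((tφ.integrable_kap_mul η).const_mul ((m : ℂ) ^ 2))]
    refine integral_congr fun p => ?_
    simp only [kap_eX]
    linear_combination (2 * π * p.2 : ℂ) ^ 2 * kap η p * fφ p * (-I_sq)
  rw [e]
  simp only [ zero_mul, integral_zero, add_zero]
  constructor <;> intro h <;> linear_combination -h

theorem equations_iff (hb : DiracBasis α β e e') (hT : 0 ≤ T) (tu : Tame fu)
    (tv : Tame fv) (tφ : Tame fφ) (tt : Tame ft)
    (hψ : ∀ t ∈ Icc 0 T, HasFourierDensity (ψ t) fun ξ => hat fu t ξ • e + hat fv t ξ • e')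
    (hφ : ∀ t ∈ Icc 0 T, HasFourierDensity (φ t) (hat fφ t))
    (hφt : ∀ t ∈ Icc 0 T, HasFourierDensity (φt t) (hat ft t))
    (c : ∀ κ, IsSym κ → ConvInt fφ fv κ ∧ ConvInt fφ fu κ ∧ ConvInt fu (refl fv) κ ∧
      ConvInt (refl fu) fv κ) :
    ((∀ ρ : 𝓢(ℝ, ℂ), ∫ x, ρ x = 1 → ∀ η, IsTest T η →
        Tendsto (fun ε => (g : ℂ) • yukawa T φ ψ ρ ε η) (𝓝[>] 0)
          (𝓝 (I • act β (pair T ψ (∂_{eT} η)) -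
            I • act (α * β) (pair T ψ (∂_{eX} η)) + (M : ℂ) • pair T ψ η))) ∧
      (∀ η, IsTest T η → pair T φ (∂_{eT} η) = -pair T φt η) ∧
      ∀ ρ : 𝓢(ℝ, ℂ), ∫ x, ρ x = 1 → ∀ η, IsTest T η →
        Tendsto (fun ε => density β T ψ ρ ε η) (𝓝[>] 0)
          (𝓝 (pair T φ (∂_{eT} (∂_{eT} η)) - pair T φ (∂_{eX} (∂_{eX} η)) +
            (m : ℂ) ^ 2 * pair T φ η))) ↔
      ∀ η, IsTest T η → FieldEq M m 0 fu fv fφ ft (I * g * conv fφ fv (kap η))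
        (I * g * conv fφ fu (kap η)) (quad fu fv (kap η)) (kap η) := by
  constructor
  · rintro ⟨h1, h2, h3⟩ η hη
    obtain ⟨ρ, hρ⟩ := exists_mollifier
    obtain ⟨c2, c1, c3, c4⟩ := c _ hη.isSym
    have k1 := tendsto_nhds_unique ((tendsto_yukawa hT hη hρ tu tv tφ hψ hφ c1 c2).const_smul (g : ℂ))
      (h1 ρ hρ η hη)
    have k2 := tendsto_nhds_unique (tendsto_density hb hT hη hρ tu tv hψ c3 c4) (h3 ρ hρ η hη)
    have k3 := (dirac_iff hb hT hη tu tv hψ _ _).1 k1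
    exact ⟨k3.1, k3.2, (deriv_iff hT hη tφ tt hφ hφt).1 (h2 η hη),
      (kleinGordon_iff hT hη tφ tt hφ hφt h2 _).1 k2⟩
  · intro h
    have h2 : ∀ η, IsTest T η → pair T φ (∂_{eT} η) = -pair T φt η := fun η hη =>
      (deriv_iff hT hη tφ tt hφ hφt).2 (h η hη).2.2.1
    refine ⟨fun ρ hρ η hη => ?_, h2, fun ρ hρ η hη => ?_⟩
    all_goals obtain ⟨c2, c1, c3, c4⟩ := c _ hη.isSym
    · rw [← (dirac_iff hb hT hη tu tv hψ (conv fφ fu (kap η)) (conv fφ fv (kap η))).2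
        ⟨(h η hη).1, (h η hη).2.1⟩]
      exact (tendsto_yukawa hT hη hρ tu tv tφ hψ hφ c1 c2).const_smul (g : ℂ)
    · rw [← (kleinGordon_iff hT hη tφ tt hφ hφt h2 _).2 (h η hη).2.2.2]
      exact tendsto_density hb hT hη hρ tu tv hψ c3 c4

end

/-- The complex conjugate of a Schwartz function. -/
def conjS (χ : 𝓢(ℝ, ℂ)) : 𝓢(ℝ, ℂ) :=
  SchwartzMap.postcompCLM (𝕜 := ℝ) (Complex.conjCLE : ℂ →L[ℝ] ℂ) χ

theorem conjS_apply (χ : 𝓢(ℝ, ℂ)) (x : ℝ) : conjS χ x = conj (χ x) := rfl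

theorem fourierInv_conjS (χ : 𝓢(ℝ, ℂ)) (ξ : ℝ) : 𝓕⁻ (conjS χ) ξ = conj (𝓕⁻ χ (-ξ)) := by
  rw [SchwartzMap.fourierInv_coe, SchwartzMap.fourierInv_coe, fourierInv_eq_ex, fourierInv_eq_ex,
    ← integral_conj]
  refine integral_congr fun x => ?_
  simp only [conjS_apply, map_mul, smul_eq_mul, conj_ex]
  congr 2; ring

/-- Hermitian functions. -/
def Herm (f : ℝ → ℂ) : Prop := ∀ᵐ ξ : ℝ, f (-ξ) = conj (f ξ)

theorem IsReal.of_herm {u : 𝓢'(ℝ, ℂ)} {f : ℝ → ℂ} (h : HasFourierDensity u f) (hf : Herm f) :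
    IsReal u := by
  intro χ hχ
  have e : conjS χ = χ := by ext x; rw [conjS_apply, Complex.conj_eq_iff_im]; exact hχ x
  rw [← Complex.conj_eq_iff_im, (h.apply χ).2, ← integral_conj, ← integral_neg_eq_self]
  refine integral_congr_ae ?_
  filter_upwards [hf] with ξ hξ
  simp only [smul_eq_mul, map_mul, hξ, Complex.conj_conj]; rw [← fourierInv_conjS, e]

theorem IsReal.apply_conjS {u : 𝓢'(ℝ, ℂ)} (hu : IsReal u) (χ : 𝓢(ℝ, ℂ)) :
    conj (u (conjS χ)) = u χ := by
  have h1 := hu (χ + conjS χ) fun x => by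
    rw [add_apply, conjS_apply, Complex.add_conj, ofReal_im]
  have h2 := hu (I • (χ - conjS χ)) fun x => by simp [conjS_apply]
  rw [← Complex.conj_eq_iff_im, map_add, map_add] at h1
  rw [← Complex.conj_eq_iff_im, map_smul, map_sub, smul_eq_mul, map_mul, map_sub, conj_I] at h2
  have h3 : u χ - u (conjS χ) = -(conj (u χ) - conj (u (conjS χ))) := by
    apply mul_left_cancel₀ Complex.I_ne_zero
    linear_combination -h2
  linear_combination (1 / 2 : ℂ) * h1 - (1 / 2 : ℂ) * h3

theorem IsReal.herm {u : 𝓢'(ℝ, ℂ)} (hu : IsReal u) {f : ℝ → ℂ} (h : HasFourierDensity u f) :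
    Herm f := by
  have mp := Measure.measurePreserving_neg 𝓛¹
  have key : HasFourierDensity u fun ξ => conj (f (-ξ)) := by
    refine ⟨continuous_conj.comp_aestronglyMeasurable
      (h.1.comp_measurePreserving mp), fun η => ?_⟩
    have h1 := h.apply (conjS (𝓕 η))
    have e : ∀ ξ, 𝓕⁻ (conjS (𝓕 η)) ξ = conj (η (-ξ)) := fun ξ => by
      rw [fourierInv_conjS, FourierTransform.fourierInv_fourier_eq]
    simp only [e] at h1
    constructor
    · have h2 : Integrable fun ξ => conj (conj (η (- -ξ)) • f (-ξ)) :=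
        Complex.conjCLE.integrable_comp_iff.2 (mp.integrable_comp_of_integrable h1.1)
      refine h2.congr (.of_forall fun ξ => ?_)
      simp [smul_eq_mul]
    · have h2 := congrArg (conj) h1.2
      rw [hu.apply_conjS, ← integral_conj, ← integral_neg_eq_self] at h2
      refine (show (𝓕 u) η = u (𝓕 η) from rfl).trans (h2.trans ?_)
      refine integral_congr fun ξ => ?_
      simp [smul_eq_mul]
  filter_upwards [h.unique key] with ξ hξ
  rw [hξ, Complex.conj_conj]

theorem exists_data {F : Type*} [NormedAddCommGroup F] [NormedSpace ℂ F] {s s' C : ℝ} (hC : 0 ≤ C)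
    {f : ℝ → F} {g : ℝ → ℂ} (hg : AEStronglyMeasurable g volume)
    (hf : MemLp (fun ξ => (sw s ξ : ℂ) • f ξ) 2 volume)
    (hle : ∀ ξ, jb ξ ^ s' * ‖g ξ‖ ≤ C * (sw s ξ * ‖f ξ‖)) :
    ∃ c : L2 ℝ, (c =ᵐ[volume] fun ξ => jc ξ s' * g ξ) ∧
      ‖c‖ ≤ C * (eLpNorm (fun ξ => (sw s ξ : ℂ) • f ξ) 2 volume).toReal := by
  have mj : Continuous fun ξ => jc ξ s' := Complex.continuous_ofReal.comp
      ((by unfold jb; fun_prop : Continuous jb).rpow_const fun ξ => .inl (jb_pos _).ne')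
  have hm : AEStronglyMeasurable (fun ξ => jc ξ s' * g ξ) volume := mj.aestronglyMeasurable.mul hg
  have hb : ∀ᵐ ξ : ℝ, ‖jc ξ s' * g ξ‖ ≤ C * ‖(sw s ξ : ℂ) • f ξ‖ := .of_forall fun ξ => by
      rw [norm_mul, norm_smul, norm_real, norm_real,
        norm_of_nonneg (jb_rpow_nonneg ξ _), norm_of_nonneg (sw_pos s ξ).le]
      exact hle ξ
  have hc := hf.of_le_mul hm hb
  refine ⟨hc.toLp _, hc.coeFn_toLp, ?_⟩
  rw [Lp.norm_toLp]
  have h2 := eLpNorm_le_mul_eLpNorm_of_ae_le_mul hb 2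
  have h3 := toReal_mono (mul_ne_top ofReal_ne_top hf.2.ne) h2
  rwa [ENNReal.toReal_mul, ENNReal.toReal_ofReal hC] at h3

theorem SobCurve.continuousInSobolev {F : Type*} [NormedAddCommGroup F] [InnerProductSpace ℂ F]
    [CompleteSpace F] {s T : ℝ} {f : ℝ² → F} (tf : Tame f) (hf : SobCurve s f)
    {u : ℝ → 𝓢'(ℝ, F)} (hu : ∀ t, HasFourierDensity (u t) (hat f t)) :
    ContinuousInSobolev s T u := by
  obtain ⟨C, hC0, hC⟩ := exists_sw_le s
  have msw : Continuous fun ξ => (sw s ξ : ℂ) := (sw_temperate s).1.continuous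
  have hb : ∀ (g : ℝ → F) (ξ : ℝ), ‖(sw s ξ : ℂ) • g ξ‖ ≤ C * ‖jc ξ s • g ξ‖ := by
    intro g ξ
    rw [norm_smul, norm_smul, norm_real, norm_real,
        norm_of_nonneg (jb_rpow_nonneg ξ _), norm_of_nonneg (sw_pos s ξ).le,
        ← mul_assoc]
    have := (hC ξ).1
    gcongr
  have mh : ∀ t, MemLp (fun ξ => (sw s ξ : ℂ) • hat f t ξ) 2 volume := fun t =>
    (hf.1 t).of_le_mul (msw.aestronglyMeasurable.smul (tf.aestronglyMeasurable_hat t))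
      (.of_forall (hb _))
  refine ⟨fun t _ => (sobolevENorm_le (hu t) (mh t)).1, fun t₀ _ => ?_⟩
  have h1 := (ENNReal.Tendsto.const_mul (a := ofReal C) (hf.2 t₀)
    (.inr ofReal_ne_top)).mono_left (nhdsWithin_le_nhds (s := Icc 0 T))
  rw [mul_zero] at h1
  refine tendsto_of_tendsto_of_tendsto_of_le_of_le tendsto_const_nhds h1 (fun _ => zero_le)
    fun t => ?_
  have m2 : MemLp (fun ξ => (sw s ξ : ℂ) • (hat f t ξ - hat f t₀ ξ)) 2 volume := by
    simp only [smul_sub]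
    exact (mh t).sub (mh t₀)
  exact (sobolevENorm_le ((hu t).sub (hu t₀)) m2).2.trans
    (eLpNorm_le_mul_eLpNorm_of_ae_le_mul (.of_forall (hb _)) 2)

theorem SobCurve.refl {s : ℝ} {f : ℝ² → ℂ} (hf : SobCurve s f) : SobCurve s (refl f) := by
  have mp := Measure.measurePreserving_neg 𝓛¹
  have e : ∀ g : ℝ → ℂ, (fun ξ => jc ξ s • conj (g (-ξ))) =
      fun ξ => conj ((fun ξ => jc ξ s • g ξ) (-ξ)) := fun g => by
    ext ξ; simp [jb_neg]
  constructor
  · intro t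
    simp only [hat_refl]; rw [e]
    exact ((hf.1 t).comp_measurePreserving mp).star
  · intro t₀
    refine (hf.2 t₀).congr fun t => ?_
    simp only [hat_refl, ← map_sub]
    have h1 : AEStronglyMeasurable (fun ξ => jc ξ s • (hat f t ξ - hat f t₀ ξ))
        volume := by
      simp only [smul_sub]
      exact (hf.1 t).1.sub (hf.1 t₀).1
    rw [e fun ξ => hat f t ξ - hat f t₀ ξ, ← eLpNorm_comp_measurePreserving h1 mp]
    exact eLpNorm_congr_norm_ae (.of_forall fun ξ => (RCLike.norm_conj _).symm)

theorem SobCurve.ph {s : ℝ} {f : ℝ² → ℂ} (tf : Tame f) (hf : SobCurve s f) : SobCurve s (ph f) := by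
  have e : ∀ᵐ ξ : ℝ, ∀ t, hat (DKG.ph f) t ξ = 1 / 2 * (hat f t ξ + hat (DKG.refl f) t ξ) := by
    filter_upwards [tf.hat_add tf.refl] with ξ hξ t
    rw [← hξ, ← smul_eq_mul, ← hat_smul (fun _ => 1 / 2)]; congr 1; ext p
    simp only [DKG.ph, smul_eq_mul]; ring
  refine (hf.add hf.refl tf tf.refl).of_le (C := 1) tf.ph (fun t => ?_) fun t t' => ?_
  all_goals
    filter_upwards [e, tf.hat_add tf.refl] with ξ h1 h2
    simp only [h1, h2, ← mul_sub, norm_mul, one_mul]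
    have := jb_rpow_nonneg ξ s
    gcongr
    refine mul_le_of_le_one_left (norm_nonneg _) (by norm_num)

theorem SobCurve.phd {s : ℝ} {f : ℝ² → ℂ} (tf : Tame f) (hf : SobCurve s f) :
    SobCurve (s - 1) (phd f) := by
  have hm : SobCurve s fun p => (-1 : ℂ) • DKG.refl f p := by
    refine hf.refl.of_le (C := 1) (tf.refl.const_smul (-1)) (fun t => ?_) fun t t' => ?_
    all_goals
      refine .of_forall fun ξ => le_of_eq ?_
      simp only [hat_smul (fun _ => (-1 : ℂ)), ← smul_sub, norm_smul, norm_neg, norm_one, one_mul]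
  have tm := tf.refl.const_smul (-1)
  have e : ∀ᵐ ξ : ℝ, ∀ t, hat (DKG.phd f) t ξ =
      (om ξ / (2 * I)) * (hat f t ξ + hat (fun p => (-1 : ℂ) • DKG.refl f p) t ξ) := by
    filter_upwards [tf.hat_add tm] with ξ hξ t
    rw [← hξ, ← smul_eq_mul, ← hat_smul (fun ξ => om ξ / (2 * I))]; congr 1; ext p
    simp only [DKG.phd, smul_eq_mul]; ring
  refine (hf.add hm tf tm).of_le (C := 4) tf.phd (fun t => ?_) fun t t' => ?_
  all_goals
    filter_upwards [e, tf.hat_add tm] with ξ h1 h2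
    simp only [h1, h2, ← mul_sub, norm_mul]
    have h3 := om_le_jb ξ
    have h4 : ‖(om ξ : ℂ) / (2 * I)‖ = om ξ / 2 := by simp [abs_of_pos (om_pos ξ)]
    rw [h4, rpow_sub_one (jb_pos ξ).ne', ← mul_assoc, ← mul_assoc]
    refine mul_le_mul_of_nonneg_right ?_ (norm_nonneg _)
    have h5 := jb_rpow_pos ξ s
    rw [div_mul_div_comm, div_le_iff₀ (by have := jb_pos ξ; positivity)]
    nlinarith

theorem SobCurve.smul_const {F : Type*} [NormedAddCommGroup F] [NormedSpace ℂ F] [CompleteSpace F]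
    {s : ℝ} {f : ℝ² → ℂ} (tf : Tame f) (hf : SobCurve s f) (v : F) :
    SobCurve s fun p => f p • v := by
  refine hf.of_le (C := ‖v‖) (tf.smul_const v) (fun t => ?_) fun t t' => ?_
  all_goals
    refine .of_forall fun ξ => le_of_eq ?_
    simp only [hat_smul_const, ← sub_smul, norm_smul]; ring

theorem measurable_bracket : Measurable bracket := by unfold bracket; fun_prop

/-- The weight of the space `X^{s,b}_σ`. -/
def bw (s b σ : ℝ) (p : ℝ²) : ℝ :=
  bracket (2 * π * p.2) ^ s * bracket (2 * π * (p.1 + σ * |p.2|)) ^ b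

theorem measurable_bw (s b σ : ℝ) : Measurable (bw s b σ) := by
  have := measurable_bracket
  unfold bw; fun_prop

theorem bw_pos (s b σ : ℝ) (p : ℝ²) : 0 < bw s b σ p := by
  have := fun y => one_pos.trans_le (one_le_bracket y)
  exact mul_pos (rpow_pos_of_pos (this _) _) (rpow_pos_of_pos (this _) _)

theorem memLp_bracket_den {s b σ lam : ℝ} (hb : 0 ≤ b) (hl : 1 ≤ lam) {h : ℝ → ℝ}
    (mh : Measurable h) {a : ℝ → ℂ} (ma : Measurable a) (na : ∀ ξ, ‖a ξ‖ ≤ 1)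
    (ha : ∀ ξ, a ξ ≠ 0 → h ξ = σ * |ξ|) (F : L2 ℝ²) :
    MemLp (fun p => bw s b σ p • (a p.2 * den (wt s b lam h) F p)) 2 volume := by
  obtain ⟨C₁, hC₁, h₁⟩ := exists_bracket_rpow_le s
  obtain ⟨C₂, hC₂, h₂⟩ := exists_bracket_rpow_le b
  have mF := (Lp.memLp F).1
  have mw := measurable_wt s b lam mh
  have mb := measurable_bw s b σ
  refine (Lp.memLp F).of_le_mul (c := C₁ * C₂) ?_ (.of_forall fun p => ?_)
  · refine mb.aestronglyMeasurable.smul ((by fun_prop : Measurable fun p : ℝ² =>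
      a p.2).aestronglyMeasurable.mul ?_)
    exact (measurable_ofReal.comp mw.inv).aestronglyMeasurable.mul mF
  · have w0 := wt_pos (s := s) (b := b) (lam := lam) (by linarith) h p
    have b0 := bw_pos s b σ p
    rw [norm_smul, norm_mul, den, norm_mul, norm_of_nonneg b0.le,
      norm_ofReal_of_nonneg (inv_pos.2 w0).le]
    by_cases h0 : a p.2 = 0
    · rw [h0, norm_zero, zero_mul, mul_zero]; positivity
    · have e : bw s b σ p ≤ C₁ * C₂ * wt s b lam h p := by
        rw [wt, ha _ h0, bw]
        calc _ ≤ (C₁ * jb p.2 ^ s) * (C₂ * lb lam (p.1 + σ * |p.2|) ^ b) := by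
              refine mul_le_mul (h₁ _).1 ((h₂ _).1.trans ?_)
                (rpow_nonneg (zero_le_one.trans (one_le_bracket _)) _)
                (mul_nonneg hC₁.le (jb_rpow_nonneg _ _))
              gcongr
              · exact (jb_pos _).le
              · exact jb_le_lb hl _
          _ = _ := by ring
      calc bw s b σ p * (‖a p.2‖ * ((wt s b lam h p)⁻¹ * ‖F p‖))
          ≤ (C₁ * C₂ * wt s b lam h p) * (1 * ((wt s b lam h p)⁻¹ * ‖F p‖)) := by
            gcongr
            exact na _
        _ = _ := by field_simp

theorem aestronglyMeasurable_of_memLp_bw {F : Type*} [NormedAddCommGroup F] [NormedSpace ℂ F]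
    {s b σ : ℝ} {f : ℝ² → F} (hf : MemLp (fun p => bw s b σ p • f p) 2 volume) :
    AEStronglyMeasurable f volume := by
  have h2 := (measurable_bw s b σ).inv.aestronglyMeasurable (μ := volume)
  refine (h2.smul hf.1).congr (.of_forall fun p => ?_)
  simp only [Pi.smul_apply', Pi.inv_apply, smul_smul, inv_mul_cancel₀ (bw_pos s b σ p).ne', one_smul]

theorem memLp_bw_refl {s b σ : ℝ} {f : ℝ² → ℂ}
    (hf : MemLp (fun p => bw s b σ p • f p) 2 volume) :
    MemLp (fun p => bw s b (-σ) p • refl f p) 2 volume := by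
  have mp := Measure.measurePreserving_neg 𝓛²
  have e : ∀ y, bracket (-y) = bracket y := fun y => by simp [bracket]
  refine ((hf.comp_measurePreserving mp).star).congr_norm ?_ (.of_forall fun p => ?_)
  · have h1 := aestronglyMeasurable_of_memLp_bw hf
    exact (measurable_bw s b (-σ)).aestronglyMeasurable.smul
      (continuous_conj.comp_aestronglyMeasurable (h1.comp_measurePreserving mp))
  · have : bw s b σ (-p) = bw s b (-σ) p := by
      simp only [bw, Prod.fst_neg, Prod.snd_neg, abs_neg, mul_neg]
      rw [e, ← e (2 * π * (p.1 + -σ * |p.2|))]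
      congr 3; ring
    simp only [Pi.star_apply, comp_apply, norm_star, norm_smul, this, refl, RCLike.norm_conj]

/-- The indicator function of a half line; up to the value at `0`. -/
def pr (σ ξ : ℝ) : ℂ := ((1 + σ * Real.sign ξ) / 2 : ℝ)

theorem measurable_pr (σ : ℝ) : Measurable (pr σ) := by
  have hs : Measurable Real.sign := by
    unfold Real.sign
    exact Measurable.ite measurableSet_Iio measurable_const
      (Measurable.ite measurableSet_Ioi measurable_const measurable_const)
  unfold pr; fun_prop

theorem norm_pr_le {σ : ℝ} (hσ : σ = 1 ∨ σ = -1) (ξ : ℝ) : ‖pr σ ξ‖ ≤ 1 := by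
  rw [pr, norm_real, norm_eq_abs, abs_le]
  rcases hσ with rfl | rfl <;> rcases Real.sign_apply_eq ξ with h | h | h <;> rw [h] <;> norm_num

theorem slow_pr {σ : ℝ} (hσ : σ = 1 ∨ σ = -1) : SlowGrowth (pr σ) :=
  ⟨measurable_pr σ, 0, 1, fun ξ => by simpa using norm_pr_le hσ ξ⟩

theorem eq_of_pr {σ ξ : ℝ} (hσ : σ = 1 ∨ σ = -1) (h0 : pr σ ξ ≠ 0) : ξ = σ * |ξ| := by
  rcases hσ with rfl | rfl <;> rcases lt_trichotomy ξ 0 with h | h | h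
  · simp [pr, Real.sign_of_neg h] at h0
  · simp [h]
  · simp [abs_of_pos h]
  · simp [abs_of_neg h]
  · simp [h]
  · simp [pr, Real.sign_of_pos h] at h0

theorem om_inv_eq (ξ : ℝ) : (((1 + (2 * π * ξ) ^ 2) ^ (-1 / 2 : ℝ) : ℝ) : ℂ) = (om ξ : ℂ)⁻¹ := by
  rw [om, sqrt_eq_rpow, ← Complex.ofReal_inv, ← rpow_neg (by positivity)]
  norm_num

theorem om_inv_temperate : (fun ξ : ℝ => (((1 + (2 * π * ξ) ^ 2) ^ (-1 / 2 : ℝ) : ℝ) :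
    ℂ)).HasTemperateGrowth := by
  have h1 : (fun ξ => (2 * π) • ξ).HasTemperateGrowth :=
    ((2 * π) • ContinuousLinearMap.id ℝ ℝ).hasTemperateGrowth
  have := (sw_temperate (-1)).comp h1
  refine (congrArg _ ?_).mp this
  ext ξ
  simp [sw, neg_div]

theorem HasFourierDensity.invSqrt {u : 𝓢'(ℝ, ℂ)} {f : ℝ → ℂ} (h : HasFourierDensity u f) :
    HasFourierDensity (invSqrtA u) fun ξ => (om ξ : ℂ)⁻¹ * f ξ := by
  have := h.multiplier om_inv_temperate
  simp only [om_inv_eq, smul_eq_mul] at this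
  have e : invSqrtA = TemperedDistribution.fourierMultiplierCLM ℂ fun ξ => (om ξ : ℂ)⁻¹ := by
    rw [invSqrtA]; congr 1; ext ξ; exact om_inv_eq ξ
  rw [e]
  exact this

theorem HasFourierDensity.halfWave {u v : 𝓢'(ℝ, ℂ)} {f g : ℝ → ℂ} (hu : HasFourierDensity u f)
    (hv : HasFourierDensity v g) (σ : ℝ) : HasFourierDensity (halfWave σ u v)
      fun ξ => f ξ + (σ * I) * ((om ξ : ℂ)⁻¹ * g ξ) := hu.add (hv.invSqrt.smul _)

theorem continuous_halfWave {σ : ℝ} {u v : ℝ → 𝓢'(ℝ, ℂ)} (hu : Continuous u) (hv : Continuous v) :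
    Continuous fun t => halfWave σ (u t) (v t) :=
  hu.add ((continuous_const_smul _).comp (invSqrtA.continuous.comp hv))

theorem hat_halfWave {z : ℝ² → ℂ} (tz : Tame z) : ∀ᵐ ξ : ℝ, ∀ t,
    hat (ph z) t ξ + I * ((om ξ : ℂ)⁻¹ * hat (phd z) t ξ) = hat z t ξ ∧
      hat (ph z) t ξ + -I * ((om ξ : ℂ)⁻¹ * hat (phd z) t ξ) = hat (refl z) t ξ := by
  filter_upwards [(tz.ph).hat_add ((tz.phd.slow_smul slow_om_inv).const_smul I),
    (tz.ph).hat_add ((tz.phd.slow_smul slow_om_inv).const_smul (-I))] with ξ h1 h2 t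
  have h3 : ∀ c, hat (fun p => c • (om p.2 : ℂ)⁻¹ • phd z p) t ξ =
      c * ((om ξ : ℂ)⁻¹ * hat (phd z) t ξ) := fun c => by
    rw [hat_smul (fun _ => c), hat_smul fun ξ => (om ξ : ℂ)⁻¹]; rfl
  have hI : ∀ x, x / (2 * I) = -(I / 2) * x := fun x => by
    rw [div_eq_iff (by simp)]
    linear_combination x * I_sq
  have om0 : ∀ ξ, (om ξ : ℂ)⁻¹ * om ξ = 1 := fun ξ =>
    inv_mul_cancel₀ (by exact_mod_cast (om_pos ξ).ne')
  have hp : ∀ p, (om p.2 : ℂ)⁻¹ * phd z p = -(I / 2) * (z p - refl z p) := fun p => by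
    rw [phd, ← mul_assoc, om0, hI, one_mul]
  rw [← h3, ← h3, ← h1, ← h2]
  constructor
  all_goals
    congr 1; ext p
    simp only [smul_eq_mul, hp, ph]; ring_nf
    rw [I_sq]; ring

theorem hat_ph {f : ℝ² → ℂ} (tf : Tame f) : ∀ᵐ ξ : ℝ, ∀ t,
    hat (ph f) t ξ = (hat f t ξ + conj (hat f t (-ξ))) / 2 ∧
    hat (phd f) t ξ = om ξ * ((hat f t ξ - conj (hat f t (-ξ))) / (2 * I)) := by
  have tm := tf.refl.const_smul (-1)
  filter_upwards [tf.hat_add tf.refl, tf.hat_add tm] with ξ h1 h2 t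
  have h3 := hat_smul (fun _ => (-1 : ℂ)) (refl f) t ξ
  rw [← hat_refl, show hat f t ξ - hat (refl f) t ξ = hat f t ξ + (-1 : ℂ) • hat (refl f) t ξ by
    simp [sub_eq_add_neg], ← h3, ← h1, ← h2]
  have h4 := fun f : ℝ² → ℂ => hat_smul (fun _ => 1 / 2) f t ξ
  have h5 := fun f : ℝ² → ℂ => hat_smul (fun ξ => om ξ / (2 * I)) f t ξ
  simp only [smul_eq_mul] at h4 h5
  constructor
  · rw [div_eq_inv_mul, ← one_div, ← h4]
    congr 1; ext p; simp only [ph]; ring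
  · rw [mul_div_assoc', mul_div_right_comm, ← h5]
    congr 1; ext p; simp only [phd, smul_eq_mul]; ring

theorem herm_hat_ph (f : ℝ² → ℂ) (t : ℝ) : Herm (hat (ph f) t) := by
  have e : refl (ph f) = ph f := by
    ext p
    simp only [ph, refl, map_div₀, map_add, Complex.conj_conj, map_ofNat, neg_neg]; ring
  refine .of_forall fun ξ => ?_
  have := hat_refl (ph f) t ξ
  rw [e] at this; rw [this, Complex.conj_conj]

theorem hat_ph_congr {f g : ℝ² → ℂ} (tf : Tame f) (tg : Tame g) {t r : ℝ}
    (h : ∀ᵐ ξ : ℝ, hat f t ξ = r * hat g t ξ) :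
    (∀ᵐ ξ : ℝ, hat (ph f) t ξ = r * hat (ph g) t ξ) ∧
      ∀ᵐ ξ : ℝ, hat (phd f) t ξ = r * hat (phd g) t ξ := by
  have h' : ∀ᵐ ξ : ℝ, hat f t (-ξ) = r * hat g t (-ξ) :=
    (Measure.measurePreserving_neg 𝓛¹).quasiMeasurePreserving.ae h
  constructor <;>
  · filter_upwards [h, h', hat_ph tf, hat_ph tg] with ξ h1 h2 h3 h4
    simp only [(h3 t).1, (h4 t).1, (h3 t).2, (h4 t).2, h1, h2, map_mul, conj_ofReal]; ring

theorem hat_refl_congr {f g : ℝ² → ℂ} {t r : ℝ} (h : ∀ᵐ ξ : ℝ, hat f t ξ = r * hat g t ξ) :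
    ∀ᵐ ξ : ℝ, hat (refl f) t ξ = r * hat (refl g) t ξ := by
  filter_upwards [(Measure.measurePreserving_neg
    𝓛¹).quasiMeasurePreserving.ae h] with ξ hξ
  rw [hat_refl, hat_refl, hξ, map_mul, conj_ofReal]

namespace IsTest

variable {T lam : ℝ} {η η' : 𝓢²} {X X' Y Y' : T3}

theorem fe_iff (hη : IsTest T η) (hη' : IsTest T η')
    (h1 : ∀ t, slice t η' = (exp (lam * t) : ℂ) • slice t η)
    (h2 : ∀ t, slice t (∂_{eT} η' - (lam : ℂ) • η') = (exp (lam * t) : ℂ) • slice t (∂_{eT} η))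
    {M m : ℝ} {n : ℂ × ℂ × ℂ} (tX : Tame3 X) (tY : Tame3 Y)
    (h : Rel T (fun t => exp (lam * t)) X Y) :
    FE M m 0 X n (kap η) ↔ FE M m lam Y n (kap η') := by
  have e := fun t (ht : t ∈ Ioc 0 T) => h.mono fun _ h => h t (Set.Ioc_subset_Icc_self ht)
  have ez := fun t ht => hat_ph_congr tX.2.2 tY.2.2 ((e t ht).mono fun _ h => h.2.2)
  exact hη.fieldEq_iff hη' h1 h2 tX.1 tX.2.1 tX.2.2.ph tX.2.2.phd tY.1 tY.2.1 tY.2.2.ph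
    tY.2.2.phd (fun t ht => (e t ht).mono fun _ h => h.1) (fun t ht => (e t ht).mono fun _ h => h.2.1)
    (fun t ht => (ez t ht).1) fun t ht => (ez t ht).2

theorem nl_eq (hη : IsTest T η) (hη' : IsTest T η') {c d : ℝ → ℝ}
    (hcd : ∀ t, slice t η' = ((c t * d t : ℝ) : ℂ) • slice t η) (tX : Tame3 X) (tY : Tame3 Y)
    (tX' : Tame3 X') (tY' : Tame3 Y') (i : NlInt X Y (kap η)) (i' : NlInt X' Y' (kap η'))
    (h : Rel T c X X') (h' : Rel T d Y Y') (g : ℝ) :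
    nl g X Y (kap η) = nl g X' Y' (kap η') := by
  have e := fun t (ht : t ∈ Ioc 0 T) => h.mono fun _ h => h t (Set.Ioc_subset_Icc_self ht)
  have e' := fun t (ht : t ∈ Ioc 0 T) => h'.mono fun _ h => h t (Set.Ioc_subset_Icc_self ht)
  have eu := fun t ht => (e t ht).mono fun _ h => h.1
  have eu' := fun t ht => (e' t ht).mono fun _ h => h.1
  have ev' := fun t ht => (e' t ht).mono fun _ h => h.2.1
  have ez := fun t ht => (hat_ph_congr tX.2.2 tX'.2.2 ((e t ht).mono fun _ h => h.2.2)).1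
  have sl := fun t (_ : t ∈ Ioc 0 T) => (hcd t).trans (by rw [Complex.ofReal_mul])
  rw [nl, nl, quad, quad, hη.conv_eq_conv hη' tX.2.2.ph tY.2.1 tX'.2.2.ph tY'.2.1 i.1 i'.1 ez ev' sl,
    hη.conv_eq_conv hη' tX.2.2.ph tY.1 tX'.2.2.ph tY'.1 i.2.1 i'.2.1 ez eu' sl,
    hη.conv_eq_conv hη' tX.1 tY.2.1.refl tX'.1 tY'.2.1.refl i.2.2.1 i'.2.2.1 eu
      (fun t ht => hat_refl_congr (ev' t ht)) sl,
    hη.conv_eq_conv hη' tX.1.refl tY.2.1 tX'.1.refl tY'.2.1 i.2.2.2 i'.2.2.2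
      (fun t ht => hat_refl_congr (eu t ht)) ev' sl]

end IsTest

theorem Rel.refl (T : ℝ) (X : T3) : Rel T (fun _ => 1) X X := .of_forall fun ξ t _ => by simp

section

variable {l k δ b : ℝ} {α β : Matrix (Fin 2) (Fin 2) ℂ} {e e' : Spinor}

theorem exists_isSolution (h : Exponents l k δ) (hb : 1 / 2 < b) (hbδ : b - 1 / 2 ≤ δ)
    (hB : DiracBasis α β e e') {M m g lam T : ℝ} (hl : 1 ≤ lam) (hT : 0 ≤ T) (G : E3)
    (hE : ∀ η, IsTest T η → FE M m 0 (dn l k b lam G)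
      (nl g (dn l k b lam G) (dn l k b lam G) (kap η)) (kap η))
    {ψ₀ : 𝓢'(ℝ, Spinor)} {φ₀ φ₁ : 𝓢'(ℝ, ℂ)}
    (iψ : HasFourierDensity ψ₀ fun ξ => hat (du l b lam G) 0 ξ • e + hat (dv l b lam G) 0 ξ • e')
    (iφ : HasFourierDensity φ₀ (hat (ph (dz k b lam G)) 0))
    (iφt : HasFourierDensity φ₁ (hat (phd (dz k b lam G)) 0)) :
    ∃ (ψ : ℝ → 𝓢'(ℝ, Spinor)) (φ φt : ℝ → 𝓢'(ℝ, ℂ)),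
      IsSolution α β M m g l k b T ψ₀ φ₀ φ₁ ψ φ φt ∧ ContinuousInSobolev (-l) T ψ ∧
      ContinuousInSobolev k T φ ∧ ContinuousInSobolev (k - 1) T φt := by
  obtain ⟨_, hc⟩ := exists_nonlinearity h hb hbδ g
  obtain ⟨B, _, hc⟩ := hc 1 lam lam le_rfl hl hl
  have hc := (hc G G).2
  obtain ⟨tu, tv, tz⟩ := tame_dn (k := k) hb hl G
  simp only [dn] at hc hE tu tv tz
  have su : SobCurve (-l) (du l b lam G) := sobCurve_den hb hl (measurable_hu 1) G.1
  have sv : SobCurve (-l) (dv l b lam G) := sobCurve_den hb hl (measurable_hu (-1)) G.2.1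
  have sz : SobCurve k (dz k b lam G) := sobCurve_den hb hl (measurable_hz 1) G.2.2
  have mz := memLp_bracket_den (s := k) (b := b) (by linarith) hl (measurable_hz 1) (a := fun _ => 1)
    measurable_const (fun _ => by simp) (fun _ _ => rfl) G.2.2
  have mu : ∀ (σ : ℝ) (a : ℝ → ℂ), Measurable a → (∀ ξ, ‖a ξ‖ ≤ 1) → (∀ ξ, a ξ ≠ 0 → hu 1 ξ = σ * |ξ|) →
      MemLp (fun p => bw (-l) b σ p • (a p.2 * du l b lam G p)) 2 volume := fun _ _ ma na ha =>
    memLp_bracket_den (by linarith) hl (measurable_hu 1) ma na ha G.1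
  have mv : ∀ (σ : ℝ) (a : ℝ → ℂ), Measurable a → (∀ ξ, ‖a ξ‖ ≤ 1) →
      (∀ ξ, a ξ ≠ 0 → hu (-1) ξ = σ * |ξ|) →
      MemLp (fun p => bw (-l) b σ p • (a p.2 * dv l b lam G p)) 2 volume := fun _ _ ma na ha =>
    memLp_bracket_den (by linarith) hl (measurable_hu (-1)) ma na ha G.2.1
  change MemLp (fun p => bw k b 1 p • (1 * dz k b lam G p)) 2 volume at mz
  simp only [one_mul] at mz
  generalize du l b lam G = u at *
  generalize dv l b lam G = v at *
  generalize dz k b lam G = z at *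
  have tψ := (tu.smul_const e).add (tv.smul_const e')
  obtain ⟨ψ, cψ, hψ'⟩ := tψ.exists_curve
  obtain ⟨φ, cφ, hφ⟩ := tz.ph.exists_curve
  obtain ⟨φt, cφt, hφt⟩ := tz.phd.exists_curve
  have hψ : ∀ t, HasFourierDensity (ψ t) fun ξ => hat u t ξ • e + hat v t ξ • e' := fun t => by
    refine (hψ' t).congr ?_
    filter_upwards [(tu.smul_const e).hat_add (tv.smul_const e')] with ξ hξ
    rw [hξ, hat_smul_const, hat_smul_const]
  obtain ⟨e1, e2, e3⟩ := (equations_iff hB hT tu tv tz.ph tz.phd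
    (fun t _ => hψ t) (fun t _ => hφ t) (fun t _ => hφt t) hc).2 hE
  refine ⟨ψ, φ, φt, ⟨cψ.continuousOn, cφ.continuousOn, cφt.continuousOn,
    fun t _ => .of_herm (hφ t) (herm_hat_ph z t), ?_, ?_, e1, e2, e3, (hψ 0).ext iψ, (hφ 0).ext iφ,
    (hφt 0).ext iφt⟩, ?_, ?_, ?_⟩
  · intro σ hσ
    have hσ2 : σ = 1 ∨ σ = -1 := hσ
    have hσ3 : -σ = 1 ∨ -σ = -1 := by rcases hσ2 with rfl | rfl <;> simp
    have t1 := (tu.slow_smul (slow_pr hσ2)).smul_const e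
    have t2 := (tv.slow_smul (slow_pr hσ3)).smul_const e'
    obtain ⟨ψσ, cσ, hσ'⟩ := (t1.add t2).exists_curve
    refine ⟨ψσ, fun t _ => ⟨_, hψ t, (hσ' t).congr ?_⟩, memXLoc_of_tame hT cσ (t1.add t2) hσ' ?_⟩
    · filter_upwards [t1.hat_add t2] with ξ hξ
      rw [hξ, hat_smul_const, hat_smul_const, hat_smul (pr σ), hat_smul (pr (-σ)), hB.diracSymbol_apply]
      simp only [pr, neg_mul, ← sub_eq_add_neg]; rfl
    · have m1 := mu σ _ (measurable_pr σ) (norm_pr_le hσ2) fun ξ hξ =>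
        (one_mul ξ).trans (eq_of_pr hσ2 hξ)
      have m2 := mv σ _ (measurable_pr (-σ)) (norm_pr_le hσ3) fun ξ hξ => by
        have := eq_of_pr hσ3 hξ
        rw [hu]; linarith
      have cs : ∀ (x : Spinor) {f : ℝ² → ℂ}, MemLp f 2 volume →
          MemLp (fun p => f p • x) 2 volume := fun x f hf =>
        ((ContinuousLinearMap.id ℂ ℂ).smulRight x).comp_memLp' hf
      refine ((cs e m1).add (cs e' m2)).ae_eq (.of_forall fun p => ?_)
      simp only [Pi.add_apply, smul_add, smul_assoc, bw, smul_eq_mul]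
  · intro σ hσ
    have hc := continuous_halfWave (σ := σ) cφ cφt
    have hd := fun t => (hφ t).halfWave (hφt t) σ
    rcases (show σ = 1 ∨ σ = -1 from hσ) with rfl | rfl
    · refine memXLoc_of_tame hT hc tz (fun t => (hd t).congr ?_) mz
      filter_upwards [hat_halfWave tz] with ξ hξ
      rw [← (hξ t).1]; simp
    · refine memXLoc_of_tame hT hc tz.refl (fun t => (hd t).congr ?_) (memLp_bw_refl mz)
      filter_upwards [hat_halfWave tz] with ξ hξ
      rw [← (hξ t).2]; simp
  · exact ((su.smul_const tu e).add (sv.smul_const tv e') (tu.smul_const e)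
      (tv.smul_const e')).continuousInSobolev tψ hψ'
  · exact (sz.ph tz).continuousInSobolev tz.ph hφ
  · exact (sz.phd tz).continuousInSobolev tz.phd hφt

end

theorem exists_data3 (l k : ℝ) {α β : Matrix (Fin 2) (Fin 2) ℂ} {e e' : Spinor}
    (hB : DiracBasis α β e e') : ∃ C : ℝ, 0 ≤ C ∧ ∀ (ψ₀ : 𝓢'(ℝ, Spinor)) (φ₀ φ₁ : 𝓢'(ℝ, ℂ)),
      TemperedDistribution.MemSobolev (-l) 2 ψ₀ → TemperedDistribution.MemSobolev k 2 φ₀ →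
      TemperedDistribution.MemSobolev (k - 1) 2 φ₁ → ∃ (f : ℝ → Spinor) (f₀ f₁ : ℝ → ℂ) (c : D3),
        HasFourierDensity ψ₀ f ∧ HasFourierDensity φ₀ f₀ ∧ HasFourierDensity φ₁ f₁ ∧
        ‖c‖ ≤ C * ((sobolevENorm (-l) ψ₀).toReal + (sobolevENorm k φ₀).toReal +
          (sobolevENorm (k - 1) φ₁).toReal) ∧
        ∀ᵐ ξ : ℝ, jc ξ l * c.1 ξ = inner ℂ e (f ξ) ∧ jc ξ l * c.2.1 ξ = inner ℂ e' (f ξ) ∧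
          jc ξ (-k) * c.2.2 ξ = f₀ ξ + I * ((om ξ : ℂ)⁻¹ * f₁ ξ) := by
  obtain ⟨C₁, p₁, h₁⟩ := exists_sw_le (-l)
  obtain ⟨C₂, p₂, h₂⟩ := exists_sw_le k
  obtain ⟨C₃, p₃, h₃⟩ := exists_sw_le (k - 1)
  refine ⟨C₁ + C₂ + 2 * C₃, by positivity, fun ψ₀ φ₀ φ₁ m₁ m₂ m₃ => ?_⟩
  obtain ⟨f, d₁, i₁, n₁⟩ := exists_density m₁
  obtain ⟨f₀, d₂, i₂, n₂⟩ := exists_density m₂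
  obtain ⟨f₁, d₃, i₃, n₃⟩ := exists_density m₃
  have key : ∀ x : Spinor, ‖x‖ = 1 → ∃ c : L2 ℝ,
      (c =ᵐ[volume] fun ξ => jc ξ (-l) * inner ℂ x (f ξ)) ∧
      ‖c‖ ≤ C₁ * (sobolevENorm (-l) ψ₀).toReal := by
    intro x hx; rw [← n₁]
    refine exists_data p₁.le ((innerSL ℂ x).continuous.comp_aestronglyMeasurable d₁.1) i₁ fun ξ => ?_
    rw [← mul_assoc]
    have h := norm_inner_le_norm (𝕜 := ℂ) x (f ξ)
    rw [hx, one_mul] at h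
    exact mul_le_mul (h₁ ξ).2 h (norm_nonneg _) (mul_nonneg p₁.le (sw_pos _ _).le)
  obtain ⟨cu, eu, nu⟩ := key e hB.norm_fst
  obtain ⟨cv, ev, nv⟩ := key e' hB.norm_snd
  obtain ⟨c₀, e₀, b₀⟩ : ∃ c : L2 ℝ, (c =ᵐ[volume] fun ξ => jc ξ k * f₀ ξ) ∧
      ‖c‖ ≤ C₂ * (sobolevENorm k φ₀).toReal := by
    rw [← n₂]
    refine exists_data p₂.le d₂.1 i₂ fun ξ => ?_
    rw [← mul_assoc]
    exact mul_le_mul_of_nonneg_right (h₂ ξ).2 (norm_nonneg _)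
  obtain ⟨c₁, e₁, b₁⟩ : ∃ c : L2 ℝ, (c =ᵐ[volume] fun ξ => jc ξ k * (I * ((om ξ : ℂ)⁻¹ * f₁ ξ))) ∧
      ‖c‖ ≤ 2 * C₃ * (sobolevENorm (k - 1) φ₁).toReal := by
    rw [← n₃]
    refine exists_data (by positivity) ?_ i₃ fun ξ => ?_
    · exact ((slow_om_inv.1).aestronglyMeasurable.mul d₃.1).const_mul _
    · have ho := om_pos ξ
      have hj := jb_pos ξ
      rw [norm_mul, norm_mul, norm_I, one_mul, norm_inv, norm_real,
        norm_of_nonneg ho.le, ← mul_assoc, ← mul_assoc]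
      refine mul_le_mul_of_nonneg_right ?_ (norm_nonneg _)
      have h5 := (h₃ ξ).2
      have h6 := jb_le_om ξ
      have h7 := sw_pos (k - 1) ξ
      rw [rpow_sub_one hj.ne', div_le_iff₀ hj] at h5
      rw [← div_eq_mul_inv, div_le_iff₀ ho]
      calc jb ξ ^ k ≤ C₃ * sw (k - 1) ξ * jb ξ := h5
        _ ≤ C₃ * sw (k - 1) ξ * (2 * om ξ) := by gcongr
        _ = _ := by ring
  set A := (sobolevENorm (-l) ψ₀).toReal
  set B := (sobolevENorm k φ₀).toReal
  set D := (sobolevENorm (k - 1) φ₁).toReal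
  have hA : 0 ≤ A := ENNReal.toReal_nonneg
  have hB' : 0 ≤ B := ENNReal.toReal_nonneg
  have hD : 0 ≤ D := ENNReal.toReal_nonneg
  have x1 := mul_nonneg p₁.le hA
  have x2 := mul_nonneg p₁.le hB'
  have x3 := mul_nonneg p₁.le hD
  have x4 := mul_nonneg p₂.le hA
  have x5 := mul_nonneg p₂.le hB'
  have x6 := mul_nonneg p₂.le hD
  have x7 := mul_nonneg p₃.le hA
  have x8 := mul_nonneg p₃.le hB'
  have x9 := mul_nonneg p₃.le hD
  refine ⟨f, f₀, f₁, (cu, cv, c₀ + c₁), d₁, d₂, d₃, ?_, ?_⟩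
  · rw [Prod.norm_def, Prod.norm_def]
    refine max_le (by nlinarith) (max_le (by nlinarith) ((norm_add_le _ _).trans (by nlinarith)))
  · filter_upwards [eu, ev, e₀, e₁, Lp.coeFn_add c₀ c₁] with ξ h1 h2 h3 h4 h5
    have j1 : ∀ s : ℝ, jc ξ s * jc ξ (-s) = 1 := fun s => by
      rw [← Complex.ofReal_mul, ← rpow_add (jb_pos ξ), add_neg_cancel, rpow_zero, ofReal_one]
    have j2 : jc ξ (-k) * jc ξ k = 1 := by rw [mul_comm, j1]
    refine ⟨?_, ?_, ?_⟩
    · rw [h1, ← mul_assoc, j1, one_mul]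
    · rw [h2, ← mul_assoc, j1, one_mul]
    · rw [h5, Pi.add_apply, h3, h4, ← mul_add, ← mul_assoc, j2, one_mul]

theorem exists_solution {l k δ b : ℝ} (h : Exponents l k δ) (hb : 1 / 2 < b)
    (hbδ : b - 1 / 2 < δ / 4) {α β : Matrix (Fin 2) (Fin 2) ℂ} {e e' : Spinor}
    (hB : DiracBasis α β e e') (M m g : ℝ) :
    ∃ T : ℝ → ℝ → ℝ → ℝ, (∀ a b c, 0 < T a b c) ∧ ∀ (ψ₀ : 𝓢'(ℝ, Spinor)) (φ₀ φ₁ : 𝓢'(ℝ, ℂ)),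
        TemperedDistribution.MemSobolev (-l) 2 ψ₀ →
        TemperedDistribution.MemSobolev k 2 φ₀ → IsReal φ₀ →
        TemperedDistribution.MemSobolev (k - 1) 2 φ₁ → IsReal φ₁ →
        ∀ T₀ : ℝ, T₀ = T (sobolevENorm (-l) ψ₀).toReal (sobolevENorm k φ₀).toReal
            (sobolevENorm (k - 1) φ₁).toReal →
          ∃ (ψ : ℝ → 𝓢'(ℝ, Spinor)) (φ φt : ℝ → 𝓢'(ℝ, ℂ)),
            IsSolution α β M m g l k b T₀ ψ₀ φ₀ φ₁ ψ φ φt ∧ ContinuousInSobolev (-l) T₀ ψ ∧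
            ContinuousInSobolev k T₀ φ ∧ ContinuousInSobolev (k - 1) T₀ φt := by
  choose lam hl hsol using exists_mildSolution h hb hbδ M m g
  obtain ⟨C, hC, hdata⟩ := exists_data3 l k hB
  refine ⟨fun x y z => (lam (C * (x + y + z)))⁻¹,
    fun x y z => inv_pos.2 (one_pos.trans_le (hl _)), ?_⟩
  rintro ψ₀ φ₀ φ₁ m₀ m₁ r₀ m₂ r₁ T rfl
  beta_reduce
  obtain ⟨f, f₀, f₁, c, d, d₀, d₁, hc, hd⟩ := hdata ψ₀ φ₀ φ₁ m₀ m₁ m₂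
  set R := C * ((sobolevENorm (-l) ψ₀).toReal + (sobolevENorm k φ₀).toReal +
          (sobolevENorm (k - 1) φ₁).toReal)
  obtain ⟨F, G, hFG, hF0, hS⟩ := hsol R c hc
  have hl := hl R
  generalize lam R = L at *
  have hL : 0 < L := by linarith
  have td := tame_dn (l := l) (k := k) hb hl
  obtain ⟨_, hN⟩ := exists_nonlinearity h hb (by linarith) g
  obtain ⟨B, _, hN⟩ := hN L L L hl hl hl
  have hFG0 : ∀ᵐ ξ : ℝ, hat (du l b L G) 0 ξ = inner ℂ e (f ξ) ∧
      hat (dv l b L G) 0 ξ = inner ℂ e' (f ξ) ∧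
      hat (dz k b L G) 0 ξ = f₀ ξ + I * ((om ξ : ℂ)⁻¹ * f₁ ξ) := by
    filter_upwards [hFG, hF0, hd] with ξ h1 h2 h3
    obtain ⟨g1, g2, g3⟩ := h1 0 ⟨le_rfl, (inv_pos.2 hL).le⟩
    rw [mul_zero, Real.exp_zero, ofReal_one, one_mul] at g1 g2 g3
    exact ⟨g1.trans (h2.1.trans h3.1), g2.trans (h2.2.1.trans h3.2.1),
      g3.trans (h2.2.2.trans h3.2.2)⟩
  have hFG0' : ∀ᵐ ξ : ℝ, hat (dz k b L G) 0 (-ξ) = f₀ (-ξ) + I * ((om (-ξ) : ℂ)⁻¹ * f₁ (-ξ)) :=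
    (Measure.measurePreserving_neg 𝓛¹).quasiMeasurePreserving.ae
      (hFG0.mono fun _ h => h.2.2)
  refine exists_isSolution h hb (by linarith) hB hl (inv_pos.2 hL).le G
    (fun η hη => ?_) (d.congr ?_) (d₀.congr ?_) (d₁.congr ?_)
  · obtain ⟨η', hη', h1, h2⟩ := hη.exists_exp_mul L
    rw [hη.fe_iff hη' h1 h2 (td G) (td F) hFG, hη.nl_eq hη' (fun t => by rw [one_mul]; exact h1 t) (td G)
      (td G) (td G) (td F) ((hN G G).2 _ hη.isSym) ((hN G F).2 _ hη'.isSym) (.refl _ _) hFG]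
    exact HalfWave.fieldEq (td F) (conj_quad_refl _ _) hS hη'.isSym
  · filter_upwards [hFG0] with ξ hξ
    rw [hξ.1, hξ.2.1, ← hB.eq_add]
  · filter_upwards [hFG0, hFG0', r₀.herm d₀, r₁.herm d₁, hat_ph (td G).2.2] with ξ h1 h2 h3 h4 h5
    rw [(h5 0).1, h1.2.2, h2, h3, h4, om_neg]
    simp only [map_add, map_mul, conj_I, map_inv₀, conj_ofReal, Complex.conj_conj]; ring
  · filter_upwards [hFG0, hFG0', r₀.herm d₀, r₁.herm d₁, hat_ph (td G).2.2] with ξ h1 h2 h3 h4 h5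
    have h6 : (om ξ : ℂ) ≠ 0 := by exact_mod_cast (om_pos ξ).ne'
    rw [(h5 0).2, h1.2.2, h2, h3, h4, om_neg]
    simp only [map_add, map_mul, conj_I, map_inv₀, conj_ofReal, Complex.conj_conj]; field_simp
    ring

theorem exists_plateau : ∃ g : ℝ → ℝ, ContDiff ℝ (⊤ : ℕ∞) g ∧ HasCompactSupport (fun x => 1 - g x) ∧
    ∀ i : ℕ, ∃ C : ℝ, ∀ y, ‖iteratedFDeriv ℝ i g y‖ ≤ C * ‖y‖ := by
  let b : ContDiffBump (0 : ℝ) := ⟨1, 2, one_pos, one_lt_two⟩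
  have hb : ContDiff ℝ (⊤ : ℕ∞) b := b.contDiff
  have hg : ContDiff ℝ (⊤ : ℕ∞) (fun x => 1 - b x) := contDiff_const.sub hb
  refine ⟨fun x => 1 - b x, hg, by simpa using b.hasCompactSupport, fun i => ?_⟩
  have hi : ((i : ℕ∞) : WithTop ℕ∞) ≤ ((⊤ : ℕ∞) : WithTop ℕ∞) := by exact_mod_cast le_top
  obtain ⟨C, hC⟩ := (b.hasCompactSupport.iteratedFDeriv (𝕜 := ℝ) i).exists_bound_of_continuous
    (hb.continuous_iteratedFDeriv hi)
  have hC0 : 0 ≤ C := (norm_nonneg _).trans (hC 0)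
  refine ⟨1 + C, fun y => ?_⟩
  by_cases hy : ‖y‖ < 1
  · have h0 : (fun x => 1 - b x) =ᶠ[𝓝 y] fun _ => 0 := by
      filter_upwards [Metric.isOpen_ball.mem_nhds (mem_ball_zero_iff.2 hy)] with x hx
      rw [b.one_of_mem_closedBall (Metric.ball_subset_closedBall hx), sub_self]
    rw [(h0.iteratedFDeriv ℝ i).eq_of_nhds]
    simp only [iteratedFDeriv_fun_zero, Pi.zero_apply, norm_zero]; positivity
  · have h1 : ‖iteratedFDeriv ℝ i (fun _ : ℝ => (1 : ℝ)) y‖ ≤ 1 := by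
      rw [norm_iteratedFDeriv_eq_norm_iteratedDeriv, iteratedDeriv_const]
      split_ifs <;> simp
    have h2 : iteratedFDeriv ℝ i (fun x => 1 - b x) y =
        iteratedFDeriv ℝ i (fun _ => (1 : ℝ)) y - iteratedFDeriv ℝ i b y :=
      iteratedFDeriv_sub_apply contDiffAt_const (hb.of_le hi).contDiffAt
    rw [h2]
    have := (norm_sub_le (iteratedFDeriv ℝ i (fun _ : ℝ => (1 : ℝ)) y)
      (iteratedFDeriv ℝ i b y)).trans (add_le_add h1 (hC y))
    nlinarith

theorem exists_cutoff (χ : 𝓢(ℝ, ℂ)) : ∃ χs : ℕ → 𝓢(ℝ, ℂ), (∀ n, HasCompactSupport (χs n)) ∧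
    (∀ n x, ∃ r : ℝ, χs n x = r * χ x) ∧ Tendsto χs atTop (𝓝 χ) := by
  obtain ⟨g, sg, cg, hg⟩ := exists_plateau
  choose C hC using hg
  have hC0 : ∀ i, 0 ≤ C i := fun i => by simpa using (norm_nonneg _).trans (hC i 1)
  set a : ℕ → ℝ := fun n => ((n : ℝ) + 1)⁻¹ with ha
  have ha0 : ∀ n, 0 < a n := fun n => by positivity
  have ha1 : ∀ n, a n ≤ 1 := fun n => inv_le_one_of_one_le₀ (by linarith [n.cast_nonneg (α := ℝ)])
  have sm : ∀ n, ContDiff ℝ (⊤ : ℕ∞) fun x => ((1 - g (a n • x) : ℝ) : ℂ) * χ x := fun n =>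
    (ofRealCLM.contDiff.comp (contDiff_const.sub (sg.comp (contDiff_const_smul _)))).mul
      (χ.smooth ⊤)
  have cs : ∀ n, HasCompactSupport fun x => ((1 - g (a n • x) : ℝ) : ℂ) * χ x := fun n => by
    refine HasCompactSupport.mul_right ?_
    have h1 := cg.comp_homeomorph (Homeomorph.smulOfNeZero (a n) (ha0 n).ne')
    exact h1.comp_left (g := fun r : ℝ => (r : ℂ)) (by simp)
  refine ⟨fun n => (cs n).toSchwartzMap (sm n), cs, fun n x => ⟨_, rfl⟩, ?_⟩
  rw [(schwartz_withSeminorms ℂ ℝ ℂ).tendsto_nhds]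
  rintro ⟨k, j⟩ ε hε
  set A := ∑ i ∈ Finset.range (j + 1), (j.choose i : ℝ) * C i * SchwartzMap.seminorm ℂ (k + 1) (j - i) χ
  have hA : 0 ≤ A := Finset.sum_nonneg fun i _ =>
    mul_nonneg (mul_nonneg (Nat.cast_nonneg _) (hC0 i)) (apply_nonneg _ _)
  have key : ∀ n, SchwartzMap.seminorm ℂ k j ((cs n).toSchwartzMap (sm n) - χ) ≤ a n * A := fun n => by
    refine SchwartzMap.seminorm_le_bound ℂ k j _ (mul_nonneg (ha0 n).le hA) fun x => ?_
    set G : ℝ → ℂ := fun x => ((-g (a n • x) : ℝ) : ℂ) with hG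
    have sG : ContDiff ℝ (⊤ : ℕ∞) fun x => g (a n • x) := sg.comp (contDiff_const_smul _)
    have e : ((cs n).toSchwartzMap (sm n) - χ : 𝓢(ℝ, ℂ)) = fun x => G x * χ x := by
      ext y
      change ((1 - g (a n • y) : ℝ) : ℂ) * χ y - χ y = _
      rw [hG]; push_cast; ring
    have hi : ∀ i : ℕ, ((i : ℕ∞) : WithTop ℕ∞) ≤ ((⊤ : ℕ∞) : WithTop ℕ∞) := fun i => by
      exact_mod_cast le_top
    have nG : ∀ i, ‖iteratedFDeriv ℝ i G x‖ ≤ a n * C i * ‖x‖ := fun i => by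
      have e1 : G = (Complex.ofRealLI : ℝ →ₗᵢ[ℝ] ℂ) ∘ fun x => -g (a n • x) := rfl
      rw [e1, LinearIsometry.norm_iteratedFDeriv_comp_left _ sG.neg.contDiffAt (hi i)]
      have e2 : (fun x => -g (a n • x)) = -fun x => g (a n • x) := rfl
      rw [e2, iteratedFDeriv_neg_apply, norm_neg, iteratedFDeriv_comp_const_smul _ (sg.of_le (hi i)),
        norm_smul, norm_pow, norm_of_nonneg (ha0 n).le]
      calc a n ^ i * ‖iteratedFDeriv ℝ i g (a n • x)‖ ≤ 1 * (C i * ‖a n • x‖) := by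
            gcongr
            · exact pow_le_one₀ (ha0 n).le (ha1 n)
            · exact hC i _
        _ = _ := by rw [norm_smul, norm_of_nonneg (ha0 n).le]; ring
    rw [e]
    calc ‖x‖ ^ k * ‖iteratedFDeriv ℝ j (fun x => G x * χ x) x‖
        ≤ ‖x‖ ^ k * ∑ i ∈ Finset.range (j + 1), (j.choose i : ℝ) * ‖iteratedFDeriv ℝ i G x‖ *
            ‖iteratedFDeriv ℝ (j - i) χ x‖ := by
          gcongr
          exact norm_iteratedFDeriv_mul_le (ofRealCLM.contDiff.comp sG.neg) (χ.smooth ⊤) x (hi j)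
      _ ≤ a n * A := by
          rw [Finset.mul_sum, Finset.mul_sum]
          refine Finset.sum_le_sum fun i _ => ?_
          calc ‖x‖ ^ k * ((j.choose i : ℝ) * ‖iteratedFDeriv ℝ i G x‖ * ‖iteratedFDeriv ℝ (j - i) χ x‖)
              ≤ ‖x‖ ^ k * ((j.choose i : ℝ) * (a n * C i * ‖x‖) * ‖iteratedFDeriv ℝ (j - i) χ x‖) := by
                gcongr; exact nG i
            _ = a n * ((j.choose i : ℝ) * C i * (‖x‖ ^ (k + 1) * ‖iteratedFDeriv ℝ (j - i) χ x‖)) := by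
                ring
            _ ≤ _ := by
                have := hC0 i
                gcongr
                exact SchwartzMap.le_seminorm ℂ _ _ χ x
  have ht : Tendsto (fun n => a n * A) atTop (𝓝 0) := by
    simpa [ha] using (tendsto_one_div_add_atTop_nhds_zero_nat).mul_const A
  filter_upwards [ht.eventually_lt_const hε] with n hn
  exact (key n).trans_lt hn

section

variable {F : Type*} [NormedAddCommGroup F] [NormedSpace ℂ F]

theorem tendsto_apply (u : 𝓢'(ℝ, F)) {χs : ℕ → 𝓢(ℝ, ℂ)} {χ : 𝓢(ℝ, ℂ)} (h : Tendsto χs atTop (𝓝 χ)) :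
    Tendsto (fun n => u (χs n)) atTop (𝓝 (u χ)) := (u.continuous.tendsto χ).comp h

theorem ext_of_hasCompactSupport {u v : 𝓢'(ℝ, F)}
    (h : ∀ χ : 𝓢(ℝ, ℂ), HasCompactSupport χ → u χ = v χ) : u = v := by
  ext χ
  obtain ⟨χs, cs, -, ht⟩ := exists_cutoff χ
  exact tendsto_nhds_unique (tendsto_apply u ht)
    ((tendsto_apply v ht).congr fun n => (h _ (cs n)).symm)

theorem IsReal.of_hasCompactSupport {u : 𝓢'(ℝ, ℂ)} (h : ∀ χ : 𝓢(ℝ, ℂ), HasCompactSupport χ →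
    (∀ x, (χ x).im = 0) → (u χ).im = 0) : IsReal u := by
  intro χ hχ
  obtain ⟨χs, cs, hr, ht⟩ := exists_cutoff χ
  have : ∀ n, (u (χs n)).im = 0 := fun n => h _ (cs n) fun x => by
    obtain ⟨r, hr⟩ := hr n x
    simp [hr, hχ x]
  exact tendsto_nhds_unique ((Complex.continuous_im.tendsto _).comp (tendsto_apply u ht))
    (tendsto_const_nhds.congr fun n => (this n).symm)

/-- A smooth function of time with compact support in `(0,T)`. -/
def IsBump (T : ℝ) (θ : ℝ → ℝ) : Prop :=
  ContDiff ℝ (⊤ : ℕ∞) θ ∧ ∃ c d, 0 < c ∧ d < T ∧ ∀ t, θ t ≠ 0 → t ∈ Icc c d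

theorem IsBump.exists_isTest {T : ℝ} {θ : ℝ → ℝ} (hθ : IsBump T θ) {χ : 𝓢(ℝ, ℂ)}
    (hχ : HasCompactSupport χ) : ∃ η : 𝓢², IsTest T η ∧
      (∀ t, slice t η = (θ t : ℂ) • χ) ∧ ∀ t, slice t (∂_{eT} η) = ((deriv θ t : ℝ) : ℂ) • χ := by
  obtain ⟨sθ, c, d, hc, hd, h0⟩ := hθ
  set f : Spacetime → ℂ := fun q => (θ (q 0) : ℂ) * χ (q 1) with hf
  let P : Fin 2 → Spacetime →L[ℝ] ℝ := fun i => EuclideanSpace.proj i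
  have sm : ContDiff ℝ (⊤ : ℕ∞) f :=
    (ofRealCLM.contDiff.comp (sθ.comp (P 0).contDiff)).mul ((χ.smooth ⊤).comp (P 1).contDiff)
  set K : Set Spacetime := pt '' (Icc c d ×ˢ tsupport χ)
  have hK : IsCompact K := (isCompact_Icc.prod hχ).image continuous_pt
  have hs : tsupport f ⊆ K := by
    refine closure_minimal (fun q hq => ⟨co q, ⟨h0 _ fun h => hq ?_, subset_tsupport _ fun h => hq ?_⟩,
      pt_co q⟩) hK.isClosed
    · rw [hf]; simp [show θ (q 0) = 0 from h]
    · rw [hf]; simp [show χ (q 1) = 0 from h]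
  have cs : HasCompactSupport f := hK.of_isClosed_subset (isClosed_tsupport _) hs
  refine ⟨cs.toSchwartzMap sm, ⟨cs, hs.trans ?_⟩, fun t => ?_, fun t => ?_⟩
  · rintro _ ⟨p, hp, rfl⟩
    exact ⟨hc.trans_le hp.1.1, hp.1.2.trans_lt hd⟩
  · ext x; rw [slice_apply]; rfl
  · ext x
    have h1 : HasFDerivAt (fun q : Spacetime => (θ (q 0) : ℂ)) (ofRealCLM.comp
        ((deriv θ t) • P 0)) (pt (t, x)) :=
      ofRealCLM.hasFDerivAt.comp _ (((sθ.differentiable (by simp) t).hasDerivAt).comp_hasFDerivAt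
        (pt (t, x)) (P 0).hasFDerivAt)
    have h2 : HasFDerivAt (fun q : Spacetime => χ (q 1)) ((fderiv ℝ χ x).comp (P 1)) (pt (t, x)) :=
      HasFDerivAt.comp (pt (t, x)) (χ.hasFDerivAt x) (P 1).hasFDerivAt
    have h3 : fderiv ℝ (cs.toSchwartzMap sm) (pt (t, x)) = _ := (h1.mul h2).fderiv
    rw [slice_apply, SchwartzMap.lineDerivOp_apply_eq_fderiv, h3]
    simp [P, mul_comm]

variable [CompleteSpace F]

theorem eqOn_zero_of_integral_bump {T : ℝ} (hT : 0 < T) {a : ℝ → F} (ha : ContinuousOn a (Icc 0 T))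
    (h : ∀ θ : ℝ → ℝ, IsBump T θ → ∫ t in (0 : ℝ)..T, θ t • a t = 0) :
    ∀ t ∈ Icc 0 T, a t = 0 := by
  have h1 : ∀ᵐ t : ℝ, t ∈ Ioo 0 T → a t = 0 := by
    refine isOpen_Ioo.ae_eq_zero_of_integral_contDiff_smul_eq_zero
      ((ha.mono Set.Ioo_subset_Icc_self).locallyIntegrableOn measurableSet_Ioo) fun g sg cg hg => ?_
    rcases Set.eq_empty_or_nonempty (tsupport g) with he | hne
    · simp [tsupport_eq_empty_iff.1 he]
    obtain ⟨c, hc, hc'⟩ := cg.isCompact.exists_isLeast hne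
    obtain ⟨d, hd, hd'⟩ := cg.isCompact.exists_isGreatest hne
    rw [← h g ⟨sg, c, d, (hg hc).1, (hg hd).2, fun t ht =>
      ⟨hc' (subset_tsupport _ ht), hd' (subset_tsupport _ ht)⟩⟩, intervalIntegral.integral_of_le hT.le,
      setIntegral_eq_integral_of_forall_compl_eq_zero fun t ht => ?_]
    have : g t = 0 := by
      by_contra h0
      have := hg (subset_tsupport _ h0)
      exact ht ⟨this.1, this.2.le⟩
    rw [this, zero_smul]
  refine Measure.eqOn_Icc_of_ae_eq volume hT.ne ?_ ha continuousOn_const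
  rw [Filter.EventuallyEq, ← Measure.restrict_congr_set Ioo_ae_eq_Icc, ae_restrict_iff' measurableSet_Ioo]
  exact h1

theorem eqOn_of_pair {T : ℝ} (hT : 0 < T) {u v : ℝ → 𝓢'(ℝ, F)} (hu : ContinuousOn u (Icc 0 T))
    (hv : ContinuousOn v (Icc 0 T)) (h : ∀ η, IsTest T η → pair T u η = pair T v η) :
    ∀ t ∈ Icc 0 T, u t = v t := by
  intro t ht
  refine ext_of_hasCompactSupport fun χ hχ => sub_eq_zero.1 ?_
  have cu := (continuous_eval_const χ).comp_continuousOn hu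
  have cv := (continuous_eval_const χ).comp_continuousOn hv
  refine eqOn_zero_of_integral_bump hT (a := fun t => u t χ - v t χ) (cu.sub cv) (fun θ hθ => ?_) t ht
  obtain ⟨η, hη, e, -⟩ := hθ.exists_isTest hχ
  have ep : ∀ w : ℝ → 𝓢'(ℝ, F), pair T w η = ∫ t in (0 : ℝ)..T, θ t • w t χ := fun w => by
    refine intervalIntegral.integral_congr fun t _ => ?_
    rw [e, ← Complex.coe_smul]
    exact map_smul (w t) _ _
  have := h η hη
  rw [ep, ep] at this
  have sm : ContinuousOn θ (Icc 0 T) := hθ.1.continuous.continuousOn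
  simp only [smul_sub]
  rw [intervalIntegral.integral_sub, this, sub_self]
  · exact ((sm.smul cu).mono (Set.uIcc_of_le hT.le).subset).intervalIntegrable
  · exact ((sm.smul cv).mono (Set.uIcc_of_le hT.le).subset).intervalIntegrable

theorem Tame.hasFourierDensity {T : ℝ} (hT : 0 < T) {f : ℝ² → F} (hf : Tame f) {u : ℝ → 𝓢'(ℝ, F)}
    (hu : ContinuousOn u (Icc 0 T)) (h : ∀ η, IsTest T η → ∫ p, kap η p • f p = pair T u η) :
    ∀ t ∈ Icc 0 T, HasFourierDensity (u t) (hat f t) := by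
  obtain ⟨v, cv, hv⟩ := hf.exists_curve
  intro t ht
  rw [eqOn_of_pair hT hu cv.continuousOn (fun η hη => ?_) t ht]
  · exact hv t
  · rw [← h η hη, hη.pair_eq hT.le hf fun t _ => hv t]

end

theorem IsBump.deriv {T : ℝ} {θ : ℝ → ℝ} (h : IsBump T θ) : IsBump T (deriv θ) := by
  obtain ⟨sθ, c, d, hc, hd, h0⟩ := h
  refine ⟨(contDiff_infty_iff_deriv.1 sθ).2, c, d, hc, hd, fun t ht => ?_⟩
  by_contra hn
  refine ht ?_
  have : θ =ᶠ[𝓝 t] fun _ => 0 := by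
    filter_upwards [isClosed_Icc.isOpen_compl.mem_nhds hn] with x hx
    by_contra h
    exact hx (h0 x h)
  rw [this.deriv_eq, deriv_const]

theorem IsBump.integral_eq {T : ℝ} {θ : ℝ → ℝ} (h : IsBump T θ) (hT : 0 ≤ T) (a : ℝ → ℂ) :
    ∫ t in (0 : ℝ)..T, (θ t : ℂ) * a t = ∫ t, (θ t : ℂ) * a t := by
  obtain ⟨-, c, d, hc, hd, h0⟩ := h
  rw [intervalIntegral.integral_of_le hT, setIntegral_eq_integral_of_forall_compl_eq_zero fun t ht => ?_]
  have : θ t = 0 := by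
    by_contra h
    exact ht ⟨hc.trans_le (h0 t h).1, (h0 t h).2.trans hd.le⟩
  rw [this, ofReal_zero, zero_mul]

theorem IsBump.integrable {T : ℝ} {θ : ℝ → ℝ} (h : IsBump T θ) {a : ℝ → ℂ} (ha : Continuous a) :
    Integrable fun t => (θ t : ℂ) * a t := by
  obtain ⟨sθ, c, d, -, -, h0⟩ := h
  refine ((Complex.continuous_ofReal.comp sθ.continuous).mul ha).integrable_of_hasCompactSupport
    (HasCompactSupport.of_support_subset_isCompact (isCompact_Icc) fun t ht => h0 t
      fun h => ht ?_)
  simp [h]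

theorem eq_of_integral_deriv_bump {T : ℝ} {a : ℝ → ℂ} (ca : Continuous a)
    (h : ∀ θ, IsBump T θ → ∫ t in (0 : ℝ)..T, ((deriv θ t : ℝ) : ℂ) * a t = 0) :
    ∀ t ∈ Icc 0 T, a t = a 0 := by
  have key : Set.EqOn a (fun _ => a 0) (Ioo 0 T) := by
    intro s hs
    have hs0 : 0 < s := hs.1
    have key := eqOn_zero_of_integral_bump (sub_pos.2 hs.2) (a := fun t => a t - a (t + s))
      (by fun_prop) (fun ψ hψ => ?_) 0 ⟨le_rfl, (sub_pos.2 hs.2).le⟩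
    · rw [zero_add] at key
      exact (sub_eq_zero.1 key).symm
    obtain ⟨sψ, c, d, hc, hd, h0⟩ := id hψ
    have cψ := sψ.continuous
    set Ψ : ℝ → ℝ := fun t => ∫ x in (0 : ℝ)..t, ψ x
    have dΨ : ∀ t, HasDerivAt Ψ (ψ t) t := fun t => (cψ.integral_hasStrictDerivAt 0 t).hasDerivAt
    have dΘ : ∀ t, HasDerivAt (fun t => Ψ t - Ψ (t - s)) (ψ t - ψ (t - s)) t := fun t =>
      (dΨ t).sub ((dΨ (t - s)).comp_sub_const t s)
    have eΘ : deriv (fun t => Ψ t - Ψ (t - s)) = fun t => ψ t - ψ (t - s) := funext fun t => (dΘ t).deriv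
    have bΘ : IsBump T fun t => Ψ t - Ψ (t - s) := by
      refine ⟨contDiff_infty_iff_deriv.2 ⟨fun t => (dΘ t).differentiableAt, ?_⟩, c, d + s, hc,
        by linarith, fun t ht => ?_⟩
      · rw [eΘ]; exact sψ.sub (sψ.comp (contDiff_id.sub contDiff_const))
      · by_contra hn
        refine ht ?_
        beta_reduce
        rw [intervalIntegral.integral_interval_sub_left (cψ.intervalIntegrable _ _)
          (cψ.intervalIntegrable _ _)]
        refine (intervalIntegral.integral_congr (g := fun _ => 0) fun x hx => ?_).trans (by simp)
        rw [Set.uIcc_of_le (by linarith)] at hx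
        by_contra h
        have := h0 x h
        exact hn ⟨by linarith [this.1, hx.2], by linarith [this.2, hx.1]⟩
    have h1 := h _ bΘ
    have hT : 0 ≤ T := (hs.1.trans hs.2).le
    rw [bΘ.deriv.integral_eq hT, eΘ] at h1
    have i1 := hψ.integrable ca
    have i2 : Integrable fun t => (ψ t : ℂ) * a (t + s) := hψ.integrable (by fun_prop)
    have i3 : Integrable fun t => (ψ (t - s) : ℂ) * a t := by simpa using i2.comp_sub_right s
    have e3 : ∫ t, (ψ (t - s) : ℂ) * a t = ∫ t, (ψ t : ℂ) * a (t + s) := by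
      simpa only [sub_add_cancel] using integral_sub_right_eq_self (fun t => (ψ t : ℂ) * a (t + s)) s
    have e1 : (fun t => ((ψ t - ψ (t - s) : ℝ) : ℂ) * a t) =
        fun t => (ψ t : ℂ) * a t - (ψ (t - s) : ℂ) * a t := by ext t; push_cast; ring
    rw [e1, integral_sub i1 i3, e3, ← integral_sub i1 i2] at h1; rw [← h1]
    have e4 := hψ.integral_eq (sub_pos.2 hs.2).le fun t => a t - a (t + s)
    simp only [mul_sub] at e4; rw [← e4]
    exact intervalIntegral.integral_congr fun t _ => by rw [real_smul, mul_sub]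
  intro t ht
  rcases (ht.1.trans ht.2).eq_or_lt with h0 | h0
  · rw [show t = 0 by linarith [ht.1, ht.2]]
  · exact key.closure ca continuous_const (by rwa [closure_Ioo h0.ne])

theorem sub_eq_integral_of_bump {T : ℝ} {a n : ℝ → ℂ} (ca : Continuous a) (cn : Continuous n)
    (h : ∀ θ, IsBump T θ → ∫ t in (0 : ℝ)..T, ((deriv θ t : ℝ) : ℂ) * a t =
      -∫ t in (0 : ℝ)..T, (θ t : ℂ) * n t) :
    ∀ t ∈ Icc 0 T, a t - a 0 = ∫ s in (0 : ℝ)..t, n s := by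
  set N : ℝ → ℂ := fun t => ∫ s in (0 : ℝ)..t, n s with hN
  have dN : ∀ t, HasDerivAt N (n t) t := fun t => (cn.integral_hasStrictDerivAt 0 t).hasDerivAt
  have cN : Continuous N := continuous_iff_continuousAt.2 fun t => (dN t).continuousAt
  intro t ht
  have := eq_of_integral_deriv_bump (ca.sub cN) (fun θ hθ => ?_) t ht
  · simp only [hN, Pi.sub_apply, intervalIntegral.integral_same, sub_zero] at this
    linear_combination this
  · obtain ⟨sθ, c, d, hc, hd, h0⟩ := id hθ
    have z : ∀ t, t ∉ Icc c d → θ t = 0 := fun t ht => by by_contra h; exact ht (h0 t h)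
    have z0 : θ 0 = 0 := z 0 fun h => by linarith [h.1]
    have zT : θ T = 0 := z T fun h => by linarith [h.2]
    have cθ : Continuous fun t => (θ t : ℂ) := Complex.continuous_ofReal.comp sθ.continuous
    have cθ' : Continuous fun t => ((deriv θ t : ℝ) : ℂ) :=
      Complex.continuous_ofReal.comp hθ.deriv.1.continuous
    have h1 := intervalIntegral.integral_deriv_mul_eq_sub (a := 0) (b := T)
      (fun x _ => ((sθ.differentiable (by simp) x).hasDerivAt).ofReal_comp)
      (fun x _ => dN x) (cθ'.intervalIntegrable _ _) (cn.intervalIntegrable _ _)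
    have h2 := (intervalIntegral.integral_add ((cθ'.mul cN).intervalIntegrable _ _)
      ((cθ.mul cn).intervalIntegrable _ _)).symm.trans h1
    rw [z0, zT, ofReal_zero, zero_mul, zero_mul, sub_zero] at h2
    simp only [Pi.sub_apply, mul_sub]
    refine (intervalIntegral.integral_sub ((cθ'.mul ca).intervalIntegrable _ _)
      ((cθ'.mul cN).intervalIntegrable _ _)).trans ?_
    refine (congrArg (· - _) (h θ hθ)).trans ?_
    linear_combination -h2

/-- The Fourier transform of the indicator function of `[0,t]`. -/
def exInt (t τ : ℝ) : ℂ := ∫ s in (0 : ℝ)..t, ex (s * τ)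

theorem continuous_exInt (t : ℝ) : Continuous (exInt t) :=
  intervalIntegral.continuous_parametric_intervalIntegral_of_continuous' (by fun_prop) 0 t

theorem norm_exInt_le (t τ : ℝ) : ‖exInt t τ‖ ≤ |t| := by
  have := intervalIntegral.norm_integral_le_of_norm_le_const (a := 0) (b := t)
    (f := fun s => ex (s * τ)) fun s _ => (norm_ex _).le
  rwa [one_mul, sub_zero] at this

theorem integral_exInt_mul {X : Type*} [MeasurableSpace X] {μ : Measure X} [SFinite μ] {u : X → ℝ}
    (hu : Measurable u) {g : X → ℂ} (hg : Integrable g μ) (t : ℝ) :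
    ∫ x, exInt t (u x) * g x ∂μ = ∫ s in (0 : ℝ)..t, ∫ x, ex (s * u x) * g x ∂μ := by
  have : IsFiniteMeasure (volume.restrict (Set.uIoc 0 t)) := by rw [Set.uIoc]; infer_instance
  rw [intervalIntegral_integral_swap]
  · simp only [exInt, intervalIntegral.integral_mul_const]
  · exact integrable_ex_smul (by fun_prop) (hg.comp_snd _)

theorem Tame.exInt_mul {f : ℝ² → ℂ} (hf : Tame f) (t : ℝ) : Tame fun p => exInt t p.1 * f p := by
  obtain ⟨mf, N, hN⟩ := hf
  have me : AEStronglyMeasurable (fun p : ℝ² => exInt t p.1) volume :=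
    ((continuous_exInt t).comp continuous_fst).aestronglyMeasurable
  refine ⟨me.mul mf, N, (hN.bdd_mul me (.of_forall fun p => norm_exInt_le t p.1)).congr
    (.of_forall fun p => ?_)⟩
  simp only; ring

theorem Tame.hat_exInt_mul {f : ℝ² → ℂ} (hf : Tame f) (t : ℝ) : ∀ᵐ ξ : ℝ,
    hat (fun p => exInt t p.1 * f p) 0 ξ = ∫ s in (0 : ℝ)..t, hat f s ξ := by
  filter_upwards [hf.integrable_slice] with ξ hξ
  have := integral_exInt_mul measurable_id hξ t
  simp only [hat, zero_mul, ex_zero, one_smul]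
  exact this

variable {T lam : ℝ}

theorem Row.hat_sub_hat (hT : 0 < T) {f : ℝ² → ℂ} {a₁ a₂ : ℝ → ℂ} {f₁ f₂ : ℝ² → ℂ} (tf : Tame f)
    (ha₁ : SlowGrowth a₁) (t₁ : Tame f₁) (ha₂ : SlowGrowth a₂) (t₂ : Tame f₂)
    (h : ∀ η, IsTest T η → Row lam f a₁ f₁ a₂ f₂ 0 (kap η)) :
    ∀ t ∈ Icc 0 T, ∀ᵐ ξ : ℝ, hat f t ξ - hat f 0 ξ =
      ∫ s in (0 : ℝ)..t, (-lam * hat f s ξ + (a₁ ξ * hat f₁ s ξ + a₂ ξ * hat f₂ s ξ)) := by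
  intro t ht
  have tc := Tame.comb ha₁ ha₂ t₁ t₂
  set n : ℝ² → ℂ := fun p => (-lam : ℂ) • f p + (a₁ p.2 * f₁ p + a₂ p.2 * f₂ p) with hn
  have tn : Tame n := (tf.const_smul _).add tc
  obtain ⟨u, cu, hu⟩ := tf.exists_curve
  obtain ⟨v, cv, hv⟩ := tn.exists_curve
  obtain ⟨w, -, hw⟩ := (tn.exInt_mul t).exists_curve
  have rapid : ∀ χ : 𝓢(ℝ, ℂ), RapidDecay fun ξ => 𝓕⁻ χ ξ := fun χ => by
    simpa using RapidDecay.fourier (𝓕⁻ (𝓕⁻ χ)) one_pos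
  have spc_apply : ∀ {f : ℝ² → ℂ} (_ : Tame f) {u : 𝓢'(ℝ, ℂ)} {s : ℝ}
      (_ : HasFourierDensity u (hat f s)) (χ : 𝓢(ℝ, ℂ)),
      u χ = ∫ p, ex (s * p.1) * (𝓕⁻ χ p.2 * f p) := by
    intro f tf u s hu χ
    have h1 := spc_eq (tf.integrable_smul (rapid χ)) s 0
    simp only [spc, zero_mul, ex_zero, one_mul, add_zero, hat_smul (fun ξ => 𝓕⁻ χ ξ)] at h1
    exact (hu.apply χ).2.trans h1
  have hp : ∀ η, IsTest T η → pair T u (∂_{eT} η) = -pair T v η := fun η hη => by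
    rw [(hη.lineDeriv eT).pair_eq hT.le tf fun t _ => hu t, hη.pair_eq hT.le tn fun t _ => hv t]
    have h1 := h η hη
    have h2 := integral_kap_eT (η := η) f
    simp only [smul_eq_mul]; rw [← neg_eq_iff_eq_neg, ← h2]
    have i1 := hη.isSym.integrable_sy_mul tf lam
    have i2 := hη.isSym.integrable_mul tf
    have e : ∀ p, sy 0 p.1 * f p * kap η p = sy lam p.1 * f p * kap η p - lam * (f p * kap η p) :=
      fun p => by simp only [sy]; push_cast; ring
    simp only [e]
    rw [integral_sub i1 (i2.const_mul _), h1, add_zero, ← integral_sub (hη.isSym.integrable_mul tc)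
      (i2.const_mul _)]
    congr 1; ext p
    simp only [hn, smul_eq_mul]; ring
  have key : u t - u 0 = w 0 := by
    refine ext_of_hasCompactSupport fun χ hχ => ?_
    have cu' : Continuous fun s => u s χ := (continuous_eval_const χ).comp cu
    have cv' : Continuous fun s => v s χ := (continuous_eval_const χ).comp cv
    have := sub_eq_integral_of_bump cu' cv' (fun θ hθ => ?_) t ht
    · refine this.trans ?_
      rw [spc_apply (tn.exInt_mul t) (hw 0)]
      have hi : Integrable fun p : ℝ² => 𝓕⁻ χ p.2 * n p := tn.integrable_smul (rapid χ)
      rw [intervalIntegral.integral_congr fun s _ => spc_apply tn (hv s) χ, ← integral_exInt_mul measurable_fst hi]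
      congr 1; ext p
      rw [zero_mul, ex_zero]; ring
    · obtain ⟨η, hη, e, e'⟩ := hθ.exists_isTest hχ
      simpa only [pair, e, e', map_smul, smul_eq_mul] using hp η hη
  have h1 := ((hu t).sub (hu 0)).unique (key ▸ hw 0)
  filter_upwards [h1, tn.hat_exInt_mul t, (tf.const_smul (-lam : ℂ)).hat_add tc,
    (t₁.slow_smul ha₁).hat_add (t₂.slow_smul ha₂)] with ξ h1 h2 h3 h4
  rw [h1, h2]
  refine intervalIntegral.integral_congr fun s _ => ?_
  have h5 := h4 s
  rw [hat_smul a₁, hat_smul a₂] at h5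
  have h6 := h3 s
  rw [hat_smul fun _ => (-lam : ℂ)] at h6
  exact h6.trans (congrArg _ h5)

theorem hat_eq_zero_of_rows (hT : 0 < T) {f g : ℝ² → ℂ} {a b c d : ℝ → ℂ} (tf : Tame f) (tg : Tame g)
    (ha : SlowGrowth a) (hb : SlowGrowth b) (hc : SlowGrowth c) (hd : SlowGrowth d)
    (h1 : ∀ η, IsTest T η → Row lam f a f b g 0 (kap η))
    (h2 : ∀ η, IsTest T η → Row lam g c f d g 0 (kap η))
    (h0 : ∀ᵐ ξ : ℝ, hat f 0 ξ = 0 ∧ hat g 0 ξ = 0) :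
    ∀ᵐ ξ : ℝ, ∀ t ∈ Icc 0 T, hat f t ξ = 0 ∧ hat g t ξ = 0 := by
  set r : ℝ → ℝ := fun q => max 0 (min T q)
  have hr : ∀ q, r q ∈ Icc 0 T := fun q => ⟨le_max_left _ _, max_le hT.le (min_le_left _ _)⟩
  have cr : Continuous r := by fun_prop
  have e1 := ae_all_iff.2 fun q : ℚ => Row.hat_sub_hat hT tf ha tf hb tg h1 (r q) (hr q)
  have e2 := ae_all_iff.2 fun q : ℚ => Row.hat_sub_hat hT tg hc tf hd tg h2 (r q) (hr q)
  filter_upwards [e1, e2, h0, tf.continuous_hat, tg.continuous_hat] with ξ e1 e2 h0 cf cg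
  set y := fun s => hat f s ξ
  set z := fun s => hat g s ξ
  rw [h0.1] at e1
  rw [h0.2] at e2
  have prim : ∀ {n : ℝ → ℂ} (_ : Continuous n) (t : ℝ),
      HasDerivAt (fun t => ∫ s in (0 : ℝ)..t, n s) (n t) t := fun cn t =>
    (cn.integral_hasStrictDerivAt 0 t).hasDerivAt
  have ext' : ∀ {y n : ℝ → ℂ} (_ : Continuous y) (_ : Continuous n)
      (_ : ∀ q : ℚ, y (r q) - 0 = ∫ s in (0 : ℝ)..r q, n s),
      ∀ t ∈ Icc 0 T, y t = ∫ s in (0 : ℝ)..t, n s := by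
    intro y n cy cn hq t ht
    have cN : Continuous fun t => ∫ s in (0 : ℝ)..t, n s :=
      continuous_iff_continuousAt.2 fun t => (prim cn t).continuousAt
    have := congrFun (Rat.denseRange_cast.equalizer (cy.comp cr) (cN.comp cr)
      (funext fun q => (sub_zero (y (r q))).symm.trans (hq q))) t
    simpa [r, ht.1, ht.2] using this
  have c1 : Continuous fun s => -lam * y s + (a ξ * y s + b ξ * z s) := by fun_prop
  have c2 : Continuous fun s => -lam * z s + (c ξ * y s + d ξ * z s) := by fun_prop
  have E1 := ext' cf c1 e1
  have E2 := ext' cg c2 e2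
  set K := |lam| + ‖a ξ‖ + ‖b ξ‖ + ‖c ξ‖ + ‖d ξ‖
  have := eq_zero_of_abs_deriv_le_mul_abs_self_of_eq_zero_right (K := K) (a := 0)
    (f := fun t => (∫ s in (0 : ℝ)..t, (-lam * y s + (a ξ * y s + b ξ * z s)),
      ∫ s in (0 : ℝ)..t, (-lam * z s + (c ξ * y s + d ξ * z s))))
    (fun t _ => ((prim c1 t).prodMk (prim c2 t)).continuousAt.continuousWithinAt)
    (fun t _ => ((prim c1 t).prodMk (prim c2 t)).hasDerivWithinAt) (by simp) (fun t ht => by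
      rw [← E1 t ⟨ht.1, ht.2.le⟩, ← E2 t ⟨ht.1, ht.2.le⟩]
      have n1 : ‖y t‖ ≤ ‖(y t, z t)‖ := norm_fst_le (y t, z t)
      have n2 : ‖z t‖ ≤ ‖(y t, z t)‖ := norm_snd_le (y t, z t)
      have bd : ∀ (A B x w X : ℂ), ‖x‖ ≤ ‖(y t, z t)‖ → ‖w‖ ≤ ‖(y t, z t)‖ → ‖X‖ ≤ ‖(y t, z t)‖ →
          ‖-lam * X + (A * x + B * w)‖ ≤ (|lam| + ‖A‖ + ‖B‖) * ‖(y t, z t)‖ := by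
        intro A B x w X hx hw hX
        refine (norm_add_le _ _).trans ((add_le_add le_rfl (norm_add_le _ _)).trans ?_)
        rw [norm_mul, norm_mul, norm_mul, norm_neg, norm_real, norm_eq_abs]
        calc _ ≤ |lam| * ‖(y t, z t)‖ + (‖A‖ * ‖(y t, z t)‖ + ‖B‖ * ‖(y t, z t)‖) := by gcongr
          _ = _ := by ring
      refine max_le ((bd _ _ _ _ _ n1 n2 n1).trans ?_) ((bd _ _ _ _ _ n1 n2 n2).trans ?_) <;>
      · gcongr
        linarith [norm_nonneg (a ξ), norm_nonneg (b ξ), norm_nonneg (c ξ), norm_nonneg (d ξ)])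
  intro t ht
  have h := Prod.mk.inj (this t ht)
  exact ⟨(E1 t ht).trans h.1, (E2 t ht).trans h.2⟩

theorem exists_den_eq {s b σ : ℝ} (hb : 0 ≤ b) {h : ℝ → ℝ} (mh : Measurable h) {a : ℝ → ℂ}
    (ma : Measurable a) (na : ∀ ξ, ‖a ξ‖ ≤ 1) (ha : ∀ ξ, a ξ ≠ 0 → h ξ = σ * |ξ|) {f : ℝ² → ℂ}
    (hf : MemLp (fun p => bw s b σ p • f p) 2 volume) :
    ∃ G : L2 ℝ², den (wt s b 1 h) G =ᵐ[volume] fun p => a p.2 * f p := by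
  obtain ⟨C₁, hC₁, h₁⟩ := exists_bracket_rpow_le s
  obtain ⟨C₂, hC₂, h₂⟩ := exists_bracket_rpow_le b
  have hm : MemLp (fun p => ((wt s b 1 h p : ℝ) : ℂ) * (a p.2 * f p)) 2 volume := by
    refine hf.of_le_mul (c := C₁ * C₂) ?_ (.of_forall fun p => ?_)
    · exact (measurable_ofReal.comp (measurable_wt s b 1 mh)).aestronglyMeasurable.mul
        ((ma.comp measurable_snd).aestronglyMeasurable.mul (aestronglyMeasurable_of_memLp_bw hf))
    · have w0 := wt_pos (s := s) (b := b) one_pos h p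
      have b0 := bw_pos s b σ p
      rw [norm_smul, norm_mul, norm_mul, norm_of_nonneg b0.le, norm_ofReal_of_nonneg w0.le]
      by_cases h0 : a p.2 = 0
      · rw [h0, norm_zero, zero_mul, mul_zero]; positivity
      · have e : wt s b 1 h p ≤ C₁ * C₂ * bw s b σ p := by
          rw [wt, ha _ h0, bw]
          calc _ ≤ (C₁ * bracket (2 * π * p.2) ^ s) *
                (C₂ * bracket (2 * π * (p.1 + σ * |p.2|)) ^ b) :=
              mul_le_mul (h₁ _).2 (h₂ _).2 (jb_rpow_nonneg _ _)
                ((jb_rpow_nonneg _ _).trans (h₁ _).2)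
            _ = _ := by ring
        calc _ ≤ C₁ * C₂ * bw s b σ p * (1 * ‖f p‖) := by gcongr; exact na _
          _ = _ := by ring
  refine ⟨hm.toLp, ?_⟩
  filter_upwards [hm.coeFn_toLp] with p hp
  have w0 := wt_pos (s := s) (b := b) one_pos h p
  rw [den, hp, ← mul_assoc, ← Complex.ofReal_mul, inv_mul_cancel₀ w0.ne', ofReal_one, one_mul]

section

variable {F : Type*} [NormedAddCommGroup F] [NormedSpace ℂ F]

theorem tame_of_memLp {s b σ : ℝ} (hb : 1 / 2 < b) {f : ℝ² → F}
    (hf : MemLp (fun p => bw s b σ p • f p) 2 volume) : Tame f := by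
  have mf := aestronglyMeasurable_of_memLp_bw hf
  have hn : MemLp (fun p => bw s b σ p • (‖f p‖ : ℂ)) 2 volume := by
    refine hf.congr_norm ?_ (.of_forall fun p => by simp [norm_smul])
    exact (measurable_bw s b σ).aestronglyMeasurable.smul
      (Complex.continuous_ofReal.comp_aestronglyMeasurable mf.norm)
  obtain ⟨G, hG⟩ := exists_den_eq (a := fun _ => 1) (by linarith) (measurable_hz σ) measurable_const
    (fun _ => by simp) (fun _ _ => rfl) hn
  obtain ⟨-, N, hN⟩ := tame_den (s := s) hb le_rfl (measurable_hz σ) G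
  refine ⟨mf, N, hN.congr' ?_ ?_⟩
  · exact ((continuous_jb.comp continuous_snd).measurable.pow_const (-N)).aestronglyMeasurable.smul mf
  · filter_upwards [hG] with p hp
    simp [norm_smul, hp]

variable [CompleteSpace F]

theorem MemXLoc.exists_tame {s b σ T : ℝ} (hb : 1 / 2 < b) (hT : 0 < T) {u : ℝ → 𝓢'(ℝ, F)}
    (h : MemXLoc s b σ T u) : ∃ f : ℝ² → F, Tame f ∧ MemLp (fun p => bw s b σ p • f p) 2 volume ∧
      ∀ t ∈ Icc 0 T, HasFourierDensity (u t) (hat f t) := by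
  obtain ⟨cu, U, ⟨f, hf, hm⟩, hU⟩ := h
  have hm' : MemLp (fun p => bw s b σ p • f (pt p)) 2 volume :=
    by simpa only [Function.comp_def, pt_zero, pt_one, bw] using hm.comp_measurePreserving measurePreserving_pt
  have tf := tame_of_memLp hb hm'
  refine ⟨fun p => f (pt p), tf, hm', tf.hasFourierDensity hT cu fun η hη => ?_⟩
  rw [← hU η hη, (hf.apply η).2]
  exact measurePreserving_pt.integral_comp measurableEmbedding_pt fun q => 𝓕⁻ η q • f q

end

theorem isReal_of_pair {T : ℝ} (hT : 0 < T) {φ φt : ℝ → 𝓢'(ℝ, ℂ)} (ct : ContinuousOn φt (Icc 0 T))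
    (hr : ∀ t ∈ Icc 0 T, IsReal (φ t))
    (h : ∀ η, IsTest T η → pair T φ (∂_{eT} η) = -pair T φt η) :
    ∀ t ∈ Icc 0 T, IsReal (φt t) := by
  intro t ht
  refine .of_hasCompactSupport fun χ hχ h0 => ?_
  have cc : ContinuousOn (fun t => φt t χ) (Icc 0 T) := (continuous_eval_const χ).comp_continuousOn ct
  have := eqOn_zero_of_integral_bump hT (a := fun t => ((φt t χ).im : ℂ))
    (Complex.continuous_ofReal.comp_continuousOn (Complex.continuous_im.comp_continuousOn cc))
    (fun θ hθ => ?_) t ht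
  · exact_mod_cast this
  · obtain ⟨η, hη, e, e'⟩ := hθ.exists_isTest hχ
    have ep : ∀ (w : ℝ → 𝓢'(ℝ, ℂ)) (η : 𝓢²) (r : ℝ → ℝ),
        (∀ t, slice t η = (r t : ℂ) • χ) → pair T w η = ∫ t in (0 : ℝ)..T, (r t : ℂ) * w t χ := by
      intro w η r hr
      refine intervalIntegral.integral_congr fun t _ => ?_
      rw [hr]
      exact map_smul (w t) _ _
    have h1 := h η hη
    rw [ep φ _ _ e', ep φt _ _ e] at h1
    have h2 : ∫ t in (0 : ℝ)..T, ((deriv θ t : ℝ) : ℂ) * φ t χ =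
        ((∫ t in (0 : ℝ)..T, deriv θ t * (φ t χ).re : ℝ) : ℂ) := by
      rw [← intervalIntegral.integral_ofReal]
      refine intervalIntegral.integral_congr fun t ht => ?_
      rw [Set.uIcc_of_le hT.le] at ht
      apply Complex.ext <;> simp [hr t ht χ h0]
    have h3 := congrArg Complex.im h1
    have hi : IntervalIntegrable (fun t => (θ t : ℂ) * φt t χ) volume 0 T :=
      (((Complex.continuous_ofReal.comp hθ.1.continuous).continuousOn.mul cc).mono
        (Set.uIcc_of_le hT.le).subset).intervalIntegrable
    have h4 := ContinuousLinearMap.intervalIntegral_comp_comm Complex.imCLM hi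
    rw [h2, ofReal_im, Complex.neg_im, zero_eq_neg, ← Complex.imCLM_apply, ← h4] at h3
    have : ∀ t, θ t • ((φt t χ).im : ℂ) = ((θ t * (φt t χ).im : ℝ) : ℂ) := fun t => by simp
    simp only [this]
    rw [intervalIntegral.integral_ofReal, Complex.ofReal_eq_zero]
    exact .trans (intervalIntegral.integral_congr fun t _ => by simp) h3

theorem om_temperate : (fun ξ : ℝ => (om ξ : ℂ)).HasTemperateGrowth := by
  have h1 : (fun ξ => (2 * π) • ξ).HasTemperateGrowth :=
    ((2 * π) • ContinuousLinearMap.id ℝ ℝ).hasTemperateGrowth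
  refine (congrArg _ ?_).mp ((sw_temperate 1).comp h1)
  ext ξ
  simp [sw, om, sqrt_eq_rpow]

theorem exists_density_halfWave {φ φt : 𝓢'(ℝ, ℂ)} (hr : IsReal φ) (hr' : IsReal φt) {P Q : ℝ → ℂ}
    (hP : HasFourierDensity (halfWave 1 φ φt) P) (hQ : HasFourierDensity (halfWave (-1) φ φt) Q) :
    HasFourierDensity φ (fun ξ => (P ξ + conj (P (-ξ))) / 2) ∧
      HasFourierDensity φt fun ξ => om ξ * ((P ξ - conj (P (-ξ))) / (2 * I)) := by
  have om0 : ∀ ξ, (om ξ : ℂ) ≠ 0 := fun ξ => by exact_mod_cast (om_pos ξ).ne'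
  have eφ : φ = (1 / 2 : ℂ) • (halfWave 1 φ φt + halfWave (-1) φ φt) := by
    simp only [halfWave, Complex.ofReal_neg]
    module
  have eA : invSqrtA φt = (-(I / 2)) • (halfWave 1 φ φt - halfWave (-1) φ φt) := by
    have : halfWave 1 φ φt - halfWave (-1) φ φt = (2 * I) • invSqrtA φt := by
      simp only [halfWave, Complex.ofReal_neg]
      module
    rw [this, smul_smul, show -(I / 2) * (2 * I) = 1 by linear_combination -I_sq, one_smul]
  have d1 : HasFourierDensity φ fun ξ => (1 / 2 : ℂ) • (P ξ + Q ξ) := by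
    rw [eφ]; exact (hP.add hQ).smul _
  have d2 : HasFourierDensity φt fun ξ => (om ξ : ℂ) • (-(I / 2)) • (P ξ - Q ξ) := by
    have h1 : HasFourierDensity (invSqrtA φt) fun ξ => (-(I / 2)) • (P ξ - Q ξ) := by
      rw [eA]; exact (hP.sub hQ).smul _
    have h2 := h1.multiplier om_temperate
    rw [invSqrtA, TemperedDistribution.fourierMultiplierCLM_fourierMultiplierCLM_apply
      om_inv_temperate om_temperate] at h2
    have h3 : ((fun ξ => (((1 + (2 * π * ξ) ^ 2) ^ (-1 / 2 : ℝ) : ℝ) : ℂ)) *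
        fun ξ => (om ξ : ℂ)) = fun _ => 1 := by
      ext ξ
      rw [Pi.mul_apply, om_inv_eq, inv_mul_cancel₀ (om0 ξ)]
    rw [h3, TemperedDistribution.fourierMultiplierCLM_const] at h2
    simpa using h2
  have key : ∀ᵐ ξ : ℝ, Q ξ = conj (P (-ξ)) := by
    filter_upwards [hr.herm d1, hr'.herm d2] with ξ h1 h2
    simp only [smul_eq_mul, map_mul, map_add, map_sub, map_neg, map_div₀, conj_I, map_one,
      map_ofNat, conj_ofReal, om_neg] at h1 h2
    have h3 := mul_left_cancel₀ (om0 ξ) h2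
    have h4 : P (-ξ) = conj (Q ξ) := by
      linear_combination h1 + I * h3 - (I_sq) *
        (-1/2 * (P (-ξ) - Q (-ξ)) - 1/2 * (conj (P ξ) - conj (Q ξ)))
    rw [h4, Complex.conj_conj]
  have hI : ∀ x, x / (2 * I) = -(I / 2) * x := fun x => by
    rw [div_eq_iff (by simp)]
    linear_combination x * I_sq
  constructor
  · refine d1.congr ?_
    filter_upwards [key] with ξ h
    rw [h, smul_eq_mul]; ring
  · refine d2.congr ?_
    filter_upwards [key] with ξ h
    rw [h, hI, smul_eq_mul, smul_eq_mul]

theorem hat_congr {f g : ℝ² → ℂ} (h : f =ᵐ[volume] g) : ∀ᵐ ξ : ℝ, ∀ t, hat f t ξ = hat g t ξ := by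
  filter_upwards [ae_prod_slice h] with ξ hξ t
  exact integral_congr_ae (hξ.mono fun τ hτ => congrArg (ex (t * τ) • ·) hτ)

theorem hat_inner {f : ℝ² → Spinor} (tf : Tame f) (e : Spinor) :
    ∀ᵐ ξ : ℝ, ∀ t, hat (fun p => inner ℂ e (f p)) t ξ = inner ℂ e (hat f t ξ) := by
  filter_upwards [tf.integrable_slice] with ξ hξ t
  have hi := integrable_ex_smul (u := fun τ => t * τ) (by fun_prop) hξ
  rw [hat, hat, ← innerSL_apply_apply ℂ, ← (innerSL ℂ e).integral_comp_comm hi]; simp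

theorem IsSolution.exists_density {α β : Matrix (Fin 2) (Fin 2) ℂ} {e e' : Spinor}
    (hB : DiracBasis α β e e') {M m g l k b T : ℝ} (hb : 1 / 2 < b) (hT : 0 < T)
    {ψ₀ : 𝓢'(ℝ, Spinor)} {φ₀ φ₁ : 𝓢'(ℝ, ℂ)} {ψ : ℝ → 𝓢'(ℝ, Spinor)} {φ φt : ℝ → 𝓢'(ℝ, ℂ)}
    (h : IsSolution α β M m g l k b T ψ₀ φ₀ φ₁ ψ φ φt) : ∃ S : E3, ∀ t ∈ Icc 0 T,
      HasFourierDensity (ψ t) (fun ξ => hat (du l b 1 S) t ξ • e + hat (dv l b 1 S) t ξ • e') ∧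
      HasFourierDensity (φ t) (hat (ph (dz k b 1 S)) t) ∧
      HasFourierDensity (φt t) (hat (phd (dz k b 1 S)) t) := by
  have hb0 : 0 ≤ b := by linarith
  obtain ⟨ψp, hψp, mp⟩ := h.memX_psi 1 (by simp)
  obtain ⟨ψm, hψm, mm⟩ := h.memX_psi (-1) (by simp)
  obtain ⟨fp, tp, np, dp⟩ := mp.exists_tame hb hT
  obtain ⟨fm, tm, nm, dm⟩ := mm.exists_tame hb hT
  obtain ⟨f, -, nf, df⟩ := (h.memY_phi 1 (by simp)).exists_tame hb hT
  obtain ⟨f', -, -, df'⟩ := (h.memY_phi (-1) (by simp)).exists_tame hb hT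
  have inn : ∀ {σ : ℝ} {f : ℝ² → Spinor} (x : Spinor), MemLp (fun p => bw (-l) b σ p • f p) 2 volume →
      MemLp (fun p => bw (-l) b σ p • inner ℂ x (f p)) 2 volume := fun x hf =>
    ((innerSL ℂ x).comp_memLp' hf).ae_eq (.of_forall fun p => by simp [inner_smul_right_eq_smul])
  have comp : ∀ (x : Spinor) (s : ℝ), (s = 1 ∨ s = -1) → ∃ G : L2 ℝ²,
      ∀ᵐ ξ : ℝ, ∀ t, hat (den (wt (-l) b 1 (hu s)) G) t ξ =
        pr s ξ * inner ℂ x (hat fp t ξ) + pr (-s) ξ * inner ℂ x (hat fm t ξ) := by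
    intro x s hs
    have hs' : -s = 1 ∨ -s = -1 := by rcases hs with rfl | rfl <;> simp
    obtain ⟨G, hG⟩ := exists_den_eq hb0 (measurable_hu s) (measurable_pr s) (norm_pr_le hs)
      (fun ξ hξ => show s * ξ = 1 * |ξ| by
        rcases hs with rfl | rfl <;> linarith [eq_of_pr (by simp) hξ]) (inn x np)
    obtain ⟨G', hG'⟩ := exists_den_eq hb0 (measurable_hu s) (measurable_pr (-s)) (norm_pr_le hs')
      (fun ξ hξ => show s * ξ = -1 * |ξ| by
        have := eq_of_pr hs' hξ
        rcases hs with rfl | rfl <;> linarith) (inn x nm)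
    refine ⟨G + G', ?_⟩
    have t1 := (tame_of_memLp hb (inn x np)).slow_smul (slow_pr hs)
    have t2 := (tame_of_memLp hb (inn x nm)).slow_smul (slow_pr hs')
    have ee : den (wt (-l) b 1 (hu s)) (G + G' : L2 ℝ²) =ᵐ[volume]
        fun p => pr s p.2 • inner ℂ x (fp p) + pr (-s) p.2 • inner ℂ x (fm p) := by
      filter_upwards [den_add (wt (-l) b 1 (hu s)) G G', hG, hG'] with p h1 h2 h3
      rw [h1, Pi.add_apply, h2, h3]; rfl
    filter_upwards [hat_congr ee, t1.hat_add t2, hat_inner tp x, hat_inner tm x] with ξ h1 h2 h3 h4 t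
    rw [h1, h2, hat_smul (pr s), hat_smul (pr (-s)), h3, h4]; rfl
  obtain ⟨U, hU⟩ := comp e 1 (.inl rfl)
  obtain ⟨V, hV⟩ := comp e' (-1) (.inr rfl)
  obtain ⟨Z, hZ⟩ := exists_den_eq (a := fun _ => 1) hb0 (measurable_hz 1) measurable_const
    (fun _ => by simp) (fun _ _ => rfl) nf
  refine ⟨(U, V, Z), fun t ht => ⟨?_, ?_⟩⟩
  · obtain ⟨q, hq, hq'⟩ := hψp t ht
    obtain ⟨r, hr, hr'⟩ := hψm t ht
    refine hq.congr ?_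
    filter_upwards [hU, hV, hq.unique hr, hq'.unique (dp t ht), hr'.unique (dm t ht),
      Measure.ae_ne volume (0 : ℝ)] with ξ h1 h2 h3 h4 h5 h6
    have h1 := h1 t
    have h2 := h2 t
    rw [← h4, ← h5, ← h3, hB.eq_add (q ξ), hB.diracSymbol_apply, hB.diracSymbol_apply] at h1 h2
    rw [hB.inner_fst, hB.inner_fst] at h1
    rw [hB.inner_snd, hB.inner_snd] at h2
    change q ξ = hat (den (wt (-l) b 1 (hu 1)) U) t ξ • e + hat (den (wt (-l) b 1 (hu (-1))) V) t ξ • e'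
    rw [h1, h2]
    conv_lhs => rw [hB.eq_add (q ξ)]
    simp only [pr]
    rcases lt_or_gt_of_ne h6 with h | h
    · simp [Real.sign_of_neg h]
    · simp [Real.sign_of_pos h]
  · obtain ⟨d1, d2⟩ := exists_density_halfWave (h.isReal t ht)
      (isReal_of_pair hT h.continuousOn_phit h.isReal h.deriv_phi t ht) (df t ht) (df' t ht)
    have e1 : dz k b 1 (U, V, Z) =ᵐ[volume] f := hZ.trans (.of_forall fun p => one_mul _)
    have tz : Tame (dz k b 1 (U, V, Z)) := tame_den hb le_rfl (measurable_hz 1) Z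
    have e2 : ∀ᵐ ξ : ℝ, hat (dz k b 1 (U, V, Z)) t ξ = hat f t ξ :=
      (hat_congr e1).mono fun ξ h => h t
    have e3 := (Measure.measurePreserving_neg 𝓛¹).quasiMeasurePreserving.ae e2
    refine ⟨d1.congr ?_, d2.congr ?_⟩ <;>
    · filter_upwards [hat_ph tz, e2, e3] with ξ h1 h2 h3
      simp only [(h1 t).1, (h1 t).2, h2, h3]

theorem Tame.hat_sub {f g : ℝ² → ℂ} (hf : Tame f) (hg : Tame g) :
    ∀ᵐ ξ : ℝ, ∀ t, hat (f - g) t ξ = hat f t ξ - hat g t ξ := by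
  have h := hf.hat_add (hg.const_smul (-1))
  filter_upwards [h] with ξ h t
  have h := h t
  rw [hat_smul fun _ => (-1 : ℂ)] at h
  rw [sub_eq_add_neg (hat f t ξ), ← neg_one_smul ℂ (hat g t ξ), ← h]
  congr 1; ext p; simp [sub_eq_add_neg]

theorem Tame3.hat_sub {X Y : T3} (h : Tame3 X) (h' : Tame3 Y) :
    ∀ᵐ ξ : ℝ, ∀ t, hat (X - Y).1 t ξ = hat X.1 t ξ - hat Y.1 t ξ ∧
      hat (X - Y).2.1 t ξ = hat X.2.1 t ξ - hat Y.2.1 t ξ ∧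
      hat (X - Y).2.2 t ξ = hat X.2.2 t ξ - hat Y.2.2 t ξ := by
  filter_upwards [h.1.hat_sub h'.1, h.2.1.hat_sub h'.2.1, h.2.2.hat_sub h'.2.2] with ξ h1 h2 h3 t
  exact ⟨h1 t, h2 t, h3 t⟩

section

variable {f f' g κ : ℝ² → ℂ}

theorem ConvInt.sub_left (h : ConvInt f g κ) (h' : ConvInt f' g κ) :
    ConvInt (f - f') g κ ∧ conv (f - f') g κ = conv f g κ - conv f' g κ := by
  have e : (fun z : ℝ² × ℝ² => (f - f') z.1 * g z.2 * κ (z.1 + z.2)) = fun z =>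
      f z.1 * g z.2 * κ (z.1 + z.2) - f' z.1 * g z.2 * κ (z.1 + z.2) := by
    ext z; rw [Pi.sub_apply]; ring
  rw [ConvInt, conv, e]
  exact ⟨Integrable.sub h h', integral_sub h h'⟩

theorem ConvInt.sub_right (h : ConvInt g f κ) (h' : ConvInt g f' κ) :
    ConvInt g (f - f') κ ∧ conv g (f - f') κ = conv g f κ - conv g f' κ := by
  have e : (fun z : ℝ² × ℝ² => g z.1 * (f - f') z.2 * κ (z.1 + z.2)) = fun z =>
      g z.1 * f z.2 * κ (z.1 + z.2) - g z.1 * f' z.2 * κ (z.1 + z.2) := by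
    ext z; rw [Pi.sub_apply]; ring
  rw [ConvInt, conv, e]
  exact ⟨Integrable.sub h h', integral_sub h h'⟩

end

section

variable {X X' Y : T3} {κ : ℝ² → ℂ}

theorem NlInt.sub_left (h : NlInt X Y κ) (h' : NlInt X' Y κ) (g : ℝ) :
    NlInt (X - X') Y κ ∧ nl g (X - X') Y κ = nl g X Y κ - nl g X' Y κ := by
  obtain ⟨a, a'⟩ := h.1.sub_left h'.1
  obtain ⟨b, b'⟩ := h.2.1.sub_left h'.2.1
  obtain ⟨c, c'⟩ := h.2.2.1.sub_left h'.2.2.1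
  obtain ⟨d, d'⟩ := h.2.2.2.sub_left h'.2.2.2
  simp only [NlInt, nl, quad, Prod.fst_sub, Prod.snd_sub, ph_sub, refl_sub]
  refine ⟨⟨a, b, c, d⟩, ?_⟩
  rw [a', b', c', d']
  ext <;> simp <;> ring

theorem NlInt.sub_right (h : NlInt Y X κ) (h' : NlInt Y X' κ) (g : ℝ) :
    NlInt Y (X - X') κ ∧ nl g Y (X - X') κ = nl g Y X κ - nl g Y X' κ := by
  obtain ⟨a, a'⟩ := h.1.sub_right h'.1
  obtain ⟨b, b'⟩ := h.2.1.sub_right h'.2.1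
  obtain ⟨c, c'⟩ := h.2.2.1.sub_right h'.2.2.1
  obtain ⟨d, d'⟩ := h.2.2.2.sub_right h'.2.2.2
  simp only [NlInt, nl, quad, Prod.fst_sub, Prod.snd_sub, refl_sub]
  refine ⟨⟨a, b, c, d⟩, ?_⟩
  rw [a', b', c', d']
  ext <;> simp <;> ring

end

theorem IsTest.exists_eq_exp_mul {T : ℝ} {η : 𝓢²} (h : IsTest T η) (a : ℝ) : ∃ θ : 𝓢², IsTest T θ ∧
      (∀ t, slice t η = (exp (a * t) : ℂ) • slice t θ) ∧
      ∀ t, slice t (∂_{eT} η - (a : ℂ) • η) = (exp (a * t) : ℂ) • slice t (∂_{eT} θ) := by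
  obtain ⟨θ, hθ, h1, h2⟩ := h.exists_exp_mul (-a)
  have e : ∀ t, (exp (a * t) : ℂ) * (exp (-a * t) : ℂ) = 1 := fun t => by
    rw [← Complex.ofReal_mul, ← Real.exp_add]; simp
  have h3 : ∀ t, slice t η = (exp (a * t) : ℂ) • slice t θ := fun t => by
    rw [h1, smul_smul, e, one_smul]
  refine ⟨θ, hθ, h3, fun t => ?_⟩
  ext x
  have e1 := DFunLike.congr_fun (h2 t) x
  have e2 := DFunLike.congr_fun (h3 t) x
  simp only [slice_apply, sub_apply, smul_apply, Complex.ofReal_neg] at e1 e2 ⊢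
  linear_combination (-(exp (a * t) : ℂ)) * e1 - a * e2 - ∂_{eT} η (pt (t, x)) * e t

theorem hat_eq_zero_of_fieldEq {M m lam T : ℝ} (hT : 0 < T) {Z : T3} (tZ : Tame3 Z)
    (h : ∀ η, IsTest T η → FE M m lam Z 0 (kap η))
    (h0 : ∀ᵐ ξ : ℝ, hat Z.1 0 ξ = 0 ∧ hat Z.2.1 0 ξ = 0 ∧ hat Z.2.2 0 ξ = 0) :
    ∀ᵐ ξ : ℝ, ∀ t ∈ Icc 0 T, hat Z.1 t ξ = 0 ∧ hat Z.2.1 t ξ = 0 ∧ hat Z.2.2 t ξ = 0 := by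
  have hz := hat_ph_congr (r := 0) tZ.2.2 tZ.2.2 (h0.mono fun ξ h => by rw [h.2.2]; simp)
  have h1 := hat_eq_zero_of_rows hT tZ.1 tZ.2.1 slow_coeff₁ (.const _) (.const _) slow_coeff₂
    (fun η hη => (h η hη).1) (fun η hη => (h η hη).2.1) (h0.mono fun ξ h => ⟨h.1, h.2.1⟩)
  have h2 := hat_eq_zero_of_rows hT tZ.2.2.ph tZ.2.2.phd (.const _) (.const _) (slow_coeff₃ m)
    (.const _) (fun η hη => (h η hη).2.2.1) (fun η hη => (h η hη).2.2.2) (by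
      filter_upwards [hz.1, hz.2] with ξ h1 h2
      simpa using And.intro h1 h2)
  filter_upwards [h1, h2, hat_halfWave tZ.2.2] with ξ h1 h2 h3 t ht
  refine ⟨(h1 t ht).1, (h1 t ht).2, ?_⟩
  rw [← (h3 t).1, (h2 t ht).1, (h2 t ht).2]; simp

theorem ae_hat_eq_zero {s b lam : ℝ} (hb : 1 / 2 < b) (hl : 1 ≤ lam) {h : ℝ → ℝ} (mh : Measurable h)
    {f : ℝ² → ℂ} (tf : Tame f) {t r : ℝ} {H : ℕ → L2 ℝ²} (hH : Tendsto H atTop (𝓝 0))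
    (e : ∀ n, ∀ᵐ ξ : ℝ, hat f t ξ = r * hat (den (wt s b lam h) (H n)) t ξ) :
    ∀ᵐ ξ : ℝ, hat f t ξ = 0 := by
  obtain ⟨C, hC⟩ := exists_enorm_hat_den_le s hb mh
  have mj : AEStronglyMeasurable (fun ξ => jc ξ s) volume := by
    exact Measurable.aestronglyMeasurable (by fun_prop)
  have key : ∀ n, ∫⁻ ξ, ‖jc ξ s • hat f t ξ‖ₑ ^ 2 ≤ ‖(r : ℂ)‖ₑ ^ 2 * C * ‖H n‖ₑ ^ 2 := by
    intro n
    rw [← L2.lintegral_slices, ← lintegral_const_mul' _ _ (by finiteness)]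
    refine lintegral_mono_ae ?_
    filter_upwards [e n] with ξ hξ
    rw [hξ, ← smul_eq_mul, smul_comm, enorm_smul, mul_pow, mul_assoc]; gcongr
    exact hC lam hl _ _ _
  have h0 : ∫⁻ ξ, ‖jc ξ s • hat f t ξ‖ₑ ^ 2 = 0 := by
    have h1 := ENNReal.Tendsto.const_mul (a := ‖(r : ℂ)‖ₑ ^ 2 * C)
      (((ENNReal.continuous_pow 2).comp continuous_enorm).tendsto (0 : L2 ℝ²) |>.comp hH)
      (.inr (by finiteness))
    simp only [comp_apply, enorm_zero, ne_eq, OfNat.ofNat_ne_zero, not_false_eq_true,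
      zero_pow, mul_zero] at h1
    exact le_antisymm (ge_of_tendsto' h1 key) zero_le
  have mf := ((mj.smul (tf.aestronglyMeasurable_hat t)).enorm.pow_const 2)
  filter_upwards [(lintegral_eq_zero_iff' mf).1 h0] with ξ hξ
  have := jb_rpow_pos ξ s
  simpa [this.ne'] using hξ

section

variable {l k δ b : ℝ}

theorem exists_rel (l k : ℝ) (hb : 1 / 2 < b) (hb' : b < 1) {lam : ℝ} (hl : 1 ≤ lam) (T : ℝ) (S S' : E3) :
    ∃ H : E3, Rel T (fun t => exp (lam * t)) (dn l k b 1 S - dn l k b 1 S') (dn l k b lam H) := by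
  have hl0 : 0 < lam := by linarith
  have tr : ∀ (s : ℝ) (h : ℝ → ℝ), Measurable h → ∀ F F' : L2 ℝ², ∃ G : L2 ℝ²,
      den (wt s b lam h) G =ᵐ[volume] den (wt s b 1 h) F - den (wt s b 1 h) F' := by
    intro s h mh F F'
    obtain ⟨U, -, hU⟩ := exists_transfer (a := ⟨lam ^ b, by positivity⟩)
      (measurable_wt s b 1 mh) (measurable_wt s b lam mh) (wt_pos one_pos h) (wt_pos hl0 h)
      measurable_const (fun p => by
        have h1 : lb lam (p.1 + h p.2) ≤ lam * lb 1 (p.1 + h p.2) := by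
          unfold lb; nlinarith [abs_nonneg (p.1 + h p.2)]
        have h2 := rpow_le_rpow (lb_pos hl0 _).le h1 (by linarith : 0 ≤ b)
        rw [mul_rpow hl0.le (lb_pos one_pos _).le] at h2
        have h3 := jb_rpow_pos p.2 s
        rw [norm_one, one_mul, wt, wt, mul_left_comm]
        exact mul_le_mul_of_nonneg_left h2 h3.le)
    refine ⟨U (F - F'), ?_⟩
    filter_upwards [hU (F - F'), den_sub (wt s b 1 h) F F'] with p h1 h2
    rw [h1, h2, one_mul]
  obtain ⟨G₁, h₁⟩ := tr (-l) _ (measurable_hu 1) S.1 S'.1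
  obtain ⟨G₂, h₂⟩ := tr (-l) _ (measurable_hu (-1)) S.2.1 S'.2.1
  obtain ⟨G₃, h₃⟩ := tr k _ (measurable_hz 1) S.2.2 S'.2.2
  obtain ⟨_, hM⟩ := exists_timeCut3 l k hb hb' 1
  obtain ⟨ℳ, -, eM⟩ := hM lam hl 0
  refine ⟨ℳ (G₁, G₂, G₃), ?_⟩
  filter_upwards [eM (G₁, G₂, G₃), hat_congr h₁, hat_congr h₂, hat_congr h₃] with ξ e h₁ h₂ h₃ t ht
  have e0 : (exp (lam * t) : ℂ) * (1 * (exp (-(lam * |t - 0|)) : ℝ)) = 1 := by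
    rw [one_mul, ← Complex.ofReal_mul, ← Real.exp_add, sub_zero, abs_of_nonneg ht.1]; simp
  have E : ∀ {x y z : ℂ}, x = 1 * (exp (-(lam * |t - 0|)) : ℝ) * y → y = z →
      z = (exp (lam * t) : ℝ) * x := by
    rintro x y _ rfl rfl
    rw [← mul_assoc, e0, one_mul]
  exact ⟨E (e t).1 (h₁ t), E (e t).2.1 (h₂ t), E (e t).2.2 (h₃ t)⟩

theorem hat_sub_eq_zero (h : Exponents l k δ) (hb : 1 / 2 < b) (hbδ : b - 1 / 2 < δ / 4)
    (M m g : ℝ) {T : ℝ} (hT : 0 < T) {S S' : E3}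
    (hE : ∀ F ∈ ({S, S'} : Set E3), ∀ η, IsTest T η →
      FE M m 0 (dn l k b 1 F) (nl g (dn l k b 1 F) (dn l k b 1 F) (kap η)) (kap η))
    (h0 : ∀ᵐ ξ : ℝ, hat (dn l k b 1 S - dn l k b 1 S').1 0 ξ = 0 ∧
      hat (dn l k b 1 S - dn l k b 1 S').2.1 0 ξ = 0 ∧
      hat (dn l k b 1 S - dn l k b 1 S').2.2 0 ξ = 0) : ∀ t ∈ Icc 0 T, ∀ᵐ ξ : ℝ,
      hat (dn l k b 1 S - dn l k b 1 S').1 t ξ = 0 ∧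
      hat (dn l k b 1 S - dn l k b 1 S').2.1 t ξ = 0 ∧
      hat (dn l k b 1 S - dn l k b 1 S').2.2 t ξ = 0 := by
  have hδ := h.δ_le
  obtain ⟨CK, hK⟩ := exists_linear l k hb (by linarith) M m
  obtain ⟨CB, hB⟩ := exists_nonlinearity h hb (by linarith) g
  set ε := b - 1 / 2 with hε
  obtain ⟨lam, hl, hX⟩ := exists_param (γ := δ - 2 * ε) (by linarith)
    (2 * CK + 4 * (CK * CB * (‖S‖ + ‖S'‖)))
  have hl0 : 0 < lam := by linarith
  obtain ⟨K, P, E, nK, nP, -, wK⟩ := hK lam hl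
  obtain ⟨_, _, N₀⟩ := hB 1 1 1 le_rfl le_rfl le_rfl
  obtain ⟨B₁, nB₁, N₁⟩ := hB lam 1 lam hl le_rfl hl
  obtain ⟨B₂, nB₂, N₂⟩ := hB lam lam 1 hl hl le_rfl
  have t₁ : ∀ F, Tame3 (dn l k b 1 F) := tame_dn hb le_rfl
  have t₂ : ∀ F, Tame3 (dn l k b lam F) := tame_dn hb hl
  have tD := (t₁ S).sub (t₁ S')
  set X := dn l k b 1 S
  set X' := dn l k b 1 S'
  have iD : ∀ κ, IsSym κ → NlInt X (X - X') κ ∧ NlInt (X - X') X' κ ∧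
      nl g X X κ - nl g X' X' κ = nl g X (X - X') κ + nl g (X - X') X' κ := fun κ hκ => by
    obtain ⟨a, a'⟩ := ((N₀ S S).2 κ hκ).sub_right ((N₀ S S').2 κ hκ) g
    obtain ⟨b, b'⟩ := ((N₀ S S').2 κ hκ).sub_left ((N₀ S' S').2 κ hκ) g
    refine ⟨a, b, ?_⟩
    rw [a', b']; abel
  have hD : ∀ η, IsTest T η → FE M m 0 (X - X') (nl g X (X - X') (kap η) + nl g (X - X') X' (kap η))
      (kap η) := fun η hη => by
    rw [← (iD _ hη.isSym).2.2]
    exact (hE S (by simp) η hη).sub hη.isSym (t₁ S) (t₁ S') (hE S' (by simp) η hη)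
  set r := fun t => exp (lam * t)
  have step : ∀ H, Rel T r (X - X') (dn l k b lam H) →
      ∃ F, ‖F‖ ≤ 1 / 2 * ‖H‖ ∧ Rel T r (X - X') (dn l k b lam F) := by
    intro H hH
    have pw : ∀ x y : ℝ, lam ^ x * lam ^ y = lam ^ (x + y) := fun x y => (rpow_add hl0 x y).symm
    have h1 : 2 * CK * lam ^ (ε - 1) ≤ 2 * CK * lam ^ (-(δ - 2 * ε)) := by
      gcongr 2 * _ * ?_
      exact rpow_le_rpow_of_exponent_le hl (by linarith)
    have h2 : 0 ≤ (CK * CB * (‖S‖ + ‖S'‖)) * lam ^ (-(δ - 2 * ε)) := by positivity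
    have h3 : 0 ≤ 2 * CK * lam ^ (-(δ - 2 * ε)) := by positivity
    obtain ⟨F, hF⟩ := exists_fixedPoint P 0 (K (B₁ S H + B₂ H S')) nP (by simp) le_rfl
      (by positivity) le_rfl (by linarith)
    rw [AddMonoidHom.zero_apply, AddMonoidHom.zero_apply, add_zero] at hF
    refine ⟨F, ?_, ?_⟩
    · have a1 : ‖K (B₁ S H + B₂ H S')‖ ≤ CK * CB * (‖S‖ + ‖S'‖) * lam ^ (-(δ - 2 * ε)) * ‖H‖ :=
        calc _ ≤ CK * lam ^ ε * (CB * lam ^ (-(δ - ε)) * ‖S‖ * ‖H‖ +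
              CB * lam ^ (-(δ - ε)) * ‖H‖ * ‖S'‖) := (nK _).trans (by
                gcongr
                exact (norm_add_le _ _).trans (add_le_add (nB₁ _ _) (nB₂ _ _)))
          _ = CK * CB * (‖S‖ + ‖S'‖) * (lam ^ ε * lam ^ (-(δ - ε))) * ‖H‖ := by ring
          _ = _ := by rw [pw, show ε + -(δ - ε) = -(δ - 2 * ε) by ring]
      have a2 : ‖F‖ ≤ ‖P F‖ + ‖K (B₁ S H + B₂ H S')‖ := by
        conv_lhs => rw [hF]
        exact norm_add_le _ _
      have a3 := nP F
      have a5 : CK * lam ^ (ε - 1) * ‖F‖ ≤ 1 / 2 * ‖F‖ := by gcongr; linarith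
      have a6 : CK * CB * (‖S‖ + ‖S'‖) * lam ^ (-(δ - 2 * ε)) * ‖H‖ ≤ 1 / 4 * ‖H‖ := by
        gcongr; linarith
      linarith
    · obtain ⟨w, w0⟩ := wK F (B₁ S H + B₂ H S') 0 (by rw [map_zero, add_zero]; exact hF)
      have w := w _ ((N₁ S H).1.add hl (N₂ H S').1)
      have hZ := hat_eq_zero_of_fieldEq hT ((t₂ F).sub (t₂ H))
        (fun η hη => by
          obtain ⟨θ, hθ, e1, e2⟩ := hη.exists_eq_exp_mul lam
          have q := (hθ.fe_iff hη e1 e2 tD (t₂ H) hH).1 (hD θ hθ)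
          obtain ⟨i1, i2, -⟩ := iD _ hθ.isSym
          rw [hθ.nl_eq hη (fun t => by rw [one_mul]; exact e1 t) (t₁ S) tD (t₁ S) (t₂ H) i1
            ((N₁ S H).2 _ hη.isSym) (.refl _ _) hH,
            hθ.nl_eq hη (fun t => by rw [mul_one]; exact e1 t) tD (t₁ S') (t₂ H) (t₁ S') i2
            ((N₂ H S').2 _ hη.isSym) hH (.refl _ _)] at q
          have p := HalfWave.fieldEq (t₂ F) (fun κ => by
            simp only [Pi.add_apply, Prod.snd_add, map_add]
            exact congrArg₂ _ (conj_quad_refl _ _ _) (conj_quad_refl _ _ _)) w hη.isSym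
          have := p.sub hη.isSym (t₂ F) (t₂ H) q
          rwa [Pi.add_apply, sub_self] at this) (by
          filter_upwards [(t₂ F).hat_sub (t₂ H), w0, hH, h0, Lp.coeFn_zero ℂ 2 𝓛¹]
            with ξ e w0 hH h0 z
          obtain ⟨e1, e2, e3⟩ := e 0
          obtain ⟨z1, z2, z3⟩ := hH 0 ⟨le_rfl, hT.le⟩
          obtain ⟨y1, y2, y3⟩ := h0
          simp only [r, mul_zero, Real.exp_zero, ofReal_one, one_mul] at z1 z2 z3
          obtain ⟨x1, x2, x3⟩ := w0
          simp only [Prod.fst_zero, Prod.snd_zero, z, Pi.zero_apply, mul_zero] at x1 x2 x3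
          rw [e1, e2, e3, ← z1, ← z2, ← z3, y1, y2, y3, sub_zero, sub_zero, sub_zero]
          exact ⟨x1, x2, x3⟩)
      filter_upwards [(t₂ F).hat_sub (t₂ H), hZ, hH] with ξ e hZ hH t ht
      obtain ⟨e1, e2, e3⟩ := e t
      obtain ⟨z1, z2, z3⟩ := hZ t ht
      rw [sub_eq_zero.1 (e1.symm.trans z1), sub_eq_zero.1 (e2.symm.trans z2),
        sub_eq_zero.1 (e3.symm.trans z3)]
      exact hH t ht
  obtain ⟨H₀, hH₀⟩ := exists_rel l k hb (by linarith) hl T S S'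
  have iter : ∀ n : ℕ, ∃ H, ‖H‖ ≤ (1 / 2) ^ n * ‖H₀‖ ∧ Rel T r (X - X') (dn l k b lam H) := by
    intro n
    induction n with
    | zero => exact ⟨H₀, by simp, hH₀⟩
    | succ n ih =>
      obtain ⟨H, h1, h2⟩ := ih
      obtain ⟨F, h3, h4⟩ := step H h2
      exact ⟨F, by rw [pow_succ']; linarith, h4⟩
  choose H nH hH using iter
  have lim : Tendsto H atTop (𝓝 0) := by
    refine squeeze_zero_norm nH ?_
    simpa using (tendsto_pow_atTop_nhds_zero_of_lt_one (r := (1 / 2 : ℝ)) (by norm_num)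
      (by norm_num)).mul_const ‖H₀‖
  intro t ht
  have q := fun n => (hH n).mono fun ξ h => h t ht
  have l1 := (continuous_fst.tendsto (0 : E3)).comp lim
  have l2 := (continuous_snd.tendsto (0 : E3)).comp lim
  filter_upwards [ae_hat_eq_zero hb hl (measurable_hu 1) tD.1 l1 fun n => (q n).mono fun _ h => h.1,
    ae_hat_eq_zero hb hl (measurable_hu (-1)) tD.2.1 ((continuous_fst.tendsto _).comp l2) fun n =>
      (q n).mono fun _ h => h.2.1, ae_hat_eq_zero hb hl (measurable_hz 1) tD.2.2
      ((continuous_snd.tendsto _).comp l2) fun n => (q n).mono fun _ h => h.2.2] with ξ a b c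
  exact ⟨a, b, c⟩

theorem IsSolution.unique (h : Exponents l k δ) (hb : 1 / 2 < b) (hbδ : b - 1 / 2 < δ / 4)
    {α β : Matrix (Fin 2) (Fin 2) ℂ} {e e' : Spinor} (hB : DiracBasis α β e e') {M m g T : ℝ}
    (hT : 0 < T) {ψ₀ : 𝓢'(ℝ, Spinor)} {φ₀ φ₁ : 𝓢'(ℝ, ℂ)} {ψ ψ' : ℝ → 𝓢'(ℝ, Spinor)}
    {φ φt φ' φt' : ℝ → 𝓢'(ℝ, ℂ)} (hs : IsSolution α β M m g l k b T ψ₀ φ₀ φ₁ ψ φ φt)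
    (hs' : IsSolution α β M m g l k b T ψ₀ φ₀ φ₁ ψ' φ' φt') :
    ∀ t ∈ Icc 0 T, ψ t = ψ' t ∧ φ t = φ' t ∧ φt t = φt' t := by
  obtain ⟨S, hS⟩ := hs.exists_density hB hb hT
  obtain ⟨S', hS'⟩ := hs'.exists_density hB hb hT
  have td := tame_dn (l := l) (k := k) hb le_rfl
  obtain ⟨_, hN⟩ := exists_nonlinearity h hb (by linarith) g
  obtain ⟨_, _, hN⟩ := hN 1 1 1 le_rfl le_rfl le_rfl
  have sub := (td S).hat_sub (td S')
  have z := hat_halfWave (td S).2.2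
  have z' := hat_halfWave (td S').2.2
  have key := hat_sub_eq_zero h hb hbδ M m g hT (S' := S') (by
    have : ∀ {F ψ φ φt} (_ : IsSolution α β M m g l k b T ψ₀ φ₀ φ₁ ψ φ φt) (_ : ∀ t ∈ Icc 0 T,
        HasFourierDensity (ψ t) (fun ξ => hat (du l b 1 F) t ξ • e + hat (dv l b 1 F) t ξ • e') ∧
        HasFourierDensity (φ t) (hat (ph (dz k b 1 F)) t) ∧
        HasFourierDensity (φt t) (hat (phd (dz k b 1 F)) t)), ∀ η, IsTest T η →
        FE M m 0 (dn l k b 1 F) (nl g (dn l k b 1 F) (dn l k b 1 F) (kap η)) (kap η) :=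
      fun {F _ _ _} hs hS => (equations_iff hB hT.le (td F).1 (td F).2.1 (td F).2.2.ph (td F).2.2.phd
        (fun t ht => (hS t ht).1) (fun t ht => (hS t ht).2.1) (fun t ht => (hS t ht).2.2)
        (hN F F).2).1 ⟨hs.dirac, hs.deriv_phi, hs.kleinGordon⟩
    rintro F (rfl | rfl)
    · exact this hs hS
    · exact this hs' hS') (by
    obtain ⟨a, a', a''⟩ := hS 0 ⟨le_rfl, hT.le⟩
    obtain ⟨c, c', c''⟩ := hS' 0 ⟨le_rfl, hT.le⟩
    rw [hs.initial_psi] at a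
    rw [hs.initial_phi] at a'
    rw [hs.initial_phit] at a''
    rw [hs'.initial_psi] at c
    rw [hs'.initial_phi] at c'
    rw [hs'.initial_phit] at c''
    filter_upwards [sub, z, z', a.unique c, a'.unique c', a''.unique c''] with ξ w z z' p q r
    obtain ⟨e1, e2, e3⟩ := w 0
    rw [e1, e2, e3, ← (z 0).1, ← (z' 0).1, q, r, sub_self, sub_eq_zero, sub_eq_zero]
    have p1 := congrArg (inner ℂ e) p
    have p2 := congrArg (inner ℂ e') p
    rw [hB.inner_fst, hB.inner_fst] at p1
    rw [hB.inner_snd, hB.inner_snd] at p2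
    exact ⟨p1, p2, rfl⟩)
  intro t ht
  obtain ⟨a, a', a''⟩ := hS t ht
  obtain ⟨c, c', c''⟩ := hS' t ht
  have k' : ∀ᵐ ξ : ℝ, hat (dn l k b 1 S).1 t ξ = hat (dn l k b 1 S').1 t ξ ∧
      hat (dn l k b 1 S).2.1 t ξ = hat (dn l k b 1 S').2.1 t ξ ∧
      hat (dn l k b 1 S).2.2 t ξ = (1 : ℝ) * hat (dn l k b 1 S').2.2 t ξ := by
    filter_upwards [key t ht, sub] with ξ h e
    obtain ⟨e1, e2, e3⟩ := e t
    rw [e1, e2, e3, sub_eq_zero, sub_eq_zero, sub_eq_zero] at h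
    simpa using h
  have kz := hat_ph_congr (td S).2.2 (td S').2.2 (k'.mono fun ξ h => h.2.2)
  refine ⟨a.ext (c.congr ?_), a'.ext (c'.congr ?_), a''.ext (c''.congr ?_)⟩
  · filter_upwards [k'] with ξ h
    rw [← h.1, ← h.2.1]
  · filter_upwards [kz.1] with ξ h
    simpa using h.symm
  · filter_upwards [kz.2] with ξ h
    simpa using h.symm

end

end DKG

end

theorem theorem1 (l k : ℝ) (hl : l < 1 / 4) (hk : 0 < k) (hlk : 2 * l + k < 1)
    (hlk' : l + k ≤ 1) (hkl : |l| ≤ k) :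
    ∃ ε₀ > 0, ∀ (α β : Matrix (Fin 2) (Fin 2) ℂ), α.IsHermitian → β.IsHermitian →
      α * α = 1 → β * β = 1 → α * β + β * α = 0 →
    ∀ M m g : ℝ, ∀ ε ∈ Set.Ioo 0 ε₀,
    ∃ T : ℝ → ℝ → ℝ → ℝ, (∀ a b c, 0 < T a b c) ∧
      ∀ (ψ₀ : 𝓢'(ℝ, DKG.Spinor)) (φ₀ φ₁ : 𝓢'(ℝ, ℂ)),
        TemperedDistribution.MemSobolev (-l) 2 ψ₀ →
        TemperedDistribution.MemSobolev k 2 φ₀ → DKG.IsReal φ₀ →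
        TemperedDistribution.MemSobolev (k - 1) 2 φ₁ → DKG.IsReal φ₁ →
        ∀ T₀ : ℝ, T₀ = T (DKG.sobolevENorm (-l) ψ₀).toReal (DKG.sobolevENorm k φ₀).toReal
            (DKG.sobolevENorm (k - 1) φ₁).toReal →
          ∃ (ψ : ℝ → 𝓢'(ℝ, DKG.Spinor)) (φ φt : ℝ → 𝓢'(ℝ, ℂ)),
            DKG.IsSolution α β M m g l k (1 / 2 + ε) T₀ ψ₀ φ₀ φ₁ ψ φ φt ∧
            DKG.ContinuousInSobolev (-l) T₀ ψ ∧
            DKG.ContinuousInSobolev k T₀ φ ∧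
            DKG.ContinuousInSobolev (k - 1) T₀ φt ∧
            ∀ (ψ' : ℝ → 𝓢'(ℝ, DKG.Spinor)) (φ' φt' : ℝ → 𝓢'(ℝ, ℂ)),
              DKG.IsSolution α β M m g l k (1 / 2 + ε) T₀ ψ₀ φ₀ φ₁ ψ' φ' φt' →
                ∀ t ∈ Set.Icc 0 T₀, ψ' t = ψ t ∧ φ' t = φ t ∧ φt' t = φt t := by
  obtain ⟨δ, h⟩ := DKG.exists_exponents hl hk hlk hlk' hkl
  refine ⟨δ / 4, by linarith [h.δ_pos], fun α β hα hβ hα2 hβ2 hαβ M m g ε hε ↦ ?_⟩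
  obtain ⟨e, e', hB⟩ := DKG.exists_diracBasis hα hβ hα2 hβ2 hαβ
  have hb : 1 / 2 < 1 / 2 + ε := by linarith [hε.1]
  have hbδ : 1 / 2 + ε - 1 / 2 < δ / 4 := by linarith [hε.2]
  obtain ⟨T, hT, H⟩ := DKG.exists_solution h hb hbδ hB M m g
  refine ⟨T, hT, fun ψ₀ φ₀ φ₁ m₀ m₁ r₀ m₂ r₁ T₀ hT₀ ↦ ?_⟩
  obtain ⟨ψ, φ, φt, hs, c₁, c₂, c₃⟩ := H ψ₀ φ₀ φ₁ m₀ m₁ r₀ m₂ r₁ T₀ hT₀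
  exact ⟨ψ, φ, φt, hs, c₁, c₂, c₃, fun ψ' φ' φt' hs' ↦
    hs'.unique h hb hbδ hB (hT₀ ▸ hT _ _ _) hs⟩
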